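/- Let $N\ge 1$. Let $\hat O$ be the algebra of power series in $b^1,\dots,b^N$ over $\mathbb C$ which converge near the origin, $\partial_i=\partial/\partial b^i$, and let $G$ be the group of $N$-tuples $g=(g^1,\dots,g^N)$ of elements of $\hat O$ without constant term whose Jacobian matrix $\partial g=(\partial_i g^j)$ is invertible, with the multiplication $(g_1g_2)^i(b)=g_2^i(g_1^1(b),\dots,g_1^N(b))$. The group $G$ acts by pull-back $g^*$ on $\hat O$ and on the spaces $\Omega^i$ of differential $i$-forms over $\hat O$, and $\Omega^{i,cl}\subset\Omega^i$ denotes the $G$-module of closed forms. Let $D$ be the free bosonic vertex algebra generated by fields $b^i(z)$ of conformal weight $0$ and $a^i(z)$ of conformal weight $1$ ($1\le i\le N$) with $a^i(z)b^j(w)\sim\delta_{ij}/(z-w)$, the other products of these fields being trivial. Let $O=\mathbb C[b^1,\dots,b^N]=D_0$ and let $\hat D=\hat O\otimes_O D$, with its canonical structure of a vertex algebra. Then $\hat D_0=\hat O$ and $\hat D_1$ has the subspace $\Omega^1=\bigoplus_i\hat O\, b^i_{-1}$ (where $b^i_{-1}=db^i$), with $\hat D_1/\Omega^1=\bigoplus_i\hat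 O\,a^i_{-1}$ the space of vector fields (where $a^i_{-1}=\partial_i$). An automorphism of the vertex algebra $\hat D$ is called natural if, for some $g\in G$, it induces $g^*$ on $\hat D_0$ and the maps induced by $g$ on the $1$-forms $\Omega^1\subset\hat D_1$ and on the vector fields $\hat D_1/\Omega^1$. Let $G^\sim$ be the group of all natural automorphisms of $\hat D$ under composition. Universal Chern classes. For $g,g_1,g_2\in G$ put $\theta_g=(\partial g)^{-1}d(\partial g)$ and $\rho_{g_1,g_2}=g_1^*\bigl(d(\partial g_2)\cdot(\partial g_2)^{-1}\bigr)$. The class $c_1\in H^1(G;\Omega^{1,cl})$ is the class of the cocycle $g\mapsto \mathrm{tr}\,\theta_g$, and $c_1^2\in H^2(G;\Omega^{2,cl})$ is the class of $(g_1,g_2)\mapsto \mathrm{tr}\,\theta_{g_1}\wedge g_1^*\,\mathrm{tr}\,\theta_{g_2}$. The class $c_2\in H^2(G;\Omega^{2,cl})$ is given, through the truncated de Rham complex $\Omega^2\to\Omega^3\to\cdots$, by the cochains $$u(g_1,g_2)=\tfrac12\bigl(\mathrm{tr}\,\theta_{g_1}\wedge\mathrm{tr}\,\rho_{g_1,g_2}-\mathrm{tr}(\theta_{g_1}\wedge\rho_{g_1,g_2})\bigr)\in\Omega^2,\qquad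 v(g)=-\tfrac16\,\mathrm{tr}(\theta_g\wedge\theta_g\wedge\theta_g)\in\Omega^3,$$ that is, it is the class of the $\Omega^{2,cl}$-valued cocycle $u(g_1,g_2)-\bigl(g_1^*\eta(g_2)-\eta(g_1g_2)+\eta(g_1)\bigr)$ for any map $\eta:G\to\Omega^2$ with $d\eta(g)=v(g)$ for all $g$. **Theorem.** The class $c_2$ exists and is uniquely determined by this description. Mapping a natural automorphism to the element $g\in G$ that it induces defines a surjective homomorphism $G^\sim\to G$, and there is a group extension $$0\longrightarrow\Omega^{2,cl}\longrightarrow G^\sim\longrightarrow G\longrightarrow 1,$$ in which a closed form $\omega=\sum_{k,i}h^{ki}\,db^k\wedge db^i$ ($h$ skew symmetric) goes to the natural automorphism which is the identity on $\hat D_0$ and sends $a^i_{-1}$ to $a^i_{-1}+\sum_k h^{ki}b^k_{-1}$. The action of $G$ on $\Omega^{2,cl}$ by conjugation in $G^\sim$ is the pull-back action. The cohomology class of this extension (the class of the cocycle $z$ with $\sigma(g_1)\sigma(g_2)=z(g_1,g_2)\,\sigma(g_1g_2)$ for a set-theoretic section $\sigma$) is equal to $$2ch_2:=c_1^2-2c_2\in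 H^2(G;\Omega^{2,cl}).$$ -/

import Mathlib

noncomputable section

namespace ChiralDO

open Filter Topology

/-! ### Convergent power series -/

instance germAlgebra (N : ℕ) : Algebra ℂ (Germ (𝓝 (0 : Fin N → ℂ)) ℂ) :=
  Algebra.ofModule
    (fun r x y => Germ.inductionOn₂ x y fun f g => by
      simp only [← Germ.coe_smul, ← Germ.coe_mul, smul_mul_assoc])
    (fun r x y => Germ.inductionOn₂ x y fun f g => by
      simp only [← Germ.coe_smul, ← Germ.coe_mul, mul_smul_comm])

/-- Germs at the origin of `ℂ^N` of holomorphic (that is, complex analytic) functions. -/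
def holoGerms (N : ℕ) : Subalgebra ℂ (Germ (𝓝 (0 : Fin N → ℂ)) ℂ) where
  carrier := {φ | ∃ f : (Fin N → ℂ) → ℂ, AnalyticAt ℂ f 0 ∧ φ = (f : Germ (𝓝 (0 : Fin N → ℂ)) ℂ)}
  mul_mem' := by
    rintro _ _ ⟨f, hf, rfl⟩ ⟨g, hg, rfl⟩
    exact ⟨f * g, hf.mul hg, (Germ.coe_mul f g).symm⟩
  add_mem' := by
    rintro _ _ ⟨f, hf, rfl⟩ ⟨g, hg, rfl⟩
    exact ⟨f + g, hf.add hg, (Germ.coe_add f g).symm⟩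
  algebraMap_mem' r := ⟨fun _ => r, analyticAt_const, by
    rw [Algebra.algebraMap_eq_smul_one]
    refine congrArg (fun f : (Fin N → ℂ) → ℂ => (f : Germ (𝓝 (0 : Fin N → ℂ)) ℂ))
      (a₁ := r • (1 : (Fin N → ℂ) → ℂ)) ?_
    ext x
    simp⟩

/-- The algebra `Ô` of power series in `b^1, …, b^N` which converge in some neighbourhood of the
origin, realized as the algebra of germs at `0` of holomorphic functions on `ℂ^N`. -/
def OHat (N : ℕ) : Type := holoGerms N

namespace OHat

variable {N : ℕ}

instance : CommRing (OHat N) := inferInstanceAs (CommRing (holoGerms N))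
instance : Algebra ℂ (OHat N) := inferInstanceAs (Algebra ℂ (holoGerms N))

/-- The germ of a function which is analytic at the origin. -/
def mk (f : (Fin N → ℂ) → ℂ) (hf : AnalyticAt ℂ f 0) : OHat N :=
  (⟨(f : Germ (𝓝 (0 : Fin N → ℂ)) ℂ), f, hf, rfl⟩ : holoGerms N)

theorem mk_eq_mk {f g : (Fin N → ℂ) → ℂ} {hf : AnalyticAt ℂ f 0} {hg : AnalyticAt ℂ g 0} :
    mk f hf = mk g hg ↔ f =ᶠ[𝓝 0] g :=
  Subtype.ext_iff.trans Germ.coe_eq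

/-- A function representing the germ. -/
def rep (φ : OHat N) : (Fin N → ℂ) → ℂ := Classical.choose φ.2

theorem rep_analyticAt (φ : OHat N) : AnalyticAt ℂ φ.rep 0 := (Classical.choose_spec φ.2).1

theorem mk_rep (φ : OHat N) : mk φ.rep φ.rep_analyticAt = φ :=
  Subtype.ext (Classical.choose_spec φ.2).2.symm

theorem ind {P : OHat N → Prop} (h : ∀ f hf, P (mk f hf)) (φ : OHat N) : P φ := by
  rw [← φ.mk_rep]
  exact h _ _

theorem rep_mk (f : (Fin N → ℂ) → ℂ) (hf : AnalyticAt ℂ f 0) : (mk f hf).rep =ᶠ[𝓝 0] f :=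
  mk_eq_mk.1 (mk_rep (mk f hf))

theorem mk_add_mk {f g : (Fin N → ℂ) → ℂ} (hf : AnalyticAt ℂ f 0) (hg : AnalyticAt ℂ g 0) :
    mk f hf + mk g hg = mk (fun x => f x + g x) (hf.add hg) := rfl

theorem mk_mul_mk {f g : (Fin N → ℂ) → ℂ} (hf : AnalyticAt ℂ f 0) (hg : AnalyticAt ℂ g 0) :
    mk f hf * mk g hg = mk (fun x => f x * g x) (hf.mul hg) := rfl

theorem smul_mk {f : (Fin N → ℂ) → ℂ} (r : ℂ) (hf : AnalyticAt ℂ f 0) :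
    r • mk f hf = mk (fun x => r * f x) (analyticAt_const.mul hf) := rfl

theorem one_eq_mk : (1 : OHat N) = mk (fun _ => 1) analyticAt_const := rfl

theorem zero_eq_mk : (0 : OHat N) = mk (fun _ => 0) analyticAt_const := rfl

theorem algebraMap_eq_mk (r : ℂ) :
    algebraMap ℂ (OHat N) r = mk (fun _ => r) analyticAt_const := by
  rw [Algebra.algebraMap_eq_smul_one, one_eq_mk, smul_mk]
  simp

/-- The value of a germ at the origin. -/
def value : OHat N →ₐ[ℂ] ℂ where
  toFun φ := φ.rep 0
  map_one' := (rep_mk (fun _ => 1) analyticAt_const).eq_of_nhds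
  map_zero' := (rep_mk (fun _ => 0) analyticAt_const).eq_of_nhds
  map_mul' := ind fun f hf => ind fun g hg => by
    rw [mk_mul_mk, (rep_mk _ _).eq_of_nhds, (rep_mk _ _).eq_of_nhds, (rep_mk _ _).eq_of_nhds]
  map_add' := ind fun f hf => ind fun g hg => by
    rw [mk_add_mk, (rep_mk _ _).eq_of_nhds, (rep_mk _ _).eq_of_nhds, (rep_mk _ _).eq_of_nhds]
  commutes' r := by
    rw [algebraMap_eq_mk, (rep_mk _ _).eq_of_nhds]
    rfl

theorem value_mk (f : (Fin N → ℂ) → ℂ) (hf : AnalyticAt ℂ f 0) : (mk f hf).value = f 0 :=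
  (rep_mk f hf).eq_of_nhds

theorem analyticAt_coord (i : Fin N) : AnalyticAt ℂ (fun x : Fin N → ℂ => x i) 0 :=
  (ContinuousLinearMap.proj (R := ℂ) (φ := fun _ : Fin N => ℂ) i).analyticAt 0

/-- The coordinate function `b^i`. -/
def coord (i : Fin N) : OHat N :=
  mk (fun x => x i) (analyticAt_coord i)

theorem analyticAt_partial {f : (Fin N → ℂ) → ℂ} {x : Fin N → ℂ} (hf : AnalyticAt ℂ f x)
    (v : Fin N → ℂ) : AnalyticAt ℂ (fun x => fderiv ℂ f x v) x :=
  ((ContinuousLinearMap.apply ℂ ℂ v).analyticAt _).comp hf.fderiv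

/-- The underlying function of the partial derivative `∂_i`. -/
def pdFun (i : Fin N) (φ : OHat N) : OHat N :=
  mk (fun x => fderiv ℂ φ.rep x (Pi.single i 1)) (analyticAt_partial φ.rep_analyticAt _)

theorem pdFun_mk (i : Fin N) (f : (Fin N → ℂ) → ℂ) (hf : AnalyticAt ℂ f 0) :
    pdFun i (mk f hf) = mk (fun x => fderiv ℂ f x (Pi.single i 1)) (analyticAt_partial hf _) := by
  refine mk_eq_mk.2 ?_
  filter_upwards [(rep_mk f hf).fderiv (𝕜 := ℂ)] with x hx
  rw [hx]

/-- The partial derivative `∂_i = ∂/∂b^i` on `Ô`. -/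
def pd (i : Fin N) : Derivation ℂ (OHat N) (OHat N) :=
  Derivation.mk'
    { toFun := pdFun i
      map_add' := ind fun f hf => ind fun g hg => by
        rw [mk_add_mk, pdFun_mk, pdFun_mk, pdFun_mk, mk_add_mk, mk_eq_mk]
        filter_upwards [hf.eventually_analyticAt, hg.eventually_analyticAt] with x h1 h2
        rw [fderiv_fun_add h1.differentiableAt h2.differentiableAt]
        rfl
      map_smul' := fun r => ind fun f hf => by
        rw [smul_mk, pdFun_mk, pdFun_mk, RingHom.id_apply, smul_mk, mk_eq_mk]
        filter_upwards [hf.eventually_analyticAt] with x h1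
        rw [fderiv_const_mul h1.differentiableAt]
        rfl }
    (ind fun f hf => ind fun g hg => by
      change pdFun i _ = _ • pdFun i _ + _ • pdFun i _
      rw [smul_eq_mul, smul_eq_mul, mk_mul_mk, pdFun_mk, pdFun_mk, pdFun_mk, mk_mul_mk, mk_mul_mk,
        mk_add_mk, mk_eq_mk]
      filter_upwards [hf.eventually_analyticAt, hg.eventually_analyticAt] with x h1 h2
      rw [fderiv_fun_mul h1.differentiableAt h2.differentiableAt]
      rfl)

theorem pd_mk (i : Fin N) (f : (Fin N → ℂ) → ℂ) (hf : AnalyticAt ℂ f 0) :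
    pd i (mk f hf) = mk (fun x => fderiv ℂ f x (Pi.single i 1)) (analyticAt_partial hf _) :=
  pdFun_mk i f hf

theorem pd_comm (i j : Fin N) (φ : OHat N) : pd i (pd j φ) = pd j (pd i φ) := by
  induction φ using ind with
  | h f hf =>
    rw [pd_mk, pd_mk, pd_mk, pd_mk, mk_eq_mk]
    filter_upwards [hf.eventually_analyticAt] with x h1
    have hd : DifferentiableAt ℂ (fderiv ℂ f) x := h1.fderiv.differentiableAt
    have key : ∀ v w : Fin N → ℂ,
        fderiv ℂ (fun y => fderiv ℂ f y v) x w = fderiv ℂ (fderiv ℂ f) x w v := by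
      intro v w
      rw [fderiv_clm_apply hd (differentiableAt_const v)]
      simp
    rw [key, key]
    exact (h1.contDiffAt (n := ⊤)).isSymmSndFDerivAt (by simp) _ _

theorem pd_coord (i j : Fin N) : pd i (coord j) = if i = j then 1 else 0 := by
  have h : ∀ x : Fin N → ℂ, fderiv ℂ (fun x : Fin N → ℂ => x j) x (Pi.single i 1)
      = if i = j then 1 else 0 := by
    intro x
    have := (ContinuousLinearMap.proj (R := ℂ) (φ := fun _ : Fin N => ℂ) j).hasFDerivAt (x := x)
    have h2 : fderiv ℂ (fun x : Fin N → ℂ => x j) x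
      = ContinuousLinearMap.proj (R := ℂ) (φ := fun _ : Fin N => ℂ) j := this.fderiv
    rw [h2]
    simp [Pi.single_apply, eq_comm]
  rw [coord, pd_mk]
  split_ifs with hij
  · rw [one_eq_mk, mk_eq_mk]
    exact Eventually.of_forall fun x => (h x).trans (by simp [hij])
  · rw [zero_eq_mk, mk_eq_mk]
    exact Eventually.of_forall fun x => (h x).trans (by simp [hij])

/-! ### Substitution of a tuple of power series without constant term -/

/-- A map `(ℂ^N, 0) → (ℂ^N, 0)` representing an `N`-tuple of germs. -/
def toMap (g : Fin N → OHat N) (x : Fin N → ℂ) : Fin N → ℂ := fun i => (g i).rep x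

theorem toMap_analyticAt (g : Fin N → OHat N) : AnalyticAt ℂ (toMap g) 0 :=
  analyticAt_pi_iff.2 fun i => (g i).rep_analyticAt

theorem toMap_zero {g : Fin N → OHat N} (hg : ∀ i, (g i).value = 0) : toMap g 0 = 0 :=
  funext hg

/-- The underlying function of the substitution `f ↦ f(g^1, …, g^N)`. -/
def substFun (g : Fin N → OHat N) (hg : ∀ i, (g i).value = 0) (φ : OHat N) : OHat N :=
  mk (fun x => φ.rep (toMap g x)) <|
    AnalyticAt.comp (by rw [toMap_zero hg]; exact φ.rep_analyticAt) (toMap_analyticAt g)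

theorem substFun_mk {g : Fin N → OHat N} (hg : ∀ i, (g i).value = 0)
    {f : (Fin N → ℂ) → ℂ} (hf : AnalyticAt ℂ f 0) :
    substFun g hg (mk f hf) = mk (fun x => f (toMap g x))
      (AnalyticAt.comp (by rw [toMap_zero hg]; exact hf) (toMap_analyticAt g)) := by
  refine mk_eq_mk.2 ?_
  have h : Tendsto (toMap g) (𝓝 0) (𝓝 0) := by
    have := (toMap_analyticAt g).continuousAt.tendsto
    rwa [toMap_zero hg] at this
  exact h.eventually (rep_mk f hf)

/-- The substitution homomorphism `f ↦ f(g^1, …, g^N)`. -/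
def subst (g : Fin N → OHat N) (hg : ∀ i, (g i).value = 0) : OHat N →ₐ[ℂ] OHat N where
  toFun := substFun g hg
  map_one' := substFun_mk hg (f := fun _ => 1) analyticAt_const
  map_zero' := substFun_mk hg (f := fun _ => 0) analyticAt_const
  map_mul' := ind fun f hf => ind fun f' hf' => by
    rw [mk_mul_mk, substFun_mk, substFun_mk, substFun_mk, mk_mul_mk]
  map_add' := ind fun f hf => ind fun f' hf' => by
    rw [mk_add_mk, substFun_mk, substFun_mk, substFun_mk, mk_add_mk]
  commutes' r := by
    rw [algebraMap_eq_mk, substFun_mk]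

theorem subst_mk {g : Fin N → OHat N} (hg : ∀ i, (g i).value = 0)
    {f : (Fin N → ℂ) → ℂ} (hf : AnalyticAt ℂ f 0) :
    subst g hg (mk f hf) = mk (fun x => f (toMap g x))
      (AnalyticAt.comp (by rw [toMap_zero hg]; exact hf) (toMap_analyticAt g)) :=
  substFun_mk hg hf

theorem subst_coord {g : Fin N → OHat N} (hg : ∀ i, (g i).value = 0) (i : Fin N) :
    subst g hg (coord i) = g i := by
  rw [coord, subst_mk]
  exact mk_rep (g i)

theorem value_subst {g : Fin N → OHat N} (hg : ∀ i, (g i).value = 0) (φ : OHat N) :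
    (subst g hg φ).value = φ.value := by
  induction φ using ind with
  | h f hf => rw [subst_mk, value_mk, value_mk, toMap_zero hg]

/-- The chain rule. -/
theorem pd_subst {g : Fin N → OHat N} (hg : ∀ i, (g i).value = 0) (i : Fin N) (φ : OHat N) :
    pd i (subst g hg φ) = ∑ k, pd i (g k) * subst g hg (pd k φ) := by
  induction φ using ind with
  | h f hf =>
    have hsum : ∀ (F : Fin N → (Fin N → ℂ) → ℂ) (hF : ∀ k, AnalyticAt ℂ (F k) 0),
        ∑ k, mk (F k) (hF k) = mk (fun x => ∑ k, F k x)
          (Finset.analyticAt_fun_sum _ fun k _ => hF k) := by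
      intro F hF
      have : ∀ s : Finset (Fin N), ∑ k ∈ s, mk (F k) (hF k) = mk (fun x => ∑ k ∈ s, F k x)
          (Finset.analyticAt_fun_sum _ fun k _ => hF k) := by
        classical
        intro s
        induction s using Finset.induction_on with
        | empty => simp [zero_eq_mk]
        | insert a s ha ih =>
          rw [Finset.sum_insert ha, ih, mk_add_mk, mk_eq_mk]
          exact Eventually.of_forall fun x => by simp [Finset.sum_insert ha]
      exact this _
    have h0 : Tendsto (toMap g) (𝓝 0) (𝓝 0) := by
      have := (toMap_analyticAt g).continuousAt.tendsto
      rwa [toMap_zero hg] at this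
    have hterm : ∀ k, pd i (g k) * subst g hg (pd k (mk f hf))
        = mk (fun x => fderiv ℂ (g k).rep x (Pi.single i 1)
            * fderiv ℂ f (toMap g x) (Pi.single k 1))
          ((analyticAt_partial (g k).rep_analyticAt _).mul
            (AnalyticAt.comp (g := fun y => fderiv ℂ f y (Pi.single k 1))
              (by rw [toMap_zero hg]; exact analyticAt_partial hf _) (toMap_analyticAt g))) := by
      intro k
      have e : pd i (g k) = mk (fun x => fderiv ℂ (g k).rep x (Pi.single i 1))
          (analyticAt_partial (g k).rep_analyticAt _) := rfl
      rw [pd_mk, subst_mk, e, mk_mul_mk]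
    rw [Finset.sum_congr rfl fun k _ => hterm k, hsum, subst_mk, pd_mk, mk_eq_mk]
    filter_upwards [h0.eventually hf.eventually_analyticAt,
      (toMap_analyticAt g).eventually_analyticAt,
      eventually_all.2 fun k => (g k).rep_analyticAt.eventually_analyticAt] with x h1 h2 h3
    have e1 : fderiv ℂ (fun x => f (toMap g x)) x
        = (fderiv ℂ f (toMap g x)).comp (fderiv ℂ (toMap g) x) :=
      fderiv_comp x h1.differentiableAt h2.differentiableAt
    have e2 : fderiv ℂ (toMap g) x (Pi.single i 1)
        = fun k => fderiv ℂ (g k).rep x (Pi.single i 1) := by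
      have : fderiv ℂ (toMap g) x = ContinuousLinearMap.pi fun k => fderiv ℂ (g k).rep x :=
        fderiv_pi fun k => (h3 k).differentiableAt
      rw [this]
      rfl
    rw [e1, ContinuousLinearMap.comp_apply, e2]
    set v : Fin N → ℂ := fun k => fderiv ℂ (g k).rep x (Pi.single i 1) with hv
    conv_lhs => rw [pi_eq_sum_univ' v]
    rw [map_sum]
    refine Finset.sum_congr rfl fun k _ => ?_
    rw [map_smul, smul_eq_mul]

theorem subst_subst {g h : Fin N → OHat N} (hg : ∀ i, (g i).value = 0)
    (hh : ∀ i, (h i).value = 0) (φ : OHat N) :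
    subst g hg (subst h hh φ)
      = subst (fun i => subst g hg (h i)) (fun i => by rw [value_subst, hh]) φ := by
  induction φ using ind with
  | h f hf =>
    rw [subst_mk, subst_mk, subst_mk, mk_eq_mk]
    have h0 : Tendsto (toMap g) (𝓝 0) (𝓝 0) := by
      have := (toMap_analyticAt g).continuousAt.tendsto
      rwa [toMap_zero hg] at this
    have : ∀ k, ∀ᶠ x in 𝓝 (0 : Fin N → ℂ), (subst g hg (h k)).rep x = (h k).rep (toMap g x) := by
      intro k
      exact rep_mk (fun x => (h k).rep (toMap g x))
        (AnalyticAt.comp (by rw [toMap_zero hg]; exact (h k).rep_analyticAt) (toMap_analyticAt g))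
    filter_upwards [eventually_all.2 this] with x hx
    congr 1
    funext k
    exact (hx k).symm

theorem subst_coord_eq (hc : ∀ i : Fin N, (coord i).value = 0) (φ : OHat N) :
    subst coord hc φ = φ := by
  induction φ using ind with
  | h f hf =>
    rw [subst_mk, mk_eq_mk]
    have : ∀ k, ∀ᶠ x in 𝓝 (0 : Fin N → ℂ), (coord k).rep x = x k := fun k => rep_mk _ _
    filter_upwards [eventually_all.2 this] with x hx
    congr 1
    funext k
    exact hx k

theorem value_coord (i : Fin N) : (coord i).value = 0 := by
  rw [coord, value_mk]
  rfl

end OHat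

/-! ### The group of coordinate changes -/

section Group

variable {N : ℕ}

/-- The Jacobian matrix `∂g = (∂_i g^j)` of an `N`-tuple of power series. -/
def jacobian (g : Fin N → OHat N) : Matrix (Fin N) (Fin N) (OHat N) :=
  Matrix.of fun i j => OHat.pd i (g j)

/-- The group `G` of convergent coordinate changes at the origin of `ℂ^N`: its elements are
`N`-tuples `g = (g^1, …, g^N)` of convergent power series without constant term whose Jacobian
matrix is non-degenerate. -/
@[ext]
structure CoordChange (N : ℕ) where
  comp : Fin N → OHat N
  value_comp : ∀ i, (comp i).value = 0
  nondeg : IsUnit (jacobian comp).det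

namespace CoordChange

/-- The Jacobian matrix of a coordinate change. -/
def jac (g : CoordChange N) : Matrix (Fin N) (Fin N) (OHat N) := jacobian g.comp

/-- The action `f ↦ f_g = g^* f = f(g^1, …, g^N)` of a coordinate change on `Ô`. -/
def pull (g : CoordChange N) : OHat N →ₐ[ℂ] OHat N := OHat.subst g.comp g.value_comp

theorem isUnit_det_jac (g : CoordChange N) : IsUnit g.jac.det := g.nondeg

theorem pd_pull (g : CoordChange N) (i : Fin N) (φ : OHat N) :
    OHat.pd i (g.pull φ) = ∑ k, g.jac i k * g.pull (OHat.pd k φ) :=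
  OHat.pd_subst g.value_comp i φ

theorem jacobian_subst (g : CoordChange N) (h : Fin N → OHat N) :
    jacobian (fun i => g.pull (h i)) = g.jac * (jacobian h).map g.pull := by
  ext i j
  rw [jacobian, Matrix.of_apply, pd_pull, Matrix.mul_apply]
  rfl

/-- The multiplication `(g₁ g₂)^i(b) = g₂^i(g₁^1(b), …, g₁^N(b))`. -/
instance : Mul (CoordChange N) where
  mul g₁ g₂ :=
    { comp := fun i => g₁.pull (g₂.comp i)
      value_comp := fun i => (OHat.value_subst _ _).trans (g₂.value_comp i)
      nondeg := by
        rw [jacobian_subst, Matrix.det_mul]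
        refine g₁.isUnit_det_jac.mul ?_
        have := g₂.nondeg.map g₁.pull
        rwa [AlgHom.map_det] at this }

theorem mul_comp (g₁ g₂ : CoordChange N) (i : Fin N) :
    (g₁ * g₂).comp i = g₁.pull (g₂.comp i) := rfl

theorem pull_mul (g₁ g₂ : CoordChange N) (φ : OHat N) :
    (g₁ * g₂).pull φ = g₁.pull (g₂.pull φ) :=
  (OHat.subst_subst g₁.value_comp g₂.value_comp φ).symm

theorem jac_mul (g₁ g₂ : CoordChange N) :
    (g₁ * g₂).jac = g₁.jac * g₂.jac.map g₁.pull :=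
  jacobian_subst g₁ g₂.comp

theorem jacobian_coord : jacobian (OHat.coord (N := N)) = 1 := by
  ext i j
  rw [jacobian, Matrix.of_apply, OHat.pd_coord, Matrix.one_apply]

instance : One (CoordChange N) where
  one :=
    { comp := OHat.coord
      value_comp := OHat.value_coord
      nondeg := by rw [jacobian_coord, Matrix.det_one]; exact isUnit_one }

theorem one_comp (i : Fin N) : (1 : CoordChange N).comp i = OHat.coord i := rfl

theorem pull_one (φ : OHat N) : (1 : CoordChange N).pull φ = φ :=
  OHat.subst_coord_eq OHat.value_coord φ

theorem jac_one : (1 : CoordChange N).jac = 1 := jacobian_coord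

theorem pull_coord (g : CoordChange N) (i : Fin N) : g.pull (OHat.coord i) = g.comp i :=
  OHat.subst_coord g.value_comp i

/-- The inverse function theorem for coordinate changes. -/
theorem exists_left_inv (g : CoordChange N) : ∃ h : CoordChange N, h * g = 1 := by
  have han : AnalyticAt ℂ (OHat.toMap g.comp) 0 := OHat.toMap_analyticAt g.comp
  have h0 : OHat.toMap g.comp 0 = 0 := OHat.toMap_zero g.value_comp
  set A : (Fin N → ℂ) →L[ℂ] (Fin N → ℂ) := fderiv ℂ (OHat.toMap g.comp) 0 with hA
  have hmat : LinearMap.toMatrix' (A : (Fin N → ℂ) →ₗ[ℂ] (Fin N → ℂ))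
      = (g.jac.map OHat.value).transpose := by
    ext i j
    have e : A = ContinuousLinearMap.pi fun k => fderiv ℂ (g.comp k).rep 0 :=
      fderiv_pi fun k => (g.comp k).rep_analyticAt.differentiableAt
    rw [LinearMap.toMatrix'_apply, Matrix.transpose_apply, Matrix.map_apply]
    have e2 : g.jac j i = OHat.mk (fun x => fderiv ℂ (g.comp i).rep x (Pi.single j 1))
      (OHat.analyticAt_partial (g.comp i).rep_analyticAt _) := rfl
    rw [e2, OHat.value_mk, e]
    rfl
  have hdet : A.det ≠ 0 := by
    have : A.det = OHat.value g.jac.det := by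
      rw [ContinuousLinearMap.det, ← LinearMap.det_toMatrix', hmat, Matrix.det_transpose,
        AlgHom.map_det]
      rfl
    rw [this]
    exact (g.isUnit_det_jac.map OHat.value).ne_zero
  set A' : (Fin N → ℂ) ≃L[ℂ] (Fin N → ℂ) := A.toContinuousLinearEquivOfDetNeZero hdet with hA'
  have hAA' : (A' : (Fin N → ℂ) →L[ℂ] (Fin N → ℂ)) = A := by ext; rfl
  have hst : HasStrictFDerivAt (OHat.toMap g.comp)
      (A' : (Fin N → ℂ) →L[ℂ] (Fin N → ℂ)) 0 := by
    rw [hAA']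
    exact han.hasStrictFDerivAt
  set R := hst.toOpenPartialHomeomorph (OHat.toMap g.comp) with hR
  have hsrc : (0 : Fin N → ℂ) ∈ R.source := hst.mem_toOpenPartialHomeomorph_source
  have hR0 : R 0 = 0 := h0
  have hsymm0 : R.symm 0 = 0 := by
    conv_lhs => rw [← hR0]
    exact R.left_inv hsrc
  have htgt : (0 : Fin N → ℂ) ∈ R.target := by
    rw [← hR0]
    exact R.map_source hsrc
  have hsan : AnalyticAt ℂ R.symm 0 :=
    R.analyticAt_symm htgt (i := A') (by rw [hsymm0]; exact han) (by rw [hsymm0, hAA']; rfl)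
  have hk : ∀ k, AnalyticAt ℂ (fun y => R.symm y k) 0 := fun k => analyticAt_pi_iff.1 hsan k
  let h : Fin N → OHat N := fun k => OHat.mk (fun y => R.symm y k) (hk k)
  have hv : ∀ k, (h k).value = 0 := by
    intro k
    change (OHat.mk _ (hk k)).value = 0
    rw [OHat.value_mk, hsymm0]
    rfl
  have hcomp : ∀ i, OHat.subst h hv (g.comp i) = OHat.coord i := by
    intro i
    conv_lhs => rw [← OHat.mk_rep (g.comp i)]
    rw [OHat.subst_mk, OHat.coord, OHat.mk_eq_mk]
    have h1 : ∀ k, ∀ᶠ y in 𝓝 (0 : Fin N → ℂ), (h k).rep y = R.symm y k :=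
      fun k => OHat.rep_mk _ (hk k)
    filter_upwards [eventually_all.2 h1, R.open_target.mem_nhds htgt] with y hy hyt
    have h2 : OHat.toMap h y = R.symm y := funext hy
    rw [h2]
    exact congrFun (R.right_inv hyt) i
  have hjac : jacobian h * (g.jac.map (OHat.subst h hv)) = 1 := by
    ext i j
    rw [← jacobian_coord, jacobian, jacobian, Matrix.of_apply, ← hcomp j, OHat.pd_subst,
      Matrix.mul_apply]
    rfl
  refine ⟨⟨h, hv, ?_⟩, ?_⟩
  · have := congrArg Matrix.det hjac
    rw [Matrix.det_mul, Matrix.det_one] at this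
    exact IsUnit.of_mul_eq_one _ this
  · ext i
    exact hcomp i

instance : Inv (CoordChange N) where
  inv g := Classical.choose g.exists_left_inv

instance : Group (CoordChange N) :=
  Group.ofLeftAxioms
    (fun g₁ g₂ g₃ => by
      ext i
      rw [mul_comp, mul_comp, mul_comp, pull_mul])
    (fun g => by
      ext i
      rw [mul_comp, pull_one])
    (fun g => Classical.choose_spec g.exists_left_inv)

theorem inv_map_pull (g h : CoordChange N) : (h.jac.map g.pull)⁻¹ = h.jac⁻¹.map g.pull := by
  refine Matrix.inv_eq_right_inv ?_
  rw [← Matrix.map_mul, Matrix.mul_nonsing_inv _ h.isUnit_det_jac]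
  exact Matrix.map_one _ (map_zero _) (map_one _)

end CoordChange

end Group

/-! ### Differential forms -/

section Forms

variable {N : ℕ}

/-- The `1`-differentials `ω = ∑ ω_i db^i` over `Ô`, given by their coefficients. -/
abbrev OneForm (N : ℕ) : Type := Fin N → OHat N

/-- The `2`-forms `ω = ∑_{i < j} ω_{ij} db^i ∧ db^j` over `Ô`, given by the skew symmetric matrix of
their coefficients `ω_{ij} = ω(∂_i, ∂_j)`. -/
def twoForms (N : ℕ) : Submodule ℂ (Matrix (Fin N) (Fin N) (OHat N)) where
  carrier := {ω | ∀ i j, ω i j = - ω j i}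
  add_mem' {a b} ha hb i j := by rw [Matrix.add_apply, Matrix.add_apply, ha, hb, neg_add]
  zero_mem' i j := by simp
  smul_mem' c a ha i j := by rw [Matrix.smul_apply, Matrix.smul_apply, ha, smul_neg]

/-- The de Rham differential of `1`-forms: `(dω)_{ij} = ∂_i ω_j - ∂_j ω_i`. -/
def dOne (ω : OneForm N) (i j : Fin N) : OHat N := OHat.pd i (ω j) - OHat.pd j (ω i)

/-- The de Rham differential of `2`-forms:
`(dω)_{ijk} = (dω)(∂_i, ∂_j, ∂_k) = ∂_i ω_{jk} + ∂_j ω_{ki} + ∂_k ω_{ij}`. -/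
def dTwo (ω : Matrix (Fin N) (Fin N) (OHat N)) (i j k : Fin N) : OHat N :=
  OHat.pd i (ω j k) + OHat.pd j (ω k i) + OHat.pd k (ω i j)

/-- The space `Ω^{1,cl}` of closed `1`-forms. -/
def closedOneForms (N : ℕ) : Submodule ℂ (OneForm N) where
  carrier := {ω | ∀ i j, dOne ω i j = 0}
  add_mem' {a b} ha hb i j := by
    have h1 := ha i j
    have h2 := hb i j
    simp only [dOne, Pi.add_apply, map_add] at *
    linear_combination h1 + h2
  zero_mem' i j := by simp [dOne]
  smul_mem' c a ha i j := by
    have h1 := ha i j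
    simp only [dOne, Pi.smul_apply, Derivation.map_smul] at *
    rw [← smul_sub, h1, smul_zero]

/-- The space `Ω^{2,cl}` of closed `2`-forms. -/
def closedTwoForms (N : ℕ) : Submodule ℂ (Matrix (Fin N) (Fin N) (OHat N)) where
  carrier := {ω | ω ∈ twoForms N ∧ ∀ i j k, dTwo ω i j k = 0}
  add_mem' {a b} ha hb := ⟨add_mem ha.1 hb.1, fun i j k => by
    have h1 := ha.2 i j k
    have h2 := hb.2 i j k
    simp only [dTwo, Matrix.add_apply, map_add] at *
    linear_combination h1 + h2⟩
  zero_mem' := ⟨zero_mem _, fun i j k => by simp [dTwo]⟩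
  smul_mem' c a ha := ⟨Submodule.smul_mem _ c ha.1, fun i j k => by
    have h1 := ha.2 i j k
    simp only [dTwo, Matrix.smul_apply, Derivation.map_smul] at *
    rw [← smul_add, ← smul_add, h1, smul_zero]⟩

/-- The wedge product of `1`-forms: `(ω ∧ η)_{ij} = ω_i η_j - ω_j η_i`. -/
def wedge (ω η : OneForm N) : Matrix (Fin N) (Fin N) (OHat N) :=
  Matrix.of fun i j => ω i * η j - ω j * η i

theorem wedge_mem {ω η : OneForm N} (hω : ω ∈ closedOneForms N) (hη : η ∈ closedOneForms N) :
    wedge ω η ∈ closedTwoForms N := by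
  refine ⟨fun i j => ?_, fun i j k => ?_⟩
  · simp only [wedge, Matrix.of_apply]
    ring
  · have h1 := hω i j
    have h2 := hω j k
    have h3 := hω k i
    have h4 := hη i j
    have h5 := hη j k
    have h6 := hη k i
    simp only [dOne, dTwo, wedge, Matrix.of_apply, map_sub, Derivation.leibniz, smul_eq_mul] at *
    linear_combination η k * h1 + η i * h2 + η j * h3 - ω k * h4 - ω i * h5 - ω j * h6

namespace CoordChange

/-- The pull-back `(g^* ω)_i = ∑_k ∂_i g^k · (ω_k)_g` of a `1`-form. -/
def pullOne (g : CoordChange N) : OneForm N →ₗ[ℂ] OneForm N where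
  toFun ω i := ∑ k, g.jac i k * g.pull (ω k)
  map_add' ω η := by
    ext i
    simp [mul_add, Finset.sum_add_distrib]
  map_smul' c ω := by
    ext i
    simp [Finset.smul_sum]

/-- The pull-back `g^* ω = ∂g · ω_g · ∂g^t` of a `2`-form, that is,
`(g^* ω)_{ij} = ∑_{k,l} ∂_i g^k · ∂_j g^l · (ω_{kl})_g`. -/
def pullTwo (g : CoordChange N) :
    Matrix (Fin N) (Fin N) (OHat N) →ₗ[ℂ] Matrix (Fin N) (Fin N) (OHat N) where
  toFun ω := g.jac * ω.map g.pull * g.jac.transpose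
  map_add' ω η := by
    rw [Matrix.map_add _ (map_add g.pull), mul_add, add_mul]
  map_smul' c ω := by
    have : (c • ω).map g.pull = c • ω.map g.pull := by ext; simp
    rw [this, Matrix.mul_smul, Matrix.smul_mul, RingHom.id_apply]

theorem pullOne_apply (g : CoordChange N) (ω : OneForm N) (i : Fin N) :
    g.pullOne ω i = ∑ k, g.jac i k * g.pull (ω k) := rfl

theorem pullTwo_apply (g : CoordChange N) (ω : Matrix (Fin N) (Fin N) (OHat N)) (i j : Fin N) :
    g.pullTwo ω i j = ∑ l, ∑ k, g.jac i k * g.pull (ω k l) * g.jac j l := by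
  change (g.jac * ω.map g.pull * g.jac.transpose) i j = _
  simp [Matrix.mul_apply, Finset.sum_mul]

theorem pd_jac (g : CoordChange N) (i j k : Fin N) :
    OHat.pd i (g.jac j k) = OHat.pd j (g.jac i k) :=
  OHat.pd_comm i j _

theorem pullOne_mul (g₁ g₂ : CoordChange N) (ω : OneForm N) :
    (g₁ * g₂).pullOne ω = g₁.pullOne (g₂.pullOne ω) := by
  ext i
  simp only [pullOne_apply, jac_mul, Matrix.mul_apply, Matrix.map_apply, pull_mul, map_sum, map_mul,
    Finset.sum_mul, Finset.mul_sum]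
  rw [Finset.sum_comm]
  simp only [mul_assoc]

theorem pullOne_one (ω : OneForm N) : (1 : CoordChange N).pullOne ω = ω := by
  ext i
  simp [pullOne_apply, jac_one, pull_one, Matrix.one_apply]

theorem pullTwo_mul (g₁ g₂ : CoordChange N) (ω : Matrix (Fin N) (Fin N) (OHat N)) :
    (g₁ * g₂).pullTwo ω = g₁.pullTwo (g₂.pullTwo ω) := by
  have e : ω.map (g₁ * g₂).pull = (ω.map g₂.pull).map g₁.pull := by
    ext i j
    simp [pull_mul]
  change (g₁ * g₂).jac * ω.map (g₁ * g₂).pull * (g₁ * g₂).jac.transpose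
    = g₁.jac * (g₂.jac * ω.map g₂.pull * g₂.jac.transpose).map g₁.pull * g₁.jac.transpose
  rw [e, jac_mul, Matrix.map_mul, Matrix.map_mul, Matrix.transpose_mul, Matrix.transpose_map]
  simp only [Matrix.mul_assoc]

theorem pullTwo_one (ω : Matrix (Fin N) (Fin N) (OHat N)) :
    (1 : CoordChange N).pullTwo ω = ω := by
  have e : ω.map (1 : CoordChange N).pull = ω := by
    ext i j
    simp [pull_one]
  change (1 : CoordChange N).jac * ω.map (1 : CoordChange N).pull
    * (1 : CoordChange N).jac.transpose = ω
  rw [e, jac_one, Matrix.one_mul, Matrix.transpose_one, Matrix.mul_one]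

theorem pullOne_mem (g : CoordChange N) {ω : OneForm N} (hω : ω ∈ closedOneForms N) :
    g.pullOne ω ∈ closedOneForms N := by
  intro i j
  simp only [dOne, pullOne_apply, map_sum, Derivation.leibniz, smul_eq_mul, pd_pull,
    Finset.sum_add_distrib, Finset.mul_sum]
  have e1 : ∑ k, g.pull (ω k) * OHat.pd i (g.jac j k)
      = ∑ k, g.pull (ω k) * OHat.pd j (g.jac i k) :=
    Finset.sum_congr rfl fun k _ => by rw [pd_jac]
  have e2 : ∑ k, ∑ l, g.jac j k * (g.jac i l * g.pull (OHat.pd l (ω k)))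
      = ∑ k, ∑ l, g.jac i k * (g.jac j l * g.pull (OHat.pd l (ω k))) := by
    rw [Finset.sum_comm]
    refine Finset.sum_congr rfl fun k _ => Finset.sum_congr rfl fun l _ => ?_
    have : OHat.pd k (ω l) = OHat.pd l (ω k) := sub_eq_zero.1 (hω k l)
    rw [this]
    ring
  rw [e1, e2, sub_self]

theorem pullTwo_skew (g : CoordChange N) {ω : Matrix (Fin N) (Fin N) (OHat N)}
    (hω : ω ∈ twoForms N) : g.pullTwo ω ∈ twoForms N := by
  intro i j
  rw [pullTwo_apply, pullTwo_apply, Finset.sum_comm, ← Finset.sum_neg_distrib]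
  refine Finset.sum_congr rfl fun k _ => ?_
  rw [← Finset.sum_neg_distrib]
  refine Finset.sum_congr rfl fun l _ => ?_
  rw [hω k l, map_neg]
  ring

theorem pullTwo_mem (g : CoordChange N) {ω : Matrix (Fin N) (Fin N) (OHat N)}
    (hω : ω ∈ closedTwoForms N) : g.pullTwo ω ∈ closedTwoForms N := by
  refine ⟨pullTwo_skew g hω.1, ?_⟩
  have hskew : ∀ k l, g.pull (ω k l) = - g.pull (ω l k) := fun k l => by
    rw [hω.1 k l, map_neg]
  let P : Fin N → Fin N → Fin N → OHat N := fun i j m =>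
    ∑ l, ∑ k, OHat.pd i (g.jac j k) * g.pull (ω k l) * g.jac m l
  let Q : Fin N → Fin N → Fin N → OHat N := fun i j m =>
    ∑ l, ∑ k, ∑ r, g.jac i r * g.jac j k * g.jac m l * g.pull (OHat.pd r (ω k l))
  have hP : ∀ i j m, P i j m = P j i m := fun i j m =>
    Finset.sum_congr rfl fun l _ => Finset.sum_congr rfl fun k _ => by rw [pd_jac]
  have key : ∀ i j m, OHat.pd i (g.pullTwo ω j m) = P i j m - P i m j + Q i j m := by
    intro i j m
    have h2 : - P i m j = ∑ l, ∑ k, g.jac j k * g.pull (ω k l) * OHat.pd i (g.jac m l) := by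
      rw [← Finset.sum_neg_distrib, Finset.sum_comm]
      simp only [← Finset.sum_neg_distrib]
      rw [Finset.sum_comm]
      conv_rhs => rw [Finset.sum_comm]
      refine Finset.sum_congr rfl fun l _ => Finset.sum_congr rfl fun k _ => ?_
      rw [hskew k l]
      ring
    rw [sub_eq_add_neg, h2, pullTwo_apply]
    simp only [P, Q, ← Finset.sum_add_distrib, map_sum, Derivation.leibniz, smul_eq_mul, pd_pull]
    refine Finset.sum_congr rfl fun l _ => Finset.sum_congr rfl fun k _ => ?_
    have : ∑ r, g.jac i r * g.jac j k * g.jac m l * g.pull (OHat.pd r (ω k l))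
        = g.jac m l * (g.jac j k * ∑ r, g.jac i r * g.pull (OHat.pd r (ω k l))) := by
      rw [Finset.mul_sum, Finset.mul_sum]
      exact Finset.sum_congr rfl fun r _ => by ring
    rw [this]
    ring
  have hQ : ∀ i j m, Q i j m + Q j m i + Q m i j = 0 := by
    intro i j m
    have e1 : Q j m i = ∑ l, ∑ k, ∑ r,
        g.jac i r * g.jac j k * g.jac m l * g.pull (OHat.pd k (ω l r)) := by
      simp only [Q]
      rw [Finset.sum_comm]
      conv_lhs => enter [2, k]; rw [Finset.sum_comm]
      conv_rhs => rw [Finset.sum_comm]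
      conv_rhs => rw [Finset.sum_comm]
      refine Finset.sum_congr rfl fun l _ => Finset.sum_congr rfl fun k _ =>
        Finset.sum_congr rfl fun r _ => ?_
      ring
    have e2 : Q m i j = ∑ l, ∑ k, ∑ r,
        g.jac i r * g.jac j k * g.jac m l * g.pull (OHat.pd l (ω r k)) := by
      simp only [Q]
      conv_lhs => enter [2, l]; rw [Finset.sum_comm]
      rw [Finset.sum_comm]
      refine Finset.sum_congr rfl fun l _ => Finset.sum_congr rfl fun k _ =>
        Finset.sum_congr rfl fun r _ => ?_
      ring
    rw [e1, e2]
    simp only [Q, ← Finset.sum_add_distrib, ← mul_add, ← map_add]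
    refine Finset.sum_eq_zero fun l _ => Finset.sum_eq_zero fun k _ =>
      Finset.sum_eq_zero fun r _ => ?_
    have : OHat.pd r (ω k l) + OHat.pd k (ω l r) + OHat.pd l (ω r k) = 0 := hω.2 r k l
    rw [this, map_zero, mul_zero]
  intro i j m
  rw [dTwo, key, key, key]
  linear_combination hQ i j m + hP i j m + hP j m i + hP m i j

end CoordChange

/-- The `G`-module `Ω^{1,cl}`. -/
def closedOneRep (N : ℕ) : Representation ℂ (CoordChange N) (closedOneForms N) where
  toFun g := g.pullOne.restrict fun _ hω => g.pullOne_mem hω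
  map_one' := by
    ext1 ω
    exact Subtype.ext (CoordChange.pullOne_one ω.1)
  map_mul' g h := by
    ext1 ω
    exact Subtype.ext (CoordChange.pullOne_mul g h ω.1)

/-- The `G`-module `Ω^{2,cl}`. -/
def closedTwoRep (N : ℕ) : Representation ℂ (CoordChange N) (closedTwoForms N) where
  toFun g := g.pullTwo.restrict fun _ hω => g.pullTwo_mem hω
  map_one' := by
    ext1 ω
    exact Subtype.ext (CoordChange.pullTwo_one ω.1)
  map_mul' g h := by
    ext1 ω
    exact Subtype.ext (CoordChange.pullTwo_mul g h ω.1)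

end Forms

/-! ### The vertex algebra `D̂` -/

section VertexAlgebra

variable {N : ℕ}

/-- The creation operators of non-zero mode: `Letter.a i m` stands for `a^i_{-m-1}` and
`Letter.b i n` stands for `b^i_{-n-1}`, for `m, n ≥ 0`. -/
inductive Letter (N : ℕ) : Type
  | a (i : Fin N) (m : ℕ) : Letter N
  | b (i : Fin N) (n : ℕ) : Letter N

/-- The space of states `D̂ = Ô ⊗_O D`. Since `D` is the algebra of polynomials in the commuting
creation operators `b^i_0`, `b^i_{-n}`, `a^i_{-n}` (`n ≥ 1`) applied to the vacuum and
`O = ℂ[b^1_0, …, b^N_0]`, this is the algebra of polynomials over `Ô` in the `b^i_{-n}`, `a^i_{-n}`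
with `n ≥ 1`. The vacuum vector is `1`. -/
abbrev DHat (N : ℕ) : Type := MvPolynomial (Letter N) (OHat N)

/-- The underlying function of `∂/∂b^i_0`. -/
def coeffPdFun (i : Fin N) (p : DHat N) : DHat N :=
  ∑ s ∈ p.support, MvPolynomial.monomial s (OHat.pd i (p.coeff s))

theorem coeff_coeffPdFun (i : Fin N) (p : DHat N) (s : Letter N →₀ ℕ) :
    (coeffPdFun i p).coeff s = OHat.pd i (p.coeff s) := by
  classical
  rw [coeffPdFun, MvPolynomial.coeff_sum]
  simp only [MvPolynomial.coeff_monomial]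
  rw [Finset.sum_ite_eq']
  split_ifs with h
  · rfl
  · rw [MvPolynomial.notMem_support_iff.1 h, map_zero]

/-- The derivative `∂/∂b^i_0`, which acts on the coefficients of a polynomial. -/
def coeffPd (i : Fin N) : DHat N →ₗ[ℂ] DHat N where
  toFun := coeffPdFun i
  map_add' p q := by
    ext s
    simp only [coeff_coeffPdFun, MvPolynomial.coeff_add, map_add]
  map_smul' c p := by
    ext s
    simp only [coeff_coeffPdFun, MvPolynomial.coeff_smul, Derivation.map_smul, RingHom.id_apply]

/-- The derivative `∂/∂a^i_{-m-1}`. -/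
def derA (i : Fin N) (m : ℕ) : DHat N →ₗ[ℂ] DHat N :=
  (MvPolynomial.pderiv (Letter.a i m)).toLinearMap.restrictScalars ℂ

/-- The derivative `∂/∂b^i_{-n}`. -/
def derB (i : Fin N) : ℕ → (DHat N →ₗ[ℂ] DHat N)
  | 0 => coeffPd i
  | n + 1 => (MvPolynomial.pderiv (Letter.b i n)).toLinearMap.restrictScalars ℂ

/-- The action of the translation operator on the generators: `T a^i_{-m} = m a^i_{-m-1}` and
`T b^i_{-n} = (n + 1) b^i_{-n-1}` for `m, n ≥ 1`. -/
def translationLetter : Letter N → DHat N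
  | Letter.a i m => (m + 1) • (MvPolynomial.X (Letter.a i (m + 1)) : DHat N)
  | Letter.b i n => (n + 2) • (MvPolynomial.X (Letter.b i (n + 1)) : DHat N)

/-- The translation operator `T`: the derivation of the algebra `D̂` such that
`T f = ∑_i ∂_i f · b^i_{-1}` for `f ∈ Ô`, `T a^i_{-m} = m a^i_{-m-1}` and
`T b^i_{-n} = (n + 1) b^i_{-n-1}`. -/
def translation (N : ℕ) : Module.End ℂ (DHat N) :=
  ∑ i, LinearMap.mulLeft ℂ (MvPolynomial.X (Letter.b i 0) : DHat N) ∘ₗ coeffPd i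
    + (MvPolynomial.mkDerivation (OHat N) translationLetter).toLinearMap.restrictScalars ℂ

open scoped TensorProduct

/-- The coefficient at `z^{-k}` of the contraction operator on `D̂ ⊗ D̂` defined by the operator
product expansion `a^i(z) b^j(w) ∼ δ_{ij} / (z - w)`. For `k = m + 1 + n` it is the sum of the terms
* `(-1)^m binom(m + n, m) ∂/∂a^i_{-m-1} ⊗ ∂/∂b^i_{-n}`, where `(-1)^m binom(m + n, m)` is the
  coefficient of `w^n z^{-k}` in `(1/m!) ∂_z^m (1/(z - w))`,
* `- (-1)^n binom(m + n, n) ∂/∂b^i_{-n} ⊗ ∂/∂a^i_{-m-1}`, where `- (-1)^n binom(m + n, n)` is the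
  coefficient of `w^m z^{-k}` in `(1/n!) ∂_z^n (-1/(z - w))`. -/
def contraction (N : ℕ) : ℕ → Module.End ℂ (DHat N ⊗[ℂ] DHat N)
  | 0 => 0
  | k + 1 => ∑ i : Fin N, ∑ mn ∈ Finset.HasAntidiagonal.antidiagonal k,
      (((-1 : ℂ) ^ mn.1 * (k.choose mn.1 : ℂ)) • TensorProduct.map (derA i mn.1) (derB i mn.2)
        - ((-1 : ℂ) ^ mn.2 * (k.choose mn.2 : ℂ)) • TensorProduct.map (derB i mn.2) (derA i mn.1))

/-- The coefficient at `z^{-k}` of the exponential of the contraction operator. -/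
def expContraction (N : ℕ) (k : ℕ) : Module.End ℂ (DHat N ⊗[ℂ] DHat N) :=
  ∑ n ∈ Finset.range (k + 1),
    (n.factorial : ℂ)⁻¹ • PowerSeries.coeff k (PowerSeries.mk (contraction N) ^ n)

/-- The weight of a monomial: `a^i_{-n}` and `b^i_{-n}` have weight `n`. -/
def monWeight (s : Letter N →₀ ℕ) : ℕ :=
  s.sum fun x c => c * match x with
    | Letter.a _ m => m + 1
    | Letter.b _ n => n + 1

/-- The polynomials all of whose monomials have weight `d`. -/
def weightSpace (N : ℕ) (d : ℤ) : Submodule ℂ (DHat N) where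
  carrier := {p | ∀ s, p.coeff s ≠ 0 → (monWeight s : ℤ) = d}
  add_mem' {p q} hp hq s hs := by
    by_cases h : p.coeff s = 0
    · refine hq s fun h' => hs ?_
      rw [MvPolynomial.coeff_add, h, h', add_zero]
    · exact hp s h
  zero_mem' s hs := absurd (MvPolynomial.coeff_zero s) hs
  smul_mem' c p hp s hs := hp s fun h => hs (by rw [MvPolynomial.coeff_smul, h, smul_zero])

theorem eq_zero_of_weight_neg {d : ℤ} (hd : d < 0) {p : DHat N} (hp : p ∈ weightSpace N d) :
    p = 0 := by
  ext s
  rw [MvPolynomial.coeff_zero]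
  by_contra h
  have := hp s h
  omega

theorem monWeight_add_single (s : Letter N →₀ ℕ) (x : Letter N) :
    monWeight (s + Finsupp.single x 1) = monWeight s + monWeight (Finsupp.single x 1) := by
  classical
  exact Finsupp.sum_add_index' (fun _ => zero_mul _) (fun _ _ _ => add_mul _ _ _)

theorem pderiv_weight {d : ℤ} (x : Letter N) {p : DHat N} (hp : p ∈ weightSpace N d) :
    MvPolynomial.pderiv x p ∈ weightSpace N (d - monWeight (Finsupp.single x 1)) := by
  intro s hs
  rw [MvPolynomial.coeff_pderiv] at hs
  have := hp _ (left_ne_zero_of_mul hs)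
  rw [monWeight_add_single] at this
  push_cast at this
  omega

theorem derA_weight {d : ℤ} (i : Fin N) (m : ℕ) {p : DHat N} (hp : p ∈ weightSpace N d) :
    derA i m p ∈ weightSpace N (d - (m + 1)) := by
  have := pderiv_weight (Letter.a i m) hp
  simpa [monWeight, derA] using this

theorem derB_weight {d : ℤ} (i : Fin N) (n : ℕ) {p : DHat N} (hp : p ∈ weightSpace N d) :
    derB i n p ∈ weightSpace N (d - n) := by
  cases n with
  | zero =>
    intro s hs
    have h : (coeffPdFun i p).coeff s ≠ 0 := hs
    rw [coeff_coeffPdFun] at h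
    simpa using hp s fun h' => h (by rw [h', map_zero])
  | succ n =>
    have := pderiv_weight (Letter.b i n) hp
    simpa [monWeight, derB] using this

/-- The span of the tensors of total weight `d`. -/
def tensorWeightSpace (N : ℕ) (d : ℤ) : Submodule ℂ (DHat N ⊗[ℂ] DHat N) :=
  Submodule.span ℂ {t | ∃ (p q : ℤ) (u v : DHat N), p + q = d ∧ u ∈ weightSpace N p ∧
    v ∈ weightSpace N q ∧ t = u ⊗ₜ v}

theorem eq_zero_of_tensorWeight_neg {d : ℤ} (hd : d < 0) {t : DHat N ⊗[ℂ] DHat N}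
    (ht : t ∈ tensorWeightSpace N d) : t = 0 := by
  have : tensorWeightSpace N d ≤ ⊥ := by
    refine Submodule.span_le.2 ?_
    rintro _ ⟨p, q, u, v, hpq, hu, hv, rfl⟩
    rcases lt_or_ge p 0 with h | h
    · rw [eq_zero_of_weight_neg h hu, TensorProduct.zero_tmul]
      exact zero_mem _
    · rw [eq_zero_of_weight_neg (by omega) hv, TensorProduct.tmul_zero]
      exact zero_mem _
  exact (Submodule.mem_bot ℂ).1 (this ht)

theorem contraction_weight (k : ℕ) {d : ℤ} {t : DHat N ⊗[ℂ] DHat N}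
    (ht : t ∈ tensorWeightSpace N d) : contraction N k t ∈ tensorWeightSpace N (d - k) := by
  cases k with
  | zero => exact zero_mem _
  | succ k =>
    have : tensorWeightSpace N d
        ≤ (tensorWeightSpace N (d - (k + 1 : ℕ))).comap (contraction N (k + 1)) := by
      refine Submodule.span_le.2 ?_
      rintro _ ⟨p, q, u, v, hpq, hu, hv, rfl⟩
      change contraction N (k + 1) (u ⊗ₜ v) ∈ tensorWeightSpace N (d - (k + 1 : ℕ))
      rw [contraction]
      simp only [LinearMap.sum_apply, LinearMap.sub_apply, LinearMap.smul_apply,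
        TensorProduct.map_tmul]
      refine Submodule.sum_mem _ fun i _ => Submodule.sum_mem _ fun mn hmn => ?_
      have hk : mn.1 + mn.2 = k := Finset.HasAntidiagonal.mem_antidiagonal.1 hmn
      refine Submodule.sub_mem _ (Submodule.smul_mem _ _ (Submodule.subset_span ?_))
        (Submodule.smul_mem _ _ (Submodule.subset_span ?_))
      · exact ⟨_, _, _, _, by push_cast; omega, derA_weight i mn.1 hu, derB_weight i mn.2 hv, rfl⟩
      · exact ⟨_, _, _, _, by push_cast; omega, derB_weight i mn.2 hu, derA_weight i mn.1 hv, rfl⟩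
    exact this ht

theorem coeff_pow_weight (n k : ℕ) {d : ℤ} {t : DHat N ⊗[ℂ] DHat N}
    (ht : t ∈ tensorWeightSpace N d) :
    PowerSeries.coeff k (PowerSeries.mk (contraction N) ^ n) t ∈ tensorWeightSpace N (d - k) := by
  induction n generalizing k d t with
  | zero =>
    rw [pow_zero, PowerSeries.coeff_one]
    split_ifs with h
    · simpa [h] using ht
    · exact zero_mem _
  | succ n ih =>
    rw [pow_succ, PowerSeries.coeff_mul, LinearMap.sum_apply]
    refine Submodule.sum_mem _ fun ij hij => ?_
    have hk : ij.1 + ij.2 = k := Finset.HasAntidiagonal.mem_antidiagonal.1 hij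
    have h := ih ij.1 (contraction_weight ij.2 ht)
    rw [PowerSeries.coeff_mk, Module.End.mul_apply]
    convert h using 2
    omega

/-- The exponential of the contraction operator is a polynomial in `z^{-1}` on every element, so
that only finitely many terms contribute to every `n`-th product. -/
theorem expContraction_eventually_zero (t : DHat N ⊗[ℂ] DHat N) :
    ∃ K : ℕ, ∀ k, K ≤ k → expContraction N k t = 0 := by
  have hadd : ∀ t t' : DHat N ⊗[ℂ] DHat N, (∃ K : ℕ, ∀ k, K ≤ k → expContraction N k t = 0) →
      (∃ K : ℕ, ∀ k, K ≤ k → expContraction N k t' = 0) →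
      ∃ K : ℕ, ∀ k, K ≤ k → expContraction N k (t + t') = 0 := by
    rintro t t' ⟨K, hK⟩ ⟨K', hK'⟩
    refine ⟨max K K', fun k hk => ?_⟩
    rw [map_add, hK k (le_trans (le_max_left _ _) hk), hK' k (le_trans (le_max_right _ _) hk),
      add_zero]
  have hmon : ∀ (s : Letter N →₀ ℕ) (f : OHat N),
      MvPolynomial.monomial s f ∈ weightSpace N (monWeight s) := by
    classical
    intro s f s' hs'
    rw [MvPolynomial.coeff_monomial] at hs'
    by_cases h : s = s'
    · rw [h]
    · rw [if_neg h] at hs'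
      exact absurd rfl hs'
  induction t using TensorProduct.induction_on with
  | zero => exact ⟨0, fun k _ => map_zero _⟩
  | add t t' h h' => exact hadd t t' h h'
  | tmul u v =>
    induction u using MvPolynomial.induction_on' with
    | add p q hp hq => rw [TensorProduct.add_tmul]; exact hadd _ _ hp hq
    | monomial s f =>
      induction v using MvPolynomial.induction_on' with
      | add p q hp hq => rw [TensorProduct.tmul_add]; exact hadd _ _ hp hq
      | monomial s' f' =>
        refine ⟨monWeight s + monWeight s' + 1, fun k hk => ?_⟩
        rw [expContraction, LinearMap.sum_apply]
        refine Finset.sum_eq_zero fun n _ => ?_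
        rw [LinearMap.smul_apply, eq_zero_of_tensorWeight_neg (d := monWeight s + monWeight s' - k)
          (by omega) (coeff_pow_weight n k (Submodule.subset_span
            ⟨_, _, _, _, rfl, hmon s f, hmon s' f', rfl⟩)), smul_zero]

/-- The `n`-th product `u_{(n)} v` of the vertex algebra `D̂`, that is, the coefficient at `z^{-n-1}`
of `Y(u, z) v`. The vertex operators are given by Wick's formula for the normally ordered field
`Y(u, z)` attached to the state `u`,
`Y(u, z) v = μ ((e^{zT} ⊗ 1) e^{C(z)} (u ⊗ v))`,
where `μ` is the multiplication of the commutative algebra `D̂` and `C(z)` is the contraction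
operator. -/
def nProd (n : ℤ) (u v : DHat N) : DHat N :=
  ∑ᶠ kl : {kl : ℕ × ℕ // (kl.2 : ℤ) - kl.1 = - n - 1},
    LinearMap.mul' ℂ (DHat N)
      (TensorProduct.map ((kl.1.2.factorial : ℂ)⁻¹ • translation N ^ kl.1.2) LinearMap.id
        (expContraction N kl.1.1 (u ⊗ₜ v)))

/-- The element `f ∈ Ô = D̂_0`. -/
def ofFun (f : OHat N) : DHat N := MvPolynomial.C f

/-- The inclusion `Ω^1 = F^1 D̂_1 ⊂ D̂_1`, `∑ ω_i db^i ↦ ∑ ω_i b^i_{-1}`. -/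
def ofOneForm (ω : OneForm N) : DHat N :=
  ∑ i, MvPolynomial.C (ω i) * MvPolynomial.X (Letter.b i 0)

/-- The elements `∑ τ^i a^i_{-1}` of `D̂_1` attached to vector fields `τ = ∑ τ^i ∂_i` over `Ô`. One
has `D̂_1 = ofVectorField (Ô^N) ⊕ ofOneForm (Ω^1)`, so that they represent the elements of
`D̂_1 / F^1 D̂_1`. -/
def ofVectorField (τ : Fin N → OHat N) : DHat N :=
  ∑ i, MvPolynomial.C (τ i) * MvPolynomial.X (Letter.a i 0)

/-- The action of a coordinate change on vector fields, `(g τ)^j = ∑_i φ^{ji} (τ^i)_g`, where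
`φ = (∂g)^{-1 t}`; it is characterized by `(g τ)(f_g) = (τ f)_g` for `f ∈ Ô`. -/
def CoordChange.pullVectorField (g : CoordChange N) (τ : Fin N → OHat N) : Fin N → OHat N :=
  fun j => ∑ i, g.jac⁻¹.transpose j i * g.pull (τ i)

/-- A linear automorphism `F` of `D̂` is an automorphism of the vertex algebra if it preserves the
vacuum and all `n`-th products. -/
def IsVertexAut (F : DHat N ≃ₗ[ℂ] DHat N) : Prop :=
  F 1 = 1 ∧ ∀ (n : ℤ) (u v : DHat N), F (nProd n u v) = nProd n (F u) (F v)

/-- `F` induces the automorphism `g` on `D̂_0 = Ô` and the automorphism induced by `g` on the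
associated graded space `Ω^1 ⊕ 𝒯` of `D̂_1` with respect to the filtration
`0 ⊂ Ω^1 = F^1 D̂_1 ⊂ D̂_1`. -/
def Induces (F : DHat N ≃ₗ[ℂ] DHat N) (g : CoordChange N) : Prop :=
  (∀ f : OHat N, F (ofFun f) = ofFun (g.pull f)) ∧
  (∀ ω : OneForm N, F (ofOneForm ω) = ofOneForm (g.pullOne ω)) ∧
  (∀ τ : Fin N → OHat N, ∃ ω : OneForm N,
    F (ofVectorField τ) = ofVectorField (g.pullVectorField τ) + ofOneForm ω)

theorem CoordChange.pullVectorField_mul (g₁ g₂ : CoordChange N) (τ : Fin N → OHat N) :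
    (g₁ * g₂).pullVectorField τ = g₁.pullVectorField (g₂.pullVectorField τ) := by
  ext j
  simp only [pullVectorField, jac_mul, Matrix.mul_inv_rev, inv_map_pull, Matrix.transpose_apply,
    Matrix.mul_apply, Matrix.map_apply, pull_mul, map_sum, map_mul, Finset.sum_mul, Finset.mul_sum]
  rw [Finset.sum_comm]
  refine Finset.sum_congr rfl fun k _ => Finset.sum_congr rfl fun i _ => ?_
  ring

theorem CoordChange.pullVectorField_one (τ : Fin N → OHat N) :
    (1 : CoordChange N).pullVectorField τ = τ := by
  ext j
  simp [pullVectorField, jac_one, pull_one, Matrix.one_apply]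

theorem ofOneForm_add (ω η : OneForm N) : ofOneForm (ω + η) = ofOneForm ω + ofOneForm η := by
  simp [ofOneForm, add_mul, Finset.sum_add_distrib]

theorem ofOneForm_neg (ω : OneForm N) : ofOneForm (-ω) = - ofOneForm ω := by
  simp [ofOneForm]

/-- The group `G^∼` of all natural automorphisms of the vertex algebra `D̂`, with the composition of
maps as multiplication. -/
def natAut (N : ℕ) : Subgroup (DHat N ≃ₗ[ℂ] DHat N) where
  carrier := {F | IsVertexAut F ∧ ∃ g : CoordChange N, Induces F g}
  one_mem' := by
    refine ⟨⟨rfl, fun _ _ _ => rfl⟩, 1, fun f => ?_, fun ω => ?_, fun τ => ⟨0, ?_⟩⟩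
    · rw [CoordChange.pull_one]; rfl
    · rw [CoordChange.pullOne_one]; rfl
    · rw [CoordChange.pullVectorField_one]; simp [ofOneForm]
  mul_mem' := by
    rintro F F' ⟨⟨h1, h2⟩, g, h3, h4, h5⟩ ⟨⟨h1', h2'⟩, g', h3', h4', h5'⟩
    refine ⟨⟨?_, fun n u v => ?_⟩, g * g', fun f => ?_, fun ω => ?_, fun τ => ?_⟩
    · rw [LinearEquiv.mul_apply, h1', h1]
    · rw [LinearEquiv.mul_apply, h2', h2]; rfl
    · rw [LinearEquiv.mul_apply, h3', h3, CoordChange.pull_mul]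
    · rw [LinearEquiv.mul_apply, h4', h4, CoordChange.pullOne_mul]
    · obtain ⟨ω, hω⟩ := h5' τ
      obtain ⟨η, hη⟩ := h5 (g'.pullVectorField τ)
      refine ⟨η + g.pullOne ω, ?_⟩
      rw [LinearEquiv.mul_apply, hω, map_add, hη, h4, ofOneForm_add,
        CoordChange.pullVectorField_mul, add_assoc]
  inv_mem' := by
    rintro F ⟨⟨h1, h2⟩, g, h3, h4, h5⟩
    have hF : ∀ x, F (F⁻¹ x) = x := fun x => F.apply_symm_apply x
    refine ⟨⟨?_, fun n u v => ?_⟩, g⁻¹, fun f => ?_, fun ω => ?_, fun τ => ?_⟩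
    · apply F.injective; rw [hF, h1]
    · apply F.injective; rw [hF, h2, hF, hF]
    · apply F.injective
      rw [hF, h3, ← CoordChange.pull_mul, mul_inv_cancel, CoordChange.pull_one]
    · apply F.injective
      rw [hF, h4, ← CoordChange.pullOne_mul, mul_inv_cancel, CoordChange.pullOne_one]
    · obtain ⟨ω, hω⟩ := h5 (g⁻¹.pullVectorField τ)
      refine ⟨- g⁻¹.pullOne ω, ?_⟩
      apply F.injective
      rw [hF, map_add, hω, h4, ← CoordChange.pullVectorField_mul, mul_inv_cancel,
        CoordChange.pullVectorField_one, map_neg, ← CoordChange.pullOne_mul, mul_inv_cancel,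
        CoordChange.pullOne_one, ofOneForm_neg]
      abel

end VertexAlgebra

/-! ### Characteristic classes in the cohomology of `G` -/

section Cohomology

variable {N : ℕ}

open groupCohomology

/-- The `G`-module `Ω^{1,cl}` of closed `1`-forms. -/
abbrev closedOneMod (N : ℕ) : Rep ℂ (CoordChange N) := Rep.of (closedOneRep N)

/-- The `G`-module `Ω^{2,cl}` of closed `2`-forms. -/
abbrev closedTwoMod (N : ℕ) : Rep ℂ (CoordChange N) := Rep.of (closedTwoRep N)

namespace CoordChange

/-- The matrix valued `1`-form `(∂g)^{-1} d(∂g) = ∑_k (∂g)^{-1} ∂_k(∂g) db^k`. -/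
def leftForm (g : CoordChange N) (k : Fin N) : Matrix (Fin N) (Fin N) (OHat N) :=
  g.jac⁻¹ * g.jac.map (OHat.pd k)

/-- The matrix valued `1`-form `d(∂g) (∂g)^{-1} = ∑_k ∂_k(∂g) (∂g)^{-1} db^k`. -/
def rightForm (g : CoordChange N) (k : Fin N) : Matrix (Fin N) (Fin N) (OHat N) :=
  g.jac.map (OHat.pd k) * g.jac⁻¹

/-- The pull-back `g^*` of a matrix valued `1`-form `∑_k Θ_k db^k`. -/
def pullMatrixForm (g : CoordChange N) (Θ : Fin N → Matrix (Fin N) (Fin N) (OHat N)) (k : Fin N) :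
    Matrix (Fin N) (Fin N) (OHat N) :=
  ∑ l, g.jac k l • (Θ l).map g.pull

/-- The `1`-form `tr((∂g)^{-1} d(∂g)) = d log det(∂g)`. -/
def traceForm (g : CoordChange N) : OneForm N := fun k => (g.leftForm k).trace

end CoordChange

theorem pd_matrix_mul (k : Fin N) (A B : Matrix (Fin N) (Fin N) (OHat N)) :
    (A * B).map (OHat.pd k) = A.map (OHat.pd k) * B + A * B.map (OHat.pd k) := by
  ext i j
  simp only [Matrix.map_apply, Matrix.mul_apply, Matrix.add_apply, map_sum, Derivation.leibniz,
    smul_eq_mul, ← Finset.sum_add_distrib]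
  exact Finset.sum_congr rfl fun l _ => by ring

theorem pd_matrix_inv (k : Fin N) {A : Matrix (Fin N) (Fin N) (OHat N)} (hA : IsUnit A.det) :
    A⁻¹.map (OHat.pd k) = - (A⁻¹ * A.map (OHat.pd k) * A⁻¹) := by
  have h := pd_matrix_mul k A⁻¹ A
  rw [Matrix.nonsing_inv_mul _ hA] at h
  have h1 : (1 : Matrix (Fin N) (Fin N) (OHat N)).map (OHat.pd k) = 0 := by
    ext i j
    rw [Matrix.map_apply, Matrix.one_apply]
    split_ifs <;> simp
  rw [h1] at h
  calc A⁻¹.map (OHat.pd k) = A⁻¹.map (OHat.pd k) * (A * A⁻¹) := by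
        rw [Matrix.mul_nonsing_inv _ hA, Matrix.mul_one]
    _ = A⁻¹.map (OHat.pd k) * A * A⁻¹ := by rw [Matrix.mul_assoc]
    _ = - (A⁻¹ * A.map (OHat.pd k) * A⁻¹) := by
        rw [eq_neg_of_add_eq_zero_left h.symm, Matrix.neg_mul]

theorem pd_trace (k : Fin N) (A : Matrix (Fin N) (Fin N) (OHat N)) :
    OHat.pd k A.trace = (A.map (OHat.pd k)).trace := by
  simp [Matrix.trace]

namespace CoordChange

theorem traceForm_mem (g : CoordChange N) : g.traceForm ∈ closedOneForms N := by
  intro i j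
  have hc : (g.jac.map (OHat.pd j)).map (OHat.pd i) = (g.jac.map (OHat.pd i)).map (OHat.pd j) := by
    ext a b
    exact OHat.pd_comm i j _
  have key : ∀ i j, OHat.pd i (g.traceForm j)
      = - (g.jac⁻¹ * g.jac.map (OHat.pd i) * (g.jac⁻¹ * g.jac.map (OHat.pd j))).trace
        + (g.jac⁻¹ * (g.jac.map (OHat.pd j)).map (OHat.pd i)).trace := by
    intro i j
    rw [traceForm, leftForm, pd_trace, pd_matrix_mul, pd_matrix_inv _ g.isUnit_det_jac,
      Matrix.trace_add, Matrix.neg_mul, Matrix.trace_neg, Matrix.mul_assoc _ g.jac⁻¹]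
  rw [dOne, key, key, hc, Matrix.trace_mul_comm (g.jac⁻¹ * g.jac.map (OHat.pd i))]
  ring

theorem traceForm_mul (g h : CoordChange N) :
    (g * h).traceForm = g.pullOne h.traceForm + g.traceForm := by
  ext k
  have hB : IsUnit (h.jac.map g.pull).det := by
    have := h.isUnit_det_jac.map g.pull
    rwa [AlgHom.map_det] at this
  have e1 : (h.jac.map g.pull).map (OHat.pd k)
      = ∑ l, g.jac k l • (h.jac.map (OHat.pd l)).map g.pull := by
    ext a b
    simp [Matrix.sum_apply, pd_pull]
  have e2 : ((h.jac.map g.pull)⁻¹ * (h.jac.map g.pull).map (OHat.pd k)).trace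
      = g.pullOne h.traceForm k := by
    rw [e1, Matrix.mul_sum, Matrix.trace_sum, pullOne_apply]
    refine Finset.sum_congr rfl fun l _ => ?_
    rw [Matrix.mul_smul, Matrix.trace_smul, smul_eq_mul, inv_map_pull, ← Matrix.map_mul, traceForm,
      leftForm, Matrix.trace, Matrix.trace, map_sum]
    rfl
  rw [Pi.add_apply, ← e2, traceForm, leftForm, jac_mul, pd_matrix_mul, Matrix.mul_inv_rev,
    Matrix.mul_add, Matrix.trace_add, add_comm]
  congr 1
  · rw [Matrix.mul_assoc, ← Matrix.mul_assoc g.jac⁻¹ g.jac, Matrix.nonsing_inv_mul _ g.isUnit_det_jac,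
      Matrix.one_mul]
  · rw [← Matrix.mul_assoc, Matrix.trace_mul_comm, ← Matrix.mul_assoc, ← Matrix.mul_assoc,
      Matrix.mul_nonsing_inv _ hB, Matrix.one_mul]
    rfl

theorem pullTwo_wedge (g : CoordChange N) (ω η : OneForm N) :
    g.pullTwo (wedge ω η) = wedge (g.pullOne ω) (g.pullOne η) := by
  ext i j
  rw [pullTwo_apply]
  simp only [wedge, Matrix.of_apply, pullOne_apply, Finset.sum_mul_sum, map_sub, map_mul]
  rw [Finset.sum_comm, ← sub_eq_zero]
  conv_lhs => enter [2, 2]; rw [Finset.sum_comm]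
  simp only [← Finset.sum_sub_distrib]
  exact Finset.sum_eq_zero fun k _ => Finset.sum_eq_zero fun l _ => by ring

end CoordChange

/-- The cocycle `g ↦ tr((∂g)^{-1} d(∂g)) ∈ Ω^{1,cl}`. -/
def chernOneCocycle (N : ℕ) : cocycles₁ (closedOneMod N) :=
  ⟨fun g => ⟨g.traceForm, g.traceForm_mem⟩, (mem_cocycles₁_iff _).2 fun g h =>
    Subtype.ext (CoordChange.traceForm_mul g h)⟩

/-- The cup product `Z^1(G; Ω^{1,cl}) × Z^1(G; Ω^{1,cl}) → Z^2(G; Ω^{2,cl})` induced by the wedge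
product of forms: `(x ∪ y)(g₁, g₂) = x(g₁) ∧ g₁^* y(g₂)`. -/
def cup (x y : cocycles₁ (closedOneMod N)) : cocycles₂ (closedTwoMod N) :=
  ⟨fun g => ⟨wedge (x g.1).1 (g.1.pullOne (y g.2).1),
      wedge_mem (x g.1).2 (g.1.pullOne_mem (y g.2).2)⟩,
    (mem_cocycles₂_iff _).2 fun g h j => Subtype.ext (by
      have hx : (x (g * h)).1 = g.pullOne (x h).1 + (x g).1 :=
        congrArg Subtype.val ((mem_cocycles₁_iff x).1 x.2 g h)
      have hy : (y (h * j)).1 = h.pullOne (y j).1 + (y h).1 :=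
        congrArg Subtype.val ((mem_cocycles₁_iff y).1 y.2 h j)
      change wedge (x (g * h)).1 ((g * h).pullOne (y j).1) + wedge (x g).1 (g.pullOne (y h).1)
        = g.pullTwo (wedge (x h).1 (h.pullOne (y j).1)) + wedge (x g).1 (g.pullOne (y (h * j)).1)
      rw [hx, hy, CoordChange.pullTwo_wedge, CoordChange.pullOne_mul, map_add]
      ext a b
      simp only [wedge, Matrix.of_apply, Matrix.add_apply, Pi.add_apply]
      ring)⟩

/-- The universal first Chern class `c_1 ∈ H^1(G; Ω^{1,cl})`. -/
def chernOne (N : ℕ) : H1 (closedOneMod N) := H1π (closedOneMod N) (chernOneCocycle N)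

/-- The square `c_1^2 = c_1 ∪ c_1 ∈ H^2(G; Ω^{2,cl})` of the universal first Chern class. -/
def chernOneSq (N : ℕ) : H2 (closedTwoMod N) :=
  H2π (closedTwoMod N) (cup (chernOneCocycle N) (chernOneCocycle N))

/-- The trace `tr(Θ ∧ Ξ)` of the product of two matrix valued `1`-forms:
`tr(Θ ∧ Ξ)_{ij} = tr(Θ_i Ξ_j) - tr(Θ_j Ξ_i)`. -/
def traceWedge (Θ Ξ : Fin N → Matrix (Fin N) (Fin N) (OHat N)) :
    Matrix (Fin N) (Fin N) (OHat N) :=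
  Matrix.of fun i j => (Θ i * Ξ j).trace - (Θ j * Ξ i).trace

/-- The `2`-form valued `2`-cocycle attached to the second elementary symmetric function of the
eigenvalues of a matrix, the polarization of which is `(tr A · tr B - tr(A B)) / 2`:
`(g₁, g₂) ↦ (tr θ₁ ∧ tr θ₂ - tr(θ₁ ∧ θ₂)) / 2`, where `θ₁ = (∂g₁)^{-1} d(∂g₁)` and
`θ₂ = g₁^* (d(∂g₂) (∂g₂)^{-1})`. -/
def chernTwoForm (g₁ g₂ : CoordChange N) : Matrix (Fin N) (Fin N) (OHat N) :=
  (1 / 2 : ℂ) • (wedge (fun k => (g₁.leftForm k).trace)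
      (fun k => (g₁.pullMatrixForm g₂.rightForm k).trace)
    - traceWedge g₁.leftForm (g₁.pullMatrixForm g₂.rightForm))

/-- The coefficients of the `3`-form `- tr(θ ∧ θ ∧ θ) / 6`, where `θ = (∂g)^{-1} d(∂g)`. -/
def chernTwoTransgression (g : CoordChange N) (i j k : Fin N) : OHat N :=
  (- 1 / 2 : ℂ) • ((g.leftForm i * g.leftForm j * g.leftForm k).trace
    - (g.leftForm i * g.leftForm k * g.leftForm j).trace)

/-- By the Poincaré lemma `Ω^{2,cl}` is quasi-isomorphic to the truncated de Rham complex
`Ω^2 → Ω^3 → ⋯`, so that a class in `H^2(G; Ω^{2,cl})` may be given by a pair of cochains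
`u ∈ C^2(G; Ω^2)` and `v ∈ C^1(G; Ω^3)` such that `δu = 0`, `du = δv` and `dv = 0`. The class `x`
which corresponds to `(u, v)` is the class of the `Ω^{2,cl}`-valued cocycle `u - δη`, for any
cochain `η ∈ C^1(G; Ω^2)` such that `dη = v`. -/
def IsClassOfPair (u : CoordChange N → CoordChange N → Matrix (Fin N) (Fin N) (OHat N))
    (v : CoordChange N → Fin N → Fin N → Fin N → OHat N) (x : H2 (closedTwoMod N)) : Prop :=
  ∃ (η : CoordChange N → twoForms N) (z : cocycles₂ (closedTwoMod N)),
    (∀ g, dTwo (η g).1 = v g) ∧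
    (∀ g₁ g₂ : CoordChange N,
      (z (g₁, g₂)).1 = u g₁ g₂ - (g₁.pullTwo (η g₂).1 - (η (g₁ * g₂)).1 + (η g₁).1)) ∧
    x = H2π (closedTwoMod N) z

/-- `x` is the universal second Chern class `c_2 ∈ H^2(G; Ω^{2,cl})`. It is given by the standard
(Bott-Shulman) representative of `c_2` in the truncated de Rham complex, which is obtained by
applying Chern-Weil theory to the simplices spanned by the flat connections `g^* ∇`, `∇` being the
connection on the tangent bundle for which the `∂_i` are horizontal. Its component in
`C^2(G; Ω^2)` is the standard cocycle of the Hodge class `c_2 ∈ H^2(G; Ω^2)`, and its component in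
`C^1(G; Ω^3)` is the transgression form. -/
def IsChernTwo (x : H2 (closedTwoMod N)) : Prop :=
  IsClassOfPair chernTwoForm chernTwoTransgression x

/-- `x ∈ H^2(G; A)` is the cohomology class of the extension `0 → A → E → G → 1` of `G` by the
`G`-module `A`: for a set-theoretic section `σ` it is the class of the cocycle `z` such that
`σ(g₁) σ(g₂) = z(g₁, g₂) σ(g₁ g₂)`. -/
def IsExtensionClass {G E : Type} [Group G] [Group E] {A : Rep.{0} ℂ G}
    (S : GroupExtension (Multiplicative A) E G) (x : H2 A) : Prop :=
  ∃ (σ : S.Section) (z : cocycles₂ A),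
    (∀ g₁ g₂ : G, σ.toFun g₁ * σ.toFun g₂
      = S.inl (Multiplicative.ofAdd (z (g₁, g₂))) * σ.toFun (g₁ * g₂)) ∧
    x = H2π A z

end Cohomology

end ChiralDO

end

/-! `D̂` is generated, with respect to its products, by the functions and the `a^i_{-1}`. A natural
automorphism over `g` is therefore the same as a choice of images of the `a^i_{-1}` having the
correct operator product expansions with the functions and with each other (`IsFrame.exists_hom`,
`eq_of_homStates`). The vector field part of the image of `a^i_{-1}` is the `i`-th row of `(∂g)⁻¹`;
the `1`-form parts are the rows of `(∂g)⁻¹ H` for a matrix `H`, which together with `g` determines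
the automorphism.

In the products of two vector fields the double contraction adds a trace of first derivatives to the
classical Courant bracket and pairing. Because of this term the conditions on `H` are inhomogeneous.
With `θ = (∂g)⁻¹ d(∂g)` their solutions are `H_{kl} = tr(θ_k θ_l)/2 - β_{kl}`, where `β` is a
`2`-form with `dβ = -tr(θ ∧ θ ∧ θ)/6` (`CoordChange.isFrame_liftCoeff`,
`natAut.transgression_spec`). The form on the right is closed, so the Poincaré lemma provides `β`
(`exists_transgression`) and every `g` lifts. For `g = 1` the solutions are exactly the closed
`2`-forms. This gives the extension.

Lifts with matrices `H₁`, `H₂` compose to the lift with matrix `H₁ + g₁^* H₂ + (tr(ρ_k θ_l))`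
(`IsLift.comp`), where `θ` belongs to `g₁` and `ρ = g₁^*(d(∂g₂)(∂g₂)⁻¹)`. The last term appears
since `a_{(-1)} f` differs from `f a` for a vector field `a` with non-constant coefficients.
Expanding `tr(θ_k θ_l)` for `g₁ g₂` shows that the symmetric parts agree. What is left is a formula
for the factor set: `z = tr θ ∧ tr ρ - 2 (u - δβ)`, where `u` is the `2`-form part of `c_2`
(`natAut.mul_eq_ofClosedTwoForm_mul_iff`). Since `tr ρ = g₁^* tr θ_{g₂}`, this reads `z = c_1^2 - 2
c_2` on cocycles. Read backwards it proves that `c_2` exists: `z` is a cocycle, being a factor set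
(`exists_factorSet`), hence so is `u - δβ`. Uniqueness holds since two choices of `β` differ by
closed forms.

All this rests on two identities for the products defined by Wick's formula: Borcherds' commutator
formula and the formula for the modes of a `(-1)`-st product (`WickData.commutator`,
`WickData.normal_order`). The composites `Y(u,z)Y(v,w)t`, `Y(v,w)Y(u,z)t` and `Y(Y(u,z-w)v,w)t` are
expansions, in three domains, of the single expression obtained by applying `E₁₂(z-w) E₁₃(z) E₂₃(w)`
and then `e^{zT} ⊗ e^{wT} ⊗ 1` to `u ⊗ v ⊗ t` and multiplying the factors. The identities thereby
become identities between binomial coefficients. -/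

noncomputable section

namespace ChiralDO

open Filter Topology
open scoped TensorProduct

/-! ### Triple tensor products, summation and expansion coefficients -/

section

section Triple

variable {V : Type*} [CommRing V] [Algebra ℂ V]

/-! ### Operators on two of the factors of a triple tensor product -/

/-- An operator acting on the first two factors of `V ⊗ V ⊗ V`. -/
def slot12 (V : Type*) [CommRing V] [Algebra ℂ V] :
    Module.End ℂ (V ⊗[ℂ] V) →ₐ[ℂ] Module.End ℂ (V ⊗[ℂ] (V ⊗[ℂ] V)) :=
  ((TensorProduct.assoc ℂ V V V).conjAlgEquiv ℂ : _ →ₐ[ℂ] _).comp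
    (Module.End.rTensorAlgHom ℂ (V ⊗[ℂ] V) V)

/-- An operator acting on the last two factors of `V ⊗ V ⊗ V`. -/
def slot23 (V : Type*) [CommRing V] [Algebra ℂ V] :
    Module.End ℂ (V ⊗[ℂ] V) →ₐ[ℂ] Module.End ℂ (V ⊗[ℂ] (V ⊗[ℂ] V)) :=
  Module.End.lTensorAlgHom ℂ (V ⊗[ℂ] V) V

/-- The exchange of the last two factors of `V ⊗ V ⊗ V`. -/
def swap23 (V : Type*) [CommRing V] [Algebra ℂ V] :
    (V ⊗[ℂ] (V ⊗[ℂ] V)) ≃ₗ[ℂ] (V ⊗[ℂ] (V ⊗[ℂ] V)) :=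
  (TensorProduct.comm ℂ V V).lTensor V

/-- An operator acting on the first and the last factor of `V ⊗ V ⊗ V`. -/
def slot13 (V : Type*) [CommRing V] [Algebra ℂ V] :
    Module.End ℂ (V ⊗[ℂ] V) →ₐ[ℂ] Module.End ℂ (V ⊗[ℂ] (V ⊗[ℂ] V)) :=
  ((swap23 V).conjAlgEquiv ℂ : _ →ₐ[ℂ] _).comp (slot12 V)

/-- The exchange of the first two factors of `V ⊗ V ⊗ V`. -/
def swap12 (V : Type*) [CommRing V] [Algebra ℂ V] : Module.End ℂ (V ⊗[ℂ] (V ⊗[ℂ] V)) :=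
  slot12 V (TensorProduct.comm ℂ V V)

theorem slot12_tmul (X : Module.End ℂ (V ⊗[ℂ] V)) (u v t : V) :
    slot12 V X (u ⊗ₜ (v ⊗ₜ t)) = TensorProduct.assoc ℂ V V V (X (u ⊗ₜ v) ⊗ₜ t) := rfl

theorem slot23_tmul (X : Module.End ℂ (V ⊗[ℂ] V)) (u v t : V) :
    slot23 V X (u ⊗ₜ (v ⊗ₜ t)) = u ⊗ₜ X (v ⊗ₜ t) := rfl

theorem slot13_tmul (X : Module.End ℂ (V ⊗[ℂ] V)) (u v t : V) :
    slot13 V X (u ⊗ₜ (v ⊗ₜ t)) = swap23 V (TensorProduct.assoc ℂ V V V (X (u ⊗ₜ t) ⊗ₜ v)) := rfl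

theorem swap12_tmul (u v t : V) : swap12 V (u ⊗ₜ (v ⊗ₜ t)) = v ⊗ₜ (u ⊗ₜ t) := rfl

theorem slot12_map (f g : Module.End ℂ V) :
    slot12 V (TensorProduct.map f g)
      = TensorProduct.map f (TensorProduct.map g LinearMap.id) := by
  refine TensorProduct.ext_threefold' ?_
  intro u v t
  rfl

theorem slot13_map (f g : Module.End ℂ V) :
    slot13 V (TensorProduct.map f g)
      = TensorProduct.map f (TensorProduct.map LinearMap.id g) := by
  refine TensorProduct.ext_threefold' ?_
  intro u v t
  rfl

theorem slot23_map (f g : Module.End ℂ V) :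
    slot23 V (TensorProduct.map f g)
      = TensorProduct.map LinearMap.id (TensorProduct.map f g) := rfl

theorem commute_slot13_second (X : Module.End ℂ (V ⊗[ℂ] V)) (f : Module.End ℂ V) :
    Commute (slot13 V X) (TensorProduct.map LinearMap.id (TensorProduct.map f LinearMap.id)) := by
  refine TensorProduct.ext_threefold' ?_
  intro u v t
  simp only [Module.End.mul_apply, TensorProduct.map_tmul, slot13_tmul, LinearMap.id_apply]
  induction X (u ⊗ₜ[ℂ] t) using TensorProduct.induction_on with
  | zero => simp
  | add x y hx hy => simp only [TensorProduct.add_tmul, map_add, hx, hy]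
  | tmul x y => rfl

theorem commute_slot23_first (X : Module.End ℂ (V ⊗[ℂ] V)) (f : Module.End ℂ V) :
    Commute (slot23 V X) (TensorProduct.map f LinearMap.id) := by
  refine TensorProduct.ext_threefold' ?_
  intro u v t
  rfl

theorem swap12_slot13 (X : Module.End ℂ (V ⊗[ℂ] V)) :
    slot13 V X * swap12 V = swap12 V * slot23 V X := by
  refine TensorProduct.ext_threefold' ?_
  intro u v t
  simp only [Module.End.mul_apply, swap12_tmul, slot13_tmul, slot23_tmul]
  induction X (v ⊗ₜ[ℂ] t) using TensorProduct.induction_on with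
  | zero => simp
  | add x y hx hy => simp only [TensorProduct.add_tmul, TensorProduct.tmul_add, map_add, hx, hy]
  | tmul x y => rfl

theorem swap12_swap12 : swap12 V * swap12 V = 1 := by
  refine TensorProduct.ext_threefold' ?_
  intro u v t
  rfl

theorem swap12_slot23 (X : Module.End ℂ (V ⊗[ℂ] V)) :
    slot23 V X * swap12 V = swap12 V * slot13 V X := by
  have h := swap12_slot13 X
  calc slot23 V X * swap12 V = swap12 V * (swap12 V * slot23 V X) * swap12 V := by
        rw [← mul_assoc, swap12_swap12, one_mul]
    _ = swap12 V * slot13 V X := by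
        rw [← h, mul_assoc, mul_assoc, swap12_swap12, mul_one]

end Triple

/-! ### Finite sums -/

/-- Both sides collect the same nonzero terms: the diagonals below `K ≥ A + B` cover the rectangle
`A × B`, outside of which `f` vanishes. It turns coefficients of products of series into double sums
with independent indices. -/
theorem sum_antidiagonal_range {M : Type*} [AddCommMonoid M] (f : ℕ → ℕ → M) {A B K : ℕ}
    (hK : A + B ≤ K) (hf : ∀ i j, A ≤ i ∨ B ≤ j → f i j = 0) :
    ∑ k ∈ Finset.range K, ∑ p ∈ Finset.HasAntidiagonal.antidiagonal k, f p.1 p.2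
      = ∑ i ∈ Finset.range A, ∑ j ∈ Finset.range B, f i j := by
  rw [Finset.sum_sigma', ← Finset.sum_product']
  refine Finset.sum_bij_ne_zero (fun x _ _ => x.2) ?_ ?_ ?_ ?_
  · rintro ⟨k, i, j⟩ h h0
    simp only [Finset.mem_product, Finset.mem_range]
    by_contra hc
    exact h0 (hf i j (by omega))
  · rintro ⟨k, i, j⟩ h h0 ⟨k', i', j'⟩ h' h0' he
    simp only [Finset.mem_sigma, Finset.HasAntidiagonal.mem_antidiagonal] at h h'
    simp only [Prod.mk.injEq] at he
    obtain ⟨rfl, rfl⟩ := he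
    obtain ⟨-, rfl⟩ := h
    obtain ⟨-, rfl⟩ := h'
    rfl
  · rintro ⟨i, j⟩ h h0
    simp only [Finset.mem_product, Finset.mem_range] at h
    exact ⟨⟨i + j, i, j⟩, Finset.mem_sigma.2 ⟨Finset.mem_range.2 (show i + j < K by omega),
      Finset.HasAntidiagonal.mem_antidiagonal.2 rfl⟩, h0, rfl⟩
  · intros
    rfl

/-- This is the substitution `P = s + e`. The ranges need not correspond: values of `P` outside `[0,
D]` are killed by `G`, values below `e` by `d`, and `S` is large enough to reach `D`. -/
theorem sum_shift {M : Type*} [AddCommGroup M] (c : ℕ → ℤ) (d : ℤ → ℤ) (G : ℤ → M) (e D : ℤ)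
    (S : ℕ) (h1 : ∀ s : ℕ, d (s + e) = c s) (h2 : ∀ P < e, d P = 0) (h3 : ∀ P < 0, G P = 0)
    (h4 : ∀ P, D < P → G P = 0) (h5 : D < S + e) :
    ∑ s ∈ Finset.range S, c s • G (s + e)
      = ∑ P ∈ Finset.range (D + 1).toNat, d P • G P := by
  refine Finset.sum_bij_ne_zero (fun s _ _ => (s + e).toNat) ?_ ?_ ?_ ?_
  · intro s hs h0
    have ha : ¬ ((s : ℤ) + e < 0) := fun h => h0 (by rw [h3 _ h, smul_zero])
    have hb : ¬ (D < (s : ℤ) + e) := fun h => h0 (by rw [h4 _ h, smul_zero])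
    rw [Finset.mem_range]
    omega
  · intro s hs h0 s' hs' h0' he
    have ha : ¬ ((s : ℤ) + e < 0) := fun h => h0 (by rw [h3 _ h, smul_zero])
    have ha' : ¬ ((s' : ℤ) + e < 0) := fun h => h0' (by rw [h3 _ h, smul_zero])
    omega
  · intro P hP h0
    rw [Finset.mem_range] at hP
    have ha : ¬ ((P : ℤ) < e) := fun h => h0 (by rw [h2 _ h, zero_smul])
    have hs : (((P : ℤ) - e).toNat : ℤ) + e = P := by omega
    refine ⟨((P : ℤ) - e).toNat, by rw [Finset.mem_range]; omega, ?_, by omega⟩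
    rwa [← h1, hs]
  · intro s hs h0
    have ha : ¬ ((s : ℤ) + e < 0) := fun h => h0 (by rw [h3 _ h, smul_zero])
    rw [← h1, Int.toNat_of_nonneg (by omega)]

/-! ### Expansion coefficients -/

/-- The coefficients of the expansion of `z^p (z - w)^{-r}` in the domain `|z| > |w|`. -/
def expCoeff (i : ℤ) : ℕ → ℤ
  | 0 => if i = -1 then 1 else 0
  | r + 1 => if 0 ≤ i then Ring.choose i r else 0

/-- Binomial coefficients with the convention that they vanish for a negative lower argument. -/
def intChoose (x e : ℤ) : ℤ := if 0 ≤ e then Ring.choose x e.toNat else 0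

/-- This is the binomial series `(z - w)^{-r} = ∑_s binom(r + s - 1, s) w^s z^{-r-s}`: the argument
`i` of `expCoeff` belongs to the power `z^{-i-1}`. For `r = s = 0` the truncated subtraction still
yields `1`. -/
theorem expCoeff_shift (r s : ℕ) : expCoeff (s + r - 1) r = ((r + s - 1).choose s : ℤ) := by
  cases r with
  | zero =>
    cases s with
    | zero => simp [expCoeff]
    | succ s =>
      have : ¬ (((s + 1 : ℕ) : ℤ) + (0 : ℕ) - 1 = -1) := by push_cast; omega
      rw [expCoeff, if_neg this, Nat.choose_eq_zero_of_lt (by omega), Nat.cast_zero]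
  | succ r =>
    have e : (s : ℤ) + (r + 1 : ℕ) - 1 = ((s + r : ℕ) : ℤ) := by push_cast; ring
    rw [e, expCoeff, if_pos (by omega), Ring.choose_natCast, show r + 1 + s - 1 = s + r by omega,
      Nat.choose_symm_add]

theorem expCoeff_eq_zero {i : ℤ} {r : ℕ} (h : i + 1 < r) : expCoeff i r = 0 := by
  cases r with
  | zero => rw [expCoeff, if_neg (by push_cast at h; omega)]
  | succ r =>
    rw [expCoeff]
    split_ifs with hi
    · lift i to ℕ using hi
      rw [Ring.choose_natCast, Nat.choose_eq_zero_of_lt (by push_cast at h; omega), Nat.cast_zero]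
    · rfl

theorem choose_neg_natCast (i s : ℕ) :
    Ring.choose (-(i : ℤ)) s = (-1) ^ s * ((i + s - 1).choose s : ℤ) := by
  rw [Ring.choose_neg, Int.negOnePow_def, Units.smul_def]
  rcases Nat.eq_zero_or_pos (i + s) with h | h
  · have h1 : i = 0 := by omega
    have h2 : s = 0 := by omega
    subst h1 h2
    simp
  · have e : (i : ℤ) + s - 1 = ((i + s - 1 : ℕ) : ℤ) := by omega
    rw [e, Ring.choose_natCast]
    simp

/-- The second term comes from expanding `(z - w)^{-r} = (-1)^r (w - z)^{-r}` for `|w| > |z|`. The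
difference of the two expansions is a divided derivative of the formal delta function, whose
coefficients are the same binomials for all integers `i`. -/
theorem expCoeff_sub (i : ℤ) (r : ℕ) :
    expCoeff i r - (-1) ^ r * expCoeff (r - 2 - i) r = intChoose i (r - 1) := by
  cases r with
  | zero =>
    have : ¬ (0 ≤ ((0 : ℕ) : ℤ) - 1) := by simp
    rw [intChoose, if_neg this, expCoeff, expCoeff]
    by_cases h : i = -1
    · subst h; simp
    · rw [if_neg h, if_neg (by push_cast; omega)]; simp
  | succ r =>
    have e : (((r + 1 : ℕ) : ℤ) - 1) = r := by push_cast; ring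
    rw [intChoose, e, if_pos (by omega), Int.toNat_natCast]
    by_cases h : 0 ≤ i
    · have h2 : expCoeff (((r + 1 : ℕ) : ℤ) - 2 - i) (r + 1) = 0 :=
        expCoeff_eq_zero (by push_cast; omega)
      rw [h2, mul_zero, sub_zero, expCoeff, if_pos h]
    · rw [expCoeff, if_neg h, zero_sub, expCoeff]
      obtain ⟨k, rfl⟩ : ∃ k : ℕ, i = -(k + 1 : ℕ) := ⟨(-i - 1).toNat, by omega⟩
      rw [choose_neg_natCast]
      have e2 : ((r + 1 : ℕ) : ℤ) - 2 - -((k + 1 : ℕ) : ℤ) = ((r + k : ℕ) : ℤ) := by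
        push_cast; ring
      rw [e2, if_pos (by omega), Ring.choose_natCast, show k + 1 + r - 1 = r + k by omega, pow_succ]
      ring

/-- Pascal's rule, with the correction at `x = 0` where the truncation sets in. In this form sums of
`expCoeff` telescope. -/
theorem expCoeff_sub_one (x : ℤ) (r : ℕ) :
    expCoeff (x - 1) r = (if 0 ≤ x then Ring.choose x r else 0)
      - (if 0 ≤ x - 1 then Ring.choose (x - 1) r else 0) := by
  cases r with
  | zero =>
    simp only [expCoeff, Ring.choose_zero_right]
    split_ifs <;> omega
  | succ r =>
    rw [expCoeff]
    by_cases h : 0 ≤ x - 1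
    · have := Ring.choose_succ_succ (x - 1) r
      rw [sub_add_cancel] at this
      rw [if_pos h, if_pos h, if_pos (by omega), this]
      ring
    · rw [if_neg h, if_neg h]
      split_ifs with h0
      · have : x = 0 := by omega
        rw [this, Ring.choose_zero_succ, sub_zero]
      · rw [sub_zero]

theorem intChoose_sub_one (x : ℤ) (r : ℕ) :
    intChoose x (r - 1) = Ring.choose (x + 1) r - Ring.choose x r := by
  cases r with
  | zero => simp [intChoose]
  | succ r =>
    have e : (((r + 1 : ℕ) : ℤ) - 1) = r := by push_cast; ring
    rw [intChoose, e, if_pos (by omega), Int.toNat_natCast, Ring.choose_succ_succ]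
    ring

/-- The two families of expansion coefficients in the normally ordered product add up to the Taylor
coefficient `∂^r/r!` of `z^P` at `z = w`. Only finitely many summands are nonzero, and `I` is past
all of them. -/
theorem expCoeff_telescope (P : ℤ) (r : ℕ) {I : ℕ} (h1 : P < I) (h2 : -P ≤ I) :
    ∑ i ∈ Finset.range I, (expCoeff (P - 1 - i) r + (-1) ^ r * expCoeff (r - 2 - (P + i)) r)
      = Ring.choose P r := by
  -- The binomial is split into its part `a` on non-negative arguments and its part `b` on negative
  -- ones. The first summands telescope to `a P`, the second to `b P`.
  let a : ℤ → ℤ := fun x => if 0 ≤ x then Ring.choose x r else 0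
  let b : ℤ → ℤ := fun x => Ring.choose x r - a x
  have e1 : ∀ i : ℕ, expCoeff (P - 1 - i) r = a (P - i) - a (P - (i + 1 : ℕ)) := by
    intro i
    have := expCoeff_sub_one (P - i) r
    rw [show P - 1 - i = P - i - 1 by ring, this]
    simp only [a]
    push_cast
    rw [show P - ((i : ℤ) + 1) = P - i - 1 by ring]
  have e2 : ∀ i : ℕ, (-1) ^ r * expCoeff (r - 2 - (P + i)) r = b (P + i) - b (P + (i + 1 : ℕ)) := by
    intro i
    have h := expCoeff_sub (P + i) r
    have h' := expCoeff_sub_one (P + i + 1) r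
    rw [add_sub_cancel_right] at h'
    rw [intChoose_sub_one] at h
    simp only [b, a]
    push_cast
    rw [← add_assoc]
    linear_combination h' - h
  rw [Finset.sum_congr rfl fun i _ => by rw [e1, e2], Finset.sum_add_distrib,
    Finset.sum_range_sub', Finset.sum_range_sub' (fun i : ℕ => b (P + i))]
  have h3 : a (P - I) = 0 := if_neg (by omega)
  have h4 : b (P + I) = 0 := by
    simp only [b, a]
    rw [if_pos (by omega), sub_self]
  simp only [Nat.cast_zero, sub_zero, add_zero, h3, h4, b]
  ring

end

/-! ### Divided powers of `T` and the data of Wick's formula -/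

section

section DividedPower

variable {V : Type*} [CommRing V] [Algebra ℂ V]

/-- The divided powers `T^p / p!`, which vanish for negative `p`. -/
def divPow (T : Module.End ℂ V) (p : ℤ) : Module.End ℂ V :=
  if 0 ≤ p then ((p.toNat.factorial : ℂ)⁻¹ • T ^ p.toNat) else 0

theorem divPow_natCast (T : Module.End ℂ V) (p : ℕ) :
    divPow T p = (p.factorial : ℂ)⁻¹ • T ^ p := by
  rw [divPow, if_pos (by omega), Int.toNat_natCast]

theorem divPow_neg (T : Module.End ℂ V) {p : ℤ} (hp : p < 0) : divPow T p = 0 :=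
  if_neg (by omega)

theorem divPow_zero (T : Module.End ℂ V) : divPow T 0 = 1 := by
  have := divPow_natCast T 0
  simpa using this

theorem mul_divPow (T : Module.End ℂ V) (p : ℤ) :
    T * divPow T p = ((p + 1 : ℤ) : ℂ) • divPow T (p + 1) := by
  rcases lt_trichotomy p (-1) with h | h | h
  · rw [divPow_neg T (by omega), divPow_neg T (by omega), mul_zero, smul_zero]
  · subst h
    rw [divPow_neg T (by omega)]
    simp
  · lift p to ℕ using by omega
    have e : ((p : ℤ) + 1) = ((p + 1 : ℕ) : ℤ) := by push_cast; ring
    rw [e, divPow_natCast, divPow_natCast, mul_smul_comm, pow_succ', smul_smul]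
    congr 1
    rw [Nat.factorial_succ]
    have h1 : ((p + 1 : ℕ) : ℂ) ≠ 0 := by exact_mod_cast Nat.succ_ne_zero p
    have h2 : ((p.factorial : ℕ) : ℂ) ≠ 0 := by exact_mod_cast Nat.factorial_ne_zero p
    push_cast at *
    field_simp

theorem divPow_mul_divPow (T : Module.End ℂ V) (p q : ℕ) :
    divPow T p * divPow T q = ((p + q).choose p : ℂ) • divPow T ((p + q : ℕ) : ℤ) := by
  rw [divPow_natCast, divPow_natCast, divPow_natCast, smul_mul_smul_comm, ← pow_add, smul_smul]
  congr 1
  have h := Nat.add_choose_mul_factorial_mul_factorial p q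
  rw [← Nat.choose_symm_add] at h
  have h1 : ((p.factorial : ℕ) : ℂ) ≠ 0 := by exact_mod_cast Nat.factorial_ne_zero p
  have h2 : ((q.factorial : ℕ) : ℂ) ≠ 0 := by exact_mod_cast Nat.factorial_ne_zero q
  have h3 : (((p + q).factorial : ℕ) : ℂ) ≠ 0 := by exact_mod_cast Nat.factorial_ne_zero (p + q)
  have h' : (((p + q).choose p : ℕ) : ℂ) * p.factorial * q.factorial = (p + q).factorial := by
    exact_mod_cast h
  field_simp
  linear_combination -h'

/-- Divided powers absorb the binomial coefficients of Leibniz' rule. In the induction `T` is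
applied to the formula for `p`, and the factor `p + 1 = a + b` is cancelled. -/
theorem divPow_apply_mul (T : Module.End ℂ V) (hT : ∀ x y, T (x * y) = T x * y + x * T y)
    (p : ℕ) (x y : V) :
    divPow T p (x * y)
      = ∑ ab ∈ Finset.HasAntidiagonal.antidiagonal p, divPow T ab.1 x * divPow T ab.2 y := by
  induction p with
  | zero => simp [divPow_zero]
  | succ p ih =>
    have hc : ((p + 1 : ℕ) : ℂ) ≠ 0 := by exact_mod_cast Nat.succ_ne_zero p
    have e : ∀ q : ℕ, ∀ z : V, T (divPow T q z) = ((q + 1 : ℕ) : ℂ) • divPow T ((q + 1 : ℕ) : ℤ) z := by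
      intro q z
      have := congrArg (fun f : Module.End ℂ V => f z) (mul_divPow T q)
      simp only [Module.End.mul_apply, LinearMap.smul_apply] at this
      rw [this]
      push_cast
      rfl
    have h1 := congrArg T ih
    rw [e, map_sum] at h1
    simp only [hT, e] at h1
    rw [Finset.sum_add_distrib] at h1
    have h2 : ∑ ab ∈ Finset.HasAntidiagonal.antidiagonal (p + 1),
        ((ab.1 : ℕ) : ℂ) • (divPow T ab.1 x * divPow T ab.2 y)
        = ∑ ab ∈ Finset.HasAntidiagonal.antidiagonal p,
          ((ab.1 + 1 : ℕ) : ℂ) • divPow T ((ab.1 + 1 : ℕ) : ℤ) x * divPow T ab.2 y := by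
      rw [Finset.Nat.sum_antidiagonal_succ]
      simp
    have h3 : ∑ ab ∈ Finset.HasAntidiagonal.antidiagonal (p + 1),
        ((ab.2 : ℕ) : ℂ) • (divPow T ab.1 x * divPow T ab.2 y)
        = ∑ ab ∈ Finset.HasAntidiagonal.antidiagonal p,
          divPow T ab.1 x * ((ab.2 + 1 : ℕ) : ℂ) • divPow T ((ab.2 + 1 : ℕ) : ℤ) y := by
      rw [Finset.Nat.sum_antidiagonal_succ']
      simp
    rw [← h2, ← h3, ← Finset.sum_add_distrib] at h1
    have h4 : ∑ ab ∈ Finset.HasAntidiagonal.antidiagonal (p + 1),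
        (((ab.1 : ℕ) : ℂ) • (divPow T ab.1 x * divPow T ab.2 y)
          + ((ab.2 : ℕ) : ℂ) • (divPow T ab.1 x * divPow T ab.2 y))
        = ((p + 1 : ℕ) : ℂ) • ∑ ab ∈ Finset.HasAntidiagonal.antidiagonal (p + 1),
          divPow T ab.1 x * divPow T ab.2 y := by
      rw [Finset.smul_sum]
      refine Finset.sum_congr rfl fun ab hab => ?_
      rw [← add_smul, ← Finset.HasAntidiagonal.mem_antidiagonal.1 hab]
      push_cast
      rfl
    rw [h4] at h1
    exact smul_right_injective V hc h1

end DividedPower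

/-- The data from which the `n`-th products on a commutative algebra with derivation `T` are
obtained by Wick's formula: the coefficients `E k` at `z^{-k}` of the exponential of a
contraction operator. -/
structure WickData (V : Type*) [CommRing V] [Algebra ℂ V] where
  T : Module.End ℂ V
  E : ℕ → Module.End ℂ (V ⊗[ℂ] V)
  T_mul : ∀ x y, T (x * y) = T x * y + x * T y
  E_zero : E 0 = 1
  E_mul_right : ∀ k, E k ∘ₗ (LinearMap.mul' ℂ V).lTensor V = (LinearMap.mul' ℂ V).lTensor V ∘ₗ
    ∑ ij ∈ Finset.HasAntidiagonal.antidiagonal k, slot12 V (E ij.1) * slot13 V (E ij.2)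
  E_mul_left : ∀ k, E k ∘ₗ (LinearMap.mul' ℂ V).rTensor V
      ∘ₗ (TensorProduct.assoc ℂ V V V).symm.toLinearMap
    = ((LinearMap.mul' ℂ V).rTensor V ∘ₗ (TensorProduct.assoc ℂ V V V).symm.toLinearMap) ∘ₗ
      ∑ ij ∈ Finset.HasAntidiagonal.antidiagonal k, slot13 V (E ij.1) * slot23 V (E ij.2)
  E_T : ∀ k, E (k + 1) * T.lTensor V = T.lTensor V * E (k + 1) + (k : ℂ) • E k
  E_swap : ∀ k, E k * (TensorProduct.comm ℂ V V).toLinearMap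
    = (-1 : ℂ) ^ k • ((TensorProduct.comm ℂ V V).toLinearMap * E k)
  comm12_13 : ∀ i j, Commute (slot12 V (E i)) (slot13 V (E j))
  comm12_23 : ∀ i j, Commute (slot12 V (E i)) (slot23 V (E j))
  comm13_23 : ∀ i j, Commute (slot13 V (E i)) (slot23 V (E j))
  E_fin : ∀ t, ∃ K : ℕ, ∀ k, K ≤ k → E k t = 0

namespace WickData

variable {V : Type*} [CommRing V] [Algebra ℂ V] (S : WickData V)

/-- `u ⊗ v ↦ T^p u / p! · v`. -/
def norm (p : ℤ) : V ⊗[ℂ] V →ₗ[ℂ] V :=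
  LinearMap.mul' ℂ V ∘ₗ (divPow S.T p).rTensor V

theorem norm_tmul (p : ℤ) (u v : V) : S.norm p (u ⊗ₜ v) = divPow S.T p u * v := rfl

theorem norm_neg {p : ℤ} (hp : p < 0) : S.norm p = 0 := by
  rw [norm, divPow_neg _ hp, LinearMap.rTensor_zero, LinearMap.comp_zero]

/-- The `n`-th product, as a function on the tensor product. -/
def prodT (n : ℤ) (t : V ⊗[ℂ] V) : V := ∑ᶠ k : ℕ, S.norm (k - n - 1) (S.E k t)

theorem prodT_eq_sum (n : ℤ) {t : V ⊗[ℂ] V} {K : ℕ} (hK : ∀ k, K ≤ k → S.E k t = 0) :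
    S.prodT n t = ∑ k ∈ Finset.range K, S.norm (k - n - 1) (S.E k t) := by
  refine finsum_eq_sum_of_support_subset _ fun k hk => ?_
  rw [Finset.coe_range, Set.mem_Iio]
  by_contra h
  exact hk (by simp only [hK k (not_lt.1 h), map_zero])

/-- The `n`-th product. -/
def prod (n : ℤ) (u v : V) : V := S.prodT n (u ⊗ₜ v)

theorem exists_bound (t t' : V ⊗[ℂ] V) :
    ∃ K : ℕ, ∀ k, K ≤ k → S.E k t = 0 ∧ S.E k t' = 0 := by
  obtain ⟨K, hK⟩ := S.E_fin t
  obtain ⟨K', hK'⟩ := S.E_fin t'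
  exact ⟨max K K', fun k hk => ⟨hK k (le_trans (le_max_left _ _) hk),
    hK' k (le_trans (le_max_right _ _) hk)⟩⟩

theorem prodT_add (n : ℤ) (t t' : V ⊗[ℂ] V) :
    S.prodT n (t + t') = S.prodT n t + S.prodT n t' := by
  obtain ⟨K, hK⟩ := S.exists_bound t t'
  rw [S.prodT_eq_sum n fun k hk => (hK k hk).1, S.prodT_eq_sum n fun k hk => (hK k hk).2,
    S.prodT_eq_sum (K := K) n fun k hk => by rw [map_add, (hK k hk).1, (hK k hk).2, add_zero],
    ← Finset.sum_add_distrib]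
  simp only [map_add]

theorem prodT_smul (n : ℤ) (c : ℂ) (t : V ⊗[ℂ] V) :
    S.prodT n (c • t) = c • S.prodT n t := by
  obtain ⟨K, hK⟩ := S.E_fin t
  rw [S.prodT_eq_sum n hK,
    S.prodT_eq_sum (K := K) n fun k hk => by rw [map_smul, hK k hk, smul_zero], Finset.smul_sum]
  simp only [map_smul]

/-- The `n`-th product as a bilinear map. -/
def prodHom (n : ℤ) : V →ₗ[ℂ] V →ₗ[ℂ] V :=
  TensorProduct.curry
    { toFun := S.prodT n
      map_add' := S.prodT_add n
      map_smul' := S.prodT_smul n }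

theorem prodHom_apply (n : ℤ) (u v : V) : S.prodHom n u v = S.prod n u v := rfl

theorem prodT_sum {ι : Type*} (n : ℤ) (s : Finset ι) (f : ι → V ⊗[ℂ] V) :
    S.prodT n (∑ i ∈ s, f i) = ∑ i ∈ s, S.prodT n (f i) := by
  classical
  induction s using Finset.induction_on with
  | empty => simp [prodT]
  | insert a s ha ih => rw [Finset.sum_insert ha, Finset.sum_insert ha, prodT_add, ih]

/-! ### Commutation of the exponential with divided powers -/

/-- Coefficientwise form of `E(z) (1 ⊗ e^{wT}) = (1 ⊗ e^{wT}) E(z - w)`. The field `E_T` is its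
derivative at `w = 0`, namely `[E(z), 1 ⊗ T] = -∂_z E(z)`; the binomials come from expanding `(z -
w)^{-r}` in powers of `w`. -/
theorem E_divPow (k : ℕ) (q : ℤ) :
    S.E k * (divPow S.T q).lTensor V
      = ∑ rs ∈ Finset.HasAntidiagonal.antidiagonal k,
        ((k - 1).choose rs.2 : ℂ) • ((divPow S.T (q - rs.2)).lTensor V * S.E rs.1) := by
  rcases lt_or_ge q 0 with hq | hq
  · rw [divPow_neg _ hq, LinearMap.lTensor_zero, mul_zero]
    refine (Finset.sum_eq_zero fun rs _ => ?_).symm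
    rw [divPow_neg _ (by omega), LinearMap.lTensor_zero, zero_mul, smul_zero]
  lift q to ℕ using hq
  cases k with
  | zero => simp [S.E_zero]
  | succ k =>
  induction q generalizing k with
  | zero =>
    rw [Finset.Nat.sum_antidiagonal_succ']
    have : ∑ p ∈ Finset.HasAntidiagonal.antidiagonal k,
        ((k + 1 - 1).choose (p.2 + 1) : ℂ)
          • ((divPow S.T ((0 : ℕ) - ((p.2 + 1 : ℕ) : ℤ))).lTensor V * S.E p.1) = 0 := by
      refine Finset.sum_eq_zero fun rs _ => ?_
      rw [divPow_neg _ (by push_cast; omega), LinearMap.lTensor_zero, zero_mul, smul_zero]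
    rw [this]
    simp only [Nat.cast_zero, sub_zero, divPow_zero, Nat.choose_zero_right, Nat.cast_one, one_smul,
      add_zero]
    rw [show (1 : Module.End ℂ V) = LinearMap.id from rfl, LinearMap.lTensor_id]
    change S.E (k + 1) * 1 = 1 * S.E (k + 1)
    rw [mul_one, one_mul]
  | succ q ih =>
    have hc : ((q + 1 : ℕ) : ℂ) ≠ 0 := by exact_mod_cast Nat.succ_ne_zero q
    have hT : ∀ p : ℤ, S.T.lTensor V * (divPow S.T p).lTensor V
        = ((p + 1 : ℤ) : ℂ) • (divPow S.T (p + 1)).lTensor V := by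
      intro p
      rw [← LinearMap.lTensor_mul, mul_divPow, LinearMap.lTensor_smul]
    -- Multiplication by `q + 1` turns `T^{q+1}/(q+1)!` into `T · T^q/q!`, so that one factor `T`
    -- can be moved through `E` by `E_T` and the rest by induction.
    refine smul_right_injective _ hc ?_
    change ((q + 1 : ℕ) : ℂ) • (S.E (k + 1) * (divPow S.T ((q + 1 : ℕ) : ℤ)).lTensor V)
      = ((q + 1 : ℕ) : ℂ) • _
    have h0 : ((q + 1 : ℕ) : ℂ) • (S.E (k + 1) * (divPow S.T ((q + 1 : ℕ) : ℤ)).lTensor V)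
        = S.E (k + 1) * S.T.lTensor V * (divPow S.T q).lTensor V := by
      rw [mul_assoc, hT, mul_smul_comm]
      push_cast
      rfl
    rw [h0, S.E_T, add_mul, mul_assoc, ih k, Finset.mul_sum, smul_mul_assoc]
    have hA : ∀ rs : ℕ × ℕ, S.T.lTensor V * (((k + 1 - 1).choose rs.2 : ℂ)
          • ((divPow S.T (q - rs.2)).lTensor V * S.E rs.1))
        = (((k + 1 - 1).choose rs.2 : ℂ) * ((q - rs.2 + 1 : ℤ) : ℂ))
          • ((divPow S.T ((q + 1 : ℕ) - rs.2)).lTensor V * S.E rs.1) := by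
      intro rs
      rw [mul_smul_comm, ← mul_assoc, hT, smul_mul_assoc, smul_smul]
      congr 4
      push_cast
      ring
    rw [Finset.sum_congr rfl fun rs _ => hA rs]
    have hB : (k : ℂ) • (S.E k * (divPow S.T q).lTensor V)
        = ∑ rs ∈ Finset.HasAntidiagonal.antidiagonal (k + 1),
          (((k + 1 - 1).choose rs.2 : ℂ) * (rs.2 : ℂ))
          • ((divPow S.T ((q + 1 : ℕ) - rs.2)).lTensor V * S.E rs.1) := by
      rw [Finset.Nat.sum_antidiagonal_succ']
      simp only [Nat.cast_zero, mul_zero, zero_smul, zero_add, add_tsub_cancel_right]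
      cases k with
      | zero => simp
      | succ k =>
        rw [ih k, Finset.smul_sum]
        refine Finset.sum_congr rfl fun rs _ => ?_
        rw [smul_smul, add_tsub_cancel_right]
        have h1 := Nat.add_one_mul_choose_eq k rs.2
        have h2 : ((k + 1 : ℕ) : ℂ) * (k.choose rs.2 : ℂ)
            = ((k + 1).choose (rs.2 + 1) : ℂ) * ((rs.2 + 1 : ℕ) : ℂ) := by
          exact_mod_cast h1
        rw [h2]
        congr 4
        push_cast
        ring
    rw [hB, ← Finset.sum_add_distrib, Finset.smul_sum]
    refine Finset.sum_congr rfl fun rs _ => ?_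
    rw [← add_smul, smul_smul]
    congr 1
    push_cast
    ring

theorem comm_mul_comm : (TensorProduct.comm ℂ V V).toLinearMap
    * (TensorProduct.comm ℂ V V).toLinearMap = (1 : Module.End ℂ (V ⊗[ℂ] V)) := by
  refine TensorProduct.ext' ?_
  intro u v
  rfl

theorem comm_lTensor (f : Module.End ℂ V) : (TensorProduct.comm ℂ V V).toLinearMap * f.lTensor V
    = f.rTensor V * (TensorProduct.comm ℂ V V).toLinearMap := by
  refine TensorProduct.ext' ?_
  intro u v
  rfl

theorem comm_rTensor (f : Module.End ℂ V) : (TensorProduct.comm ℂ V V).toLinearMap * f.rTensor V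
    = f.lTensor V * (TensorProduct.comm ℂ V V).toLinearMap := by
  refine TensorProduct.ext' ?_
  intro u v
  rfl

/-- Conjugation with the exchange of factors replaces `E(z)` by `E(-z)`, so that here `E(z) (e^{wT}
⊗ 1) = (e^{wT} ⊗ 1) E(z + w)`; this is the sign `(-1)^s`. -/
theorem E_divPow_left (k : ℕ) (q : ℤ) :
    S.E k * (divPow S.T q).rTensor V
      = ∑ rs ∈ Finset.HasAntidiagonal.antidiagonal k,
        ((-1) ^ rs.2 * ((k - 1).choose rs.2 : ℂ))
          • ((divPow S.T (q - rs.2)).rTensor V * S.E rs.1) := by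
  set σ : Module.End ℂ (V ⊗[ℂ] V) := (TensorProduct.comm ℂ V V).toLinearMap with hσ
  have hE : ∀ k, S.E k = (-1 : ℂ) ^ k • (σ * S.E k * σ) := by
    intro k
    rw [mul_assoc, S.E_swap, mul_smul_comm, smul_smul, ← mul_assoc, comm_mul_comm, one_mul,
      ← mul_pow]
    simp
  calc S.E k * (divPow S.T q).rTensor V
      = (-1 : ℂ) ^ k • (σ * (S.E k * (divPow S.T q).lTensor V) * σ) := by
        conv_lhs => rw [hE k]
        rw [smul_mul_assoc, mul_assoc (σ * S.E k), comm_rTensor, ← mul_assoc, ← mul_assoc]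
    _ = _ := by
        rw [E_divPow, Finset.mul_sum, Finset.sum_mul, Finset.smul_sum]
        refine Finset.sum_congr rfl fun rs hrs => ?_
        rw [mul_smul_comm, smul_mul_assoc, smul_smul, ← mul_assoc σ, comm_lTensor]
        conv_rhs => rw [hE rs.1]
        rw [mul_smul_comm, smul_smul, mul_assoc, mul_assoc, mul_assoc σ]
        congr 1
        rw [← Finset.HasAntidiagonal.mem_antidiagonal.1 hrs, pow_add]
        have h1 : (-1 : ℂ) ^ rs.1 * (-1) ^ rs.2 = (-1) ^ rs.2 * (-1) ^ rs.1 := mul_comm _ _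
        rw [h1]
        ring

end WickData

end

/-! ### Composition of vertex operators and Borcherds' identities -/

section

namespace WickData

variable {V : Type*} [CommRing V] [Algebra ℂ V] (S : WickData V)

/-- `u ⊗ v ⊗ t ↦ T^p u / p! · T^q v / q! · t`. -/
def norm₃ (p q : ℤ) : V ⊗[ℂ] (V ⊗[ℂ] V) →ₗ[ℂ] V := S.norm p ∘ₗ (S.norm q).lTensor V

theorem norm₃_tmul (p q : ℤ) (u v t : V) :
    S.norm₃ p q (u ⊗ₜ (v ⊗ₜ t)) = divPow S.T p u * (divPow S.T q v * t) := rfl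

theorem norm₃_neg_left {p : ℤ} (hp : p < 0) (q : ℤ) : S.norm₃ p q = 0 := by
  rw [norm₃, norm_neg _ hp, LinearMap.zero_comp]

theorem norm₃_neg_right (p : ℤ) {q : ℤ} (hq : q < 0) : S.norm₃ p q = 0 := by
  rw [norm₃, norm_neg _ hq, LinearMap.lTensor_zero, LinearMap.comp_zero]

theorem norm₃_swap (p q : ℤ) : S.norm₃ p q ∘ₗ swap12 V = S.norm₃ q p := by
  refine TensorProduct.ext_threefold' ?_
  intro u v t
  change divPow S.T p v * (divPow S.T q u * t) = divPow S.T q u * (divPow S.T p v * t)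
  ring

/-- Leibniz' rule produces `T^a/a! · T^q/q!` on `u`, which is `binom(a + q, q)` times a single
divided power; then `P = a + q`. The terms with `P < q` on the right have coefficient zero. -/
theorem norm_norm (p : ℤ) (q : ℕ) :
    S.norm p ∘ₗ (S.norm q).rTensor V ∘ₗ (TensorProduct.assoc ℂ V V V).symm.toLinearMap
      = ∑ P ∈ Finset.range (p + q + 1).toNat, (P.choose q : ℤ) • S.norm₃ P (p + q - P) := by
  refine TensorProduct.ext_threefold' ?_
  intro u v t
  change divPow S.T p (divPow S.T q u * v) * t = _
  rw [LinearMap.sum_apply]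
  simp only [LinearMap.smul_apply, norm₃_tmul]
  rcases lt_or_ge p 0 with hp | hp
  · rw [divPow_neg _ hp, LinearMap.zero_apply, zero_mul]
    refine (Finset.sum_eq_zero fun P hP => ?_).symm
    rcases lt_or_ge P q with h | h
    · rw [Nat.choose_eq_zero_of_lt h, Nat.cast_zero, zero_smul]
    · rw [divPow_neg S.T (p := p + q - P) (by omega), LinearMap.zero_apply, zero_mul, mul_zero,
        smul_zero]
  · lift p to ℕ using hp
    rw [divPow_apply_mul _ S.T_mul, Finset.Nat.sum_antidiagonal_eq_sum_range_succ_mk,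
      Finset.sum_mul]
    have hn : ((p : ℤ) + q + 1).toNat = q + (p + 1) := by omega
    rw [hn, Finset.sum_range_add]
    have h0 : ∑ P ∈ Finset.range q, (P.choose q : ℤ)
        • (divPow S.T P u * (divPow S.T (p + q - P) v * t)) = 0 := by
      refine Finset.sum_eq_zero fun P hP => ?_
      rw [Nat.choose_eq_zero_of_lt (Finset.mem_range.1 hP), Nat.cast_zero, zero_smul]
    rw [h0, zero_add]
    refine Finset.sum_congr rfl fun a ha => ?_
    have ha' := Finset.mem_range.1 ha
    have h1 := congrArg (fun f : Module.End ℂ V => f u) (divPow_mul_divPow S.T a q)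
    simp only [Module.End.mul_apply, LinearMap.smul_apply] at h1
    rw [h1, add_comm a q]
    have h2 : ((p - a : ℕ) : ℤ) = p + q - ((q + a : ℕ) : ℤ) := by omega
    rw [h2, Nat.choose_symm_add, smul_mul_assoc, smul_mul_assoc, mul_assoc, natCast_zsmul,
      Nat.cast_smul_eq_nsmul]

/-- Sums of the values of `S.norm₃` over all pairs of exponents with sum `D`. -/
def tri (c : ℤ → ℤ) (D : ℤ) : V ⊗[ℂ] (V ⊗[ℂ] V) →ₗ[ℂ] V :=
  ∑ P ∈ Finset.range (D + 1).toNat, c P • S.norm₃ P (D - P)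

theorem tri_apply (c : ℤ → ℤ) (D : ℤ) (X : V ⊗[ℂ] (V ⊗[ℂ] V)) :
    S.tri c D X = ∑ P ∈ Finset.range (D + 1).toNat, c P • S.norm₃ P (D - P) X := by
  rw [tri, LinearMap.sum_apply]
  rfl

theorem tri_swap (c : ℤ → ℤ) (D : ℤ) (X : V ⊗[ℂ] (V ⊗[ℂ] V)) :
    S.tri c D (swap12 V X) = S.tri (fun P => c (D - P)) D X := by
  have e : ∀ p q, S.norm₃ p q (swap12 V X) = S.norm₃ q p X := fun p q =>
    LinearMap.congr_fun (S.norm₃_swap p q) X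
  rw [tri_apply, tri_apply]
  simp only [e]
  rcases lt_or_ge D 0 with h | h
  · rw [show (D + 1).toNat = 0 by omega]
    simp
  · lift D to ℕ using h
    rw [show ((D : ℤ) + 1).toNat = D + 1 by omega, ← Finset.sum_range_reflect]
    refine Finset.sum_congr rfl fun P hP => ?_
    have hP' := Finset.mem_range.1 hP
    have : ((D + 1 - 1 - P : ℕ) : ℤ) = D - P := by omega
    rw [this, sub_sub_cancel]

/-- Contractions of `u` with the product `T^q v/q! · t` are contractions with `v` and with `t`.
Moving the divided power out through `E₁₂` shifts its argument, as in `E_divPow`; it commutes with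
`E₁₃`. -/
theorem E_norm (k : ℕ) (q : ℤ) (X : V ⊗[ℂ] (V ⊗[ℂ] V)) :
    S.E k ((S.norm q).lTensor V X)
      = ∑ ij ∈ Finset.HasAntidiagonal.antidiagonal k,
          ∑ rs ∈ Finset.HasAntidiagonal.antidiagonal ij.1,
            ((ij.1 - 1).choose rs.2 : ℂ) • (S.norm (q - rs.2)).lTensor V
              (slot12 V (S.E rs.1) (slot13 V (S.E ij.2) X)) := by
  have e : ∀ q, (S.norm q).lTensor V
      = (LinearMap.mul' ℂ V).lTensor V ∘ₗ slot12 V ((divPow S.T q).lTensor V) := by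
    intro q
    refine TensorProduct.ext_threefold' ?_
    intro u v t
    rfl
  have hs : ∀ q, slot12 V ((divPow S.T q).lTensor V)
      = TensorProduct.map LinearMap.id (TensorProduct.map (divPow S.T q) LinearMap.id) := fun q =>
    slot12_map _ _
  have h1 : S.E k ((S.norm q).lTensor V X) = (S.E k ∘ₗ (LinearMap.mul' ℂ V).lTensor V)
      (slot12 V ((divPow S.T q).lTensor V) X) := by rw [e]; rfl
  rw [h1, S.E_mul_right, LinearMap.comp_apply, LinearMap.sum_apply, map_sum]
  refine Finset.sum_congr rfl fun ij _ => ?_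
  have h2 : slot13 V (S.E ij.2) * slot12 V ((divPow S.T q).lTensor V)
      = slot12 V ((divPow S.T q).lTensor V) * slot13 V (S.E ij.2) := by
    rw [hs]
    exact commute_slot13_second _ _
  rw [← Module.End.mul_apply, mul_assoc, h2, ← mul_assoc, ← map_mul, S.E_divPow, map_sum,
    Finset.sum_mul, LinearMap.sum_apply, map_sum]
  refine Finset.sum_congr rfl fun rs _ => ?_
  rw [map_smul, smul_mul_assoc, LinearMap.smul_apply, map_smul, e, map_mul]
  rfl

theorem E_norm_left (k : ℕ) (q : ℤ) (X : V ⊗[ℂ] (V ⊗[ℂ] V)) :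
    S.E k ((S.norm q).rTensor V ((TensorProduct.assoc ℂ V V V).symm X))
      = ∑ ij ∈ Finset.HasAntidiagonal.antidiagonal k,
          ∑ rs ∈ Finset.HasAntidiagonal.antidiagonal ij.1,
            ((-1) ^ rs.2 * ((ij.1 - 1).choose rs.2 : ℂ)) • (S.norm (q - rs.2)).rTensor V
              ((TensorProduct.assoc ℂ V V V).symm
                (slot13 V (S.E rs.1) (slot23 V (S.E ij.2) X))) := by
  have e : ∀ q, (S.norm q).rTensor V ∘ₗ (TensorProduct.assoc ℂ V V V).symm.toLinearMap
      = ((LinearMap.mul' ℂ V).rTensor V ∘ₗ (TensorProduct.assoc ℂ V V V).symm.toLinearMap)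
        ∘ₗ slot13 V ((divPow S.T q).rTensor V) := by
    intro q
    refine TensorProduct.ext_threefold' ?_
    intro u v t
    rfl
  have hs : ∀ q, slot13 V ((divPow S.T q).rTensor V)
      = TensorProduct.map (divPow S.T q) LinearMap.id := by
    intro q
    have := slot13_map (divPow S.T q) LinearMap.id
    rwa [TensorProduct.map_id] at this
  have h1 : S.E k ((S.norm q).rTensor V ((TensorProduct.assoc ℂ V V V).symm X))
      = (S.E k ∘ₗ (LinearMap.mul' ℂ V).rTensor V
        ∘ₗ (TensorProduct.assoc ℂ V V V).symm.toLinearMap)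
      (slot13 V ((divPow S.T q).rTensor V) X) :=
    congrArg (S.E k) (LinearMap.congr_fun (e q) X)
  rw [h1, S.E_mul_left, LinearMap.comp_apply, LinearMap.sum_apply, map_sum]
  refine Finset.sum_congr rfl fun ij _ => ?_
  have h2 : slot23 V (S.E ij.2) * slot13 V ((divPow S.T q).rTensor V)
      = slot13 V ((divPow S.T q).rTensor V) * slot23 V (S.E ij.2) := by
    rw [hs]
    exact commute_slot23_first _ _
  rw [← Module.End.mul_apply, mul_assoc, h2, ← mul_assoc, ← map_mul, S.E_divPow_left, map_sum,
    Finset.sum_mul, LinearMap.sum_apply, map_sum]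
  refine Finset.sum_congr rfl fun rs _ => ?_
  rw [map_smul, smul_mul_assoc, LinearMap.smul_apply, map_smul, map_mul]
  congr 1
  exact (LinearMap.congr_fun (e (q - rs.2)) _).symm

/-- The operators `E` on the three pairs of factors. -/
def triE (r j l : ℕ) : Module.End ℂ (V ⊗[ℂ] (V ⊗[ℂ] V)) :=
  slot12 V (S.E r) * (slot13 V (S.E j) * slot23 V (S.E l))

/-- `R` is so large that `E k`, acting on any two factors of `X`, vanishes for `k ≥ R`. -/
def TriBound (R : ℕ) (X : V ⊗[ℂ] (V ⊗[ℂ] V)) : Prop :=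
  ∀ k, R ≤ k → slot12 V (S.E k) X = 0 ∧ slot13 V (S.E k) X = 0 ∧ slot23 V (S.E k) X = 0

theorem exists_triBound (u v t : V) : ∃ R, S.TriBound R (u ⊗ₜ (v ⊗ₜ t)) := by
  obtain ⟨K, hK⟩ := S.exists_bound (u ⊗ₜ v) (u ⊗ₜ t)
  obtain ⟨K', hK'⟩ := S.E_fin (v ⊗ₜ t)
  refine ⟨max K K', fun k hk => ?_⟩
  have h1 := hK k (le_trans (le_max_left _ _) hk)
  have h2 := hK' k (le_trans (le_max_right _ _) hk)
  refine ⟨?_, ?_, ?_⟩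
  · rw [slot12_tmul, h1.1, TensorProduct.zero_tmul, map_zero]
  · rw [slot13_tmul, h1.2, TensorProduct.zero_tmul, map_zero, map_zero]
  · rw [slot23_tmul, h2, TensorProduct.tmul_zero]

theorem triE_eq_zero {R : ℕ} {X : V ⊗[ℂ] (V ⊗[ℂ] V)} (h : S.TriBound R X) {r j l : ℕ}
    (hr : R ≤ r ∨ R ≤ j ∨ R ≤ l) : S.triE r j l X = 0 := by
  have e1 : S.triE r j l = slot13 V (S.E j) * slot23 V (S.E l) * slot12 V (S.E r) := by
    rw [triE, ((S.comm12_13 r j).mul_right (S.comm12_23 r l)).eq]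
  have e2 : S.triE r j l = slot12 V (S.E r) * (slot23 V (S.E l) * slot13 V (S.E j)) := by
    rw [triE, (S.comm13_23 j l).eq]
  rcases hr with hr | hr | hr
  · rw [e1, Module.End.mul_apply, (h r hr).1, map_zero]
  · rw [e2, Module.End.mul_apply, Module.End.mul_apply, (h j hr).2.1, map_zero, map_zero]
  · rw [triE, Module.End.mul_apply, Module.End.mul_apply, (h l hr).2.2, map_zero, map_zero]

theorem triBound_swap {R : ℕ} {X : V ⊗[ℂ] (V ⊗[ℂ] V)} (h : S.TriBound R X) :
    S.TriBound R (swap12 V X) := by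
  intro k hk
  obtain ⟨h1, h2, h3⟩ := h k hk
  refine ⟨?_, ?_, ?_⟩
  · rw [swap12, ← Module.End.mul_apply, ← map_mul, S.E_swap, map_smul, map_mul,
      LinearMap.smul_apply, Module.End.mul_apply, h1, map_zero, smul_zero]
  · rw [← Module.End.mul_apply, swap12_slot13, Module.End.mul_apply, h3, map_zero]
  · rw [← Module.End.mul_apply, swap12_slot23, Module.End.mul_apply, h2, map_zero]

theorem triE_swap (r j l : ℕ) :
    S.triE r j l * swap12 V = (-1 : ℂ) ^ r • (swap12 V * S.triE r l j) := by
  have h : slot12 V (S.E r) * swap12 V = (-1 : ℂ) ^ r • (swap12 V * slot12 V (S.E r)) := by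
    rw [swap12, ← map_mul, S.E_swap, map_smul, map_mul]
  rw [triE, mul_assoc, mul_assoc, swap12_slot23, ← mul_assoc (slot13 V (S.E j)), swap12_slot13,
    mul_assoc, ← mul_assoc, h, smul_mul_assoc, mul_assoc, triE, (S.comm13_23 l j).eq]

/-- The part of `Y(u,z) Y(v,w) t` with `E₂₃` in degree `l`. It is the coefficient of `z^{-m-1}
w^{-n-1}` in terms `z^P w^{D-P+⋯} (z-w)^{-r} z^{-j} w^{-l}`, the middle factor being expanded for
`|z| > |w|`: the power of `z` required from it is `z^{-(m+P-j)-1}`. -/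
theorem prodT_lTensor_norm {R : ℕ} {X : V ⊗[ℂ] (V ⊗[ℂ] V)} (hR : S.TriBound R X) (m n : ℤ)
    (l : ℕ) :
    S.prodT m ((S.norm (l - n - 1)).lTensor V (slot23 V (S.E l) X))
      = ∑ r ∈ Finset.range R, ∑ j ∈ Finset.range R,
        S.tri (fun P => expCoeff (m + P - j) r) (r + j + l - m - n - 2) (S.triE r j l X) := by
  obtain ⟨K, hK⟩ := S.E_fin ((S.norm (l - n - 1)).lTensor V (slot23 V (S.E l) X))
  -- For `s ≥ B` the exponent `l - n - 1 - s` of the second divided power is negative, so the term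
  -- vanishes.
  set B := (l - n).toNat with hB
  let g : ℕ → ℕ → ℕ → V := fun j r s => ((r + s - 1).choose s : ℂ) •
    S.norm₃ ((r + s : ℕ) + j - m - 1) (l - n - 1 - s) (S.triE r j l X)
  have hg : ∀ j r s, R ≤ r ∨ B ≤ s → g j r s = 0 := by
    rintro j r s (h | h)
    · simp only [g]
      rw [S.triE_eq_zero hR (Or.inl h), map_zero, smul_zero]
    · simp only [g]
      rw [norm₃_neg_right _ _ (by omega), LinearMap.zero_apply, smul_zero]
  have hg' : ∀ j r s, R ≤ j → g j r s = 0 := by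
    intro j r s h
    simp only [g]
    rw [S.triE_eq_zero hR (Or.inr (Or.inl h)), map_zero, smul_zero]
  have h1 : S.prodT m ((S.norm (l - n - 1)).lTensor V (slot23 V (S.E l) X))
      = ∑ k ∈ Finset.range (max K (R + B + R)), ∑ ij ∈ Finset.HasAntidiagonal.antidiagonal k,
        ∑ rs ∈ Finset.HasAntidiagonal.antidiagonal ij.1, g ij.2 rs.1 rs.2 := by
    rw [S.prodT_eq_sum (K := max K (R + B + R)) m
      fun k hk => hK k (le_trans (le_max_left _ _) hk)]
    refine Finset.sum_congr rfl fun k _ => ?_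
    rw [E_norm, map_sum]
    refine Finset.sum_congr rfl fun ij hij => ?_
    rw [map_sum]
    refine Finset.sum_congr rfl fun rs hrs => ?_
    have e1 := Finset.HasAntidiagonal.mem_antidiagonal.1 hij
    have e2 := Finset.HasAntidiagonal.mem_antidiagonal.1 hrs
    simp only [g]
    rw [map_smul, ← e1, ← e2, norm₃]
    push_cast
    rfl
  rw [h1, sum_antidiagonal_range (fun i j => ∑ rs ∈ Finset.HasAntidiagonal.antidiagonal i,
    g j rs.1 rs.2) (le_max_right K (R + B + R)), Finset.sum_comm]
  · conv_rhs => rw [Finset.sum_comm]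
    refine Finset.sum_congr rfl fun j _ => ?_
    rw [sum_antidiagonal_range (g j) le_rfl (hg j)]
    refine Finset.sum_congr rfl fun r _ => ?_
    rw [tri_apply]
    -- `P = r + s + j - m - 1` is the exponent of `T` on the first factor. The binomials in `s`
    -- become the values of `expCoeff`.
    have h := sum_shift (fun s => ((r + s - 1).choose s : ℤ)) (fun P => expCoeff (m + P - j) r)
      (fun P => S.norm₃ P (r + j + l - m - n - 2 - P) (S.triE r j l X)) (r + j - m - 1)
      (r + j + l - m - n - 2) B ?_ ?_ ?_ ?_ (by omega)
    · rw [← h]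
      refine Finset.sum_congr rfl fun s _ => ?_
      simp only [g]
      rw [natCast_zsmul, Nat.cast_smul_eq_nsmul]
      congr 3
      · push_cast; ring
      · ring
    · intro s
      rw [← expCoeff_shift]
      congr 1
      ring
    · intro P hP
      exact expCoeff_eq_zero (by omega)
    · intro P hP
      rw [norm₃_neg_left _ hP, LinearMap.zero_apply]
    · intro P hP
      rw [norm₃_neg_right _ _ (by omega), LinearMap.zero_apply]
  · rintro i j (h | h)
    · refine Finset.sum_eq_zero fun rs hrs => hg _ _ _ ?_
      have := Finset.HasAntidiagonal.mem_antidiagonal.1 hrs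
      omega
    · exact Finset.sum_eq_zero fun rs _ => hg' _ _ _ h

/-- The composition of two vertex operators. -/
theorem prod_prod {R : ℕ} {u v t : V} (hR : S.TriBound R (u ⊗ₜ (v ⊗ₜ t))) (m n : ℤ) :
    S.prod m u (S.prod n v t) = ∑ r ∈ Finset.range R, ∑ j ∈ Finset.range R, ∑ l ∈ Finset.range R,
      S.tri (fun P => expCoeff (m + P - j) r) (r + j + l - m - n - 2)
        (S.triE r j l (u ⊗ₜ (v ⊗ₜ t))) := by
  set X := u ⊗ₜ[ℂ] (v ⊗ₜ[ℂ] t) with hX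
  obtain ⟨L, hL⟩ := S.E_fin (v ⊗ₜ t)
  have h1 : u ⊗ₜ[ℂ] S.prod n v t = ∑ l ∈ Finset.range (max L R),
      (S.norm (l - n - 1)).lTensor V (slot23 V (S.E l) X) := by
    rw [prod, S.prodT_eq_sum (K := max L R) n fun k hk => hL k (le_trans (le_max_left _ _) hk),
      TensorProduct.tmul_sum]
    rfl
  have h2 : ∑ l ∈ Finset.range (max L R), S.prodT m ((S.norm (l - n - 1)).lTensor V
      (slot23 V (S.E l) X)) = ∑ l ∈ Finset.range R, S.prodT m ((S.norm (l - n - 1)).lTensor V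
      (slot23 V (S.E l) X)) := by
    refine (Finset.sum_subset (Finset.range_mono (le_max_right _ _)) fun l _ hl => ?_).symm
    rw [(hR l (by simpa using hl)).2.2, map_zero]
    simp [prodT]
  rw [prod, h1, prodT_sum, h2]
  simp only [S.prodT_lTensor_norm hR]
  rw [Finset.sum_comm]
  exact Finset.sum_congr rfl fun r _ => Finset.sum_comm

theorem intChoose_vandermonde (P i e : ℕ) :
    ∑ s ∈ Finset.range (e + 1), ((-1) ^ s * ((i + s - 1).choose s : ℤ)) * (P.choose (e - s) : ℤ)
      = Ring.choose ((P : ℤ) - i) e := by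
  rw [sub_eq_neg_add, Ring.add_choose_eq e (Commute.all _ _),
    Finset.Nat.sum_antidiagonal_eq_sum_range_succ_mk]
  refine Finset.sum_congr rfl fun s _ => ?_
  rw [choose_neg_natCast, Ring.choose_natCast]

/-- The part of `Y(Y(u,x)v,w)t` with `E₁₂` in degree `r`. Here `z = w + x` is expanded for `|w| >
|x|`: the power `z^{P-j}` contributes `binom(P - j, e) x^e`, and `x^{e-r} = x^{-m-1}` forces `e = r
- m - 1`. A negative `e` contributes nothing, in accordance with `intChoose`. -/
theorem prodT_rTensor_norm {R : ℕ} {X : V ⊗[ℂ] (V ⊗[ℂ] V)} (hR : S.TriBound R X) (m n : ℤ)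
    (r : ℕ) :
    S.prodT n ((S.norm (r - m - 1)).rTensor V
        ((TensorProduct.assoc ℂ V V V).symm (slot12 V (S.E r) X)))
      = ∑ j ∈ Finset.range R, ∑ l ∈ Finset.range R,
        S.tri (fun P => intChoose (P - j) (r - m - 1)) (r + j + l - m - n - 2)
          (S.triE r j l X) := by
  rcases lt_or_ge ((r : ℤ) - m - 1) 0 with h0 | h0
  · rw [norm_neg _ h0, LinearMap.rTensor_zero, LinearMap.zero_apply]
    have : S.prodT n 0 = 0 := by simp [prodT]
    rw [this]
    refine (Finset.sum_eq_zero fun j _ => Finset.sum_eq_zero fun l _ => ?_).symm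
    rw [tri_apply]
    refine Finset.sum_eq_zero fun P _ => ?_
    rw [intChoose, if_neg (by omega), zero_smul]
  obtain ⟨e, he⟩ : ∃ e : ℕ, (r : ℤ) - m - 1 = e := ⟨_, (Int.toNat_of_nonneg h0).symm⟩
  obtain ⟨K, hK⟩ := S.E_fin ((S.norm (r - m - 1)).rTensor V
        ((TensorProduct.assoc ℂ V V V).symm (slot12 V (S.E r) X)))
  have hcomm : ∀ j l, slot13 V (S.E j) (slot23 V (S.E l) (slot12 V (S.E r) X))
      = S.triE r j l X := by
    intro j l
    rw [triE, ((S.comm12_13 r j).mul_right (S.comm12_23 r l)).eq]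
    rfl
  let g : ℕ → ℕ → ℕ → V := fun l j s => ((-1) ^ s * ((j + s - 1).choose s : ℂ)) •
    S.norm ((j + s : ℕ) + l - n - 1) ((S.norm (e - s)).rTensor V
      ((TensorProduct.assoc ℂ V V V).symm (S.triE r j l X)))
  have hg : ∀ l j s, R ≤ j ∨ e + 1 ≤ s → g l j s = 0 := by
    rintro l j s (h | h)
    · simp only [g]
      rw [S.triE_eq_zero hR (Or.inr (Or.inl h)), map_zero, map_zero, map_zero, smul_zero]
    · simp only [g]
      rw [norm_neg S (p := (e : ℤ) - s) (by omega), LinearMap.rTensor_zero, LinearMap.zero_apply,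
        map_zero, smul_zero]
  have hg' : ∀ l j s, R ≤ l → g l j s = 0 := by
    intro l j s h
    simp only [g]
    rw [S.triE_eq_zero hR (Or.inr (Or.inr h)), map_zero, map_zero, map_zero, smul_zero]
  have h1 : S.prodT n ((S.norm (r - m - 1)).rTensor V
        ((TensorProduct.assoc ℂ V V V).symm (slot12 V (S.E r) X)))
      = ∑ k ∈ Finset.range (max K (R + (e + 1) + R)),
        ∑ ij ∈ Finset.HasAntidiagonal.antidiagonal k,
        ∑ rs ∈ Finset.HasAntidiagonal.antidiagonal ij.1, g ij.2 rs.1 rs.2 := by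
    rw [S.prodT_eq_sum (K := max K (R + (e + 1) + R)) n
      fun k hk => hK k (le_trans (le_max_left _ _) hk)]
    refine Finset.sum_congr rfl fun k _ => ?_
    rw [E_norm_left, map_sum]
    refine Finset.sum_congr rfl fun ij hij => ?_
    rw [map_sum]
    refine Finset.sum_congr rfl fun rs hrs => ?_
    have e1 := Finset.HasAntidiagonal.mem_antidiagonal.1 hij
    have e2 := Finset.HasAntidiagonal.mem_antidiagonal.1 hrs
    simp only [g]
    rw [map_smul, ← e1, ← e2, hcomm, he]
    push_cast
    rfl
  rw [h1, sum_antidiagonal_range (fun i j => ∑ rs ∈ Finset.HasAntidiagonal.antidiagonal i,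
    g j rs.1 rs.2) (le_max_right K (R + (e + 1) + R)), Finset.sum_comm]
  · conv_rhs => rw [Finset.sum_comm]
    refine Finset.sum_congr rfl fun l _ => ?_
    rw [sum_antidiagonal_range (g l) le_rfl (hg l)]
    refine Finset.sum_congr rfl fun j _ => ?_
    rw [tri_apply]
    -- For fixed `P` the dependence on `s` is now only in two binomials: one from shifting `E₁₃`,
    -- one from merging two divided powers. Vandermonde's identity sums them.
    have hN : ∀ s ∈ Finset.range (e + 1), g l j s = ∑ P ∈ Finset.range
        ((r : ℤ) + j + l - m - n - 2 + 1).toNat,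
        (((-1) ^ s * ((j + s - 1).choose s : ℤ)) * (P.choose (e - s) : ℤ)) •
          S.norm₃ P (r + j + l - m - n - 2 - P) (S.triE r j l X) := by
      intro s hs
      have hs' := Finset.mem_range.1 hs
      have := LinearMap.congr_fun (S.norm_norm ((j + s : ℕ) + l - n - 1) (e - s)) (S.triE r j l X)
      have e3 : ((e - s : ℕ) : ℤ) = e - s := by omega
      have e4 : (((j + s : ℕ) : ℤ) + l - n - 1 + ((e - s : ℕ) : ℤ)) = r + j + l - m - n - 2 := by
        omega
      rw [e4, LinearMap.sum_apply, e3] at this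
      simp only [g]
      have hc : ((-1 : ℂ) ^ s * ((j + s - 1).choose s : ℂ))
          = (((-1) ^ s * ((j + s - 1).choose s : ℤ) : ℤ) : ℂ) := by push_cast; rfl
      rw [hc, Int.cast_smul_eq_zsmul]
      refine (congrArg _ this).trans ?_
      rw [Finset.smul_sum]
      refine Finset.sum_congr rfl fun P _ => ?_
      rw [LinearMap.smul_apply, smul_smul]
    rw [Finset.sum_congr rfl hN, Finset.sum_comm]
    refine Finset.sum_congr rfl fun P _ => ?_
    rw [← Finset.sum_smul, intChoose_vandermonde, he, intChoose, if_pos (by omega),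
      Int.toNat_natCast]
  · rintro i j (h | h)
    · refine Finset.sum_eq_zero fun rs hrs => hg _ _ _ ?_
      have := Finset.HasAntidiagonal.mem_antidiagonal.1 hrs
      omega
    · exact Finset.sum_eq_zero fun rs _ => hg' _ _ _ h

/-- The vertex operator of a product. -/
theorem prod_prod_left {R : ℕ} {u v t : V} (hR : S.TriBound R (u ⊗ₜ (v ⊗ₜ t))) (m n : ℤ) :
    S.prod n (S.prod m u v) t
      = ∑ r ∈ Finset.range R, ∑ j ∈ Finset.range R, ∑ l ∈ Finset.range R,
      S.tri (fun P => intChoose (P - j) (r - m - 1)) (r + j + l - m - n - 2)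
        (S.triE r j l (u ⊗ₜ (v ⊗ₜ t))) := by
  set X := u ⊗ₜ[ℂ] (v ⊗ₜ[ℂ] t) with hX
  obtain ⟨L, hL⟩ := S.E_fin (u ⊗ₜ v)
  have h1 : S.prod m u v ⊗ₜ[ℂ] t = ∑ l ∈ Finset.range (max L R),
      (S.norm (l - m - 1)).rTensor V
        ((TensorProduct.assoc ℂ V V V).symm (slot12 V (S.E l) X)) := by
    rw [prod, S.prodT_eq_sum (K := max L R) m fun k hk => hL k (le_trans (le_max_left _ _) hk),
      TensorProduct.sum_tmul]
    refine Finset.sum_congr rfl fun k _ => ?_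
    rw [hX, slot12_tmul, LinearEquiv.symm_apply_apply]
    rfl
  have h2 : ∑ l ∈ Finset.range (max L R), S.prodT n ((S.norm (l - m - 1)).rTensor V
        ((TensorProduct.assoc ℂ V V V).symm (slot12 V (S.E l) X)))
      = ∑ l ∈ Finset.range R, S.prodT n ((S.norm (l - m - 1)).rTensor V
        ((TensorProduct.assoc ℂ V V V).symm (slot12 V (S.E l) X))) := by
    refine (Finset.sum_subset (Finset.range_mono (le_max_right _ _)) fun l _ hl => ?_).symm
    rw [(hR l (by simpa using hl)).1, map_zero, map_zero]
    simp [prodT]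
  rw [prod, h1, prodT_sum, h2]
  exact Finset.sum_congr rfl fun r _ => S.prodT_rTensor_norm hR m n r

/-- Exchanging `u` and `v` interchanges `E₁₃` and `E₂₃` and multiplies `E₁₂` in degree `r` by
`(-1)^r`. The result is the expression of `prod_prod` with `(z - w)^{-r}` expanded for `|w| > |z|`.
-/
theorem prod_prod_swap {R : ℕ} {u v t : V} (hR : S.TriBound R (u ⊗ₜ (v ⊗ₜ t))) (m n : ℤ) :
    S.prod n v (S.prod m u t)
      = ∑ r ∈ Finset.range R, ∑ j ∈ Finset.range R, ∑ l ∈ Finset.range R,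
      S.tri (fun P => (-1) ^ r * expCoeff (r - 2 - (m + P - j)) r) (r + j + l - m - n - 2)
        (S.triE r j l (u ⊗ₜ (v ⊗ₜ t))) := by
  have h := S.prod_prod (R := R) (u := v) (v := u) (t := t) (S.triBound_swap hR) n m
  rw [h]
  refine Finset.sum_congr rfl fun r _ => ?_
  rw [Finset.sum_comm]
  refine Finset.sum_congr rfl fun j _ => Finset.sum_congr rfl fun l _ => ?_
  have e : v ⊗ₜ[ℂ] (u ⊗ₜ[ℂ] t) = swap12 V (u ⊗ₜ (v ⊗ₜ t)) := rfl
  have e2 := LinearMap.congr_fun (S.triE_swap r l j) (u ⊗ₜ (v ⊗ₜ t))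
  rw [Module.End.mul_apply, LinearMap.smul_apply, Module.End.mul_apply] at e2
  rw [e, e2, map_smul, tri_swap,
    show (r : ℤ) + l + j - n - m - 2 = r + j + l - m - n - 2 by ring, tri_apply, tri_apply,
    Finset.smul_sum]
  refine Finset.sum_congr rfl fun P _ => ?_
  have hc : ((-1 : ℂ) ^ r) = (((-1 : ℤ) ^ r : ℤ) : ℂ) := by push_cast; rfl
  rw [hc, Int.cast_smul_eq_zsmul, smul_smul]
  congr 3
  ring

/-- Borcherds' commutator formula. -/
theorem commutator (u v t : V) (m n : ℤ) {I : ℕ} (hI : ∀ i : ℕ, I ≤ i → S.prod i u v = 0) :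
    S.prod m u (S.prod n v t) - S.prod n v (S.prod m u t)
      = ∑ i ∈ Finset.range I, (Ring.choose m i : ℤ) • S.prod (m + n - i) (S.prod i u v) t := by
  obtain ⟨R, hR⟩ := S.exists_triBound u v t
  have hz : ∀ k, S.prod k 0 t = 0 := fun k => by rw [← prodHom_apply, map_zero]; rfl
  have hext : ∑ i ∈ Finset.range I, (Ring.choose m i : ℤ) • S.prod (m + n - i) (S.prod i u v) t
      = ∑ i ∈ Finset.range (max I R),
        (Ring.choose m i : ℤ) • S.prod (m + n - i) (S.prod i u v) t := by
    refine Finset.sum_subset (Finset.range_mono (le_max_left _ _)) fun i _ hi => ?_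
    rw [hI i (by simpa using hi), hz, smul_zero]
  rw [hext, S.prod_prod hR, S.prod_prod_swap hR]
  simp only [S.prod_prod_left hR, ← Finset.sum_sub_distrib, Finset.smul_sum]
  conv_rhs => rw [Finset.sum_comm]
  refine Finset.sum_congr rfl fun r hr => ?_
  conv_rhs => rw [Finset.sum_comm]
  refine Finset.sum_congr rfl fun j _ => ?_
  conv_rhs => rw [Finset.sum_comm]
  refine Finset.sum_congr rfl fun l _ => ?_
  simp only [show ∀ i : ℕ, (r : ℤ) + j + l - i - (m + n - i) - 2 = r + j + l - m - n - 2
    from fun i => by ring, tri_apply, Finset.smul_sum, ← Finset.sum_sub_distrib]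
  conv_rhs => rw [Finset.sum_comm]
  refine Finset.sum_congr rfl fun P _ => ?_
  -- All terms now involve the same vectors `triE r j l` and exponents `P`, and only coefficients
  -- are to be compared. What remains is Vandermonde's identity `binom(m + (P - j), r - 1) = ∑_i
  -- binom(m, i) binom(P - j, r - 1 - i)`; for `r = 0` both sides are zero.
  rw [← sub_smul, expCoeff_sub]
  simp only [smul_smul]
  rw [← Finset.sum_smul]
  congr 1
  have hr' := Finset.mem_range.1 hr
  cases r with
  | zero =>
    rw [intChoose, if_neg (by simp)]
    refine (Finset.sum_eq_zero fun i _ => ?_).symm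
    rw [intChoose, if_neg (by push_cast; omega), mul_zero]
  | succ r =>
    have e : (((r + 1 : ℕ) : ℤ) - 1) = r := by push_cast; ring
    rw [intChoose, e, if_pos (by omega), Int.toNat_natCast, add_sub_assoc,
      Ring.add_choose_eq r (Commute.all _ _), Finset.Nat.sum_antidiagonal_eq_sum_range_succ_mk]
    rw [← Finset.sum_subset (Finset.range_mono (show r + 1 ≤ max I R from le_trans hr'.le (le_max_right _ _)))]
    · refine Finset.sum_congr rfl fun i hi => ?_
      have := Finset.mem_range.1 hi
      rw [intChoose, if_pos (by push_cast; omega)]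
      congr 2
      push_cast
      omega
    · intro i _ hi
      have : r + 1 ≤ i := by simpa using hi
      rw [intChoose, if_neg (by push_cast; omega), mul_zero]

/-- The vertex operator of a `(-1)`-st product is the normally ordered product. -/
theorem normal_order (u v t : V) (n : ℤ) :
    ∃ I₀ : ℕ, ∀ I, I₀ ≤ I → S.prod n (S.prod (-1) u v) t
      = ∑ i ∈ Finset.range I, (S.prod (-1 - i) u (S.prod (n + i) v t)
        + S.prod (n - 1 - i) v (S.prod i u t)) := by
  obtain ⟨R, hR⟩ := S.exists_triBound u v t
  -- The exponents satisfy `0 ≤ P < r + j + l - n` with `r, j, l < R`, so this bound exceeds every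
  -- `|P - j|`, as `expCoeff_telescope` requires.
  refine ⟨4 * R + n.natAbs + 4, fun I hI => ?_⟩
  simp only [S.prod_prod_left hR, S.prod_prod hR, S.prod_prod_swap hR, ← Finset.sum_add_distrib]
  conv_rhs => rw [Finset.sum_comm]
  refine Finset.sum_congr rfl fun r hr => ?_
  conv_rhs => rw [Finset.sum_comm]
  refine Finset.sum_congr rfl fun j hj => ?_
  conv_rhs => rw [Finset.sum_comm]
  refine Finset.sum_congr rfl fun l hl => ?_
  have hr' := Finset.mem_range.1 hr
  have hj' := Finset.mem_range.1 hj
  have hl' := Finset.mem_range.1 hl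
  simp only [show ∀ i : ℕ, (r : ℤ) + j + l - (-1 - i) - (n + i) - 2 = r + j + l - n - 1
    from fun i => by ring, show ∀ i : ℕ, (r : ℤ) + j + l - i - (n - 1 - i) - 2 = r + j + l - n - 1
    from fun i => by ring, show (r : ℤ) + j + l - (-1) - n - 2 = r + j + l - n - 1 by ring,
    tri_apply, ← Finset.sum_add_distrib]
  conv_rhs => rw [Finset.sum_comm]
  refine Finset.sum_congr rfl fun P hP => ?_
  have hP' := Finset.mem_range.1 hP
  simp only [← add_smul]
  rw [← Finset.sum_smul]
  congr 1
  have e : ((r : ℤ) - -1 - 1) = r := by ring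
  rw [e, intChoose, if_pos (by omega), Int.toNat_natCast,
    ← expCoeff_telescope (P - j) r (I := I) (by omega) (by omega)]
  refine Finset.sum_congr rfl fun i _ => ?_
  congr 2
  · ring
  · congr 1
    ring

end WickData

end

/-! ### Formal exponentials of families of operators -/

section

/-! ### Exponentials of commuting families of operators -/

section Exponential

variable {M M' : Type*} [AddCommGroup M] [Module ℂ M] [AddCommGroup M'] [Module ℂ M']

/-- `e` is the sequence of coefficients of `exp (∑ c_k z^{-k})`, by way of the differential
equation of the exponential. -/
def IsExpOf (c e : ℕ → Module.End ℂ M) : Prop :=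
  e 0 = 1 ∧ ∀ k : ℕ, (k : ℂ) • e k
    = ∑ ij ∈ Finset.HasAntidiagonal.antidiagonal k, (ij.1 : ℂ) • (c ij.1 * e ij.2)

/-- The equation determines `e k` recursively from `c`, since `k ≠ 0` is invertible and the term
with index `0` has factor `0`. Hence a map compatible with the exponents is compatible with the
exponentials. Most properties of the exponential of the contraction are deduced from those of the
contraction in this way. -/
theorem IsExpOf.intertwine {c e : ℕ → Module.End ℂ M} {c' e' : ℕ → Module.End ℂ M'}
    (h : IsExpOf c e) (h' : IsExpOf c' e') (L : M' →ₗ[ℂ] M) (hc : ∀ k, c k ∘ₗ L = L ∘ₗ c' k)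
    (k : ℕ) : e k ∘ₗ L = L ∘ₗ e' k := by
  induction k using Nat.strong_induction_on with
  | _ k ih =>
    rcases Nat.eq_zero_or_pos k with rfl | hk
    · rw [h.1, h'.1]
      rfl
    · have hk' : (k : ℂ) ≠ 0 := by exact_mod_cast hk.ne'
      refine smul_right_injective _ hk' ?_
      change (k : ℂ) • (e k ∘ₗ L) = (k : ℂ) • (L ∘ₗ e' k)
      rw [← LinearMap.smul_comp, ← LinearMap.comp_smul, h.2, h'.2]
      ext x
      simp only [LinearMap.comp_apply, LinearMap.sum_apply, map_sum, LinearMap.smul_apply, map_smul]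
      refine Finset.sum_congr rfl fun ij hij => ?_
      have hij' := Finset.HasAntidiagonal.mem_antidiagonal.1 hij
      rcases Nat.eq_zero_or_pos ij.1 with h0 | h0
      · rw [h0]
        simp
      · have e1 := LinearMap.congr_fun (ih ij.2 (by omega)) x
        have e2 := LinearMap.congr_fun (hc ij.1) (e' ij.2 x)
        simp only [LinearMap.comp_apply] at e1 e2
        rw [Module.End.mul_apply, Module.End.mul_apply, e1, e2]

theorem IsExpOf.commute {c e : ℕ → Module.End ℂ M} (h : IsExpOf c e) {X : Module.End ℂ M}
    (hX : ∀ k, Commute X (c k)) (k : ℕ) : Commute X (e k) := by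
  have := h.intertwine h X (fun k => ((hX k).eq).symm) k
  exact this.symm

theorem IsExpOf.map {c e : ℕ → Module.End ℂ M} (h : IsExpOf c e)
    (f : Module.End ℂ M →ₐ[ℂ] Module.End ℂ M') :
    IsExpOf (fun k => f (c k)) (fun k => f (e k)) := by
  refine ⟨(congrArg f h.1).trans (map_one f), fun k => ?_⟩
  rw [← map_smul, h.2, map_sum]
  simp only [map_smul, map_mul]

/-- The operator `z d/dz`, up to the sign, on formal power series in `z^{-1}`. -/
def eulerSeries {R : Type*} [Semiring R] [Module ℂ R] (f : PowerSeries R) : PowerSeries R :=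
  PowerSeries.mk fun k => (k : ℂ) • PowerSeries.coeff k f

theorem coeff_eulerSeries {R : Type*} [Semiring R] [Module ℂ R] (f : PowerSeries R) (k : ℕ) :
    PowerSeries.coeff k (eulerSeries f) = (k : ℂ) • PowerSeries.coeff k f :=
  PowerSeries.coeff_mk _ _

theorem eulerSeries_mul {R : Type*} [Ring R] [Algebra ℂ R] (f g : PowerSeries R) :
    eulerSeries (f * g) = eulerSeries f * g + f * eulerSeries g := by
  ext k
  simp only [eulerSeries, PowerSeries.coeff_mk, map_add, PowerSeries.coeff_mul, Finset.smul_sum,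
    ← Finset.sum_add_distrib, smul_mul_assoc, mul_smul_comm, ← add_smul]
  refine Finset.sum_congr rfl fun ij hij => ?_
  rw [← Finset.HasAntidiagonal.mem_antidiagonal.1 hij]
  push_cast
  rfl

theorem commute_series {R : Type*} [Ring R] {f g : PowerSeries R}
    (h : ∀ i j, Commute (PowerSeries.coeff i f) (PowerSeries.coeff j g)) : Commute f g := by
  ext k
  rw [PowerSeries.coeff_mul, PowerSeries.coeff_mul, ← Finset.Nat.sum_antidiagonal_swap]
  exact Finset.sum_congr rfl fun ij _ => (h ij.2 ij.1).eq

theorem isExpOf_iff {c e : ℕ → Module.End ℂ M} : IsExpOf c e ↔ e 0 = 1 ∧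
    eulerSeries (PowerSeries.mk e) = eulerSeries (PowerSeries.mk c) * PowerSeries.mk e := by
  refine and_congr_right fun _ => ?_
  rw [PowerSeries.ext_iff]
  refine forall_congr' fun k => ?_
  simp only [eulerSeries, PowerSeries.coeff_mk, PowerSeries.coeff_mul, smul_mul_assoc]

/-- The Leibniz rule for `z d/dz` applied to the product of the series; commutation is used to move
the logarithmic derivative of the second factor past the first factor. -/
theorem IsExpOf.mul {c e c' e' : ℕ → Module.End ℂ M} (h : IsExpOf c e) (h' : IsExpOf c' e')
    (hc : ∀ i j, Commute (c i) (c' j)) :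
    IsExpOf (fun k => c k + c' k)
      (fun k => ∑ ij ∈ Finset.HasAntidiagonal.antidiagonal k, e ij.1 * e' ij.2) := by
  have h1 := isExpOf_iff.1 h
  have h2 := isExpOf_iff.1 h'
  have e1 : PowerSeries.mk (fun k => ∑ ij ∈ Finset.HasAntidiagonal.antidiagonal k, e ij.1 * e' ij.2)
      = PowerSeries.mk e * PowerSeries.mk e' := by
    ext1 k
    simp [PowerSeries.coeff_mul]
  have e2 : eulerSeries (PowerSeries.mk fun k => c k + c' k)
      = eulerSeries (PowerSeries.mk c) + eulerSeries (PowerSeries.mk c') := by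
    ext1 k
    simp [eulerSeries]
  have e3 : Commute (PowerSeries.mk e) (eulerSeries (PowerSeries.mk c')) := by
    refine commute_series fun i j => ?_
    simp only [eulerSeries, PowerSeries.coeff_mk]
    exact Commute.smul_right ((h.commute (fun k => (hc k j).symm) i).symm) _
  refine isExpOf_iff.2 ⟨by simp [h.1, h'.1], ?_⟩
  rw [e1, e2, eulerSeries_mul, h1.2, h2.2, add_mul, mul_assoc, ← mul_assoc (PowerSeries.mk e),
    e3.eq, mul_assoc]

/-- Termwise `z d/dz (c^{n+1}/(n+1)!) = (z d/dz c) c^n/n!`, by commutativity. It identifies the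
explicit exponential with the solution of the recursion. -/
theorem isExpOf_series (c : ℕ → Module.End ℂ M) (h0 : c 0 = 0)
    (hc : ∀ i j, Commute (c i) (c j)) :
    IsExpOf c (fun k => ∑ n ∈ Finset.range (k + 1),
      (n.factorial : ℂ)⁻¹ • PowerSeries.coeff k (PowerSeries.mk c ^ n)) := by
  have hpow : ∀ n : ℕ, eulerSeries (PowerSeries.mk c ^ (n + 1))
      = ((n + 1 : ℕ) : ℂ) • (eulerSeries (PowerSeries.mk c) * PowerSeries.mk c ^ n) := by
    intro n
    have hcc : Commute (PowerSeries.mk c) (eulerSeries (PowerSeries.mk c)) := by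
      refine commute_series fun i j => ?_
      simp only [eulerSeries, PowerSeries.coeff_mk]
      exact Commute.smul_right (hc i j) _
    induction n with
    | zero => simp
    | succ n ih =>
      rw [pow_succ, eulerSeries_mul, ih, ((hcc.pow_left (n + 1)).eq), smul_mul_assoc, mul_assoc,
        ← pow_succ]
      push_cast
      module
  -- Because `c 0 = 0`, the power `c^n` starts in degree `n`, so truncating the exponential sum
  -- after `n = k` loses nothing in degree `k`.
  have hlow : ∀ n k, k < n → PowerSeries.coeff k (PowerSeries.mk c ^ n) = 0 := by
    intro n
    induction n with
    | zero => intro k hk; omega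
    | succ n ih =>
      intro k hk
      rw [pow_succ, PowerSeries.coeff_mul]
      refine Finset.sum_eq_zero fun ij hij => ?_
      have := Finset.HasAntidiagonal.mem_antidiagonal.1 hij
      rcases Nat.eq_zero_or_pos ij.2 with h | h
      · rw [h, PowerSeries.coeff_mk, h0, mul_zero]
      · rw [ih _ (by omega), zero_mul]
  refine ⟨by simp, fun k => ?_⟩
  have hs : ∀ j, j ≤ k → ∑ n ∈ Finset.range (j + 1),
      (n.factorial : ℂ)⁻¹ • PowerSeries.coeff j (PowerSeries.mk c ^ n)
      = ∑ n ∈ Finset.range (k + 1),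
        (n.factorial : ℂ)⁻¹ • PowerSeries.coeff j (PowerSeries.mk c ^ n) := by
    intro j hj
    refine Finset.sum_subset (Finset.range_mono (by omega)) fun n _ hn => ?_
    rw [hlow n j (by simpa using hn), smul_zero]
  have hR : ∑ ij ∈ Finset.HasAntidiagonal.antidiagonal k,
      (ij.1 : ℂ) • (c ij.1 * ∑ n ∈ Finset.range (ij.2 + 1),
        (n.factorial : ℂ)⁻¹ • PowerSeries.coeff ij.2 (PowerSeries.mk c ^ n))
      = ∑ n ∈ Finset.range (k + 1), (n.factorial : ℂ)⁻¹ •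
        PowerSeries.coeff k (eulerSeries (PowerSeries.mk c) * PowerSeries.mk c ^ n) := by
    simp only [PowerSeries.coeff_mul, Finset.smul_sum]
    rw [Finset.sum_comm]
    refine Finset.sum_congr rfl fun ij hij => ?_
    have := Finset.HasAntidiagonal.mem_antidiagonal.1 hij
    rw [hs _ (by omega), Finset.mul_sum, Finset.smul_sum]
    refine Finset.sum_congr rfl fun n _ => ?_
    simp only [eulerSeries, PowerSeries.coeff_mk, mul_smul_comm, smul_mul_assoc]
    rw [smul_comm]
  have hkk : PowerSeries.coeff k (eulerSeries (PowerSeries.mk c) * PowerSeries.mk c ^ k) = 0 := by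
    rw [PowerSeries.coeff_mul]
    refine Finset.sum_eq_zero fun ij hij => ?_
    have := Finset.HasAntidiagonal.mem_antidiagonal.1 hij
    rcases Nat.eq_zero_or_pos ij.1 with h | h
    · simp [h, eulerSeries]
    · rw [hlow k ij.2 (by omega), mul_zero]
  rw [hR, Finset.sum_range_succ, hkk, smul_zero, add_zero]
  beta_reduce
  rw [Finset.sum_range_succ', smul_add,
    Finset.smul_sum]
  have hz : (k : ℂ) • ((Nat.factorial 0 : ℂ)⁻¹ • PowerSeries.coeff k (PowerSeries.mk c ^ 0)) = 0 := by
    rw [pow_zero, PowerSeries.coeff_one]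
    split_ifs with h
    · simp [h]
    · simp
  rw [hz, add_zero]
  refine Finset.sum_congr rfl fun n _ => ?_
  have h1 := congrArg (PowerSeries.coeff k) (hpow n)
  have h2 : PowerSeries.coeff k (((n + 1 : ℕ) : ℂ) • (eulerSeries (PowerSeries.mk c)
      * PowerSeries.mk c ^ n)) = ((n + 1 : ℕ) : ℂ) • PowerSeries.coeff k
        (eulerSeries (PowerSeries.mk c) * PowerSeries.mk c ^ n) := rfl
  rw [coeff_eulerSeries, h2] at h1
  rw [smul_comm, h1]
  have h3 : ((n + 1 : ℕ) : ℂ) ≠ 0 := by exact_mod_cast Nat.succ_ne_zero n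
  have h4 : ((n.factorial : ℕ) : ℂ) ≠ 0 := by exact_mod_cast Nat.factorial_ne_zero n
  rw [smul_smul, Nat.factorial_succ]
  congr 1
  push_cast at *
  field_simp

end Exponential

end

/-! ### Derivations attached to the letters and the translation operator -/

section

variable {N : ℕ}

/-! ### Derivations of the algebra of states -/

/-- The Leibniz rule. -/
def IsDer {V : Type*} [CommRing V] [Algebra ℂ V] (D : Module.End ℂ V) : Prop :=
  ∀ x y, D (x * y) = D x * y + x * D y

theorem IsDer.map_one {V : Type*} [CommRing V] [Algebra ℂ V] {D : Module.End ℂ V} (h : IsDer D) :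
    D 1 = 0 := by
  have := h 1 1
  simp only [mul_one, one_mul] at this
  exact left_eq_add.1 this

theorem IsDer.commutator {V : Type*} [CommRing V] [Algebra ℂ V] {D D' : Module.End ℂ V}
    (h : IsDer D) (h' : IsDer D') : IsDer (D * D' - D' * D) := by
  intro x y
  simp only [LinearMap.sub_apply, Module.End.mul_apply, h x y, h' x y, map_add, h _ _, h' _ _]
  ring

theorem IsDer.smul {V : Type*} [CommRing V] [Algebra ℂ V] {D : Module.End ℂ V}
    (h : IsDer D) (c : ℂ) : IsDer (c • D) := by
  intro x y
  simp only [LinearMap.smul_apply, h x y, smul_add, smul_mul_assoc, mul_smul_comm]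

/-- The derivations are only `ℂ`-linear and may act on the coefficients, so agreement on the letters
does not suffice and the elements of `Ô` have to be tested too. -/
theorem IsDer.ext {D D' : Module.End ℂ (DHat N)} (h : IsDer D) (h' : IsDer D')
    (hC : ∀ f : OHat N, D (MvPolynomial.C f) = D' (MvPolynomial.C f))
    (hX : ∀ x : Letter N, D (MvPolynomial.X x) = D' (MvPolynomial.X x)) : D = D' := by
  refine LinearMap.ext fun p => ?_
  induction p using MvPolynomial.induction_on with
  | C f => exact hC f
  | add p q hp hq => rw [map_add, map_add, hp, hq]
  | mul_X p x hp => rw [h, h', hp, hX]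

theorem coeffPd_C (i : Fin N) (f : OHat N) :
    coeffPd i (MvPolynomial.C f) = MvPolynomial.C (OHat.pd i f) := by
  classical
  ext s
  change (coeffPdFun i _).coeff s = _
  rw [coeff_coeffPdFun, MvPolynomial.coeff_C, MvPolynomial.coeff_C]
  split_ifs <;> simp

theorem coeffPd_X (i : Fin N) (x : Letter N) :
    coeffPd i (MvPolynomial.X x) = 0 := by
  classical
  ext s
  change (coeffPdFun i _).coeff s = _
  rw [coeff_coeffPdFun, MvPolynomial.coeff_X]
  split_ifs <;> simp

theorem isDer_coeffPd (i : Fin N) : IsDer (coeffPd i) := by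
  classical
  intro p q
  ext s
  change (coeffPdFun i _).coeff s = (coeffPdFun i _ * q + p * coeffPdFun i _).coeff s
  rw [coeff_coeffPdFun, MvPolynomial.coeff_add, MvPolynomial.coeff_mul, MvPolynomial.coeff_mul,
    MvPolynomial.coeff_mul, map_sum, ← Finset.sum_add_distrib]
  refine Finset.sum_congr rfl fun ab _ => ?_
  rw [coeff_coeffPdFun, coeff_coeffPdFun, Derivation.leibniz, smul_eq_mul, smul_eq_mul]
  ring

theorem isDer_pderiv (x : Letter N) :
    IsDer ((MvPolynomial.pderiv (R := OHat N) x).toLinearMap.restrictScalars ℂ) := by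
  intro p q
  change MvPolynomial.pderiv x (p * q) = MvPolynomial.pderiv x p * q + p * MvPolynomial.pderiv x q
  rw [Derivation.leibniz, smul_eq_mul, smul_eq_mul]
  ring

theorem isDer_derA (i : Fin N) (m : ℕ) : IsDer (derA i m) := isDer_pderiv _

theorem isDer_derB (i : Fin N) (n : ℕ) : IsDer (derB i n) := by
  cases n with
  | zero => exact isDer_coeffPd i
  | succ n => exact isDer_pderiv _

theorem derA_C (i : Fin N) (m : ℕ) (f : OHat N) : derA i m (MvPolynomial.C f) = 0 :=
  MvPolynomial.pderiv_C

theorem derA_X [DecidableEq (Letter N)] (i : Fin N) (m : ℕ) (x : Letter N) :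
    derA i m (MvPolynomial.X x) = if x = Letter.a i m then 1 else 0 := by
  change MvPolynomial.pderiv (Letter.a i m) (MvPolynomial.X x) = _
  rw [MvPolynomial.pderiv_X, Pi.single_apply]

theorem derB_zero_C (i : Fin N) (f : OHat N) :
    derB i 0 (MvPolynomial.C f) = MvPolynomial.C (OHat.pd i f) := coeffPd_C i f

theorem derB_succ_C (i : Fin N) (n : ℕ) (f : OHat N) :
    derB i (n + 1) (MvPolynomial.C f) = 0 := MvPolynomial.pderiv_C

theorem derB_zero_X (i : Fin N) (x : Letter N) : derB i 0 (MvPolynomial.X x) = 0 := coeffPd_X i x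

theorem derB_succ_X [DecidableEq (Letter N)] (i : Fin N) (n : ℕ) (x : Letter N) :
    derB i (n + 1) (MvPolynomial.X x) = if x = Letter.b i n then 1 else 0 := by
  change MvPolynomial.pderiv (Letter.b i n) (MvPolynomial.X x) = _
  rw [MvPolynomial.pderiv_X, Pi.single_apply]

/-- The derivations `∂/∂a^i_{-m-1}` and `∂/∂b^i_{-n}`. -/
def letterDer (N : ℕ) : Set (Module.End ℂ (DHat N)) :=
  {D | (∃ i m, D = derA i m) ∨ ∃ i n, D = derB i n}

theorem isDer_letterDer {D : Module.End ℂ (DHat N)} (h : D ∈ letterDer N) : IsDer D := by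
  rcases h with ⟨i, m, rfl⟩ | ⟨i, n, rfl⟩
  · exact isDer_derA i m
  · exact isDer_derB i n

theorem letterDer_X {D : Module.End ℂ (DHat N)} (h : D ∈ letterDer N) (x : Letter N) :
    ∃ c : ℂ, D (MvPolynomial.X x) = algebraMap ℂ _ c := by
  classical
  rcases h with ⟨i, m, rfl⟩ | ⟨i, n, rfl⟩
  · rw [derA_X]
    split_ifs
    · exact ⟨1, by rw [map_one]⟩
    · exact ⟨0, by rw [map_zero]⟩
  · cases n with
    | zero => exact ⟨0, by rw [derB_zero_X, map_zero]⟩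
    | succ n =>
      rw [derB_succ_X]
      split_ifs
      · exact ⟨1, by rw [map_one]⟩
      · exact ⟨0, by rw [map_zero]⟩

theorem IsDer.map_algebraMap {V : Type*} [CommRing V] [Algebra ℂ V] {D : Module.End ℂ V}
    (h : IsDer D) (c : ℂ) : D (algebraMap ℂ V c) = 0 := by
  rw [Algebra.algebraMap_eq_smul_one, map_smul, h.map_one, smul_zero]

/-- The commutator is again a derivation. On letters both derivations take scalar values, which are
annihilated; on coefficients only the `∂_i` act, and these commute. -/
theorem letterDer_comm {D D' : Module.End ℂ (DHat N)} (h : D ∈ letterDer N)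
    (h' : D' ∈ letterDer N) : Commute D D' := by
  have hz : IsDer (0 : Module.End ℂ (DHat N)) := fun x y => by simp
  refine sub_eq_zero.1 (((isDer_letterDer h).commutator (isDer_letterDer h')).ext hz ?_ ?_)
  · intro f
    rw [LinearMap.sub_apply, Module.End.mul_apply, Module.End.mul_apply, LinearMap.zero_apply]
    have hc : ∀ {D : Module.End ℂ (DHat N)}, D ∈ letterDer N →
        (∃ i, D = derB i 0) ∨ ∀ f, D (MvPolynomial.C f) = 0 := by
      rintro D (⟨i, m, rfl⟩ | ⟨i, n, rfl⟩)
      · exact Or.inr fun f => derA_C i m f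
      · cases n with
        | zero => exact Or.inl ⟨i, rfl⟩
        | succ n => exact Or.inr fun f => derB_succ_C i n f
    rcases hc h with ⟨i, rfl⟩ | h1 <;> rcases hc h' with ⟨j, rfl⟩ | h2
    · rw [derB_zero_C, derB_zero_C, derB_zero_C, derB_zero_C, OHat.pd_comm, sub_self]
    · rw [h2, map_zero, derB_zero_C, h2, sub_zero]
    · rw [h1, map_zero, derB_zero_C, h1, sub_zero]
    · rw [h1, h2, map_zero, map_zero, sub_zero]
  · intro x
    rw [LinearMap.sub_apply, Module.End.mul_apply, Module.End.mul_apply, LinearMap.zero_apply]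
    obtain ⟨c, hc⟩ := letterDer_X h x
    obtain ⟨c', hc'⟩ := letterDer_X h' x
    rw [hc, hc', (isDer_letterDer h).map_algebraMap, (isDer_letterDer h').map_algebraMap, sub_zero]

theorem translation_C (f : OHat N) : translation N (MvPolynomial.C f)
    = ∑ i, MvPolynomial.X (Letter.b i 0) * MvPolynomial.C (OHat.pd i f) := by
  have h : (MvPolynomial.mkDerivation (OHat N) translationLetter).toLinearMap.restrictScalars ℂ
      (MvPolynomial.C f) = (0 : DHat N) := Derivation.map_algebraMap _ _
  rw [translation, LinearMap.add_apply, h, add_zero, LinearMap.sum_apply]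
  refine Finset.sum_congr rfl fun i _ => ?_
  rw [LinearMap.comp_apply, coeffPd_C]
  rfl

theorem translation_X (x : Letter N) :
    translation N (MvPolynomial.X x) = translationLetter x := by
  have h : (MvPolynomial.mkDerivation (OHat N) translationLetter).toLinearMap.restrictScalars ℂ
      (MvPolynomial.X x) = (translationLetter x : DHat N) := MvPolynomial.mkDerivation_X _ _ _
  rw [translation, LinearMap.add_apply, h, LinearMap.sum_apply]
  have : ∑ i : Fin N, (LinearMap.mulLeft ℂ (MvPolynomial.X (Letter.b i 0) : DHat N) ∘ₗ coeffPd i)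
      (MvPolynomial.X x) = 0 := by
    refine Finset.sum_eq_zero fun i _ => ?_
    rw [LinearMap.comp_apply, coeffPd_X, map_zero]
  rw [this, zero_add]

theorem isDer_translation : IsDer (translation N) := by
  intro x y
  have h : ∀ p q : DHat N, (MvPolynomial.mkDerivation (OHat N)
      (translationLetter (N := N))).toLinearMap.restrictScalars ℂ (p * q)
      = (MvPolynomial.mkDerivation (OHat N) (translationLetter (N := N))).toLinearMap.restrictScalars
        ℂ p * q + p * (MvPolynomial.mkDerivation (OHat N)
          (translationLetter (N := N))).toLinearMap.restrictScalars ℂ q := by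
    intro p q
    change MvPolynomial.mkDerivation (OHat N) translationLetter (p * q)
      = MvPolynomial.mkDerivation (OHat N) translationLetter p * q
        + p * MvPolynomial.mkDerivation (OHat N) translationLetter q
    rw [Derivation.leibniz, smul_eq_mul, smul_eq_mul]
    ring
  have h2 : ∀ p q : DHat N, ∑ i : Fin N, (LinearMap.mulLeft ℂ (MvPolynomial.X (Letter.b i 0) : DHat N)
      ∘ₗ coeffPd i) (p * q)
      = (∑ i : Fin N, (LinearMap.mulLeft ℂ (MvPolynomial.X (Letter.b i 0) : DHat N)
        ∘ₗ coeffPd i) p) * q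
        + p * ∑ i : Fin N, (LinearMap.mulLeft ℂ (MvPolynomial.X (Letter.b i 0) : DHat N)
        ∘ₗ coeffPd i) q := by
    intro p q
    rw [Finset.sum_mul, Finset.mul_sum, ← Finset.sum_add_distrib]
    refine Finset.sum_congr rfl fun i _ => ?_
    simp only [LinearMap.comp_apply, isDer_coeffPd i p q, LinearMap.mulLeft_apply]
    ring
  simp only [translation, LinearMap.add_apply, LinearMap.sum_apply, h, h2]
  ring

/-- `T` raises the mode of `a` by one with factor the new index, so the commutator lowers it. For `m
= 0` the truncated index `m - 1` is harmless, its coefficient being zero. -/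
theorem derA_translation (i : Fin N) (m : ℕ) :
    derA i m * translation N = translation N * derA i m + (m : ℂ) • derA i (m - 1) := by
  classical
  refine sub_eq_iff_eq_add'.1 ?_
  refine ((isDer_derA i m).commutator isDer_translation).ext ((isDer_derA i (m - 1)).smul _) ?_ ?_
  · intro f
    rw [LinearMap.sub_apply, Module.End.mul_apply, Module.End.mul_apply, LinearMap.smul_apply,
      derA_C, derA_C, map_zero, smul_zero, sub_zero, translation_C, map_sum]
    refine Finset.sum_eq_zero fun j _ => ?_
    rw [isDer_derA, derA_C, derA_X, if_neg (by simp)]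
    simp
  · intro x
    obtain ⟨c, hc⟩ := letterDer_X (Or.inl ⟨i, m, rfl⟩) x
    rw [LinearMap.sub_apply, Module.End.mul_apply, Module.End.mul_apply, LinearMap.smul_apply,
      hc, isDer_translation.map_algebraMap, sub_zero, translation_X, derA_X]
    cases x with
    | b j p => simp only [translationLetter, map_nsmul, derA_X]; simp
    | a j p =>
      simp only [translationLetter, map_nsmul, derA_X, Letter.a.injEq]
      cases m with
      | zero => simp
      | succ m =>
        simp only [add_left_inj, add_tsub_cancel_right]
        split_ifs with h
        · rw [h.2, Nat.cast_smul_eq_nsmul]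
        · simp

/-- As for `a`, but `n = 1` links letters and coefficients: `T f = ∑ b^i_{-1} ∂_i f`, so
differentiating by `b^i_{-1}` leaves `∂_i f`. For `n = 0` it is the commutation of `T` with `∂_i`.
-/
theorem derB_translation (i : Fin N) (n : ℕ) :
    derB i n * translation N = translation N * derB i n + (n : ℂ) • derB i (n - 1) := by
  classical
  refine sub_eq_iff_eq_add'.1 ?_
  refine ((isDer_derB i n).commutator isDer_translation).ext ((isDer_derB i (n - 1)).smul _) ?_ ?_
  · intro f
    rw [LinearMap.sub_apply, Module.End.mul_apply, Module.End.mul_apply, LinearMap.smul_apply,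
      translation_C, map_sum]
    rcases n with _ | _ | n
    · rw [derB_zero_C, translation_C]
      simp only [isDer_derB i 0 _ _, derB_zero_X, derB_zero_C, zero_mul, zero_add]
      simp [OHat.pd_comm i]
    · simp only [zero_add, isDer_derB i 1 _ _, derB_succ_X, derB_succ_C, mul_zero, add_zero,
        map_zero, sub_zero, tsub_self, derB_zero_C, Letter.b.injEq, and_true]
      simp
    · simp only [isDer_derB i _ _ _, derB_succ_X, derB_succ_C, mul_zero, add_zero,
        map_zero, sub_zero, Letter.b.injEq]
      simp [derB_succ_C]
  · intro x
    obtain ⟨c, hc⟩ := letterDer_X (Or.inr ⟨i, n, rfl⟩) x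
    rw [LinearMap.sub_apply, Module.End.mul_apply, Module.End.mul_apply, LinearMap.smul_apply,
      hc, isDer_translation.map_algebraMap, sub_zero, translation_X]
    rcases n with _ | _ | n
    · cases x <;> simp only [translationLetter, map_nsmul, derB_zero_X] <;> simp
    · cases x <;> simp only [translationLetter, map_nsmul, derB_succ_X] <;>
        simp [derB_zero_X]
    · cases x with
      | a j p => simp only [translationLetter, map_nsmul, derB_succ_X]; simp [derB_succ_X]
      | b j p =>
        simp only [translationLetter, map_nsmul, derB_succ_X, Letter.b.injEq, add_left_inj,
          show n + 1 + 1 - 1 = n + 1 from rfl]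
        split_ifs with h
        · rw [h.2, Nat.cast_smul_eq_nsmul]
        · simp

end

/-! ### The contraction operator satisfies the axioms of Wick data -/

section

variable {N : ℕ}

/-! ### The contraction operator -/

/-- The span of the tensors `D ⊗ D'` of derivations attached to letters. -/
def letterSpan (N : ℕ) : Submodule ℂ (Module.End ℂ (DHat N ⊗[ℂ] DHat N)) :=
  Submodule.span ℂ {X | ∃ D ∈ letterDer N, ∃ D' ∈ letterDer N, X = TensorProduct.map D D'}

theorem contraction_mem (k : ℕ) : contraction N k ∈ letterSpan N := by
  cases k with
  | zero => exact zero_mem _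
  | succ k =>
    have hA : ∀ i m, derA i m ∈ letterDer N := fun i m => Or.inl ⟨i, m, rfl⟩
    have hB : ∀ i n, derB i n ∈ letterDer N := fun i n => Or.inr ⟨i, n, rfl⟩
    refine Submodule.sum_mem _ fun i _ => Submodule.sum_mem _ fun mn _ => ?_
    have e : ∀ X Y : DHat N ⊗[ℂ] DHat N →ₗ[ℂ] DHat N ⊗[ℂ] DHat N, X - Y = X + (-1 : ℂ) • Y :=
      fun X Y => LinearMap.ext fun t => by
        change X t - Y t = X t + (-1 : ℂ) • Y t
        module
    rw [e, smul_smul]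
    exact (letterSpan N).add_mem
      ((letterSpan N).smul_mem _ (Submodule.subset_span ⟨_, hA i mn.1, _, hB i mn.2, rfl⟩))
      ((letterSpan N).smul_mem _ (Submodule.subset_span ⟨_, hB i mn.2, _, hA i mn.1, rfl⟩))

theorem letterSpan_commute {M : Type*} [AddCommGroup M] [Module ℂ M]
    (f g : Module.End ℂ (DHat N ⊗[ℂ] DHat N) →ₐ[ℂ] Module.End ℂ M)
    (h : ∀ D₁ ∈ letterDer N, ∀ D₂ ∈ letterDer N, ∀ D₃ ∈ letterDer N, ∀ D₄ ∈ letterDer N,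
      Commute (f (TensorProduct.map D₁ D₂)) (g (TensorProduct.map D₃ D₄)))
    {X Y : Module.End ℂ (DHat N ⊗[ℂ] DHat N)} (hX : X ∈ letterSpan N) (hY : Y ∈ letterSpan N) :
    Commute (f X) (g Y) := by
  induction hX using Submodule.span_induction with
  | zero => rw [map_zero]; exact Commute.zero_left _
  | add x y _ _ hx hy => rw [map_add]; exact hx.add_left hy
  | smul c x _ hx => rw [map_smul]; exact hx.smul_left c
  | mem x hx =>
    obtain ⟨D₁, h1, D₂, h2, rfl⟩ := hx
    induction hY using Submodule.span_induction with
    | zero => rw [map_zero]; exact Commute.zero_right _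
    | add x y _ _ hx hy => rw [map_add]; exact hx.add_right hy
    | smul c x _ hx => rw [map_smul]; exact hx.smul_right c
    | mem y hy =>
      obtain ⟨D₃, h3, D₄, h4, rfl⟩ := hy
      exact h D₁ h1 D₂ h2 D₃ h3 D₄ h4

theorem contraction_commute (i j : ℕ) : Commute (contraction N i) (contraction N j) := by
  refine letterSpan_commute (AlgHom.id ℂ _) (AlgHom.id ℂ _) ?_ (contraction_mem i)
    (contraction_mem j)
  intro D₁ h1 D₂ h2 D₃ h3 D₄ h4
  change TensorProduct.map D₁ D₂ * TensorProduct.map D₃ D₄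
    = TensorProduct.map D₃ D₄ * TensorProduct.map D₁ D₂
  rw [← TensorProduct.map_mul, ← TensorProduct.map_mul, (letterDer_comm h1 h3).eq,
    (letterDer_comm h2 h4).eq]

theorem contraction_commute12_13 (i j : ℕ) :
    Commute (slot12 _ (contraction N i)) (slot13 _ (contraction N j)) := by
  refine letterSpan_commute _ _ ?_ (contraction_mem i) (contraction_mem j)
  intro D₁ h1 D₂ h2 D₃ h3 D₄ h4
  rw [slot12_map, slot13_map]
  refine TensorProduct.ext_threefold' ?_
  intro u v t
  have := LinearMap.congr_fun (letterDer_comm h1 h3).eq u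
  simp only [Module.End.mul_apply] at this
  simp only [Module.End.mul_apply, TensorProduct.map_tmul, LinearMap.id_apply, this]

theorem contraction_commute12_23 (i j : ℕ) :
    Commute (slot12 _ (contraction N i)) (slot23 _ (contraction N j)) := by
  refine letterSpan_commute _ _ ?_ (contraction_mem i) (contraction_mem j)
  intro D₁ h1 D₂ h2 D₃ h3 D₄ h4
  rw [slot12_map, slot23_map]
  refine TensorProduct.ext_threefold' ?_
  intro u v t
  have := LinearMap.congr_fun (letterDer_comm h2 h3).eq v
  simp only [Module.End.mul_apply] at this
  simp only [Module.End.mul_apply, TensorProduct.map_tmul, LinearMap.id_apply, this]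

theorem contraction_commute13_23 (i j : ℕ) :
    Commute (slot13 _ (contraction N i)) (slot23 _ (contraction N j)) := by
  refine letterSpan_commute _ _ ?_ (contraction_mem i) (contraction_mem j)
  intro D₁ h1 D₂ h2 D₃ h3 D₄ h4
  rw [slot13_map, slot23_map]
  refine TensorProduct.ext_threefold' ?_
  intro u v t
  have := LinearMap.congr_fun (letterDer_comm h2 h4).eq t
  simp only [Module.End.mul_apply] at this
  simp only [Module.End.mul_apply, TensorProduct.map_tmul, LinearMap.id_apply, this]

/-- In `D ⊗ D'` the second factor is a derivation, so a contraction with a product is the sum of the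
contractions with the factors. Exponentiated by `IsExpOf.intertwine`, this becomes the product of
`E₁₂` and `E₁₃`. -/
theorem letterSpan_mul_right {X : Module.End ℂ (DHat N ⊗[ℂ] DHat N)} (hX : X ∈ letterSpan N) :
    X ∘ₗ (LinearMap.mul' ℂ (DHat N)).lTensor (DHat N)
      = (LinearMap.mul' ℂ (DHat N)).lTensor (DHat N) ∘ₗ (slot12 _ X + slot13 _ X) := by
  induction hX using Submodule.span_induction with
  | zero => simp
  | add x y _ _ hx hy =>
    rw [LinearMap.add_comp, hx, hy, map_add, map_add, ← LinearMap.comp_add]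
    congr 1
    abel
  | smul c x _ hx => rw [LinearMap.smul_comp, hx, map_smul, map_smul, ← smul_add, LinearMap.comp_smul]
  | mem x hx =>
    obtain ⟨D, h, D', h', rfl⟩ := hx
    rw [slot12_map, slot13_map]
    refine TensorProduct.ext_threefold' ?_
    intro u v t
    change D u ⊗ₜ[ℂ] D' (v * t) = (LinearMap.mul' ℂ (DHat N)).lTensor (DHat N)
      (D u ⊗ₜ (D' v ⊗ₜ t) + D u ⊗ₜ (v ⊗ₜ D' t))
    rw [map_add, isDer_letterDer h', TensorProduct.tmul_add]
    rfl

theorem letterSpan_mul_left {X : Module.End ℂ (DHat N ⊗[ℂ] DHat N)} (hX : X ∈ letterSpan N) :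
    X ∘ₗ ((LinearMap.mul' ℂ (DHat N)).rTensor (DHat N)
        ∘ₗ (TensorProduct.assoc ℂ (DHat N) (DHat N) (DHat N)).symm.toLinearMap)
      = ((LinearMap.mul' ℂ (DHat N)).rTensor (DHat N)
        ∘ₗ (TensorProduct.assoc ℂ (DHat N) (DHat N) (DHat N)).symm.toLinearMap)
        ∘ₗ (slot13 _ X + slot23 _ X) := by
  induction hX using Submodule.span_induction with
  | zero => simp
  | add x y _ _ hx hy =>
    rw [LinearMap.add_comp, hx, hy, map_add, map_add, ← LinearMap.comp_add]
    congr 1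
    abel
  | smul c x _ hx => rw [LinearMap.smul_comp, hx, map_smul, map_smul, ← smul_add, LinearMap.comp_smul]
  | mem x hx =>
    obtain ⟨D, h, D', h', rfl⟩ := hx
    rw [slot13_map, slot23_map]
    refine TensorProduct.ext_threefold' ?_
    intro u v t
    change D (u * v) ⊗ₜ[ℂ] D' t = ((LinearMap.mul' ℂ (DHat N)).rTensor (DHat N)
        ∘ₗ (TensorProduct.assoc ℂ (DHat N) (DHat N) (DHat N)).symm.toLinearMap)
      (D u ⊗ₜ (v ⊗ₜ D' t) + u ⊗ₜ (D v ⊗ₜ D' t))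
    rw [map_add, isDer_letterDer h, TensorProduct.add_tmul]
    rfl

/-- Exchanging the factors interchanges the two families of terms of the contraction and replaces
`z` by `-z`; the signs agree because the modes satisfy `m + n = k` in degree `k + 1`. -/
theorem contraction_swap (k : ℕ) :
    contraction N k ∘ₗ (TensorProduct.comm ℂ (DHat N) (DHat N)).toLinearMap
      = (TensorProduct.comm ℂ (DHat N) (DHat N)).toLinearMap ∘ₗ
        ((-1 : ℂ) ^ k • contraction N k) := by
  cases k with
  | zero => simp [contraction]
  | succ k =>
    refine TensorProduct.ext' ?_
    intro u v
    change contraction N (k + 1) (v ⊗ₜ u) = (TensorProduct.comm ℂ (DHat N) (DHat N)).toLinearMap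
      (((-1 : ℂ) ^ (k + 1) • contraction N (k + 1)) (u ⊗ₜ v))
    simp only [contraction, LinearMap.smul_apply, LinearMap.sum_apply, map_smul, map_sum,
      LinearMap.sub_apply, map_sub, TensorProduct.map_tmul, LinearEquiv.coe_coe,
      TensorProduct.comm_tmul, Finset.smul_sum]
    refine Finset.sum_congr rfl fun i _ => Finset.sum_congr rfl fun mn hmn => ?_
    have h := Finset.HasAntidiagonal.mem_antidiagonal.1 hmn
    have h1 : (-1 : ℂ) ^ (k + 1) * (-1) ^ mn.1 = - (-1) ^ mn.2 := by
      rw [← h, pow_succ, pow_add]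
      have : (-1 : ℂ) ^ mn.1 * (-1) ^ mn.1 = 1 := by rw [← mul_pow]; simp
      linear_combination - (-1 : ℂ) ^ mn.2 * this
    have h2 : (-1 : ℂ) ^ (k + 1) * (-1) ^ mn.2 = - (-1) ^ mn.1 := by
      rw [← h, pow_succ, pow_add]
      have : (-1 : ℂ) ^ mn.2 * (-1) ^ mn.2 = 1 := by rw [← mul_pow]; simp
      linear_combination - (-1 : ℂ) ^ mn.1 * this
    have hk : k.choose mn.2 = k.choose mn.1 := by rw [← h, Nat.choose_symm_add]
    rw [smul_sub, smul_smul, smul_smul, ← mul_assoc, ← mul_assoc, h1, h2, hk]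
    module

/-- This is `[C(z), 1 ⊗ T] = -∂_z C(z)`. Commuting with `T` lowers the mode in the second factor,
and `(k + 1) binom(k, n) = (n + 1) binom(k + 1, n + 1)` reassembles the coefficients in degree `k +
1`. -/
theorem contraction_translation (k : ℕ) :
    contraction N (k + 1) * (translation N).lTensor (DHat N)
      = (translation N).lTensor (DHat N) * contraction N (k + 1) + (k : ℂ) • contraction N k := by
  have hB : ∀ i n, ∀ v : DHat N, derB i n (translation N v)
      = translation N (derB i n v) + (n : ℂ) • derB i (n - 1) v := fun i n v =>
    LinearMap.congr_fun (derB_translation i n) v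
  have hA : ∀ i n, ∀ v : DHat N, derA i n (translation N v)
      = translation N (derA i n v) + (n : ℂ) • derA i (n - 1) v := fun i n v =>
    LinearMap.congr_fun (derA_translation i n) v
  refine TensorProduct.ext' ?_
  intro u v
  change contraction N (k + 1) (u ⊗ₜ translation N v)
    = (translation N).lTensor (DHat N) (contraction N (k + 1) (u ⊗ₜ v))
      + (k : ℂ) • contraction N k (u ⊗ₜ v)
  have h1 : contraction N (k + 1) (u ⊗ₜ translation N v)
      - (translation N).lTensor (DHat N) (contraction N (k + 1) (u ⊗ₜ v))
      = ∑ i : Fin N, ((∑ mn ∈ Finset.HasAntidiagonal.antidiagonal k,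
      ((-1 : ℂ) ^ mn.1 * (k.choose mn.1 : ℂ)) • ((mn.2 : ℂ) • (derA i mn.1 u ⊗ₜ[ℂ] derB i (mn.2 - 1) v)))
      - ∑ mn ∈ Finset.HasAntidiagonal.antidiagonal k,
        ((-1 : ℂ) ^ mn.2 * (k.choose mn.1 : ℂ)) •
          ((mn.1 : ℂ) • (derB i mn.2 u ⊗ₜ[ℂ] derA i (mn.1 - 1) v))) := by
    simp only [contraction, LinearMap.sum_apply, map_smul, map_sum,
      LinearMap.sub_apply, map_sub, TensorProduct.map_tmul, LinearMap.smul_apply,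
      LinearMap.lTensor_tmul, hA, hB, ← Finset.sum_sub_distrib, TensorProduct.tmul_add,
      TensorProduct.tmul_smul, smul_add]
    refine Finset.sum_congr rfl fun i _ => Finset.sum_congr rfl fun mn hmn => ?_
    have h := Finset.HasAntidiagonal.mem_antidiagonal.1 hmn
    have e : k.choose mn.2 = k.choose mn.1 := by
      rw [← h, Nat.choose_symm_add]
    try rw [e]
    module
  rw [← sub_eq_iff_eq_add', h1]
  cases k with
  | zero => simp
  | succ k =>
    have h2 : ∀ i : Fin N, ∑ mn ∈ Finset.HasAntidiagonal.antidiagonal (k + 1),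
        ((-1 : ℂ) ^ mn.1 * ((k + 1).choose mn.1 : ℂ)) •
          ((mn.2 : ℂ) • (derA i mn.1 u ⊗ₜ[ℂ] derB i (mn.2 - 1) v))
        = ((k + 1 : ℕ) : ℂ) • ∑ mn ∈ Finset.HasAntidiagonal.antidiagonal k,
          ((-1 : ℂ) ^ mn.1 * (k.choose mn.1 : ℂ)) • (derA i mn.1 u ⊗ₜ[ℂ] derB i mn.2 v) := by
      intro i
      rw [Finset.Nat.sum_antidiagonal_succ']
      simp only [Nat.cast_zero, zero_smul, smul_zero, zero_add, add_tsub_cancel_right,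
        Finset.smul_sum, smul_smul]
      refine Finset.sum_congr rfl fun mn hmn => ?_
      have h := Finset.HasAntidiagonal.mem_antidiagonal.1 hmn
      congr 1
      have h3 := Nat.add_one_mul_choose_eq k mn.2
      have h4 : ((k + 1 : ℕ) : ℂ) * (k.choose mn.2 : ℂ)
          = ((k + 1).choose (mn.2 + 1) : ℂ) * ((mn.2 + 1 : ℕ) : ℂ) := by exact_mod_cast h3
      have e1 : k.choose mn.2 = k.choose mn.1 := by rw [← h, Nat.choose_symm_add]
      have e2 : (k + 1).choose (mn.2 + 1) = (k + 1).choose mn.1 := by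
        rw [← h, add_assoc, Nat.choose_symm_add]
      rw [e1, e2] at h4
      linear_combination - (-1 : ℂ) ^ mn.1 * h4
    have h2' : ∀ i : Fin N, ∑ mn ∈ Finset.HasAntidiagonal.antidiagonal (k + 1),
        ((-1 : ℂ) ^ mn.2 * ((k + 1).choose mn.1 : ℂ)) •
          ((mn.1 : ℂ) • (derB i mn.2 u ⊗ₜ[ℂ] derA i (mn.1 - 1) v))
        = ((k + 1 : ℕ) : ℂ) • ∑ mn ∈ Finset.HasAntidiagonal.antidiagonal k,
          ((-1 : ℂ) ^ mn.2 * (k.choose mn.1 : ℂ)) • (derB i mn.2 u ⊗ₜ[ℂ] derA i mn.1 v) := by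
      intro i
      rw [Finset.Nat.sum_antidiagonal_succ]
      simp only [Nat.cast_zero, zero_smul, smul_zero, zero_add, add_tsub_cancel_right,
        Finset.smul_sum, smul_smul]
      refine Finset.sum_congr rfl fun mn hmn => ?_
      congr 1
      have h3 := Nat.add_one_mul_choose_eq k mn.1
      have h4 : ((k + 1 : ℕ) : ℂ) * (k.choose mn.1 : ℂ)
          = ((k + 1).choose (mn.1 + 1) : ℂ) * ((mn.1 + 1 : ℕ) : ℂ) := by exact_mod_cast h3
      linear_combination - (-1 : ℂ) ^ mn.2 * h4
    simp only [h2, h2', ← smul_sub, contraction, LinearMap.sum_apply, LinearMap.sub_apply,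
      LinearMap.smul_apply, TensorProduct.map_tmul, Finset.smul_sum, ← Finset.sum_sub_distrib]
    refine Finset.sum_congr rfl fun i _ => Finset.sum_congr rfl fun mn hmn => ?_
    have h := Finset.HasAntidiagonal.mem_antidiagonal.1 hmn
    have e : k.choose mn.2 = k.choose mn.1 := by rw [← h, Nat.choose_symm_add]
    try rw [e]

theorem isExpOf_expContraction : IsExpOf (contraction N) (expContraction N) :=
  isExpOf_series _ rfl contraction_commute

theorem isExpOf_swap {V : Type*} [AddCommGroup V] [Module ℂ V] {c e : ℕ → Module.End ℂ V}
    (h : IsExpOf c e) : IsExpOf (fun k => (-1 : ℂ) ^ k • c k) (fun k => (-1 : ℂ) ^ k • e k) := by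
  refine ⟨by simp [h.1], fun k => ?_⟩
  rw [smul_comm, h.2, Finset.smul_sum]
  refine Finset.sum_congr rfl fun ij hij => ?_
  rw [smul_comm, smul_mul_smul_comm, ← pow_add, Finset.HasAntidiagonal.mem_antidiagonal.1 hij]

/-- Commuting `t` through the recursion for `(k + 1) e_{k+1}` gives terms from `c` and, by
induction, terms from lower `e`. Their coefficients `i` and `j` with `i + j = k` add up to the
factor `k`. -/
theorem IsExpOf.commutator {V : Type*} [AddCommGroup V] [Module ℂ V] {c e : ℕ → Module.End ℂ V}
    (h : IsExpOf c e) (t : Module.End ℂ V)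
    (ht : ∀ k, c (k + 1) * t = t * c (k + 1) + (k : ℂ) • c k) (k : ℕ) :
    e (k + 1) * t = t * e (k + 1) + (k : ℂ) • e k := by
  induction k using Nat.strong_induction_on with
  | _ k ih =>
    have hk : ((k + 1 : ℕ) : ℂ) ≠ 0 := by exact_mod_cast Nat.succ_ne_zero k
    refine smul_right_injective _ hk ?_
    change ((k + 1 : ℕ) : ℂ) • (e (k + 1) * t) = ((k + 1 : ℕ) : ℂ) • (t * e (k + 1) + (k : ℂ) • e k)
    -- The induction hypothesis concerns positive indices; at `j = 0`, where `e 0 = 1`, the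
    -- correction is set to zero.
    have h2 : ∀ j, j ≤ k → e j * t = t * e j + ((j - 1 : ℕ) : ℂ) • (if j = 0 then 0 else e (j - 1)) := by
      intro j hj
      cases j with
      | zero => simp [h.1]
      | succ j => simpa using ih j (by omega)
    have h3 : ∀ ij ∈ Finset.HasAntidiagonal.antidiagonal k,
        ((ij.1 + 1 : ℕ) : ℂ) • (c (ij.1 + 1) * e ij.2) * t
        = ((ij.1 + 1 : ℕ) : ℂ) • (t * (c (ij.1 + 1) * e ij.2))
          + (((ij.1 + 1 : ℕ) : ℂ) * (ij.1 : ℂ)) • (c ij.1 * e ij.2)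
          + (((ij.1 + 1 : ℕ) : ℂ) * ((ij.2 - 1 : ℕ) : ℂ)) •
            (c (ij.1 + 1) * if ij.2 = 0 then 0 else e (ij.2 - 1)) := by
      intro ij hij
      have := Finset.HasAntidiagonal.mem_antidiagonal.1 hij
      rw [smul_mul_assoc, mul_assoc, h2 ij.2 (by omega), mul_add, ← mul_assoc, ht, add_mul,
        mul_smul_comm, smul_mul_assoc, mul_assoc]
      module
    have h4 : ∑ ij ∈ Finset.HasAntidiagonal.antidiagonal k,
        (((ij.1 + 1 : ℕ) : ℂ) * ((ij.2 - 1 : ℕ) : ℂ)) •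
            (c (ij.1 + 1) * if ij.2 = 0 then 0 else e (ij.2 - 1))
        = ∑ ij ∈ Finset.HasAntidiagonal.antidiagonal k,
          ((ij.1 : ℂ) * (ij.2 : ℂ)) • (c ij.1 * e ij.2) := by
      cases k with
      | zero => simp
      | succ k =>
        rw [Finset.Nat.sum_antidiagonal_succ', Finset.Nat.sum_antidiagonal_succ]
        simp
    rw [← smul_mul_assoc, h.2, Finset.Nat.sum_antidiagonal_succ, smul_add, smul_smul]
    have h5 : ((k + 1 : ℕ) : ℂ) • (t * e (k + 1)) = t * ∑ ij ∈ Finset.HasAntidiagonal.antidiagonal k,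
        ((ij.1 + 1 : ℕ) : ℂ) • (c (ij.1 + 1) * e ij.2) := by
      rw [← mul_smul_comm, h.2, Finset.Nat.sum_antidiagonal_succ]
      simp
    rw [h5, mul_comm ((k + 1 : ℕ) : ℂ), ← smul_smul, smul_comm, h.2 k]
    simp only [Nat.cast_zero, zero_smul, zero_add]
    rw [Finset.sum_mul, Finset.sum_congr rfl h3, Finset.sum_add_distrib, Finset.sum_add_distrib, h4,
      Finset.mul_sum, add_assoc, ← Finset.sum_add_distrib, Finset.smul_sum]
    congr 1
    · refine Finset.sum_congr rfl fun ij _ => ?_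
      rw [mul_smul_comm]
    · refine Finset.sum_congr rfl fun ij hij => ?_
      rw [← Finset.HasAntidiagonal.mem_antidiagonal.1 hij]
      push_cast
      module

/-- The algebra of states with its translation operator and its contraction operator. -/
def stateData (N : ℕ) : WickData (DHat N) where
  T := translation N
  E := expContraction N
  T_mul := isDer_translation
  E_zero := isExpOf_expContraction.1
  E_mul_right k := by
    refine isExpOf_expContraction.intertwine
      ((isExpOf_expContraction.map (slot12 _)).mul (isExpOf_expContraction.map (slot13 _))
        contraction_commute12_13) _ (fun k => letterSpan_mul_right (contraction_mem k)) k
  E_mul_left k := by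
    refine isExpOf_expContraction.intertwine
      ((isExpOf_expContraction.map (slot13 _)).mul (isExpOf_expContraction.map (slot23 _))
        contraction_commute13_23) _ (fun k => letterSpan_mul_left (contraction_mem k)) k
  E_T k := isExpOf_expContraction.commutator _ contraction_translation k
  E_swap k := by
    have := (isExpOf_expContraction (N := N)).intertwine
      (isExpOf_swap isExpOf_expContraction) _
      contraction_swap k
    rw [LinearMap.comp_smul] at this
    exact this
  comm12_13 i j := ((isExpOf_expContraction.map (slot13 _)).commute (fun k =>
    (((isExpOf_expContraction.map (slot12 _)).commute (fun l =>
      (contraction_commute12_13 l k).symm) i).symm)) j)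
  comm12_23 i j := ((isExpOf_expContraction.map (slot23 _)).commute (fun k =>
    (((isExpOf_expContraction.map (slot12 _)).commute (fun l =>
      (contraction_commute12_23 l k).symm) i).symm)) j)
  comm13_23 i j := ((isExpOf_expContraction.map (slot23 _)).commute (fun k =>
    (((isExpOf_expContraction.map (slot13 _)).commute (fun l =>
      (contraction_commute13_23 l k).symm) i).symm)) j)
  E_fin := expContraction_eventually_zero

/-- A pair `(k, l)` in the defining sum is determined by `k`. Those `k` for which `l = k - n - 1`
would be negative occur only on the right, where `norm` vanishes. -/
theorem nProd_eq_sum (n : ℤ) (u v : DHat N) {K : ℕ}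
    (hK : ∀ k, K ≤ k → expContraction N k (u ⊗ₜ v) = 0) :
    nProd n u v = ∑ k ∈ Finset.range K,
      (stateData N).norm (k - n - 1) (expContraction N k (u ⊗ₜ v)) := by
  classical
  let g : {kl : ℕ × ℕ // (kl.2 : ℤ) - kl.1 = - n - 1} → DHat N := fun kl =>
    LinearMap.mul' ℂ (DHat N)
      (TensorProduct.map ((kl.1.2.factorial : ℂ)⁻¹ • translation N ^ kl.1.2) LinearMap.id
        (expContraction N kl.1.1 (u ⊗ₜ v)))
  have hg : ∀ kl, g kl = (stateData N).norm (kl.1.1 - n - 1) (expContraction N kl.1.1 (u ⊗ₜ v)) := by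
    rintro ⟨⟨k, l⟩, h⟩
    have e : (k : ℤ) - n - 1 = l := by simp only at h; omega
    simp only [g]
    rw [e, WickData.norm, divPow_natCast]
    rfl
  have hinj : Function.Injective (fun kl : {kl : ℕ × ℕ // (kl.2 : ℤ) - kl.1 = - n - 1} => kl.1.1) := by
    rintro ⟨⟨k, l⟩, h⟩ ⟨⟨k', l'⟩, h'⟩ he
    simp only at he h h'
    subst he
    have : l = l' := by omega
    subst this
    rfl
  change ∑ᶠ kl, g kl = _
  rw [finsum_congr hg, ← finsum_mem_range (f := fun k : ℕ =>
    (stateData N).norm (k - n - 1) (expContraction N k (u ⊗ₜ v))) hinj]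
  rw [finsum_mem_def]
  refine (finsum_congr fun k => ?_).trans ((stateData N).prodT_eq_sum n (t := u ⊗ₜ v) hK)
  by_cases h : k ∈ Set.range
    fun kl : {kl : ℕ × ℕ // (kl.2 : ℤ) - kl.1 = - n - 1} => kl.1.1
  · rw [Set.indicator_of_mem h]
    rfl
  · rw [Set.indicator_of_notMem h, WickData.norm_neg, LinearMap.zero_apply]
    by_contra hk
    exact h ⟨⟨(k, ((k : ℤ) - n - 1).toNat), by simp only; omega⟩, rfl⟩

theorem nProd_eq (n : ℤ) (u v : DHat N) : nProd n u v = (stateData N).prod n u v := by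
  obtain ⟨K, hK⟩ := expContraction_eventually_zero (u ⊗ₜ[ℂ] v)
  rw [nProd_eq_sum n u v hK]
  exact ((stateData N).prodT_eq_sum n hK).symm

end

/-! ### Modes of the generators and products of low weight -/

section

variable {N : ℕ}

/-! ### The `n`-th products of the algebra of states -/

/-- The `n`-th product as a bilinear map. -/
def nProdHom (N : ℕ) (n : ℤ) : DHat N →ₗ[ℂ] DHat N →ₗ[ℂ] DHat N := (stateData N).prodHom n

theorem nProdHom_apply (n : ℤ) (u v : DHat N) : nProdHom N n u v = nProd n u v :=
  (nProd_eq n u v).symm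

theorem nProd_add_left (n : ℤ) (u u' v : DHat N) :
    nProd n (u + u') v = nProd n u v + nProd n u' v := by
  simp only [← nProdHom_apply, map_add, LinearMap.add_apply]

theorem nProd_add_right (n : ℤ) (u v v' : DHat N) :
    nProd n u (v + v') = nProd n u v + nProd n u v' := by
  simp only [← nProdHom_apply, map_add]

theorem nProd_smul_left (n : ℤ) (c : ℂ) (u v : DHat N) :
    nProd n (c • u) v = c • nProd n u v := by
  simp only [← nProdHom_apply, map_smul, LinearMap.smul_apply]

theorem nProd_zero_left (n : ℤ) (v : DHat N) : nProd n 0 v = 0 := by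
  simp only [← nProdHom_apply, map_zero, LinearMap.zero_apply]

/-- With at most a simple pole in the expansion of `u` and `v`, only the term `i = 0` of Borcherds'
formula survives. The generators satisfy this hypothesis. -/
theorem nProd_commutator (u v t : DHat N) (m n : ℤ) (h : ∀ i : ℕ, 1 ≤ i → nProd i u v = 0) :
    nProd m u (nProd n v t) - nProd n v (nProd m u t) = nProd (m + n) (nProd 0 u v) t := by
  simp only [nProd_eq] at *
  have := (stateData N).commutator u v t m n (I := 1) h
  simpa using this

theorem nProd_comm (u v t : DHat N) (m n : ℤ) (h : ∀ i : ℕ, nProd i u v = 0) :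
    nProd m u (nProd n v t) = nProd n v (nProd m u t) := by
  have h1 := nProd_commutator u v t m n fun i _ => h i
  have h2 : nProd 0 u v = 0 := by simpa using h 0
  rw [h2, nProd_zero_left] at h1
  exact sub_eq_zero.1 h1

theorem nProd_normal_order (u v t : DHat N) (n : ℤ) :
    ∃ I₀ : ℕ, ∀ I, I₀ ≤ I → nProd n (nProd (-1) u v) t
      = ∑ i ∈ Finset.range I, (nProd (-1 - i) u (nProd (n + i) v t)
        + nProd (n - 1 - i) v (nProd i u t)) := by
  simp only [nProd_eq]
  exact (stateData N).normal_order u v t n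

/-- The divided powers of the translation operator. -/
abbrev tpow (N : ℕ) (p : ℤ) : Module.End ℂ (DHat N) := divPow (translation N) p

theorem norm_eq (p : ℤ) (u v : DHat N) : (stateData N).norm p (u ⊗ₜ v) = tpow N p u * v := rfl

theorem tpow_one_apply (u : DHat N) : tpow N 1 u = translation N u := by
  have := divPow_natCast (translation N) 1
  simp only [Nat.cast_one, Nat.factorial_one, inv_one, pow_one, one_smul] at this
  rw [tpow, this]

theorem tpow_zero_apply (u : DHat N) : tpow N 0 u = u := by
  rw [tpow, divPow_zero]
  rfl

theorem tpow_one {p : ℤ} (hp : p ≠ 0) : tpow N p (1 : DHat N) = 0 := by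
  rcases lt_or_ge p 0 with h | h
  · rw [tpow, divPow_neg _ h, LinearMap.zero_apply]
  · lift p to ℕ using h
    obtain ⟨q, rfl⟩ := Nat.exists_eq_succ_of_ne_zero (n := p) (by simpa using hp)
    rw [tpow, divPow_natCast, LinearMap.smul_apply, pow_succ, Module.End.mul_apply,
      isDer_translation.map_one, map_zero, smul_zero]

theorem isExpOf_expContraction_apply (k : ℕ) (t : DHat N ⊗[ℂ] DHat N) :
    (k : ℂ) • expContraction N k t = ∑ ij ∈ Finset.HasAntidiagonal.antidiagonal k,
      (ij.1 : ℂ) • contraction N ij.1 (expContraction N ij.2 t) := by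
  have := LinearMap.congr_fun ((isExpOf_expContraction (N := N)).2 k) t
  rw [LinearMap.smul_apply, LinearMap.sum_apply] at this
  exact this

theorem contraction_one_tmul (k : ℕ) (y : DHat N) : contraction N k ((1 : DHat N) ⊗ₜ y) = 0 := by
  cases k with
  | zero => rfl
  | succ k =>
    simp only [contraction, LinearMap.sum_apply, LinearMap.sub_apply, LinearMap.smul_apply,
      TensorProduct.map_tmul, (isDer_derA _ _).map_one, (isDer_derB _ _).map_one,
      TensorProduct.zero_tmul, smul_zero, sub_zero, Finset.sum_const_zero]

/-- The `n`-th products by an element all of whose contractions are scalar in the first factor. -/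
theorem nProd_of_contraction {u v : DHat N} (y : ℕ → DHat N)
    (h : ∀ k, contraction N (k + 1) (u ⊗ₜ v) = (1 : DHat N) ⊗ₜ y k) (n : ℤ) :
    nProd n u v = tpow N (-n - 1) u * v + if 0 ≤ n then y n.toNat else 0 := by
  -- After one contraction the first factor is `1`, which admits no further contraction. So in
  -- positive degrees the exponential coincides with its linear term.
  have hE : ∀ k, expContraction N (k + 1) (u ⊗ₜ v) = (1 : DHat N) ⊗ₜ y k := by
    intro k
    induction k using Nat.strong_induction_on with
    | _ k ih =>
      have hk : ((k + 1 : ℕ) : ℂ) ≠ 0 := by exact_mod_cast Nat.succ_ne_zero k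
      refine smul_right_injective _ hk ?_
      change ((k + 1 : ℕ) : ℂ) • expContraction N (k + 1) (u ⊗ₜ v) = ((k + 1 : ℕ) : ℂ) • _
      rw [isExpOf_expContraction_apply, Finset.Nat.sum_antidiagonal_succ',
        (isExpOf_expContraction (N := N)).1, Module.End.one_apply, h, add_eq_left]
      refine Finset.sum_eq_zero fun ij hij => ?_
      rcases Nat.eq_zero_or_pos ij.1 with h0 | h0
      · rw [h0, Nat.cast_zero, zero_smul]
      · have := Finset.HasAntidiagonal.mem_antidiagonal.1 hij
        simp only
        rw [ih ij.2 (by omega), contraction_one_tmul, smul_zero]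
  obtain ⟨K, hK⟩ := expContraction_eventually_zero (u ⊗ₜ[ℂ] v)
  rw [nProd_eq_sum n u v (K := max K n.toNat + 1 + 1)
    fun k hk => hK k (by have := le_max_left K n.toNat; omega), Finset.sum_range_succ',
    (isExpOf_expContraction (N := N)).1, Module.End.one_apply, norm_eq, add_comm]
  congr 1
  · congr 2
    push_cast
    ring_nf
  · simp only [hE, norm_eq]
    split_ifs with hn
    · rw [Finset.sum_eq_single n.toNat]
      · have : ((n.toNat + 1 : ℕ) : ℤ) - n - 1 = 0 := by omega
        rw [this, tpow_zero_apply, one_mul]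
      · intro k _ hk
        rw [tpow_one (by omega), zero_mul]
      · intro hk
        rw [Finset.mem_range] at hk
        have := le_max_right K n.toNat
        omega
    · refine Finset.sum_eq_zero fun k _ => ?_
      rw [tpow_one (by omega), zero_mul]

theorem nProd_of_contraction_zero {u v : DHat N}
    (h : ∀ k, contraction N (k + 1) (u ⊗ₜ v) = 0) (n : ℤ) :
    nProd n u v = tpow N (-n - 1) u * v := by
  have := nProd_of_contraction (u := u) (v := v) (fun _ => 0)
    (fun k => by rw [h, TensorProduct.tmul_zero]) n
  simpa using this

theorem contraction_tmul_succ (k : ℕ) (u v : DHat N) :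
    contraction N (k + 1) (u ⊗ₜ v) = ∑ i : Fin N, ∑ mn ∈ Finset.HasAntidiagonal.antidiagonal k,
      (((-1 : ℂ) ^ mn.1 * (k.choose mn.1 : ℂ)) • (derA i mn.1 u ⊗ₜ[ℂ] derB i mn.2 v)
        - ((-1 : ℂ) ^ mn.2 * (k.choose mn.2 : ℂ)) • (derB i mn.2 u ⊗ₜ[ℂ] derA i mn.1 v)) := by
  simp only [contraction, LinearMap.sum_apply, LinearMap.sub_apply, LinearMap.smul_apply,
    TensorProduct.map_tmul]

theorem nProd_one_right (n : ℤ) (u : DHat N) : nProd n u 1 = tpow N (-n - 1) u := by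
  rw [nProd_of_contraction_zero, mul_one]
  intro k
  rw [contraction_tmul_succ]
  simp only [(isDer_derA _ _).map_one, (isDer_derB _ _).map_one, TensorProduct.tmul_zero,
    smul_zero, sub_zero, Finset.sum_const_zero]

theorem nProd_a (i : Fin N) (n : ℤ) (v : DHat N) :
    nProd n (MvPolynomial.X (Letter.a i 0)) v = tpow N (-n - 1) (MvPolynomial.X (Letter.a i 0)) * v
      + if 0 ≤ n then derB i n.toNat v else 0 := by
  classical
  refine nProd_of_contraction (fun n => derB i n v) (fun k => ?_) n
  rw [contraction_tmul_succ, Finset.sum_eq_single i]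
  · rw [Finset.sum_eq_single (0, k)]
    · cases k with
      | zero => simp [derA_X, derB_zero_X]
      | succ k => simp [derA_X, derB_succ_X]
    · rintro ⟨m, n⟩ h hne
      have := Finset.HasAntidiagonal.mem_antidiagonal.1 h
      have hm : m ≠ 0 := by
        rintro rfl
        exact hne (by simp at this; rw [this])
      have hB : derB i n (MvPolynomial.X (Letter.a i 0) : DHat N) = 0 := by
        cases n with
        | zero => rw [derB_zero_X]
        | succ n => rw [derB_succ_X, if_neg (by simp)]
      simp only
      rw [hB, derA_X, if_neg (by simpa using hm.symm)]
      simp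
    · intro h
      exact absurd (Finset.HasAntidiagonal.mem_antidiagonal.2 (by simp)) h
  · intro j _ hj
    refine Finset.sum_eq_zero fun mn _ => ?_
    have hB : derB j mn.2 (MvPolynomial.X (Letter.a i 0) : DHat N) = 0 := by
      rcases mn.2 with _ | n
      · rw [derB_zero_X]
      · rw [derB_succ_X, if_neg (by simp)]
    rw [hB, derA_X, if_neg (by simp [hj.symm])]
    simp
  · intro h
    exact absurd (Finset.mem_univ _) h

theorem nProd_b (i : Fin N) (n : ℤ) (v : DHat N) :
    nProd n (ofFun (OHat.coord i)) v = tpow N (-n - 1) (ofFun (OHat.coord i)) * v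
      + if 0 ≤ n then - derA i n.toNat v else 0 := by
  refine nProd_of_contraction (fun n => - derA i n v) (fun k => ?_) n
  have hA : ∀ j m, derA j m (ofFun (OHat.coord i) : DHat N) = 0 := fun j m => derA_C _ _ _
  have hB : ∀ j n, derB j n (ofFun (OHat.coord i) : DHat N) = if j = i ∧ n = 0 then 1 else 0 := by
    intro j n
    cases n with
    | zero =>
      rw [ofFun, derB_zero_C, OHat.pd_coord]
      by_cases h : j = i <;> simp [h]
    | succ n => rw [ofFun, derB_succ_C, if_neg (by simp)]
  rw [contraction_tmul_succ, Finset.sum_eq_single i]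
  · rw [Finset.sum_eq_single (k, 0)]
    · simp [hA, hB, TensorProduct.tmul_neg]
    · rintro ⟨m, n⟩ h hne
      have := Finset.HasAntidiagonal.mem_antidiagonal.1 h
      have hn : n ≠ 0 := by
        rintro rfl
        exact hne (by simp at this; rw [this])
      simp [hA, hB, hn]
    · intro h
      exact absurd (Finset.HasAntidiagonal.mem_antidiagonal.2 (by simp)) h
  · intro j _ hj
    refine Finset.sum_eq_zero fun mn _ => ?_
    simp [hA, hB, hj]
  · intro h
    exact absurd (Finset.mem_univ _) h

theorem tpow_succ_apply (p : ℕ) (u w : DHat N)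
    (h : translation N (tpow N p u) = ((p + 1 : ℕ) : ℂ) • w) : tpow N ((p + 1 : ℕ) : ℤ) u = w := by
  have h1 := LinearMap.congr_fun (mul_divPow (translation N) p) u
  rw [Module.End.mul_apply, LinearMap.smul_apply] at h1
  have hk : ((p + 1 : ℕ) : ℂ) ≠ 0 := by exact_mod_cast Nat.succ_ne_zero p
  refine smul_right_injective _ hk ?_
  change ((p + 1 : ℕ) : ℂ) • _ = ((p + 1 : ℕ) : ℂ) • w
  rw [← h, tpow, h1]
  push_cast
  rfl

theorem tpow_a (i : Fin N) (m : ℕ) :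
    tpow N m (MvPolynomial.X (Letter.a i 0)) = MvPolynomial.X (Letter.a i m) := by
  induction m with
  | zero => exact tpow_zero_apply _
  | succ m ih =>
    refine tpow_succ_apply m _ _ ?_
    rw [ih, translation_X, translationLetter, Nat.cast_smul_eq_nsmul]

theorem translation_ofFun (f : OHat N) :
    translation N (ofFun f) = ofOneForm fun k => OHat.pd k f := by
  rw [ofFun, translation_C, ofOneForm]
  exact Finset.sum_congr rfl fun i _ => mul_comm _ _

theorem tpow_b (i : Fin N) (n : ℕ) :
    tpow N ((n + 1 : ℕ) : ℤ) (ofFun (OHat.coord i)) = MvPolynomial.X (Letter.b i n) := by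
  induction n with
  | zero =>
    refine tpow_succ_apply 0 _ _ ?_
    rw [Nat.cast_zero, tpow_zero_apply, translation_ofFun, ofOneForm]
    simp [OHat.pd_coord]
  | succ n ih =>
    refine tpow_succ_apply (n + 1) _ _ ?_
    rw [ih, translation_X, translationLetter, Nat.cast_smul_eq_nsmul]

/-- Multiplication by a letter is a negative mode of a generator. With `b_mul` this turns induction
over polynomials into induction over products, so that maps preserving products can be studied
letter by letter. -/
theorem a_mul (i : Fin N) (m : ℕ) (v : DHat N) :
    MvPolynomial.X (Letter.a i m) * v = nProd (-m - 1) (MvPolynomial.X (Letter.a i 0)) v := by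
  rw [nProd_a, if_neg (by omega), add_zero, ← tpow_a i m]
  congr 2
  ring_nf

theorem b_mul (i : Fin N) (n : ℕ) (v : DHat N) :
    MvPolynomial.X (Letter.b i n) * v = nProd (-n - 2) (ofFun (OHat.coord i)) v := by
  rw [nProd_b, if_neg (by omega), add_zero, ← tpow_b i n]
  congr 2
  push_cast
  ring_nf

/-! ### Products of elements of low weight -/

theorem expContraction_eq_zero {d k : ℕ} {t : DHat N ⊗[ℂ] DHat N}
    (ht : t ∈ tensorWeightSpace N d) (hk : d < k) : expContraction N k t = 0 := by
  rw [expContraction, LinearMap.sum_apply]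
  refine Finset.sum_eq_zero fun n _ => ?_
  rw [LinearMap.smul_apply, eq_zero_of_tensorWeight_neg (d := d - k) (by omega)
    (coeff_pow_weight n k ht), smul_zero]

theorem ofFun_mem (f : OHat N) : ofFun f ∈ weightSpace N 0 := by
  classical
  intro s hs
  rw [ofFun, MvPolynomial.coeff_C] at hs
  split_ifs at hs with h
  · rw [← h]; simp [monWeight]
  · exact absurd rfl hs

theorem C_mul_X_mem (f : OHat N) (x : Letter N) (hx : monWeight (Finsupp.single x 1) = 1) :
    MvPolynomial.C f * MvPolynomial.X x ∈ weightSpace N 1 := by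
  classical
  intro s hs
  rw [MvPolynomial.coeff_C_mul, MvPolynomial.coeff_X] at hs
  split_ifs at hs with h
  · rw [← h, hx]; rfl
  · exact absurd (mul_zero _) hs

theorem ofOneForm_mem (ω : OneForm N) : ofOneForm ω ∈ weightSpace N 1 :=
  Submodule.sum_mem _ fun i _ => C_mul_X_mem _ _ (by simp [monWeight])

theorem ofVectorField_mem (τ : Fin N → OHat N) : ofVectorField τ ∈ weightSpace N 1 :=
  Submodule.sum_mem _ fun i _ => C_mul_X_mem _ _ (by simp [monWeight])

/-- A contraction in degree `k` lowers the total weight by `k`, so in total weight at most two only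
`E₀ = 1`, `E₁ = C₁` and `E₂ = C₂ + C₁²/2` can contribute. -/
theorem nProd_low {p q : ℕ} {u v : DHat N} (hu : u ∈ weightSpace N p) (hv : v ∈ weightSpace N q)
    (h : p + q ≤ 2) (n : ℤ) :
    nProd n u v = tpow N (-n - 1) u * v + (stateData N).norm (-n) (contraction N 1 (u ⊗ₜ v))
      + (stateData N).norm (1 - n) (contraction N 2 (u ⊗ₜ v)
        + (1 / 2 : ℂ) • contraction N 1 (contraction N 1 (u ⊗ₜ v))) := by
  have ht : u ⊗ₜ[ℂ] v ∈ tensorWeightSpace N ((p + q : ℕ) : ℤ) :=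
    Submodule.subset_span ⟨p, q, u, v, by push_cast; rfl, hu, hv, rfl⟩
  have h0 : expContraction N 0 (u ⊗ₜ v) = u ⊗ₜ v := by
    rw [(isExpOf_expContraction (N := N)).1]; rfl
  have h1 : expContraction N 1 (u ⊗ₜ v) = contraction N 1 (u ⊗ₜ v) := by
    have := isExpOf_expContraction_apply 1 (u ⊗ₜ[ℂ] v)
    rw [Finset.Nat.sum_antidiagonal_succ] at this
    simpa [h0] using this
  have h2 : expContraction N 2 (u ⊗ₜ v) = contraction N 2 (u ⊗ₜ v)
        + (1 / 2 : ℂ) • contraction N 1 (contraction N 1 (u ⊗ₜ v)) := by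
    have := isExpOf_expContraction_apply 2 (u ⊗ₜ[ℂ] v)
    rw [Finset.Nat.sum_antidiagonal_succ, Finset.Nat.sum_antidiagonal_succ] at this
    simp only [Nat.cast_zero, zero_smul, zero_add, Finset.Nat.antidiagonal_zero,
      Finset.sum_singleton, h0, h1, Nat.cast_one, one_smul] at this
    refine smul_right_injective _ (two_ne_zero (α := ℂ)) ?_
    change (2 : ℂ) • _ = (2 : ℂ) • _
    rw [show ((2 : ℕ) : ℂ) = 2 by norm_num] at this
    rw [this, smul_add, smul_smul, add_comm]
    norm_num
  rw [nProd_eq_sum n u v (K := 3) fun k hk => expContraction_eq_zero ht (by omega),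
    Finset.sum_range_succ, Finset.sum_range_succ, Finset.sum_range_one, h0, h1, h2, norm_eq]
  rw [show ((0 : ℕ) : ℤ) - n - 1 = -n - 1 by simp, show ((1 : ℕ) : ℤ) - n - 1 = -n by simp,
    show ((2 : ℕ) : ℤ) - n - 1 = 1 - n by push_cast; ring]

theorem nProd_low_eq_zero {p q : ℕ} {u v : DHat N} (hu : u ∈ weightSpace N p)
    (hv : v ∈ weightSpace N q) (h : p + q ≤ 2) {n : ℤ} (hn : 2 ≤ n) : nProd n u v = 0 := by
  rw [nProd_low hu hv h, tpow, divPow_neg _ (by omega), WickData.norm_neg _ (by omega),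
    WickData.norm_neg _ (by omega)]
  simp

theorem contraction_one (u v : DHat N) : contraction N 1 (u ⊗ₜ v)
    = ∑ i : Fin N, (derA i 0 u ⊗ₜ[ℂ] derB i 0 v - derB i 0 u ⊗ₜ[ℂ] derA i 0 v) := by
  rw [contraction_tmul_succ]
  simp

theorem contraction_two (u v : DHat N) : contraction N 2 (u ⊗ₜ v)
    = ∑ i : Fin N, (derA i 0 u ⊗ₜ[ℂ] derB i 1 v + derB i 1 u ⊗ₜ[ℂ] derA i 0 v
      - derA i 1 u ⊗ₜ[ℂ] derB i 0 v - derB i 0 u ⊗ₜ[ℂ] derA i 1 v) := by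
  rw [contraction_tmul_succ]
  refine Finset.sum_congr rfl fun i _ => ?_
  rw [Finset.Nat.sum_antidiagonal_succ]
  simp only [Finset.Nat.antidiagonal_zero, Finset.sum_singleton]
  norm_num
  module

end

/-! ### Operator product expansions of functions, vector fields and one-forms -/

section

variable {N : ℕ}

/-! ### Products of functions, vector fields and one-forms -/

theorem ofFun_add (f g : OHat N) : ofFun (f + g) = ofFun f + ofFun g := map_add _ _ _

theorem ofFun_neg (f : OHat N) : ofFun (-f) = -ofFun f := map_neg _ _

theorem ofFun_zero : ofFun (0 : OHat N) = 0 := map_zero _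

theorem ofFun_mul (f g : OHat N) : ofFun (f * g) = ofFun f * ofFun g := map_mul _ _ _

theorem ofFun_sum {ι : Type*} (s : Finset ι) (f : ι → OHat N) :
    ofFun (∑ i ∈ s, f i) = ∑ i ∈ s, ofFun (f i) := map_sum _ _ _

theorem ofOneForm_sum {ι : Type*} (s : Finset ι) (ω : ι → OneForm N) :
    ofOneForm (∑ i ∈ s, ω i) = ∑ i ∈ s, ofOneForm (ω i) := by
  simp only [ofOneForm, Finset.sum_apply, map_sum, Finset.sum_mul]
  exact Finset.sum_comm

theorem ofFun_mul_ofOneForm (f : OHat N) (ω : OneForm N) :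
    ofFun f * ofOneForm ω = ofOneForm (f • ω) := by
  simp only [ofFun, ofOneForm, Finset.mul_sum, Pi.smul_apply, smul_eq_mul, map_mul, mul_assoc]

theorem ofVectorField_add (τ σ : Fin N → OHat N) :
    ofVectorField (τ + σ) = ofVectorField τ + ofVectorField σ := by
  simp [ofVectorField, add_mul, Finset.sum_add_distrib]

theorem ofVectorField_neg (τ : Fin N → OHat N) : ofVectorField (-τ) = -ofVectorField τ := by
  simp [ofVectorField]

theorem ofVectorField_sum {ι : Type*} (s : Finset ι) (τ : ι → Fin N → OHat N) :
    ofVectorField (∑ i ∈ s, τ i) = ∑ i ∈ s, ofVectorField (τ i) := by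
  simp only [ofVectorField, Finset.sum_apply, map_sum, Finset.sum_mul]
  exact Finset.sum_comm

theorem ofFun_mul_ofVectorField (f : OHat N) (τ : Fin N → OHat N) :
    ofFun f * ofVectorField τ = ofVectorField (f • τ) := by
  simp only [ofFun, ofVectorField, Finset.mul_sum, Pi.smul_apply, smul_eq_mul, map_mul, mul_assoc]

theorem ofVectorField_single (i : Fin N) :
    ofVectorField (Pi.single i 1) = (MvPolynomial.X (Letter.a i 0) : DHat N) := by
  rw [ofVectorField, Finset.sum_eq_single i]
  · simp
  · intro j _ hj; simp [hj]
  · intro h; exact absurd (Finset.mem_univ _) h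

theorem derA_ofFun (i : Fin N) (m : ℕ) (f : OHat N) : derA i m (ofFun f) = 0 := derA_C _ _ _

theorem derB_zero_ofFun (i : Fin N) (f : OHat N) : derB i 0 (ofFun f) = ofFun (OHat.pd i f) :=
  derB_zero_C _ _

theorem derB_succ_ofFun (i : Fin N) (m : ℕ) (f : OHat N) : derB i (m + 1) (ofFun f) = 0 :=
  derB_succ_C _ _ _

theorem derA_zero_ofVectorField (i : Fin N) (τ : Fin N → OHat N) :
    derA i 0 (ofVectorField τ) = ofFun (τ i) := by
  classical
  rw [ofVectorField, map_sum, Finset.sum_eq_single i]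
  · rw [isDer_derA i 0, derA_C, derA_X, if_pos rfl]; simp [ofFun]
  · intro j _ hj
    rw [isDer_derA i 0, derA_C, derA_X, if_neg (by simp [hj])]; simp
  · intro h; exact absurd (Finset.mem_univ _) h

theorem derA_succ_ofVectorField (i : Fin N) (m : ℕ) (τ : Fin N → OHat N) :
    derA i (m + 1) (ofVectorField τ) = 0 := by
  classical
  rw [ofVectorField, map_sum]
  refine Finset.sum_eq_zero fun j _ => ?_
  rw [isDer_derA i _, derA_C, derA_X, if_neg (by simp)]; simp

theorem derB_zero_ofVectorField (i : Fin N) (τ : Fin N → OHat N) :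
    derB i 0 (ofVectorField τ) = ofVectorField fun j => OHat.pd i (τ j) := by
  rw [ofVectorField, ofVectorField, map_sum]
  refine Finset.sum_congr rfl fun j _ => ?_
  rw [isDer_derB i 0, derB_zero_C, derB_zero_X]; simp

theorem derB_succ_ofVectorField (i : Fin N) (m : ℕ) (τ : Fin N → OHat N) :
    derB i (m + 1) (ofVectorField τ) = 0 := by
  classical
  rw [ofVectorField, map_sum]
  refine Finset.sum_eq_zero fun j _ => ?_
  rw [isDer_derB i _, derB_succ_C, derB_succ_X, if_neg (by simp)]; simp

theorem derA_ofOneForm (i : Fin N) (m : ℕ) (ω : OneForm N) : derA i m (ofOneForm ω) = 0 := by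
  classical
  rw [ofOneForm, map_sum]
  refine Finset.sum_eq_zero fun j _ => ?_
  rw [isDer_derA i _, derA_C, derA_X, if_neg (by simp)]; simp

theorem derB_zero_ofOneForm (i : Fin N) (ω : OneForm N) :
    derB i 0 (ofOneForm ω) = ofOneForm fun j => OHat.pd i (ω j) := by
  rw [ofOneForm, ofOneForm, map_sum]
  refine Finset.sum_congr rfl fun j _ => ?_
  rw [isDer_derB i 0, derB_zero_C, derB_zero_X]; simp

theorem derB_one_ofOneForm (i : Fin N) (ω : OneForm N) :
    derB i 1 (ofOneForm ω) = ofFun (ω i) := by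
  classical
  rw [ofOneForm, map_sum, Finset.sum_eq_single i]
  · rw [isDer_derB i 1, derB_succ_C, derB_succ_X, if_pos rfl]; simp [ofFun]
  · intro j _ hj
    rw [isDer_derB i 1, derB_succ_C, derB_succ_X, if_neg (by simp [hj])]; simp
  · intro h; exact absurd (Finset.mem_univ _) h

/-- Products by elements on both of which all `∂/∂a` vanish. -/
theorem nProd_of_derA_eq_zero {u v : DHat N} (hu : ∀ i m, derA i m u = 0)
    (hv : ∀ i m, derA i m v = 0) (n : ℤ) : nProd n u v = tpow N (-n - 1) u * v := by
  refine nProd_of_contraction_zero (fun k => ?_) n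
  rw [contraction_tmul_succ]
  simp [hu, hv]

theorem nProd_of_derA_eq_zero_of_nonneg {u v : DHat N} (hu : ∀ i m, derA i m u = 0)
    (hv : ∀ i m, derA i m v = 0) {n : ℤ} (hn : 0 ≤ n) : nProd n u v = 0 := by
  rw [nProd_of_derA_eq_zero hu hv, tpow, divPow_neg _ (by omega), LinearMap.zero_apply, zero_mul]

theorem nProd_ofOneForm_ofOneForm (ω η : OneForm N) {n : ℤ} (hn : 0 ≤ n) :
    nProd n (ofOneForm ω) (ofOneForm η) = 0 :=
  nProd_of_derA_eq_zero_of_nonneg (fun i m => derA_ofOneForm i m ω)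
    (fun i m => derA_ofOneForm i m η) hn

theorem nProd_ofOneForm_ofFun (ω : OneForm N) (f : OHat N) {n : ℤ} (hn : 0 ≤ n) :
    nProd n (ofOneForm ω) (ofFun f) = 0 :=
  nProd_of_derA_eq_zero_of_nonneg (fun i m => derA_ofOneForm i m ω)
    (fun i m => derA_ofFun i m f) hn

theorem nProd_ofFun_ofOneForm (ω : OneForm N) (f : OHat N) {n : ℤ} (hn : 0 ≤ n) :
    nProd n (ofFun f) (ofOneForm ω) = 0 :=
  nProd_of_derA_eq_zero_of_nonneg (fun i m => derA_ofFun i m f)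
    (fun i m => derA_ofOneForm i m ω) hn

theorem nProd_ofFun_ofFun (f g : OHat N) {n : ℤ} (hn : 0 ≤ n) :
    nProd n (ofFun f) (ofFun g) = 0 :=
  nProd_of_derA_eq_zero_of_nonneg (fun i m => derA_ofFun i m f) (fun i m => derA_ofFun i m g) hn

theorem nProd_neg_one_ofOneForm_ofFun (ω : OneForm N) (f : OHat N) :
    nProd (-1) (ofOneForm ω) (ofFun f) = ofOneForm (f • ω) := by
  rw [nProd_of_derA_eq_zero (fun i m => derA_ofOneForm i m ω) (fun i m => derA_ofFun i m f),
    ← ofFun_mul_ofOneForm, mul_comm]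
  congr 1
  exact tpow_zero_apply _

theorem contraction_one_vectorField_fun (τ : Fin N → OHat N) (f : OHat N) :
    contraction N 1 (ofVectorField τ ⊗ₜ ofFun f)
      = ∑ i, ofFun (τ i) ⊗ₜ[ℂ] ofFun (OHat.pd i f) := by
  simp [contraction_one, derA_zero_ofVectorField, derB_zero_ofFun, derA_ofFun]

theorem contraction_one_fun_vectorField (f : OHat N) (τ : Fin N → OHat N) :
    contraction N 1 (ofFun f ⊗ₜ ofVectorField τ)
      = -∑ i, ofFun (OHat.pd i f) ⊗ₜ[ℂ] ofFun (τ i) := by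
  simp [contraction_one, derA_zero_ofVectorField, derB_zero_ofFun, derA_ofFun]

theorem contraction_one_fun_fun (f g : OHat N) :
    contraction N 1 (ofFun f ⊗ₜ ofFun g) = 0 := by
  simp [contraction_one, derA_ofFun]

theorem nProd_vectorField_fun (τ : Fin N → OHat N) (f : OHat N) (n : ℤ) :
    nProd n (ofVectorField τ) (ofFun f) = tpow N (-n - 1) (ofVectorField τ) * ofFun f
      + ∑ i, tpow N (-n) (ofFun (τ i)) * ofFun (OHat.pd i f) := by
  rw [nProd_low (p := 1) (q := 0) (ofVectorField_mem τ) (ofFun_mem f) (by norm_num),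
    contraction_one_vectorField_fun, contraction_two]
  simp [contraction_one_fun_fun, derA_ofFun, derA_succ_ofVectorField, norm_eq,
    derB_succ_ofFun _ 0]

theorem nProd_zero_vectorField_fun (τ : Fin N → OHat N) (f : OHat N) :
    nProd 0 (ofVectorField τ) (ofFun f) = ofFun (∑ i, τ i * OHat.pd i f) := by
  rw [nProd_vectorField_fun, tpow, divPow_neg _ (by omega), LinearMap.zero_apply, zero_mul,
    zero_add, ofFun_sum]
  refine Finset.sum_congr rfl fun i _ => ?_
  rw [ofFun_mul]
  congr 1
  exact tpow_zero_apply _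

theorem nProd_vectorField_fun_of_pos (τ : Fin N → OHat N) (f : OHat N) {n : ℤ} (hn : 1 ≤ n) :
    nProd n (ofVectorField τ) (ofFun f) = 0 := by
  rw [nProd_vectorField_fun, tpow, divPow_neg _ (by omega), LinearMap.zero_apply, zero_mul,
    zero_add]
  refine Finset.sum_eq_zero fun i _ => ?_
  rw [tpow, divPow_neg _ (by omega), LinearMap.zero_apply, zero_mul]

/-- The product `τ_{(-1)} f` is not `f τ`: contracting `τ` with `f` leaves `∑ T τ^i · ∂_i f`. The
composition law of lifts owes its trace term to this `1`-form. -/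
theorem nProd_neg_one_vectorField_fun (τ : Fin N → OHat N) (f : OHat N) :
    nProd (-1) (ofVectorField τ) (ofFun f) = ofVectorField (f • τ)
      + ofOneForm (∑ i, OHat.pd i f • fun k => OHat.pd k (τ i)) := by
  rw [nProd_vectorField_fun, ofOneForm_sum, ← ofFun_mul_ofVectorField, mul_comm (ofFun f)]
  congr 1
  · congr 1
    exact tpow_zero_apply _
  · refine Finset.sum_congr rfl fun i _ => ?_
    rw [← ofFun_mul_ofOneForm, mul_comm, ← translation_ofFun]
    congr 1
    exact tpow_one_apply _

theorem nProd_fun_vectorField (f : OHat N) (τ : Fin N → OHat N) (n : ℤ) :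
    nProd n (ofFun f) (ofVectorField τ) = tpow N (-n - 1) (ofFun f) * ofVectorField τ
      - ∑ i, tpow N (-n) (ofFun (OHat.pd i f)) * ofFun (τ i) := by
  rw [nProd_low (p := 0) (q := 1) (ofFun_mem f) (ofVectorField_mem τ) (by norm_num),
    contraction_one_fun_vectorField, contraction_two]
  simp [contraction_one_fun_fun, derA_ofFun, derA_succ_ofVectorField, norm_eq,
    derB_succ_ofFun _ 0, sub_eq_add_neg]

theorem nProd_zero_fun_vectorField (f : OHat N) (τ : Fin N → OHat N) :
    nProd 0 (ofFun f) (ofVectorField τ) = -ofFun (∑ i, τ i * OHat.pd i f) := by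
  rw [nProd_fun_vectorField, tpow, divPow_neg _ (by omega), LinearMap.zero_apply, zero_mul,
    zero_sub, ofFun_sum]
  congr 1
  refine Finset.sum_congr rfl fun i _ => ?_
  rw [ofFun_mul, mul_comm (ofFun (τ i))]
  congr 1
  exact tpow_zero_apply _

theorem nProd_fun_vectorField_of_pos (τ : Fin N → OHat N) (f : OHat N) {n : ℤ} (hn : 1 ≤ n) :
    nProd n (ofFun f) (ofVectorField τ) = 0 := by
  rw [nProd_fun_vectorField, tpow, divPow_neg _ (by omega), LinearMap.zero_apply, zero_mul,
    zero_sub, neg_eq_zero]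
  refine Finset.sum_eq_zero fun i _ => ?_
  rw [tpow, divPow_neg _ (by omega), LinearMap.zero_apply, zero_mul]

theorem contraction_one_fun_oneForm (f : OHat N) (ω : OneForm N) :
    contraction N 1 (ofFun f ⊗ₜ ofOneForm ω) = 0 := by
  simp [contraction_one, derA_ofFun, derA_ofOneForm]

theorem contraction_one_oneForm_fun (f : OHat N) (ω : OneForm N) :
    contraction N 1 (ofOneForm ω ⊗ₜ ofFun f) = 0 := by
  simp [contraction_one, derA_ofFun, derA_ofOneForm]

theorem nProd_vectorField_oneForm (τ : Fin N → OHat N) (ω : OneForm N) {n : ℤ} (hn : 0 ≤ n) :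
    nProd n (ofVectorField τ) (ofOneForm ω)
      = ∑ i, tpow N (-n) (ofFun (τ i)) * ofOneForm (fun k => OHat.pd i (ω k))
        + ∑ i, tpow N (1 - n) (ofFun (τ i)) * ofFun (ω i) := by
  rw [nProd_low (p := 1) (q := 1) (ofVectorField_mem τ) (ofOneForm_mem ω) (by norm_num),
    contraction_one, contraction_two, tpow, divPow_neg _ (by omega), LinearMap.zero_apply]
  simp [contraction_one_fun_oneForm, derA_ofOneForm, derA_succ_ofVectorField _ 0, norm_eq,
    derA_zero_ofVectorField, derB_zero_ofOneForm, derB_one_ofOneForm]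

theorem nProd_oneForm_vectorField (ω : OneForm N) (τ : Fin N → OHat N) {n : ℤ} (hn : 0 ≤ n) :
    nProd n (ofOneForm ω) (ofVectorField τ)
      = -∑ i, tpow N (-n) (ofOneForm (fun k => OHat.pd i (ω k))) * ofFun (τ i)
        + ∑ i, tpow N (1 - n) (ofFun (ω i)) * ofFun (τ i) := by
  rw [nProd_low (p := 1) (q := 1) (ofOneForm_mem ω) (ofVectorField_mem τ) (by norm_num),
    contraction_one, contraction_two, tpow, divPow_neg _ (by omega), LinearMap.zero_apply]
  simp [contraction_one_oneForm_fun, derA_ofOneForm, derA_succ_ofVectorField _ 0, norm_eq,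
    derA_zero_ofVectorField, derB_zero_ofOneForm, derB_one_ofOneForm]

/-- The last sum is the double contraction. It has no classical counterpart and is the source of all
traces below. The two contractions can be made in either order, which cancels the `1/2` of the
exponential; the sign is that of one reversed contraction. -/
theorem nProd_vectorField_vectorField (τ σ : Fin N → OHat N) {n : ℤ} (hn : 0 ≤ n) :
    nProd n (ofVectorField τ) (ofVectorField σ)
      = ∑ i, tpow N (-n) (ofFun (τ i)) * ofVectorField (fun k => OHat.pd i (σ k))
        - ∑ i, tpow N (-n) (ofVectorField (fun k => OHat.pd i (τ k))) * ofFun (σ i)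
        - ∑ i, ∑ j, tpow N (1 - n) (ofFun (OHat.pd j (τ i))) * ofFun (OHat.pd i (σ j)) := by
  have h1 : contraction N 1 (ofVectorField τ ⊗ₜ ofVectorField σ)
      = ∑ i, (ofFun (τ i) ⊗ₜ[ℂ] ofVectorField (fun k => OHat.pd i (σ k))
        - ofVectorField (fun k => OHat.pd i (τ k)) ⊗ₜ[ℂ] ofFun (σ i)) := by
    simp [contraction_one, derA_zero_ofVectorField, derB_zero_ofVectorField]
  have h2 : contraction N 2 (ofVectorField τ ⊗ₜ ofVectorField σ) = 0 := by
    simp [contraction_two, derA_succ_ofVectorField _ 0, derB_succ_ofVectorField _ 0]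
  have h3 : contraction N 1 (contraction N 1 (ofVectorField τ ⊗ₜ ofVectorField σ))
      = (-2 : ℂ) • ∑ i, ∑ j, ofFun (OHat.pd j (τ i)) ⊗ₜ[ℂ] ofFun (OHat.pd i (σ j)) := by
    have e : ∑ i, ∑ j, ofFun (OHat.pd i (τ j)) ⊗ₜ[ℂ] ofFun (OHat.pd j (σ i))
      = ∑ i, ∑ j, ofFun (OHat.pd j (τ i)) ⊗ₜ[ℂ] ofFun (OHat.pd i (σ j)) := Finset.sum_comm
    rw [h1, map_sum]
    simp only [map_sub, contraction_one_fun_vectorField, contraction_one_vectorField_fun,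
      Finset.sum_sub_distrib, Finset.sum_neg_distrib]
    rw [e]
    module
  rw [nProd_low (p := 1) (q := 1) (ofVectorField_mem τ) (ofVectorField_mem σ) (by norm_num),
    h2, h3, h1, tpow, divPow_neg _ (by omega), LinearMap.zero_apply, zero_mul, zero_add, zero_add,
    smul_smul, sub_eq_add_neg _ (∑ i, ∑ j, _)]
  simp only [map_sum, map_sub, map_smul, norm_eq, Finset.sum_sub_distrib]
  congr 1
  norm_num

end

/-! ### Translation covariance and maps which preserve products -/

section

variable {N : ℕ}

/-! ### Translation of states -/

/-- The coefficient of `w` in the shift rule `E_divPow_left`, that is, its case `q = 1`. -/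
theorem WickData.E_T_left {V : Type*} [CommRing V] [Algebra ℂ V] (S : WickData V) (k : ℕ)
    (t : V ⊗[ℂ] V) : S.E (k + 1) (S.T.rTensor V t)
      = S.T.rTensor V (S.E (k + 1) t) - (k : ℂ) • S.E k t := by
  have h1 : divPow S.T 1 = S.T := by
    have := divPow_natCast S.T 1
    simpa using this
  have h := S.E_divPow_left (k + 1) 1
  rw [Finset.Nat.sum_antidiagonal_succ', Finset.sum_eq_single (k, 0)] at h
  · simp only [Nat.cast_zero, sub_zero, h1, pow_zero, Nat.choose_zero_right, Nat.cast_one, mul_one,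
      one_smul, zero_add, pow_one, Nat.add_sub_cancel, Nat.choose_one_right, neg_mul, one_mul,
      sub_self, divPow_zero] at h
    have e : (1 : Module.End ℂ V).rTensor V = 1 := LinearMap.rTensor_id _ _
    rw [e, one_mul] at h
    have := LinearMap.congr_fun h t
    rw [Module.End.mul_apply, LinearMap.add_apply, Module.End.mul_apply, LinearMap.smul_apply,
      neg_smul, ← sub_eq_add_neg] at this
    exact this
  · rintro ⟨r, s⟩ hrs hne
    have := Finset.HasAntidiagonal.mem_antidiagonal.1 hrs
    have hs : s ≠ 0 := by
      rintro rfl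
      exact hne (by simp at this; rw [this])
    simp only
    rw [divPow_neg _ (by push_cast; omega), LinearMap.rTensor_zero, zero_mul, smul_zero]
  · intro h
    exact absurd (Finset.HasAntidiagonal.mem_antidiagonal.2 (by simp)) h

theorem divPow_apply_T {V : Type*} [CommRing V] [Algebra ℂ V] (T : Module.End ℂ V) (p : ℤ) :
    divPow T p * T = ((p + 1 : ℤ) : ℂ) • divPow T (p + 1) := by
  rw [← mul_divPow]
  rcases lt_or_ge p 0 with h | h
  · rw [divPow_neg _ h, zero_mul, mul_zero]
  · lift p to ℕ using h
    rw [divPow_natCast, smul_mul_assoc, mul_smul_comm, ← pow_succ, ← pow_succ']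

/-- This is `Y(Tu, z) = ∂_z Y(u, z)`. The factor `k - n` from the divided powers and the factor `-k`
from moving `T` out of the exponential add up to `-n`. -/
theorem WickData.prod_T {V : Type*} [CommRing V] [Algebra ℂ V] (S : WickData V) (n : ℤ) (u v : V) :
    S.prod n (S.T u) v = (-n : ℂ) • S.prod (n - 1) u v := by
  obtain ⟨K, hK⟩ := S.E_fin (u ⊗ₜ[ℂ] v)
  have hnorm : ∀ (p : ℤ) (t : V ⊗[ℂ] V), S.norm p (S.T.rTensor V t)
      = ((p + 1 : ℤ) : ℂ) • S.norm (p + 1) t := by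
    intro p t
    induction t using TensorProduct.induction_on with
    | zero => simp
    | add t t' h h' => simp only [map_add, h, h', smul_add]
    | tmul x y =>
      have := LinearMap.congr_fun (divPow_apply_T S.T p) x
      rw [Module.End.mul_apply, LinearMap.smul_apply] at this
      rw [LinearMap.rTensor_tmul, S.norm_tmul, this, S.norm_tmul, smul_mul_assoc]
  have hE : ∀ k, S.E (k + 1) (S.T u ⊗ₜ[ℂ] v)
      = S.T.rTensor V (S.E (k + 1) (u ⊗ₜ v)) - (k : ℂ) • S.E k (u ⊗ₜ v) := fun k =>
    S.E_T_left k (u ⊗ₜ v)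
  have hE0 : S.E 0 (S.T u ⊗ₜ[ℂ] v) = S.T.rTensor V (S.E 0 (u ⊗ₜ v)) := by
    rw [S.E_zero]; rfl
  rw [WickData.prod, WickData.prod, S.prodT_eq_sum (K := K + 1) n fun k hk => ?_,
    S.prodT_eq_sum (n - 1) hK, Finset.sum_range_succ', hE0, Finset.smul_sum]
  · simp only [hE, map_sub, map_smul, hnorm]
    rw [Finset.sum_sub_distrib, sub_add_eq_add_sub,
      ← Finset.sum_range_succ' (fun k : ℕ => ((((k : ℤ) - n - 1 + 1 : ℤ)) : ℂ)
        • S.norm ((k : ℤ) - n - 1 + 1) (S.E k (u ⊗ₜ[ℂ] v))), Finset.sum_range_succ, hK K le_rfl,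
      map_zero, smul_zero, add_zero, ← Finset.sum_sub_distrib]
    refine Finset.sum_congr rfl fun k _ => ?_
    rw [show (k : ℤ) - n - 1 + 1 = k - (n - 1) - 1 by ring,
      show ((k + 1 : ℕ) : ℤ) - n - 1 = k - (n - 1) - 1 by push_cast; ring, ← sub_smul]
    congr 1
    push_cast
    ring
  · obtain ⟨k, rfl⟩ := Nat.exists_eq_succ_of_ne_zero (n := k) (by omega)
    rw [Nat.succ_eq_add_one, hE, hK k (by omega), hK (k + 1) (by omega), map_zero, smul_zero,
      sub_zero]

theorem nProd_translation (n : ℤ) (u v : DHat N) :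
    nProd n (translation N u) v = (-n : ℂ) • nProd (n - 1) u v := by
  rw [nProd_eq, nProd_eq]
  exact (stateData N).prod_T n u v

theorem nProd_one_left (n : ℤ) (v : DHat N) : nProd n 1 v = if n = -1 then v else 0 := by
  have := nProd_of_contraction_zero (u := (1 : DHat N)) (v := v)
    (fun k => contraction_one_tmul _ _) n
  rw [this]
  split_ifs with h
  · rw [h, show -(-1 : ℤ) - 1 = 0 by norm_num, tpow_zero_apply, one_mul]
  · rw [tpow_one (by omega), zero_mul]

/-- All negative products are `(-1)`-st products with divided powers of `T` on the left, so closure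
under the latter and under `T` suffices. -/
theorem nProd_neg_one_tpow (m : ℕ) (u v : DHat N) :
    nProd (-1) (tpow N m u) v = nProd (-m - 1) u v := by
  induction m generalizing u with
  | zero =>
    rw [Nat.cast_zero, tpow_zero_apply]
    rfl
  | succ m ih =>
    have hc : ((m + 1 : ℕ) : ℂ) ≠ 0 := by exact_mod_cast Nat.succ_ne_zero m
    have h := LinearMap.congr_fun (divPow_apply_T (translation N) m) u
    rw [Module.End.mul_apply, LinearMap.smul_apply] at h
    refine smul_right_injective _ hc ?_
    change ((m + 1 : ℕ) : ℂ) • nProd (-1) _ v = ((m + 1 : ℕ) : ℂ) • _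
    rw [← nProd_smul_left, show ((m + 1 : ℕ) : ℂ) • tpow N ((m + 1 : ℕ) : ℤ) u
      = tpow N m (translation N u) by rw [tpow, h]; push_cast; rfl, ih, nProd_translation]
    congr 1
    · push_cast; ring
    · congr 1
      push_cast; ring

/-! ### Linear maps which preserve the products -/

/-- The states `u` such that `F (u_{(n)} v) = (F u)_{(n)} (F v)` for all `n` and `v`. -/
def homStates (F : DHat N →ₗ[ℂ] DHat N) : Submodule ℂ (DHat N) where
  carrier := {u | ∀ (n : ℤ) (v : DHat N), F (nProd n u v) = nProd n (F u) (F v)}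
  add_mem' {u u'} h h' n v := by
    rw [nProd_add_left, map_add, h, h', map_add, nProd_add_left]
  zero_mem' n v := by rw [nProd_zero_left, map_zero, nProd_zero_left]
  smul_mem' c u h n v := by
    rw [nProd_smul_left, map_smul, h, map_smul, nProd_smul_left]

theorem mem_homStates {F : DHat N →ₗ[ℂ] DHat N} {u : DHat N} : u ∈ homStates F ↔
    ∀ (n : ℤ) (v : DHat N), F (nProd n u v) = nProd n (F u) (F v) := Iff.rfl

/-- Because `T u = u_{(-2)} 1`, a map which fixes the vacuum and is compatible with the products by
`u` commutes with `T` on `u`. -/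
theorem homStates_translation {F : DHat N →ₗ[ℂ] DHat N} (h1 : F 1 = 1) {u : DHat N}
    (hu : u ∈ homStates F) : translation N u ∈ homStates F ∧
      F (translation N u) = translation N (F u) := by
  have h : F (translation N u) = translation N (F u) := by
    have := mem_homStates.1 hu (-2) 1
    rwa [nProd_one_right, h1, nProd_one_right, show -(-2 : ℤ) - 1 = 1 by norm_num, tpow_one_apply,
      tpow_one_apply] at this
  refine ⟨fun n v => ?_, h⟩
  rw [h, nProd_translation, nProd_translation, map_smul, mem_homStates.1 hu]

/-- The modes of `u_{(-1)} v` are finite sums of composites of modes of `u` and `v`. The number of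
summands in `nProd_normal_order` may be any large number, so one choice serves before and after
applying `F`. -/
theorem homStates_nProd_neg_one {F : DHat N →ₗ[ℂ] DHat N} {u v : DHat N}
    (hu : u ∈ homStates F) (hv : v ∈ homStates F) : nProd (-1) u v ∈ homStates F := by
  intro n t
  obtain ⟨I, hI⟩ := nProd_normal_order u v t n
  obtain ⟨I', hI'⟩ := nProd_normal_order (F u) (F v) (F t) n
  rw [mem_homStates.1 hu (-1) v, hI _ (le_max_left I I'), hI' _ (le_max_right I I'), map_sum]
  refine Finset.sum_congr rfl fun i _ => ?_
  rw [map_add, mem_homStates.1 hu, mem_homStates.1 hv, mem_homStates.1 hv, mem_homStates.1 hu]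

theorem homStates_nProd_neg {F : DHat N →ₗ[ℂ] DHat N} (h1 : F 1 = 1) {u v : DHat N}
    (hu : u ∈ homStates F) (hv : v ∈ homStates F) (m : ℕ) : nProd (-m - 1) u v ∈ homStates F := by
  rw [← nProd_neg_one_tpow]
  refine homStates_nProd_neg_one ?_ hv
  rw [tpow, divPow_natCast, LinearMap.smul_apply]
  refine Submodule.smul_mem _ _ ?_
  induction m with
  | zero => simpa using hu
  | succ m ih =>
    rw [pow_succ', Module.End.mul_apply]
    exact (homStates_translation h1 ih).1

/-- Every state arises from functions by repeated negative products with the `a^i_{-1}` and the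
coordinate functions, and `homStates F` is closed under such products. -/
theorem homStates_eq_top {F : DHat N →ₗ[ℂ] DHat N} (h1 : F 1 = 1)
    (hC : ∀ f, ofFun f ∈ homStates F) (ha : ∀ i, MvPolynomial.X (Letter.a i 0) ∈ homStates F) :
    homStates F = ⊤ := by
  refine eq_top_iff.2 fun p _ => ?_
  induction p using MvPolynomial.induction_on with
  | C f => exact hC f
  | add p q hp hq => exact Submodule.add_mem _ (hp trivial) (hq trivial)
  | mul_X p x hp =>
    rw [mul_comm]
    rcases x with ⟨i, m⟩ | ⟨i, n⟩
    · rw [a_mul]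
      exact homStates_nProd_neg h1 (ha i) (hp trivial) m
    · rw [b_mul]
      have := homStates_nProd_neg h1 (hC (OHat.coord i)) (hp trivial) (n + 1)
      rwa [show -((n + 1 : ℕ) : ℤ) - 1 = -n - 2 by push_cast; ring] at this

/-- A product preserving linear map is determined by its values on the generating states. -/
theorem eq_of_homStates {F F' : DHat N →ₗ[ℂ] DHat N} (h : homStates F = ⊤) (h' : homStates F' = ⊤)
    (hC : ∀ f, F (ofFun f) = F' (ofFun f))
    (ha : ∀ i, F (MvPolynomial.X (Letter.a i 0)) = F' (MvPolynomial.X (Letter.a i 0))) :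
    F = F' := by
  have hF : ∀ (n : ℤ) (u v : DHat N), F (nProd n u v) = nProd n (F u) (F v) := fun n u v =>
    (h ▸ Submodule.mem_top : u ∈ homStates F) n v
  have hF' : ∀ (n : ℤ) (u v : DHat N), F' (nProd n u v) = nProd n (F' u) (F' v) := fun n u v =>
    (h' ▸ Submodule.mem_top : u ∈ homStates F') n v
  refine LinearMap.ext fun p => ?_
  induction p using MvPolynomial.induction_on with
  | C f => exact hC f
  | add p q hp hq => rw [map_add, map_add, hp, hq]
  | mul_X p x hp =>
    rw [mul_comm]
    rcases x with ⟨i, m⟩ | ⟨i, n⟩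
    · rw [a_mul, hF, hF', hp, ha]
    · rw [b_mul, hF, hF', hp, hC]

end

/-! ### The universal property of the algebra of states -/

section

variable {N : ℕ}

/-! ### Construction of product preserving maps -/

/-- A product over a finitely supported function needs a commutative ring; the subalgebra generated
by the commuting elements `L x` is one. -/
theorem exists_monomial_of_commute {σ A : Type*} [Ring A] [Algebra ℂ A] (L : σ → A)
    (hL : ∀ x y, L x * L y = L y * L x) : ∃ M : (σ →₀ ℕ) → A, M 0 = 1 ∧
      ∀ x s, M (Finsupp.single x 1 + s) = L x * M s := by
  classical
  have hc : IsMulCommutative (Algebra.adjoin ℂ (Set.range L)) :=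
    Algebra.isMulCommutative_adjoin ℂ (by
      rintro _ ⟨x, rfl⟩ _ ⟨y, rfl⟩
      exact hL x y)
  let _ : CommRing (Algebra.adjoin ℂ (Set.range L)) :=
    { (inferInstance : Ring (Algebra.adjoin ℂ (Set.range L))) with
      mul_comm := fun x y => hc.is_comm.comm x y }
  let f : σ → Algebra.adjoin ℂ (Set.range L) := fun x =>
    ⟨L x, Algebra.subset_adjoin ⟨x, rfl⟩⟩
  refine ⟨fun s => (s.prod fun x k => f x ^ k : Algebra.adjoin ℂ (Set.range L)).1, ?_, ?_⟩
  · exact congrArg Subtype.val (Finsupp.prod_zero_index (h := fun x k => f x ^ k))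
  · intro x s
    refine (congrArg Subtype.val (Finsupp.prod_add_index' (h := fun x k => f x ^ k)
      (fun _ => pow_zero _) (fun _ _ _ => pow_add _ _ _))).trans ?_
    rw [Finsupp.prod_single_index (h := fun x k => f x ^ k) (pow_zero _), pow_one]
    rfl

/-- A linear map with prescribed values on coefficients which intertwines the multiplications by
the letters with given commuting operators. -/
theorem exists_linearMap_of_commute (φ : OHat N →ₗ[ℂ] DHat N) (L : Letter N → Module.End ℂ (DHat N))
    (hL : ∀ x y, L x * L y = L y * L x) : ∃ F : DHat N →ₗ[ℂ] DHat N,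
      (∀ f, F (ofFun f) = φ f) ∧ ∀ x p, F (MvPolynomial.X x * p) = L x (F p) := by
  classical
  obtain ⟨M, h0, hM⟩ := exists_monomial_of_commute L hL
  let F : DHat N →ₗ[ℂ] DHat N :=
    (Finsupp.lsum ℂ fun s => M s ∘ₗ φ) ∘ₗ
      ((MvPolynomial.basisMonomials (Letter N) (OHat N)).repr.toLinearMap.restrictScalars ℂ)
  have hF : ∀ s f, F (MvPolynomial.monomial s f) = M s (φ f) := by
    intro s f
    have h1 : (MvPolynomial.basisMonomials (Letter N) (OHat N)).repr (MvPolynomial.monomial s f)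
        = Finsupp.single s f := by
      have : (MvPolynomial.monomial s f : DHat N)
          = f • MvPolynomial.basisMonomials (Letter N) (OHat N) s := by
        rw [MvPolynomial.coe_basisMonomials, MvPolynomial.smul_monomial, smul_eq_mul, mul_one]
      rw [this, map_smul, Module.Basis.repr_self, Finsupp.smul_single, smul_eq_mul, mul_one]
    change Finsupp.lsum ℂ (fun s => M s ∘ₗ φ)
      ((MvPolynomial.basisMonomials (Letter N) (OHat N)).repr (MvPolynomial.monomial s f)) = _
    rw [h1, Finsupp.lsum_single]
    rfl
  refine ⟨F, fun f => ?_, fun x p => ?_⟩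
  · have := hF 0 f
    rwa [h0] at this
  · induction p using MvPolynomial.induction_on' with
    | monomial s f =>
      have : MvPolynomial.X x * MvPolynomial.monomial s f
          = (MvPolynomial.monomial (Finsupp.single x 1 + s) f : DHat N) := by
        rw [MvPolynomial.X, MvPolynomial.monomial_mul, one_mul]
      rw [this, hF, hF, hM]
      rfl
    | add p q hp hq => rw [mul_add, map_add, hp, hq, map_add, map_add]

/-- States which have the same operator product expansions with the functions `g^* f` and with
each other as the `a^i_{-1}` have with the functions `f` and with each other. -/
structure IsFrame (g : CoordChange N) (A : Fin N → DHat N) : Prop where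
  zero_fun : ∀ i f, nProd 0 (A i) (ofFun (g.pull f)) = ofFun (g.pull (OHat.pd i f))
  pos_fun : ∀ i f (n : ℤ), 1 ≤ n → nProd n (A i) (ofFun f) = 0
  fun_zero : ∀ i f, nProd 0 (ofFun (g.pull f)) (A i) = -ofFun (g.pull (OHat.pd i f))
  fun_pos : ∀ i f (n : ℤ), 1 ≤ n → nProd n (ofFun f) (A i) = 0
  self : ∀ i j (n : ℤ), 0 ≤ n → nProd n (A i) (A j) = 0

theorem isFrame_one : IsFrame (1 : CoordChange N) fun i => MvPolynomial.X (Letter.a i 0) where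
  zero_fun i f := by
    rw [CoordChange.pull_one, CoordChange.pull_one, ← ofVectorField_single,
      nProd_zero_vectorField_fun, Finset.sum_eq_single i]
    · simp
    · intro j _ hj; simp [hj]
    · intro h; exact absurd (Finset.mem_univ _) h
  pos_fun i f n hn := by
    rw [← ofVectorField_single, nProd_vectorField_fun_of_pos _ _ hn]
  fun_zero i f := by
    rw [CoordChange.pull_one, CoordChange.pull_one, ← ofVectorField_single,
      nProd_zero_fun_vectorField, Finset.sum_eq_single i]
    · simp
    · intro j _ hj; simp [hj]
    · intro h; exact absurd (Finset.mem_univ _) h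
  fun_pos i f n hn := by
    rw [← ofVectorField_single, nProd_fun_vectorField_of_pos _ _ hn]
  self i j n hn := by
    have h : ∀ (i : Fin N) (n : ℕ) (j : Fin N),
        derB i n (MvPolynomial.X (Letter.a j 0) : DHat N) = 0 := by
      classical
      intro i n j
      cases n with
      | zero => rw [derB_zero_X]
      | succ n => rw [derB_succ_X, if_neg (by simp)]
    rw [nProd_a, h, tpow, divPow_neg _ (by omega), LinearMap.zero_apply, zero_mul, zero_add,
      ite_self]

/-- Only the zeroth product of `A i` with a function is nonzero, so the commutator of modes is a
mode of a derivative of the function. The formula is the same for every frame, which makes the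
comparison with the standard frame possible. -/
theorem IsFrame.commutator_fun {g : CoordChange N} {A : Fin N → DHat N} (h : IsFrame g A)
    (i : Fin N) (f : OHat N) (m n : ℤ) (v : DHat N) :
    nProd m (A i) (nProd n (ofFun (g.pull f)) v) = nProd n (ofFun (g.pull f)) (nProd m (A i) v)
      + nProd (m + n) (ofFun (g.pull (OHat.pd i f))) v := by
  have := nProd_commutator (A i) (ofFun (g.pull f)) v m n
    fun k hk => h.pos_fun i _ k (by exact_mod_cast hk)
  rw [h.zero_fun] at this
  rw [← this]
  abel

theorem IsFrame.fun_commutator {g : CoordChange N} {A : Fin N → DHat N} (h : IsFrame g A)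
    (i : Fin N) (f : OHat N) (m n : ℤ) (v : DHat N) :
    nProd m (ofFun (g.pull f)) (nProd n (A i) v) = nProd n (A i) (nProd m (ofFun (g.pull f)) v)
      - nProd (m + n) (ofFun (g.pull (OHat.pd i f))) v := by
  rw [h.commutator_fun, add_comm n m]
  abel

theorem IsFrame.comm {g : CoordChange N} {A : Fin N → DHat N} (h : IsFrame g A)
    (i j : Fin N) (m n : ℤ) (v : DHat N) :
    nProd m (A i) (nProd n (A j) v) = nProd n (A j) (nProd m (A i) v) :=
  nProd_comm _ _ _ _ _ fun k => h.self i j k (by positivity)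

theorem nProd_fun_comm (f f' : OHat N) (m n : ℤ) (v : DHat N) :
    nProd m (ofFun f) (nProd n (ofFun f') v) = nProd n (ofFun f') (nProd m (ofFun f) v) :=
  nProd_comm _ _ _ _ _ fun k => nProd_ofFun_ofFun f f' (by positivity)

theorem CoordChange.pull_pd_coord (g : CoordChange N) (i j : Fin N) :
    g.pull (OHat.pd i (OHat.coord j)) = if i = j then 1 else 0 := by
  rw [OHat.pd_coord]
  split_ifs <;> simp

/-- The operators by which a product preserving map intertwines the letters. -/
def frameOp (g : CoordChange N) (A : Fin N → DHat N) : Letter N → Module.End ℂ (DHat N)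
  | Letter.a i m => nProdHom N (-m - 1) (A i)
  | Letter.b i n => nProdHom N (-n - 2) (ofFun (g.comp i))

/-- The commutator of modes of `A i` and of a coordinate function is the mode of `1` or `0` with
index `-m - n - 3`. The only nonzero mode of the vacuum has index `-1`. -/
theorem IsFrame.frameOp_comm {g : CoordChange N} {A : Fin N → DHat N} (h : IsFrame g A)
    (x y : Letter N) : frameOp g A x * frameOp g A y = frameOp g A y * frameOp g A x := by
  have hab : ∀ (i j : Fin N) (m n : ℕ) (v : DHat N),
      nProd (-m - 1) (A i) (nProd (-n - 2) (ofFun (g.comp j)) v)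
        = nProd (-n - 2) (ofFun (g.comp j)) (nProd (-m - 1) (A i) v) := by
    intro i j m n v
    rw [← g.pull_coord, h.commutator_fun, g.pull_pd_coord]
    split_ifs
    · rw [show ofFun (1 : OHat N) = 1 from map_one _, nProd_one_left, if_neg (by omega), add_zero]
    · rw [ofFun_zero, nProd_zero_left, add_zero]
  refine LinearMap.ext fun v => ?_
  rw [Module.End.mul_apply, Module.End.mul_apply]
  rcases x with ⟨i, m⟩ | ⟨i, m⟩ <;> rcases y with ⟨j, n⟩ | ⟨j, n⟩ <;>
    simp only [frameOp, nProdHom_apply]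
  · exact h.comm i j _ _ v
  · exact hab i j m n v
  · exact (hab j i n m v).symm
  · exact nProd_fun_comm _ _ _ _ v

/-- The substitution homomorphism on the polynomials in the letters `b` extending `g^*` and
commuting with translation. -/
def jetPull (g : CoordChange N) : DHat N →+* DHat N :=
  MvPolynomial.eval₂Hom ((MvPolynomial.C : OHat N →+* DHat N).comp g.pull.toRingHom) fun x =>
    match x with
    | Letter.a _ _ => 0
    | Letter.b i n => tpow N ((n + 1 : ℕ) : ℤ) (ofFun (g.comp i))

theorem jetPull_ofFun (g : CoordChange N) (f : OHat N) :
    jetPull g (ofFun f) = ofFun (g.pull f) := MvPolynomial.eval₂Hom_C _ _ _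

theorem jetPull_a (g : CoordChange N) (i : Fin N) (m : ℕ) :
    jetPull g (MvPolynomial.X (Letter.a i m)) = 0 := MvPolynomial.eval₂Hom_X' _ _ _

theorem jetPull_b (g : CoordChange N) (i : Fin N) (n : ℕ) :
    jetPull g (MvPolynomial.X (Letter.b i n)) = tpow N ((n + 1 : ℕ) : ℤ) (ofFun (g.comp i)) :=
  MvPolynomial.eval₂Hom_X' _ _ _

theorem jetPull_smul (g : CoordChange N) (c : ℂ) (p : DHat N) :
    jetPull g (c • p) = c • jetPull g p := by
  have h : ∀ c : ℂ, (algebraMap ℂ (DHat N) c) = ofFun (algebraMap ℂ (OHat N) c) := fun c => rfl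
  rw [Algebra.smul_def, Algebra.smul_def, map_mul, h, jetPull_ofFun, AlgHom.commutes]

theorem translation_tpow (p : ℤ) (u : DHat N) :
    translation N (tpow N p u) = ((p + 1 : ℤ) : ℂ) • tpow N (p + 1) u := by
  have := LinearMap.congr_fun (mul_divPow (translation N) p) u
  rwa [Module.End.mul_apply, LinearMap.smul_apply] at this

theorem jetPull_translation (g : CoordChange N) (p : DHat N) :
    jetPull g (translation N p) = translation N (jetPull g p) := by
  induction p using MvPolynomial.induction_on with
  | C f =>
    rw [show (MvPolynomial.C f : DHat N) = ofFun f from rfl, jetPull_ofFun, translation_ofFun,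
      translation_ofFun, ofOneForm, map_sum]
    have : ∀ i, jetPull g (MvPolynomial.C (OHat.pd i f) * MvPolynomial.X (Letter.b i 0))
        = ofOneForm fun k => g.jac k i * g.pull (OHat.pd i f) := by
      intro i
      rw [map_mul, jetPull_b, zero_add, Nat.cast_one, tpow_one_apply, translation_ofFun]
      have := jetPull_ofFun g (OHat.pd i f)
      rw [show (MvPolynomial.C (OHat.pd i f) : DHat N) = ofFun (OHat.pd i f) from rfl, this,
        ofFun_mul_ofOneForm]
      congr 1
      ext k
      exact mul_comm _ _
    rw [Finset.sum_congr rfl fun i _ => this i, ← ofOneForm_sum]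
    congr 1
    ext k
    rw [g.pd_pull, Finset.sum_apply]
  | add p q hp hq => simp only [map_add, hp, hq]
  | mul_X p x hp =>
    have hx : jetPull g (translation N (MvPolynomial.X x))
        = translation N (jetPull g (MvPolynomial.X x)) := by
      rw [translation_X]
      rcases x with ⟨i, m⟩ | ⟨i, n⟩
      · rw [jetPull_a, map_zero, translationLetter, map_nsmul, jetPull_a, smul_zero]
      · rw [jetPull_b, translationLetter, map_nsmul, jetPull_b, translation_tpow,
          ← Nat.cast_smul_eq_nsmul ℂ]
        push_cast
        congr 1
        ring
    rw [isDer_translation, map_add, map_mul, map_mul, hp, map_mul, isDer_translation, hx]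

theorem jetPull_tpow (g : CoordChange N) (m : ℕ) (p : DHat N) :
    jetPull g (tpow N m p) = tpow N m (jetPull g p) := by
  rw [tpow, divPow_natCast, LinearMap.smul_apply, LinearMap.smul_apply, jetPull_smul]
  congr 1
  induction m with
  | zero => rfl
  | succ m ih => rw [pow_succ', Module.End.mul_apply, Module.End.mul_apply, jetPull_translation, ih]

theorem derA_tpow_ofFun (i : Fin N) (m : ℕ) (p : ℕ) (f : OHat N) :
    derA i m (tpow N p (ofFun f)) = 0 := by
  rw [tpow, divPow_natCast, LinearMap.smul_apply, map_smul]
  have : ∀ m, derA i m ((translation N ^ p) (ofFun f)) = 0 := by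
    induction p with
    | zero => exact fun m => derA_ofFun i m f
    | succ p ih =>
      intro m
      have := LinearMap.congr_fun (derA_translation i m) ((translation N ^ p) (ofFun f))
      rw [Module.End.mul_apply, LinearMap.add_apply, Module.End.mul_apply, LinearMap.smul_apply, ih,
        ih, map_zero, smul_zero, add_zero] at this
      rw [pow_succ', Module.End.mul_apply, this]
  rw [this, smul_zero]

theorem derA_jetPull (g : CoordChange N) (i : Fin N) (m : ℕ) (p : DHat N) :
    derA i m (jetPull g p) = 0 := by
  induction p using MvPolynomial.induction_on with
  | C f =>
    have := jetPull_ofFun g f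
    rw [show (MvPolynomial.C f : DHat N) = ofFun f from rfl, this, derA_ofFun]
  | add p q hp hq => rw [map_add, map_add, hp, hq, add_zero]
  | mul_X p x hp =>
    rw [map_mul, isDer_derA, hp, zero_mul, zero_add]
    rcases x with ⟨j, k⟩ | ⟨j, k⟩
    · rw [jetPull_a, map_zero, mul_zero]
    · rw [jetPull_b, derA_tpow_ofFun, mul_zero]

/-- The polynomials which do not contain the letters `a`. -/
def jets (N : ℕ) : Subalgebra (OHat N) (DHat N) :=
  Algebra.adjoin (OHat N) (Set.range fun x : Fin N × ℕ => MvPolynomial.X (Letter.b x.1 x.2))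

theorem ofFun_mem_jets (f : OHat N) : ofFun f ∈ jets N := (jets N).algebraMap_mem f

theorem translation_mem_jets {p : DHat N} (hp : p ∈ jets N) : translation N p ∈ jets N := by
  have hb : ∀ i n, (MvPolynomial.X (Letter.b i n) : DHat N) ∈ jets N := fun i n =>
    Algebra.subset_adjoin ⟨(i, n), rfl⟩
  induction hp using Algebra.adjoin_induction with
  | mem x hx =>
    obtain ⟨⟨i, n⟩, rfl⟩ := hx
    rw [translation_X, translationLetter]
    exact nsmul_mem (hb _ _) _
  | algebraMap f =>
    change translation N (MvPolynomial.C f) ∈ _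
    rw [translation_C]
    exact sum_mem fun i _ => mul_mem (hb _ _) (ofFun_mem_jets _)
  | add x y _ _ hx hy => rw [map_add]; exact add_mem hx hy
  | mul x y hx' hy' hx hy =>
    rw [isDer_translation]
    exact add_mem (mul_mem hx hy') (mul_mem hx' hy)

theorem tpow_mem_jets (m : ℕ) {p : DHat N} (hp : p ∈ jets N) : tpow N m p ∈ jets N := by
  rw [tpow, divPow_natCast, LinearMap.smul_apply]
  have : ∀ {q}, q ∈ jets N → ∀ c : ℂ, c • q ∈ jets N := by
    intro q hq c
    rw [← algebraMap_smul (OHat N) c q]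
    exact Subalgebra.smul_mem _ hq _
  refine this ?_ _
  induction m with
  | zero => exact hp
  | succ m ih =>
    rw [pow_succ', Module.End.mul_apply]
    exact translation_mem_jets ih

theorem mem_jets_iff_exists {p : DHat N} (hp : p ∈ jets N) : ∃ q : MvPolynomial (Fin N × ℕ) (OHat N),
    p = MvPolynomial.rename (fun x => Letter.b x.1 x.2) q := by
  have : jets N ≤ (MvPolynomial.rename (R := OHat N)
      (fun x : Fin N × ℕ => (Letter.b x.1 x.2 : Letter N))).range := by
    refine Algebra.adjoin_le ?_
    rintro _ ⟨x, rfl⟩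
    exact ⟨MvPolynomial.X x, MvPolynomial.rename_X _ _⟩
  obtain ⟨q, hq⟩ := this hp
  exact ⟨q, hq.symm⟩

/-- The universal property of `D̂`. -/
theorem IsFrame.exists_hom {g : CoordChange N} {A : Fin N → DHat N} (h : IsFrame g A) :
    ∃ F : DHat N →ₗ[ℂ] DHat N, homStates F = ⊤ ∧ (∀ f, F (ofFun f) = ofFun (g.pull f)) ∧
      ∀ i, F (MvPolynomial.X (Letter.a i 0)) = A i := by
  -- The map is forced: a monomial is a word in negative modes applied to a function, and must go to
  -- the corresponding word in modes of the frame. Commutativity of these modes makes this well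
  -- defined.
  obtain ⟨F, hC, hX⟩ := exists_linearMap_of_commute
    { toFun := fun f => ofFun (g.pull f)
      map_add' := fun f f' => by rw [map_add, ofFun_add]
      map_smul' := fun c f => by rw [map_smul]; exact (MvPolynomial.smul_monomial c).symm }
    (frameOp g A) h.frameOp_comm
  replace hC : ∀ f, F (ofFun f) = ofFun (g.pull f) := hC
  have hXa : ∀ i m p, F (MvPolynomial.X (Letter.a i m) * p) = nProd (-m - 1) (A i) (F p) :=
    fun i m p => (hX _ p).trans (nProdHom_apply _ _ _)
  have hXb : ∀ i n p, F (MvPolynomial.X (Letter.b i n) * p)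
      = nProd (-n - 2) (ofFun (g.comp i)) (F p) := fun i n p =>
    (hX _ p).trans (nProdHom_apply _ _ _)
  have h1 : F 1 = 1 := by
    have := hC 1
    rwa [map_one] at this
  have hFa : ∀ i, F (MvPolynomial.X (Letter.a i 0)) = A i := by
    intro i
    have := hXa i 0 1
    rwa [mul_one, h1, nProd_one_right, Nat.cast_zero, show -(-(0 : ℤ) - 1) - 1 = 0 by norm_num,
      tpow_zero_apply] at this
  -- Without letters `a` there are no contractions, and products are multiplications of divided
  -- powers. Hence `F` is the ring homomorphism `jetPull` there. This settles the negative products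
  -- of two functions, which contain `T^m f/m!` and not only letters.
  have hjet : ∀ p ∈ jets N, F p = jetPull g p := by
    intro p hp
    obtain ⟨q, rfl⟩ := mem_jets_iff_exists hp
    clear hp
    induction q using MvPolynomial.induction_on with
    | C f =>
      rw [MvPolynomial.rename_C]
      exact (hC f).trans (jetPull_ofFun g f).symm
    | add p q hp hq => simp only [map_add, hp, hq]
    | mul_X p x hp =>
      rw [map_mul, MvPolynomial.rename_X, mul_comm, hXb, map_mul, jetPull_b, hp,
        nProd_of_derA_eq_zero (fun i m => derA_ofFun i m _) (fun i m => derA_jetPull g i m _)]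
      congr 3
      push_cast
      ring
  -- Induction on the letters of `v`: the mode is moved past the outermost letter, and the
  -- commutators which arise have the same form for the standard frame and for `A`.
  have hstepA : ∀ v i n, F (nProd n (MvPolynomial.X (Letter.a i 0)) v) = nProd n (A i) (F v) := by
    intro v i n
    induction v using MvPolynomial.induction_on with
    | C f =>
      change F (nProd n _ (ofFun f)) = nProd n _ (F (ofFun f))
      have h0 := isFrame_one.zero_fun i f
      simp only [CoordChange.pull_one] at h0
      rcases lt_trichotomy n 0 with hn | rfl | hn
      · obtain ⟨m, rfl⟩ : ∃ m : ℕ, n = -m - 1 := ⟨(-n - 1).toNat, by omega⟩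
        rw [← a_mul, hXa]
      · rw [h0, hC, hC, h.zero_fun]
      · rw [isFrame_one.pos_fun i f n hn, hC, h.pos_fun i _ n hn, map_zero]
    | add p q hp hq => rw [nProd_add_right, map_add, hp, hq, map_add, nProd_add_right]
    | mul_X p x hp =>
      rw [mul_comm]
      rcases x with ⟨j, m⟩ | ⟨j, k⟩
      · rw [a_mul, isFrame_one.comm i j, ← a_mul, hXa, hp, ← a_mul, hXa, h.comm]
      · have e := isFrame_one.commutator_fun i (OHat.coord j) n (-k - 2) p
        simp only [CoordChange.pull_one] at e
        rw [b_mul, e, map_add, ← b_mul, hXb, hp, ← b_mul, hXb, ← g.pull_coord j,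
          h.commutator_fun, g.pull_pd_coord, OHat.pd_coord]
        congr 1
        split_ifs
        · rw [show ofFun (1 : OHat N) = 1 from map_one _, nProd_one_left, nProd_one_left]
          split_ifs
          · rfl
          · rw [map_zero]
        · rw [ofFun_zero, nProd_zero_left, nProd_zero_left, map_zero]
  -- The same induction for modes of functions. The function `f` has to vary, because passing an
  -- `a^j` replaces it by `∂_j f`.
  have hstepF : ∀ v f n, F (nProd n (ofFun f) v) = nProd n (ofFun (g.pull f)) (F v) := by
    intro v
    induction v using MvPolynomial.induction_on with
    | C h' =>
      intro f n
      change F (nProd n _ (ofFun h')) = nProd n _ (F (ofFun h'))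
      rcases lt_or_ge n 0 with hn | hn
      · obtain ⟨m, rfl⟩ : ∃ m : ℕ, n = -m - 1 := ⟨(-n - 1).toNat, by omega⟩
        rw [hC, nProd_of_derA_eq_zero (fun i m => derA_ofFun i m _) (fun i m => derA_ofFun i m _),
          nProd_of_derA_eq_zero (fun i m => derA_ofFun i m _) (fun i m => derA_ofFun i m _),
          show -(-(m : ℤ) - 1) - 1 = m by ring,
          hjet _ (mul_mem (tpow_mem_jets m (ofFun_mem_jets f)) (ofFun_mem_jets h')), map_mul,
          jetPull_tpow, jetPull_ofFun, jetPull_ofFun]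
      · rw [hC, nProd_ofFun_ofFun _ _ hn, nProd_ofFun_ofFun _ _ hn, map_zero]
    | add p q hp hq =>
      intro f n
      rw [nProd_add_right, map_add, hp, hq, map_add, nProd_add_right]
    | mul_X p x hp =>
      intro f n
      rw [mul_comm]
      rcases x with ⟨j, m⟩ | ⟨j, k⟩
      · have e := isFrame_one.fun_commutator j f n (-m - 1) p
        simp only [CoordChange.pull_one] at e
        rw [a_mul, e, map_sub, ← a_mul, hXa, hp, hp, ← a_mul, hXa, h.fun_commutator]
      · rw [b_mul, nProd_fun_comm, ← b_mul, hXb, hp, ← b_mul, hXb, nProd_fun_comm]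
  refine ⟨F, homStates_eq_top h1 (fun f n v => ?_) (fun i n v => ?_), hC, hFa⟩
  · rw [hstepF, hC]
  · rw [hstepA, hFa]

end

/-! ### The frame of a coordinate change and the equations for its lifts -/

section

variable {N : ℕ}

/-! ### Operator product expansions of states of weight one -/

theorem nProd_one_weight_one (τ σ : Fin N → OHat N) (ω η : OneForm N) :
    nProd 1 (ofVectorField τ + ofOneForm ω) (ofVectorField σ + ofOneForm η)
      = ofFun (∑ i, τ i * η i + ∑ i, ω i * σ i
        - ∑ i, ∑ j, OHat.pd j (τ i) * OHat.pd i (σ j)) := by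
  have h0 : tpow N (-1) = 0 := divPow_neg _ (by norm_num)
  rw [nProd_add_left, nProd_add_right, nProd_add_right,
    nProd_vectorField_vectorField _ _ (by norm_num), nProd_vectorField_oneForm _ _ (by norm_num),
    nProd_oneForm_vectorField _ _ (by norm_num), nProd_ofOneForm_ofOneForm _ _ (by norm_num)]
  simp only [h0, LinearMap.zero_apply, zero_mul, Finset.sum_const_zero, sub_self, tpow_zero_apply,
    zero_sub, neg_zero, zero_add, add_zero, ← ofFun_mul, ← ofFun_sum, ← ofFun_neg, ← ofFun_add]
  congr 1
  ring

theorem nProd_zero_weight_one (τ σ : Fin N → OHat N) (ω η : OneForm N) :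
    nProd 0 (ofVectorField τ + ofOneForm ω) (ofVectorField σ + ofOneForm η)
      = ofVectorField (fun m => ∑ i, (τ i * OHat.pd i (σ m) - σ i * OHat.pd i (τ m)))
        + ofOneForm (fun m => ∑ i, (τ i * OHat.pd i (η m) + η i * OHat.pd m (τ i))
          + ∑ i, σ i * (OHat.pd m (ω i) - OHat.pd i (ω m))
          - ∑ i, ∑ j, OHat.pd i (σ j) * OHat.pd m (OHat.pd j (τ i))) := by
  rw [nProd_add_left, nProd_add_right, nProd_add_right,
    nProd_vectorField_vectorField _ _ le_rfl, nProd_vectorField_oneForm _ _ le_rfl,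
    nProd_oneForm_vectorField _ _ le_rfl, nProd_ofOneForm_ofOneForm _ _ le_rfl]
  simp only [neg_zero, tpow_zero_apply, tpow_one_apply, translation_ofFun,
    mul_comm (ofOneForm _) (ofFun _), mul_comm (ofVectorField _) (ofFun _), ofFun_mul_ofOneForm,
    ofFun_mul_ofVectorField, ← ofOneForm_sum, ← ofVectorField_sum, sub_eq_add_neg, add_zero,
    ← ofOneForm_neg, ← ofVectorField_neg]
  have e1 : (fun m => ∑ i, (τ i * OHat.pd i (σ m) + -(σ i * OHat.pd i (τ m))))
      = ∑ i, τ i • (fun k => OHat.pd i (σ k)) + -∑ i, σ i • fun k => OHat.pd i (τ k) := by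
    ext m
    simp [Finset.sum_apply, Finset.sum_add_distrib]
  have e2 : (fun m => ∑ i, (τ i * OHat.pd i (η m) + η i * OHat.pd m (τ i))
          + ∑ i, σ i * (OHat.pd m (ω i) + -OHat.pd i (ω m))
          + -∑ i, ∑ j, OHat.pd i (σ j) * OHat.pd m (OHat.pd j (τ i)))
      = -∑ i, ∑ j, OHat.pd i (σ j) • (fun k => OHat.pd k (OHat.pd j (τ i)))
        + (∑ i, τ i • (fun k => OHat.pd i (η k)) + ∑ i, η i • fun k => OHat.pd k (τ i))
        + (-∑ i, σ i • (fun k => OHat.pd i (ω k)) + ∑ i, σ i • fun k => OHat.pd k (ω i)) := by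
    ext m
    simp only [Finset.sum_apply, Finset.sum_add_distrib, Pi.add_apply, Pi.neg_apply, Pi.smul_apply,
      smul_eq_mul, mul_add, mul_neg, Finset.sum_neg_distrib]
    ring
  rw [e1, e2, ofVectorField_add, ofOneForm_add, ofOneForm_add, ofOneForm_add, ofOneForm_add]
  abel

/-! ### The frame of a coordinate change -/

namespace CoordChange

variable (g : CoordChange N)

/-- The vector fields `∑_k ((∂g)^{-1})_{ik} ∂_k`, which act by `∂_i` on the functions `g^* f`. -/
def frameDer (i : Fin N) : Derivation ℂ (OHat N) (OHat N) := ∑ k, g.jac⁻¹ i k • OHat.pd k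

theorem frameDer_apply (i : Fin N) (f : OHat N) :
    g.frameDer i f = ∑ k, g.jac⁻¹ i k * OHat.pd k f := by
  have := congrFun (map_sum (Derivation.coeFnAddMonoidHom (R := ℂ) (A := OHat N) (M := OHat N))
    (fun k => g.jac⁻¹ i k • OHat.pd k) Finset.univ) f
  rw [Finset.sum_apply] at this
  exact this

theorem inv_mul_jac : g.jac⁻¹ * g.jac = 1 := Matrix.nonsing_inv_mul _ g.isUnit_det_jac

theorem jac_mul_inv : g.jac * g.jac⁻¹ = 1 := Matrix.mul_nonsing_inv _ g.isUnit_det_jac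

theorem frameDer_pull (i : Fin N) (f : OHat N) :
    g.frameDer i (g.pull f) = g.pull (OHat.pd i f) := by
  have h : ∀ k, ∑ j, g.jac⁻¹ i j * g.jac j k = if i = k then 1 else 0 := by
    intro k
    rw [← Matrix.mul_apply, inv_mul_jac, Matrix.one_apply]
  rw [frameDer_apply]
  simp only [pd_pull, Finset.mul_sum]
  rw [Finset.sum_comm]
  simp only [← mul_assoc, ← Finset.sum_mul, h, ite_mul, one_mul, zero_mul]
  simp

theorem pd_inv_apply (l i k : Fin N) : OHat.pd l (g.jac⁻¹ i k)
    = -∑ a, ∑ b, g.jac⁻¹ i a * OHat.pd l (g.jac a b) * g.jac⁻¹ b k := by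
  have := congrFun (congrFun (pd_matrix_inv l g.isUnit_det_jac) i) k
  rw [Matrix.map_apply] at this
  rw [this, Matrix.neg_apply, Matrix.mul_apply, Finset.sum_comm]
  simp only [Matrix.mul_apply, Matrix.map_apply, Finset.sum_mul]

/-- The vector fields of the frame commute. -/
theorem frameDer_inv (i p m : Fin N) :
    g.frameDer i (g.jac⁻¹ p m) = g.frameDer p (g.jac⁻¹ i m) := by
  have h : ∀ i p, g.frameDer i (g.jac⁻¹ p m)
      = -∑ k, ∑ a, ∑ b, g.jac⁻¹ i k * g.jac⁻¹ p a * OHat.pd k (g.jac a b) * g.jac⁻¹ b m := by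
    intro i p
    rw [frameDer_apply, ← Finset.sum_neg_distrib]
    refine Finset.sum_congr rfl fun k _ => ?_
    rw [pd_inv_apply, mul_neg, Finset.mul_sum]
    simp only [Finset.mul_sum, mul_assoc]
  rw [h, h, Finset.sum_comm]
  congr 1
  refine Finset.sum_congr rfl fun k _ => Finset.sum_congr rfl fun a _ =>
    Finset.sum_congr rfl fun b _ => ?_
  rw [g.pd_jac]
  ring

/-- The matrix of the derivatives `∂_l τ^k` of the coefficients of a vector field of the frame. -/
def frameJac (i : Fin N) : Matrix (Fin N) (Fin N) (OHat N) :=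
  Matrix.of fun l k => OHat.pd l (g.jac⁻¹ i k)

theorem frameJac_apply (i l k : Fin N) : g.frameJac i l k = OHat.pd l (g.jac⁻¹ i k) := rfl

theorem frameJac_eq (i : Fin N) : g.frameJac i = -∑ a, g.jac⁻¹ i a • g.rightForm a := by
  ext l k
  rw [frameJac_apply, pd_inv_apply, Matrix.neg_apply, Matrix.sum_apply]
  congr 1
  refine Finset.sum_congr rfl fun a _ => ?_
  rw [Matrix.smul_apply, rightForm, Matrix.mul_apply, smul_eq_mul, Finset.mul_sum]
  refine Finset.sum_congr rfl fun b _ => ?_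
  rw [Matrix.map_apply, g.pd_jac, mul_assoc]

theorem rightForm_eq (a : Fin N) : g.rightForm a = g.jac * g.leftForm a * g.jac⁻¹ := by
  rw [rightForm, leftForm, ← Matrix.mul_assoc, jac_mul_inv, Matrix.one_mul]

theorem frameDer_frameJac (i j l k : Fin N) : g.frameDer i (g.frameJac j l k)
    = OHat.pd l (g.frameDer i (g.jac⁻¹ j k)) - (g.frameJac i * g.frameJac j) l k := by
  simp only [frameDer_apply, Matrix.mul_apply, frameJac_apply, map_sum, Derivation.leibniz,
    smul_eq_mul, Finset.sum_add_distrib]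
  rw [eq_sub_iff_add_eq]
  congr 1
  · exact Finset.sum_congr rfl fun a _ => by rw [OHat.pd_comm]
  · exact Finset.sum_congr rfl fun a _ => mul_comm _ _

/-- The matrices `frameJac` are minus the connection form `d(∂g)(∂g)⁻¹` evaluated on the frame, and
this is its flatness. It follows by differentiating the relation `D_i τ_j = D_j τ_i` between the
commuting fields of the frame. -/
theorem frameJac_flat (i j : Fin N) :
    (g.frameJac j).map (g.frameDer i) - (g.frameJac i).map (g.frameDer j)
      = g.frameJac j * g.frameJac i - g.frameJac i * g.frameJac j := by
  ext l k
  rw [Matrix.sub_apply, Matrix.sub_apply, Matrix.map_apply, Matrix.map_apply, frameDer_frameJac,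
    frameDer_frameJac, frameDer_inv]
  ring

theorem frameDer_trace_mul (i : Fin N) (A B : Matrix (Fin N) (Fin N) (OHat N)) :
    g.frameDer i (A * B).trace = (A.map (g.frameDer i) * B).trace
      + (A * B.map (g.frameDer i)).trace := by
  simp only [Matrix.trace, Matrix.diag_apply, Matrix.mul_apply, map_sum, Derivation.leibniz,
    smul_eq_mul, Finset.sum_add_distrib, Matrix.map_apply]
  rw [add_comm]
  congr 1
  exact Finset.sum_congr rfl fun a _ => Finset.sum_congr rfl fun b _ => mul_comm _ _

/-- The states over the vector fields of the frame, with `1`-form components given by a matrix of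
coefficients with respect to the coframe `dg^p`. -/
def frameState (h : Matrix (Fin N) (Fin N) (OHat N)) (i : Fin N) : DHat N :=
  ofVectorField (g.jac⁻¹ i) + ofOneForm fun k => ∑ p, h i p * g.jac k p

theorem nProd_zero_frameState_fun (h : Matrix (Fin N) (Fin N) (OHat N)) (i : Fin N) (f : OHat N) :
    nProd 0 (g.frameState h i) (ofFun (g.pull f)) = ofFun (g.pull (OHat.pd i f)) := by
  rw [frameState, nProd_add_left, nProd_zero_vectorField_fun, nProd_ofOneForm_ofFun _ _ le_rfl,
    add_zero, ← frameDer_apply, frameDer_pull]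

theorem coframe_apply (h : Matrix (Fin N) (Fin N) (OHat N)) (i j : Fin N) :
    ∑ k, (∑ p, h i p * g.jac k p) * g.jac⁻¹ j k = h i j := by
  have e : ∀ p, ∑ k, g.jac⁻¹ j k * g.jac k p = if j = p then 1 else 0 := by
    intro p
    rw [← Matrix.mul_apply, inv_mul_jac, Matrix.one_apply]
  simp only [Finset.sum_mul]
  rw [Finset.sum_comm]
  have : ∀ p, ∑ k, h i p * g.jac k p * g.jac⁻¹ j k = h i p * if j = p then 1 else 0 := by
    intro p
    rw [← e, Finset.mul_sum]
    exact Finset.sum_congr rfl fun k _ => by ring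
  rw [Finset.sum_congr rfl fun p _ => this p]
  simp

theorem coframe_ext {E : OneForm N} (h : ∀ p, ∑ m, g.jac⁻¹ p m * E m = 0) : E = 0 := by
  have h1 : g.jac⁻¹.mulVec E = 0 := funext h
  have h2 := congrArg g.jac.mulVec h1
  rwa [Matrix.mulVec_mulVec, jac_mul_inv, Matrix.one_mulVec, Matrix.mulVec_zero] at h2

theorem nProd_one_frameState (h : Matrix (Fin N) (Fin N) (OHat N)) (i j : Fin N) :
    nProd 1 (g.frameState h i) (g.frameState h j)
      = ofFun (h i j + h j i - (g.frameJac i * g.frameJac j).trace) := by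
  rw [frameState, frameState, nProd_one_weight_one]
  congr 1
  rw [coframe_apply, add_comm (h i j)]
  congr 1
  · congr 1
    rw [← g.coframe_apply h j i]
    exact Finset.sum_congr rfl fun k _ => mul_comm _ _
  · rw [Matrix.trace, Finset.sum_comm]
    refine Finset.sum_congr rfl fun a _ => ?_
    rw [Matrix.diag_apply, Matrix.mul_apply]
    rfl

/-- The zeroth product is the Courant bracket `[τ_i, τ_j] + L_{τ_i} ω_j - ι_{τ_j} dω_i` corrected by
the double contraction. The fields commute, and evaluating the `1`-form part on `τ_p` gives the
difference of the two sides of `hE`. -/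
theorem nProd_zero_frameState {h : Matrix (Fin N) (Fin N) (OHat N)} (i j : Fin N)
    (hE : ∀ p, g.frameDer i (h j p) - g.frameDer j (h i p) + g.frameDer p (h i j)
      = (g.frameJac j * (g.frameJac i).map (g.frameDer p)).trace) :
    nProd 0 (g.frameState h i) (g.frameState h j) = 0 := by
  set W : Fin N → OneForm N := fun i k => ∑ p, h i p * g.jac k p with hWdef
  have hW : ∀ i p, h i p = ∑ k, W i k * g.jac⁻¹ p k := fun i p => (g.coframe_apply h i p).symm
  have hD : ∀ i j p, g.frameDer i (h j p) = ∑ m, g.jac⁻¹ p m * g.frameDer i (W j m)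
      + ∑ m, W j m * g.frameDer i (g.jac⁻¹ p m) := by
    intro i j p
    rw [hW j p, map_sum, ← Finset.sum_add_distrib]
    refine Finset.sum_congr rfl fun m _ => ?_
    rw [Derivation.leibniz, smul_eq_mul, smul_eq_mul, add_comm]
  have hV : (fun m => ∑ k, (g.jac⁻¹ i k * OHat.pd k (g.jac⁻¹ j m)
      - g.jac⁻¹ j k * OHat.pd k (g.jac⁻¹ i m))) = 0 := by
    ext m
    rw [Finset.sum_sub_distrib, ← frameDer_apply, ← frameDer_apply, frameDer_inv, sub_self]
    rfl
  have hO : (fun m => ∑ k, (g.jac⁻¹ i k * OHat.pd k (W j m) + W j k * OHat.pd m (g.jac⁻¹ i k))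
      + ∑ k, g.jac⁻¹ j k * (OHat.pd m (W i k) - OHat.pd k (W i m))
      - ∑ k, ∑ l, OHat.pd k (g.jac⁻¹ j l) * OHat.pd m (OHat.pd l (g.jac⁻¹ i k))) = 0 := by
    -- A `1`-form vanishes if it vanishes on all fields of the frame. In the result the derivatives
    -- of the coefficients of the frame cancel by `frameDer_inv`.
    refine g.coframe_ext fun p => ?_
    have t2 : ∑ m, g.jac⁻¹ p m * ∑ k, W j k * OHat.pd m (g.jac⁻¹ i k)
        = ∑ k, W j k * g.frameDer p (g.jac⁻¹ i k) := by
      simp only [frameDer_apply, Finset.mul_sum]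
      rw [Finset.sum_comm]
      exact Finset.sum_congr rfl fun k _ => Finset.sum_congr rfl fun m _ => by ring
    have t3 : ∑ m, g.jac⁻¹ p m * ∑ k, g.jac⁻¹ j k * OHat.pd m (W i k)
        = ∑ k, g.jac⁻¹ j k * g.frameDer p (W i k) := by
      simp only [frameDer_apply, Finset.mul_sum]
      rw [Finset.sum_comm]
      exact Finset.sum_congr rfl fun k _ => Finset.sum_congr rfl fun m _ => by ring
    have t5 : ∑ m, g.jac⁻¹ p m
        * ∑ k, ∑ l, OHat.pd k (g.jac⁻¹ j l) * OHat.pd m (OHat.pd l (g.jac⁻¹ i k))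
        = (g.frameJac j * (g.frameJac i).map (g.frameDer p)).trace := by
      simp only [Matrix.trace, Matrix.diag_apply, Matrix.mul_apply, Matrix.map_apply,
        frameJac_apply, frameDer_apply, Finset.mul_sum]
      rw [Finset.sum_comm]
      refine Finset.sum_congr rfl fun k _ => ?_
      rw [Finset.sum_comm]
      exact Finset.sum_congr rfl fun l _ => Finset.sum_congr rfl fun m _ => by ring
    simp only [mul_sub, mul_add, Finset.sum_add_distrib, Finset.sum_sub_distrib]
    rw [t2, t3, t5, ← hE p, hD, hD, hD]
    simp only [← frameDer_apply]
    have e : ∀ i j, ∑ m, W j m * g.frameDer i (g.jac⁻¹ p m)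
        = ∑ m, W j m * g.frameDer p (g.jac⁻¹ i m) := fun i j =>
      Finset.sum_congr rfl fun m _ => by rw [g.frameDer_inv]
    rw [e, e]
    ring
  rw [frameState, frameState, nProd_zero_weight_one]
  refine (congrArg₂ (fun τ ω => ofVectorField τ + ofOneForm ω) hV hO).trans ?_
  simp [ofVectorField, ofOneForm]

/-- `h1` says that the first products vanish and `h0` that the zeroth do; higher products vanish by
weight. The expansions with functions see only the vector field part. -/
theorem isFrame_frameState {h : Matrix (Fin N) (Fin N) (OHat N)}
    (h1 : ∀ i j, h i j + h j i = (g.frameJac i * g.frameJac j).trace)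
    (h0 : ∀ i j p, g.frameDer i (h j p) - g.frameDer j (h i p) + g.frameDer p (h i j)
      = (g.frameJac j * (g.frameJac i).map (g.frameDer p)).trace) :
    IsFrame g (g.frameState h) where
  zero_fun i f := g.nProd_zero_frameState_fun h i f
  pos_fun i f n hn := by
    rw [frameState, nProd_add_left, nProd_vectorField_fun_of_pos _ _ hn,
      nProd_ofOneForm_ofFun _ _ (by omega), add_zero]
  fun_zero i f := by
    rw [frameState, nProd_add_right, nProd_zero_fun_vectorField, nProd_ofFun_ofOneForm _ _ le_rfl,
      add_zero, ← frameDer_apply, frameDer_pull]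
  fun_pos i f n hn := by
    rw [frameState, nProd_add_right, nProd_fun_vectorField_of_pos _ _ hn,
      nProd_ofFun_ofOneForm _ _ (by omega), add_zero]
  self i j n hn := by
    rcases eq_or_lt_of_le hn with rfl | hn
    · exact g.nProd_zero_frameState i j (h0 i j)
    rcases eq_or_lt_of_le (show 1 ≤ n from hn) with rfl | hn
    · rw [nProd_one_frameState, h1, sub_self, ofFun_zero]
    · exact nProd_low_eq_zero (p := 1) (q := 1)
        (Submodule.add_mem _ (ofVectorField_mem _) (ofOneForm_mem _))
        (Submodule.add_mem _ (ofVectorField_mem _) (ofOneForm_mem _)) (by norm_num) hn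

/-! ### Frames and transgression -/

/-- The matrix valued form `θ` evaluated on the frame. -/
def frameForm (i : Fin N) : Matrix (Fin N) (Fin N) (OHat N) := ∑ a, g.jac⁻¹ i a • g.leftForm a

/-- Inside traces `frameJac` may hence be replaced by minus `θ` evaluated on the frame, which
relates the equations for lifts to the forms that define `c_2`. -/
theorem frameJac_eq_conj (i : Fin N) : g.frameJac i = -(g.jac * g.frameForm i * g.jac⁻¹) := by
  rw [frameJac_eq, frameForm, Matrix.mul_sum, Matrix.sum_mul]
  congr 1
  refine Finset.sum_congr rfl fun a _ => ?_
  rw [rightForm_eq, Matrix.mul_smul, Matrix.smul_mul]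

theorem conj_mul_conj (A B : Matrix (Fin N) (Fin N) (OHat N)) :
    (g.jac * A * g.jac⁻¹) * (g.jac * B * g.jac⁻¹) = g.jac * (A * B) * g.jac⁻¹ := by
  calc _ = g.jac * A * (g.jac⁻¹ * g.jac) * B * g.jac⁻¹ := by simp only [Matrix.mul_assoc]
    _ = _ := by rw [inv_mul_jac, Matrix.mul_one]; simp only [Matrix.mul_assoc]

theorem trace_conj (A : Matrix (Fin N) (Fin N) (OHat N)) :
    (g.jac * A * g.jac⁻¹).trace = A.trace := by
  rw [Matrix.trace_mul_comm, ← Matrix.mul_assoc, inv_mul_jac, Matrix.one_mul]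

theorem trace_frameJac_mul (i j : Fin N) :
    (g.frameJac i * g.frameJac j).trace = (g.frameForm i * g.frameForm j).trace := by
  rw [frameJac_eq_conj, frameJac_eq_conj, neg_mul_neg, conj_mul_conj, trace_conj]

theorem trace_frameJac_mul_mul (i j p : Fin N) :
    (g.frameJac i * g.frameJac j * g.frameJac p).trace
      = -(g.frameForm i * g.frameForm j * g.frameForm p).trace := by
  rw [frameJac_eq_conj, frameJac_eq_conj, frameJac_eq_conj, neg_mul_neg, mul_neg, conj_mul_conj,
    conj_mul_conj, Matrix.trace_neg, trace_conj]

/-- This is Cartan's formula for `dβ` on three vector fields; the bracket terms are absent since the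
frame commutes. In the proof these are the terms `X`, which cancel by their symmetry. -/
theorem sum_dTwo {β : Matrix (Fin N) (Fin N) (OHat N)} (hβ : β ∈ twoForms N) (i j p : Fin N) :
    g.frameDer i ((g.jac⁻¹ * β * g.jac⁻¹.transpose) j p)
      + g.frameDer j ((g.jac⁻¹ * β * g.jac⁻¹.transpose) p i)
      + g.frameDer p ((g.jac⁻¹ * β * g.jac⁻¹.transpose) i j)
      = ∑ a, ∑ b, ∑ c, g.jac⁻¹ i a * g.jac⁻¹ j b * g.jac⁻¹ p c * dTwo β a b c := by
  set K := g.jac⁻¹ with hK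
  let Q : Fin N → Fin N → Fin N → OHat N := fun i j p =>
    ∑ b, ∑ c, K j b * K p c * g.frameDer i (β b c)
  let X : Fin N → Fin N → Fin N → OHat N := fun i j p =>
    ∑ b, ∑ c, g.frameDer i (K j b) * β b c * K p c
  have hX : ∀ i j p, X i j p = X j i p := fun i j p =>
    Finset.sum_congr rfl fun b _ => Finset.sum_congr rfl fun c _ => by
      rw [hK, g.frameDer_inv]
  have key : ∀ i j p, g.frameDer i ((K * β * K.transpose) j p) = Q i j p + X i j p - X i p j := by
    intro i j p
    have e : (K * β * K.transpose) j p = ∑ b, ∑ c, K j b * β b c * K p c := by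
      simp only [Matrix.mul_apply, Matrix.transpose_apply, Finset.sum_mul]
      exact Finset.sum_comm
    have e3 : - X i p j = ∑ b, ∑ c, K j b * β b c * g.frameDer i (K p c) := by
      simp only [X]
      rw [Finset.sum_comm, ← Finset.sum_neg_distrib]
      refine Finset.sum_congr rfl fun b _ => ?_
      rw [← Finset.sum_neg_distrib]
      refine Finset.sum_congr rfl fun c _ => ?_
      rw [hβ c b]
      ring
    rw [e, sub_eq_add_neg, e3]
    simp only [Q, X, map_sum, Derivation.leibniz, smul_eq_mul, ← Finset.sum_add_distrib]
    exact Finset.sum_congr rfl fun b _ => Finset.sum_congr rfl fun c _ => by ring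
  have q1 : Q i j p = ∑ a, ∑ b, ∑ c, K i a * K j b * K p c * OHat.pd a (β b c) := by
    simp only [Q, frameDer_apply, Finset.mul_sum]
    rw [Finset.sum_congr rfl fun b _ => Finset.sum_comm, Finset.sum_comm]
    exact Finset.sum_congr rfl fun a _ => Finset.sum_congr rfl fun b _ =>
      Finset.sum_congr rfl fun c _ => by ring
  have q2 : Q j p i = ∑ a, ∑ b, ∑ c, K i a * K j b * K p c * OHat.pd b (β c a) := by
    simp only [Q, frameDer_apply, Finset.mul_sum]
    rw [Finset.sum_comm]
    refine Finset.sum_congr rfl fun a _ => ?_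
    rw [Finset.sum_comm]
    exact Finset.sum_congr rfl fun b _ => Finset.sum_congr rfl fun c _ => by ring
  have q3 : Q p i j = ∑ a, ∑ b, ∑ c, K i a * K j b * K p c * OHat.pd c (β a b) := by
    simp only [Q, frameDer_apply, Finset.mul_sum]
    exact Finset.sum_congr rfl fun a _ => Finset.sum_congr rfl fun b _ =>
      Finset.sum_congr rfl fun c _ => by ring
  simp only [dTwo, mul_add, Finset.sum_add_distrib]
  rw [key, key, key, ← q1, ← q2, ← q3, hX i j p, hX i p j, hX j p i]
  ring

/-- The evaluation of the transgression form on the frame. Replacing three factors `θ` by `frameJac`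
changes the sign, whence `1/2` in place of `-1/2`. -/
theorem sum_transgression (i j p : Fin N) :
    ∑ a, ∑ b, ∑ c, g.jac⁻¹ i a * g.jac⁻¹ j b * g.jac⁻¹ p c * chernTwoTransgression g a b c
      = (1 / 2 : ℂ) • ((g.frameJac i * g.frameJac j * g.frameJac p).trace
        - (g.frameJac i * g.frameJac p * g.frameJac j).trace) := by
  have e : ∀ i j p, (g.frameForm i * g.frameForm j * g.frameForm p).trace
      = ∑ a, ∑ b, ∑ c, g.jac⁻¹ i a * g.jac⁻¹ j b * g.jac⁻¹ p c
        * (g.leftForm a * g.leftForm b * g.leftForm c).trace := by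
    intro i j p
    simp only [frameForm, Matrix.sum_mul, Matrix.mul_sum, Matrix.trace_sum, Matrix.smul_mul,
      Matrix.mul_smul, Matrix.trace_smul, smul_eq_mul]
    simp only [Finset.mul_sum]
    rw [Finset.sum_congr rfl fun x _ => Finset.sum_comm, Finset.sum_comm]
    refine Finset.sum_congr rfl fun a _ => ?_
    rw [Finset.sum_comm]
    exact Finset.sum_congr rfl fun b _ => Finset.sum_congr rfl fun c _ => by ring
  have e' : ∑ a, ∑ b, ∑ c, g.jac⁻¹ i a * g.jac⁻¹ j b * g.jac⁻¹ p c
        * (g.leftForm a * g.leftForm c * g.leftForm b).trace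
      = (g.frameForm i * g.frameForm p * g.frameForm j).trace := by
    rw [e]
    refine Finset.sum_congr rfl fun a _ => ?_
    rw [Finset.sum_comm]
    exact Finset.sum_congr rfl fun b _ => Finset.sum_congr rfl fun c _ => by ring
  rw [trace_frameJac_mul_mul, trace_frameJac_mul_mul, e i j p, ← e']
  simp only [chernTwoTransgression, mul_smul_comm, ← Finset.smul_sum, mul_sub,
    Finset.sum_sub_distrib]
  module

/-- The coefficients with respect to the coframe of the `1`-form components of the lift of a
coordinate change defined by a `2`-form. -/
def liftCoeff (β : Matrix (Fin N) (Fin N) (OHat N)) : Matrix (Fin N) (Fin N) (OHat N) :=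
  Matrix.of fun i j => (1 / 2 : ℂ) • (g.frameJac i * g.frameJac j).trace
    - (g.jac⁻¹ * β * g.jac⁻¹.transpose) i j

/-- The first products fix the symmetric part of `h` as half the trace and leave the skew part free.
In the second equation the skew part enters through `dβ`; by flatness the traces leave exactly the
cubic expression of the transgression form. -/
theorem isFrame_liftCoeff {β : Matrix (Fin N) (Fin N) (OHat N)} (hβ : β ∈ twoForms N)
    (hd : dTwo β = chernTwoTransgression g) : IsFrame g (g.frameState (g.liftCoeff β)) := by
  have hb : ∀ i j, (g.jac⁻¹ * β * g.jac⁻¹.transpose) i j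
      = -(g.jac⁻¹ * β * g.jac⁻¹.transpose) j i := by
    intro i j
    have : β = -β.transpose := by
      ext a b
      exact hβ a b
    conv_lhs => rw [this]
    rw [← Matrix.transpose_apply (g.jac⁻¹ * β * g.jac⁻¹.transpose), Matrix.transpose_mul,
      Matrix.transpose_mul, Matrix.transpose_transpose, Matrix.mul_neg, Matrix.neg_mul,
      Matrix.mul_assoc, Matrix.neg_apply]
  refine g.isFrame_frameState (fun i j => ?_) (fun i j p => ?_)
  · rw [liftCoeff, Matrix.of_apply, Matrix.of_apply, hb j i,
      Matrix.trace_mul_comm (g.frameJac j)]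
    module
  · have h1 := g.sum_dTwo hβ i j p
    rw [hd, sum_transgression, hb p i, map_neg] at h1
    -- Three uses of flatness, each multiplied by the third matrix, bring all traces with
    -- derivatives to a common form. The cubic traces are normalised by cyclic permutation before
    -- they are compared.
    have hflat : ∀ i j p, (g.frameJac p * (g.frameJac j).map (g.frameDer i)).trace
        = (g.frameJac p * (g.frameJac i).map (g.frameDer j)).trace
          + (g.frameJac p * g.frameJac j * g.frameJac i).trace
          - (g.frameJac p * g.frameJac i * g.frameJac j).trace := by
      intro i j p
      have := congrArg (fun A => (g.frameJac p * A).trace) (g.frameJac_flat i j)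
      simp only [Matrix.mul_sub, Matrix.trace_sub, ← Matrix.mul_assoc] at this
      linear_combination this
    have c : ∀ i j p, (g.frameJac i * g.frameJac j * g.frameJac p).trace
        = (g.frameJac p * g.frameJac i * g.frameJac j).trace := fun i j p =>
      Matrix.trace_mul_cycle _ _ _
    have f1 := hflat i j p
    have f2 := hflat i p j
    have f3 := hflat p j i
    rw [c p j i, c p i j, c j p i] at f1
    rw [c j p i, c j i p, c p j i] at f2
    simp only [liftCoeff, Matrix.of_apply, map_sub, Derivation.map_smul, frameDer_trace_mul]
    rw [Matrix.trace_mul_comm ((g.frameJac j).map _), Matrix.trace_mul_comm ((g.frameJac i).map _),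
      Matrix.trace_mul_comm ((g.frameJac i).map _)]
    linear_combination (norm := module) (1 / 2 : ℂ) • f1 + (1 / 2 : ℂ) • f2 + (1 / 2 : ℂ) • f3 - h1

end CoordChange

end

/-! ### Lifts of coordinate changes and their composition -/

section

variable {N : ℕ}

theorem ofFun_injective : Function.Injective (ofFun (N := N)) := MvPolynomial.C_injective _ _

theorem ofOneForm_injective : Function.Injective (ofOneForm (N := N)) := by
  intro ω η h
  ext i : 1
  refine ofFun_injective ?_
  rw [← derB_one_ofOneForm, h, derB_one_ofOneForm]

/-! ### Lifts of coordinate changes -/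

namespace CoordChange

/-- The image of `a^i_{-1}` under the lift of a coordinate change given by a matrix `H`. -/
def liftState (g : CoordChange N) (H : Matrix (Fin N) (Fin N) (OHat N)) (i : Fin N) : DHat N :=
  ofVectorField (g.jac⁻¹ i) + ofOneForm ((g.jac⁻¹ * H) i)

/-- The matrix `tr(θ_k θ_l) / 2 - β_{kl}` of the lift of a coordinate change given by a `2`-form. -/
def liftForm (g : CoordChange N) (β : Matrix (Fin N) (Fin N) (OHat N)) :
    Matrix (Fin N) (Fin N) (OHat N) :=
  Matrix.of fun k l => (1 / 2 : ℂ) • (g.leftForm k * g.leftForm l).trace - β k l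

/-- A change of basis: `liftCoeff` has coefficients with respect to the coframe `dg^p`, convenient
for operator products, `liftForm` with respect to the `db^k`, convenient for composition. -/
theorem liftCoeff_eq (g : CoordChange N) (β : Matrix (Fin N) (Fin N) (OHat N)) :
    g.liftCoeff β = g.jac⁻¹ * g.liftForm β * g.jac⁻¹.transpose := by
  have e : g.liftForm β = (Matrix.of fun k l => (1 / 2 : ℂ) • (g.leftForm k * g.leftForm l).trace)
      - β := rfl
  rw [e, Matrix.mul_sub, Matrix.sub_mul]
  ext i j
  rw [liftCoeff, Matrix.of_apply, Matrix.sub_apply]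
  congr 1
  rw [trace_frameJac_mul, frameForm, frameForm]
  simp only [Matrix.sum_mul, Matrix.mul_sum, Matrix.trace_sum, Matrix.smul_mul,
    Matrix.mul_smul, Matrix.trace_smul, smul_eq_mul]
  simp only [Matrix.mul_apply, Matrix.transpose_apply,
      Matrix.of_apply, Finset.smul_sum, Finset.sum_mul, Finset.mul_sum]
  refine Finset.sum_congr rfl fun a _ => Finset.sum_congr rfl fun b _ => ?_
  rw [mul_smul_comm, smul_mul_assoc]
  congr 1
  ring

theorem liftState_liftForm (g : CoordChange N) (β : Matrix (Fin N) (Fin N) (OHat N)) :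
    g.liftState (g.liftForm β) = g.frameState (g.liftCoeff β) := by
  ext1 i
  rw [liftState, frameState]
  congr 2
  have h : g.liftCoeff β * g.jac.transpose = g.jac⁻¹ * g.liftForm β := by
    rw [liftCoeff_eq, Matrix.mul_assoc, ← Matrix.transpose_mul, jac_mul_inv, Matrix.transpose_one,
      Matrix.mul_one]
  rw [← h]
  rfl

/-- The matrix valued form `ρ = g₁^* (d(∂g₂) (∂g₂)^{-1})`. -/
abbrev crossForm (g₁ g₂ : CoordChange N) (k : Fin N) : Matrix (Fin N) (Fin N) (OHat N) :=
  g₁.pullMatrixForm g₂.rightForm k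

theorem pd_map_pull (g₁ g₂ : CoordChange N) (k : Fin N) :
    (g₂.jac.map g₁.pull).map (OHat.pd k)
      = ∑ l, g₁.jac k l • (g₂.jac.map (OHat.pd l)).map g₁.pull := by
  ext a b
  simp [Matrix.sum_apply, pd_pull]

theorem crossForm_eq (g₁ g₂ : CoordChange N) (k : Fin N) : g₁.crossForm g₂ k
    = (g₂.jac.map g₁.pull).map (OHat.pd k) * g₂.jac⁻¹.map g₁.pull := by
  rw [pd_map_pull, crossForm, pullMatrixForm, Matrix.sum_mul]
  refine Finset.sum_congr rfl fun l _ => ?_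
  rw [Matrix.smul_mul, rightForm, Matrix.map_mul]

theorem isUnit_det_map_pull (g₁ g₂ : CoordChange N) : IsUnit (g₂.jac.map g₁.pull).det := by
  have := g₂.isUnit_det_jac.map g₁.pull
  rwa [AlgHom.map_det] at this

theorem pd_map_pull_inv (g₁ g₂ : CoordChange N) (k : Fin N) :
    (g₂.jac⁻¹.map g₁.pull).map (OHat.pd k) = -(g₂.jac⁻¹.map g₁.pull * g₁.crossForm g₂ k) := by
  rw [← inv_map_pull, pd_matrix_inv k (isUnit_det_map_pull g₁ g₂), crossForm_eq, inv_map_pull,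
    Matrix.mul_assoc]

/-- Up to the invertible factor on the right this is the pull-back of the second derivatives of the
components of `g₂`, which are symmetric. -/
theorem jac_mul_crossForm (g₁ g₂ : CoordChange N) (k l j : Fin N) :
    (g₁.jac * g₁.crossForm g₂ l) k j = (g₁.jac * g₁.crossForm g₂ k) l j := by
  have h : ∀ k l b, (g₁.jac * (g₂.jac.map g₁.pull).map (OHat.pd l)) k b
      = ∑ p, ∑ q, g₁.jac k p * g₁.jac l q * g₁.pull (OHat.pd q (g₂.jac p b)) := by
    intro k l b
    simp only [Matrix.mul_apply, Matrix.map_apply, pd_pull, Finset.mul_sum, mul_assoc]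
  have hs : ∀ k l b, (g₁.jac * (g₂.jac.map g₁.pull).map (OHat.pd l)) k b
      = (g₁.jac * (g₂.jac.map g₁.pull).map (OHat.pd k)) l b := by
    intro k l b
    rw [h, h, Finset.sum_comm]
    refine Finset.sum_congr rfl fun p _ => Finset.sum_congr rfl fun q _ => ?_
    rw [g₂.pd_jac]
    ring
  rw [crossForm_eq, crossForm_eq, ← Matrix.mul_assoc, ← Matrix.mul_assoc, Matrix.mul_apply,
    Matrix.mul_apply]
  exact Finset.sum_congr rfl fun b _ => by rw [hs]

/-- The matrix `tr(ρ_k θ_l)`. -/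
def crossTrace (g₁ g₂ : CoordChange N) : Matrix (Fin N) (Fin N) (OHat N) :=
  Matrix.of fun k l => (g₁.crossForm g₂ k * g₁.leftForm l).trace

/-- Here `θ` is written through the derivative of `(∂g₁)⁻¹`, and the symmetry `jac_mul_crossForm`
moves the summation index `k` into the position in which the anomaly of `F` produces it. -/
theorem crossTrace_apply (g₁ g₂ : CoordChange N) (l m : Fin N) : g₁.crossTrace g₂ l m
    = -∑ j, ∑ k, OHat.pd m (g₁.jac⁻¹ j k) * (g₁.jac * g₁.crossForm g₂ k) l j := by
  have h : g₁.leftForm m = -(g₁.jac⁻¹.map (OHat.pd m) * g₁.jac) := by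
    rw [pd_matrix_inv m g₁.isUnit_det_jac, Matrix.neg_mul, neg_neg, Matrix.mul_assoc,
      inv_mul_jac, Matrix.mul_one, leftForm]
  rw [crossTrace, Matrix.of_apply, h, Matrix.mul_neg, Matrix.trace_neg, Matrix.trace_mul_comm,
    Matrix.mul_assoc]
  congr 1
  rw [Matrix.trace]
  refine Finset.sum_congr rfl fun j _ => ?_
  rw [Matrix.diag_apply, Matrix.mul_apply]
  exact Finset.sum_congr rfl fun k _ => by rw [jac_mul_crossForm, Matrix.map_apply]

theorem jac_mul_inv_eq (g₁ g₂ : CoordChange N) :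
    (g₁ * g₂).jac⁻¹ = g₂.jac⁻¹.map g₁.pull * g₁.jac⁻¹ := by
  rw [jac_mul, Matrix.mul_inv_rev, inv_map_pull]

/-- The left side is the anomalous `1`-form which the lift of `g₁` adds to the vector field
`(g₂.jac⁻¹) i`. It is thus identified as the contribution of `crossTrace` to the matrix of the
composite. -/
theorem sum_pd_pull_inv (g₁ g₂ : CoordChange N) (i m : Fin N) :
    ∑ j, ∑ k, OHat.pd k (g₁.pull (g₂.jac⁻¹ i j)) * OHat.pd m (g₁.jac⁻¹ j k)
      = ((g₁ * g₂).jac⁻¹ * g₁.crossTrace g₂) i m := by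
  have h : ∀ k, g₂.jac⁻¹.map g₁.pull * g₁.crossForm g₂ k
      = (g₁ * g₂).jac⁻¹ * (g₁.jac * g₁.crossForm g₂ k) := by
    intro k
    rw [jac_mul_inv_eq, Matrix.mul_assoc, ← Matrix.mul_assoc g₁.jac⁻¹, inv_mul_jac, Matrix.one_mul]
  have h2 : ∀ j k, OHat.pd k (g₁.pull (g₂.jac⁻¹ i j))
      = -∑ l, (g₁ * g₂).jac⁻¹ i l * (g₁.jac * g₁.crossForm g₂ k) l j := by
    intro j k
    have := congrFun (congrFun (pd_map_pull_inv g₁ g₂ k) i) j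
    rw [h, Matrix.neg_apply, Matrix.mul_apply] at this
    exact this
  rw [Matrix.mul_apply]
  simp only [h2, crossTrace_apply, neg_mul, mul_neg, Finset.sum_neg_distrib, Finset.sum_mul,
    Finset.mul_sum]
  congr 1
  rw [Finset.sum_congr rfl fun j _ => Finset.sum_comm, Finset.sum_comm]
  exact Finset.sum_congr rfl fun l _ => Finset.sum_congr rfl fun j _ =>
    Finset.sum_congr rfl fun k _ => by ring

end CoordChange

/-- `F` is the product preserving map over the coordinate change `g` which sends the `a^i_{-1}` to
the states given by the matrix `H`. -/
structure IsLift (F : DHat N →ₗ[ℂ] DHat N) (g : CoordChange N)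
    (H : Matrix (Fin N) (Fin N) (OHat N)) : Prop where
  hom : homStates F = ⊤
  ofFun : ∀ f, F (ofFun f) = ofFun (g.pull f)
  a : ∀ i, F (MvPolynomial.X (Letter.a i 0)) = g.liftState H i

theorem exists_isLift (g : CoordChange N) {β : Matrix (Fin N) (Fin N) (OHat N)}
    (hβ : β ∈ twoForms N) (hd : dTwo β = chernTwoTransgression g) :
    ∃ F, IsLift F g (g.liftForm β) := by
  obtain ⟨F, h, h1, h2⟩ := (g.isFrame_liftCoeff hβ hd).exists_hom
  exact ⟨F, h, h1, fun i => by rw [h2, g.liftState_liftForm]⟩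

namespace IsLift

variable {F F' : DHat N →ₗ[ℂ] DHat N} {g g' : CoordChange N}
  {H H' : Matrix (Fin N) (Fin N) (OHat N)}

theorem nProd (h : IsLift F g H) (n : ℤ) (u v : DHat N) :
    F (nProd n u v) = ChiralDO.nProd n (F u) (F v) :=
  (h.hom ▸ Submodule.mem_top : u ∈ homStates F) n v

theorem map_one (h : IsLift F g H) : F 1 = 1 := by
  have := h.ofFun 1
  rwa [_root_.map_one] at this

theorem unique (h : IsLift F g H) (h' : IsLift F' g H) : F = F' :=
  eq_of_homStates h.hom h'.hom (fun f => by rw [h.ofFun, h'.ofFun]) fun i => by rw [h.a, h'.a]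

theorem matrix_unique (h : IsLift F g H) (h' : IsLift F g H') : H = H' := by
  have e : g.jac⁻¹ * H = g.jac⁻¹ * H' := by
    refine funext fun i => ofOneForm_injective ?_
    have := (h.a i).symm.trans (h'.a i)
    rw [CoordChange.liftState, CoordChange.liftState] at this
    exact add_left_cancel this
  have := congrArg (g.jac * ·) e
  simpa only [← Matrix.mul_assoc, g.jac_mul_inv, Matrix.one_mul] using this

theorem oneForm (h : IsLift F g H) (ω : OneForm N) :
    F (ofOneForm ω) = ofOneForm (g.pullOne ω) := by
  have e : ∀ i f, F (MvPolynomial.C f * MvPolynomial.X (Letter.b i 0))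
      = ofOneForm fun k => g.jac k i * g.pull f := by
    intro i f
    rw [mul_comm, b_mul, h.nProd, h.ofFun, g.pull_coord]
    have := h.ofFun f
    rw [show (MvPolynomial.C f : DHat N) = ChiralDO.ofFun f from rfl, this,
      nProd_of_derA_eq_zero (fun i m => derA_ofFun i m _) (fun i m => derA_ofFun i m _),
      Nat.cast_zero, show -(-(0 : ℤ) - 2) - 1 = 1 by norm_num, tpow_one_apply, translation_ofFun,
      mul_comm, ofFun_mul_ofOneForm]
    congr 1
    ext k
    exact mul_comm _ _
  rw [ofOneForm, map_sum, Finset.sum_congr rfl fun i _ => e i _, ← ofOneForm_sum]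
  congr 1
  ext k
  rw [Finset.sum_apply, g.pullOne_apply]

/-- The field `a^j` has constant coefficients, so `f a^j = a^j_{(-1)} f` exactly. Its image `(F
a^j)_{(-1)} (g^* f)` has non-constant coefficients and acquires the additional `1`-form. -/
theorem vectorField (h : IsLift F g H) (τ : Fin N → OHat N) :
    F (ofVectorField τ) = ofVectorField (g.pullVectorField τ)
      + ofOneForm (fun m => ∑ j, ∑ k, OHat.pd k (g.pull (τ j)) * OHat.pd m (g.jac⁻¹ j k)
        + ∑ j, g.pull (τ j) * (g.jac⁻¹ * H) j m) := by
  have e : ∀ j f, F (MvPolynomial.C f * MvPolynomial.X (Letter.a j 0))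
      = ofVectorField (g.pull f • g.jac⁻¹ j)
        + ofOneForm (∑ k, OHat.pd k (g.pull f) • fun m => OHat.pd m (g.jac⁻¹ j k))
        + ofOneForm (g.pull f • (g.jac⁻¹ * H) j) := by
    intro j f
    have := h.ofFun f
    rw [mul_comm, a_mul, h.nProd, h.a, show (MvPolynomial.C f : DHat N) = ChiralDO.ofFun f from rfl,
      this, Nat.cast_zero, show -(0 : ℤ) - 1 = -1 by norm_num, CoordChange.liftState,
      nProd_add_left, nProd_neg_one_vectorField_fun, nProd_neg_one_ofOneForm_ofFun]
  rw [ofVectorField, map_sum, Finset.sum_congr rfl fun i _ => e i _, Finset.sum_add_distrib,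
    Finset.sum_add_distrib, ← ofVectorField_sum, ← ofOneForm_sum, ← ofOneForm_sum, add_assoc,
    ← ofOneForm_add]
  congr 2
  · ext k
    rw [Finset.sum_apply, CoordChange.pullVectorField]
    exact Finset.sum_congr rfl fun i _ => mul_comm _ _
  · ext m
    simp only [Finset.sum_apply, Pi.add_apply, Pi.smul_apply, smul_eq_mul]

/-- The composition law of lifts. -/
theorem comp (h : IsLift F g H) (h' : IsLift F' g' H') :
    IsLift (F ∘ₗ F') (g * g') (H + g.pullTwo H' + g.crossTrace g') where
  hom := by
    refine eq_top_iff.2 fun u _ n v => ?_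
    simp only [LinearMap.comp_apply, h'.nProd, h.nProd]
  ofFun f := by rw [LinearMap.comp_apply, h'.ofFun, h.ofFun, CoordChange.pull_mul]
  a i := by
    rw [LinearMap.comp_apply, h'.a, CoordChange.liftState, map_add, h.vectorField, h.oneForm,
      add_assoc, ← ofOneForm_add, CoordChange.liftState]
    congr 2
    · ext k
      rw [CoordChange.jac_mul_inv_eq, Matrix.mul_apply, CoordChange.pullVectorField]
      exact Finset.sum_congr rfl fun j _ => mul_comm _ _
    · ext m
      have e1 : ∑ j, g.pull (g'.jac⁻¹ i j) * (g.jac⁻¹ * H) j m = ((g * g').jac⁻¹ * H) i m := by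
        rw [CoordChange.jac_mul_inv_eq, Matrix.mul_assoc, Matrix.mul_apply]
        rfl
      have e2 : g.pullOne ((g'.jac⁻¹ * H') i) m = ((g * g').jac⁻¹ * g.pullTwo H') i m := by
        have : (g * g').jac⁻¹ * g.pullTwo H'
            = (g'.jac⁻¹ * H').map g.pull * g.jac.transpose := by
          change _ * (g.jac * H'.map g.pull * g.jac.transpose) = _
          rw [CoordChange.jac_mul_inv_eq, Matrix.map_mul]
          calc _ = g'.jac⁻¹.map g.pull * (g.jac⁻¹ * g.jac) * H'.map g.pull * g.jac.transpose := by
                simp only [Matrix.mul_assoc]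
            _ = _ := by rw [g.inv_mul_jac, Matrix.mul_one]
        rw [this, Matrix.mul_apply, CoordChange.pullOne_apply]
        exact Finset.sum_congr rfl fun k _ => mul_comm _ _
      rw [Pi.add_apply, e1, e2, CoordChange.sum_pd_pull_inv, Matrix.mul_add, Matrix.mul_add,
        Matrix.add_apply, Matrix.add_apply]
      ring

theorem id : IsLift (LinearMap.id : DHat N →ₗ[ℂ] DHat N) 1 0 where
  hom := eq_top_iff.2 fun u _ n v => rfl
  ofFun f := by rw [CoordChange.pull_one]; rfl
  a i := by
    rw [CoordChange.liftState, CoordChange.jac_one, inv_one, Matrix.mul_zero, LinearMap.id_apply,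
      ← ofVectorField_single, show ofOneForm ((0 : Matrix (Fin N) (Fin N) (OHat N)) i) = 0 by
        simp [ofOneForm], add_zero]
    congr 1
    ext j
    rw [Matrix.one_apply, Pi.single_apply]
    simp only [eq_comm]

theorem crossTrace_one_left (g : CoordChange N) : (1 : CoordChange N).crossTrace g = 0 := by
  ext k l
  have : (1 : CoordChange N).leftForm l = 0 := by
    rw [CoordChange.leftForm, CoordChange.jac_one]
    have : (1 : Matrix (Fin N) (Fin N) (OHat N)).map (OHat.pd l) = 0 := by
      ext i j
      rw [Matrix.map_apply, Matrix.one_apply]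
      split_ifs <;> simp
    rw [this, Matrix.mul_zero]
  rw [CoordChange.crossTrace, Matrix.of_apply, this, Matrix.mul_zero, Matrix.trace_zero]
  rfl

/-- The lifts of the identity are given by closed `2`-forms. -/
theorem mem_closedTwoForms (h : IsLift F 1 H) : H ∈ closedTwoForms N := by
  have hA : ∀ i, F (MvPolynomial.X (Letter.a i 0))
      = ofVectorField (Pi.single i 1) + ofOneForm (H i) := by
    intro i
    rw [h.a, CoordChange.liftState, CoordChange.jac_one, inv_one, Matrix.one_mul]
    congr 2
    ext j
    rw [Matrix.one_apply, Pi.single_apply]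
    simp only [eq_comm]
  have hprod : ∀ i j (n : ℤ), 0 ≤ n →
      ChiralDO.nProd n (ofVectorField (Pi.single i 1) + ofOneForm (H i))
        (ofVectorField (Pi.single j 1) + ofOneForm (H j)) = 0 := by
    intro i j n hn
    rw [← hA, ← hA, ← h.nProd, isFrame_one.self i j n hn, map_zero]
  have hs : ∀ (i : Fin N) (f : Fin N → OHat N),
      ∑ k, (Pi.single i 1 : Fin N → OHat N) k * f k = f i := by
    intro i f
    simp [Pi.single_apply]
  have hp : ∀ (i j k : Fin N), OHat.pd k ((Pi.single i 1 : Fin N → OHat N) j) = 0 := by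
    intro i j k
    rw [Pi.single_apply]
    split_ifs <;> simp
  have hskew : ∀ i j, H i j = -H j i := by
    intro i j
    -- Over the identity the frame is constant and all double contractions vanish: the first
    -- products give `H + Hᵗ = 0`, and the zeroth products then give `dH = 0`.
    have := hprod i j 1 (by norm_num)
    rw [nProd_one_weight_one] at this
    simp only [hp, mul_zero, Finset.sum_const_zero, sub_zero, hs,
      mul_comm (H i _)] at this
    rw [← ofFun_zero] at this
    have := ofFun_injective this
    linear_combination this
  refine ⟨hskew, fun i j k => ?_⟩
  have := hprod i j 0 le_rfl
  rw [nProd_zero_weight_one] at this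
  simp only [hp, mul_zero, Finset.sum_const_zero, sub_zero, hs, add_zero, map_zero] at this
  have hz : ofVectorField (fun _ : Fin N => (0 : OHat N)) = 0 := by simp [ofVectorField]
  have hz' : ofOneForm (0 : OneForm N) = 0 := by simp [ofOneForm]
  rw [hz, zero_add, ← hz'] at this
  have := congrFun (ofOneForm_injective this) k
  simp only [Pi.zero_apply] at this
  rw [dTwo, hskew k i, map_neg]
  linear_combination this

end IsLift

end

/-! ### The Poincaré lemma and closedness of the transgression form -/

section

variable {N : ℕ}

/-! ### The Poincaré lemma for `3`-forms -/

namespace OHat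

theorem mk_sum {ι : Type*} (s : Finset ι) (F : ι → (Fin N → ℂ) → ℂ)
    (hF : ∀ k, AnalyticAt ℂ (F k) 0) : ∑ k ∈ s, mk (F k) (hF k)
      = mk (fun x => ∑ k ∈ s, F k x) (Finset.analyticAt_fun_sum _ fun k _ => hF k) := by
  classical
  induction s using Finset.induction_on with
  | empty => simp [zero_eq_mk]
  | insert a s ha ih =>
    rw [Finset.sum_insert ha, ih, mk_add_mk, mk_eq_mk]
    exact Eventually.of_forall fun x => by simp [Finset.sum_insert ha]

/-- The operator `E + m`, where `E` is the Euler vector field. -/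
def eulerAdd (m : ℕ) : OHat N →ₗ[ℂ] OHat N :=
  ∑ k, LinearMap.mulLeft ℂ (coord k) ∘ₗ (pd k).toLinearMap + (m : ℂ) • LinearMap.id

theorem eulerAdd_apply (m : ℕ) (φ : OHat N) :
    eulerAdd m φ = ∑ k, coord k * pd k φ + (m : ℂ) • φ := by
  rw [eulerAdd, LinearMap.add_apply, LinearMap.sum_apply]
  rfl

/-- The Euler field `E` multiplies a form of degree `n` by `n` and `∂_i` lowers the degree by one.
So inverting `E + 3` on a `3`-form inverts `E + 4` on its derivatives. -/
theorem pd_eulerAdd (i : Fin N) (m : ℕ) (φ : OHat N) :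
    pd i (eulerAdd m φ) = eulerAdd (m + 1) (pd i φ) := by
  rw [eulerAdd_apply, eulerAdd_apply, map_add, map_sum, Derivation.map_smul]
  simp only [Derivation.leibniz, smul_eq_mul, pd_coord, Finset.sum_add_distrib]
  have : ∑ k, pd k φ * (if i = k then 1 else 0) = pd i φ := by simp
  rw [this, Finset.sum_congr rfl fun k _ => by rw [pd_comm i k]]
  push_cast
  module

theorem fderiv_apply_self (f : (Fin N → ℂ) → ℂ) (x : Fin N → ℂ) :
    fderiv ℂ f x x = ∑ k, x k * fderiv ℂ f x (Pi.single k 1) := by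
  conv_lhs => rw [show fderiv ℂ f x x = fderiv ℂ f x (∑ k, x k • Pi.single k (1 : ℂ)) by
    congr 1; exact pi_eq_sum_univ' x]
  rw [map_sum]
  exact Finset.sum_congr rfl fun k _ => by rw [map_smul, smul_eq_mul]

theorem analyticAt_euler {f : (Fin N → ℂ) → ℂ} (hf : AnalyticAt ℂ f 0) :
    AnalyticAt ℂ (fun x => fderiv ℂ f x x) 0 := by
  simp only [fderiv_apply_self]
  exact Finset.analyticAt_fun_sum _ fun k _ =>
    (analyticAt_coord k).mul (analyticAt_partial hf _)

theorem eulerAdd_mk (m : ℕ) {f : (Fin N → ℂ) → ℂ} (hf : AnalyticAt ℂ f 0) :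
    eulerAdd m (mk f hf) = mk (fun x => fderiv ℂ f x x + m * f x)
      ((analyticAt_euler hf).add (analyticAt_const.mul hf)) := by
  have h : ∀ k, coord k * pd k (mk f hf) = mk (fun x => x k * fderiv ℂ f x (Pi.single k 1))
      ((analyticAt_coord k).mul (analyticAt_partial hf _)) := by
    intro k
    rw [pd_mk, coord, mk_mul_mk]
  rw [eulerAdd_apply, Finset.sum_congr rfl fun k _ => h k, mk_sum, smul_mk, mk_add_mk, mk_eq_mk]
  refine Eventually.of_forall fun x => ?_
  dsimp only
  rw [fderiv_apply_self]

/-- Along a ray, `t^m f(tx)` has derivative `t^{m-1} ((E + m) f)(tx) = 0`. It is therefore constant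
on `[0, 1]`, and it vanishes at `t = 0` because `m ≥ 1`. -/
theorem eulerAdd_injective {m : ℕ} (hm : 1 ≤ m) :
    Function.Injective (eulerAdd (N := N) m) := by
  refine (injective_iff_map_eq_zero _).2 fun φ => ?_
  induction φ using ind with
  | h f hf =>
  intro h
  rw [eulerAdd_mk, zero_eq_mk, mk_eq_mk] at h
  rw [zero_eq_mk, mk_eq_mk]
  obtain ⟨ε, hε, hball⟩ := Metric.eventually_nhds_iff_ball.1 (h.and hf.eventually_analyticAt)
  refine Metric.eventually_nhds_iff_ball.2 ⟨ε, hε, fun x hx => ?_⟩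
  have hmem : ∀ t ∈ Set.Icc (0 : ℝ) 1, (t : ℂ) • x ∈ Metric.ball (0 : Fin N → ℂ) ε := by
    intro t ht
    rw [mem_ball_zero_iff] at hx ⊢
    rw [norm_smul, Complex.norm_real, Real.norm_of_nonneg ht.1]
    exact lt_of_le_of_lt (mul_le_of_le_one_left (norm_nonneg _) ht.2) hx
  have hderiv : ∀ t ∈ Set.Icc (0 : ℝ) 1,
      HasDerivAt (fun t : ℝ => (t : ℂ) ^ m * f ((t : ℂ) • x)) 0 t := by
    intro t ht
    have h2 := (hball _ (hmem t ht)).2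
    have h1 : fderiv ℂ f ((t : ℂ) • x) ((t : ℂ) • x) + m * f ((t : ℂ) • x) = 0 :=
      (hball _ (hmem t ht)).1
    have d1 : HasDerivAt (fun t : ℝ => (t : ℂ) • x) x t := by
      have := (Complex.ofRealCLM.hasDerivAt (x := t)).smul_const x
      simpa using this
    have d2 : HasDerivAt (fun t : ℝ => f ((t : ℂ) • x)) (fderiv ℂ f ((t : ℂ) • x) x) t := by
      have d := h2.differentiableAt.hasFDerivAt.restrictScalars ℝ
      exact HasFDerivAt.comp_hasDerivAt (l := f) t d d1
    have d3 : HasDerivAt (fun t : ℝ => (t : ℂ) ^ m) (m * (t : ℂ) ^ (m - 1)) t :=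
      (hasDerivAt_pow m (t : ℂ)).comp_ofReal
    have d4 := d3.mul d2
    have e : (m : ℂ) * (t : ℂ) ^ (m - 1) * f ((t : ℂ) • x)
        + (t : ℂ) ^ m * fderiv ℂ f ((t : ℂ) • x) x = 0 := by
      have e1 : fderiv ℂ f ((t : ℂ) • x) ((t : ℂ) • x) = t * fderiv ℂ f ((t : ℂ) • x) x := by
        rw [map_smul, smul_eq_mul]
      rw [e1] at h1
      obtain ⟨k, rfl⟩ : ∃ k, m = k + 1 := ⟨m - 1, by omega⟩
      rw [Nat.add_sub_cancel]
      linear_combination (t : ℂ) ^ k * h1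
    exact e ▸ d4
  have hconst := constant_of_has_deriv_right_zero
    (fun t ht => (hderiv t ht).continuousAt.continuousWithinAt)
    (fun t ht => (hderiv t ⟨ht.1, ht.2.le⟩).hasDerivWithinAt) 1 (by simp)
  simpa [show m ≠ 0 by omega] using hconst

/-- The homogeneous part of degree `n` is divided by `n + m ≥ 1`, which does not decrease the radius
of convergence. -/
theorem eulerAdd_surjective {m : ℕ} (hm : 1 ≤ m) :
    Function.Surjective (eulerAdd (N := N) m) := by
  intro φ
  induction φ using ind with
  | h f hf =>
  obtain ⟨p, r, hp⟩ := id hf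
  let q : FormalMultilinearSeries ℂ (Fin N → ℂ) ℂ := fun n => (((n + m : ℕ) : ℂ)⁻¹) • p n
  have hc : ∀ n, ((n + m : ℕ) : ℂ) ≠ 0 := fun n => by exact_mod_cast (by omega : n + m ≠ 0)
  have hle : ∀ n, ‖q n‖ ≤ ‖p n‖ := by
    intro n
    rw [norm_smul, norm_inv, Complex.norm_natCast]
    refine mul_le_of_le_one_left (norm_nonneg _) (inv_le_one_of_one_le₀ ?_)
    exact_mod_cast (by omega : 1 ≤ n + m)
  have hrad : r ≤ q.radius := hp.r_le.trans (FormalMultilinearSeries.radius_le_of_le hle)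
  have hq : HasFPowerSeriesOnBall q.sum q 0 r :=
    (q.hasFPowerSeriesOnBall (hp.r_pos.trans_le hrad)).mono hp.r_pos hrad
  have hqa : AnalyticAt ℂ q.sum 0 := hq.analyticAt
  refine ⟨mk q.sum hqa, ?_⟩
  rw [eulerAdd_mk, mk_eq_mk]
  filter_upwards [Metric.eball_mem_nhds (0 : Fin N → ℂ) hp.r_pos] with x hx
  have h1 := hp.hasSum hx
  have h2 := hq.hasSum hx
  have h3 := hq.fderiv.hasSum hx
  rw [zero_add] at h1 h2 h3
  have h4 : HasSum (fun n => ((n + 1 : ℕ) : ℂ) * q (n + 1) fun _ => x) (fderiv ℂ q.sum x x) := by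
    have := (ContinuousLinearMap.apply ℂ ℂ x).hasSum h3
    simpa only [ContinuousLinearMap.apply_apply, FormalMultilinearSeries.derivSeries_apply_diag,
      nsmul_eq_mul] using this
  have h5 : HasSum (fun n : ℕ => (n : ℂ) * q n fun _ => x) (fderiv ℂ q.sum x x) := by
    have := (hasSum_nat_add_iff (f := fun n : ℕ => (n : ℂ) * q n fun _ => x) 1).1 h4
    simpa using this
  have h6 := h5.add (h2.mul_left (m : ℂ))
  have e : (fun n : ℕ => (n : ℂ) * (q n fun _ => x) + m * (q n fun _ => x))
      = fun n => p n fun _ => x := by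
    funext n
    have : (q n fun _ => x) = ((n + m : ℕ) : ℂ)⁻¹ * p n fun _ => x := rfl
    rw [this, ← add_mul, ← mul_assoc, ← Nat.cast_add, mul_inv_cancel₀ (hc n), one_mul]
  rw [e] at h6
  exact h6.unique h1

end OHat

/-- The Poincaré lemma: a closed `3`-form is exact. -/
theorem exists_dTwo_eq {v : Fin N → Fin N → Fin N → OHat N} (h12 : ∀ i j k, v i j k = -v j i k)
    (h23 : ∀ i j k, v i j k = -v i k j)
    (hd : ∀ l i j k, OHat.pd l (v i j k)
      = OHat.pd i (v l j k) + OHat.pd j (v l k i) + OHat.pd k (v l i j)) :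
    ∃ η ∈ twoForms N, dTwo η = v := by
  -- By Cartan's formula `d ι_E w + ι_E dw = L_E w`, and `L_E` is `E + 3` on the coefficients of a
  -- `3`-form. So `w = (E + 3)⁻¹ v`, which inherits skew symmetry and closedness by injectivity of
  -- `E + 3` and `E + 4`.
  choose w hw using fun i j k => OHat.eulerAdd_surjective (N := N) (m := 3) (by norm_num) (v i j k)
  have hinj3 := OHat.eulerAdd_injective (N := N) (m := 3) (by norm_num)
  have hinj4 := OHat.eulerAdd_injective (N := N) (m := 4) (by norm_num)
  have w12 : ∀ i j k, w i j k = -w j i k := fun i j k => hinj3 (by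
    rw [map_neg, hw, hw, h12])
  have w23 : ∀ i j k, w i j k = -w i k j := fun i j k => hinj3 (by
    rw [map_neg, hw, hw, h23])
  have wd : ∀ l i j k, OHat.pd l (w i j k)
      = OHat.pd i (w l j k) + OHat.pd j (w l k i) + OHat.pd k (w l i j) := fun l i j k => hinj4 (by
    rw [map_add, map_add, ← OHat.pd_eulerAdd, ← OHat.pd_eulerAdd, ← OHat.pd_eulerAdd,
      ← OHat.pd_eulerAdd, hw, hw, hw, hw, hd])
  -- This is the contraction `ι_E w`.
  refine ⟨Matrix.of fun i j => ∑ l, OHat.coord l * w l i j, fun i j => ?_, ?_⟩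
  · rw [Matrix.of_apply, Matrix.of_apply, ← Finset.sum_neg_distrib]
    exact Finset.sum_congr rfl fun l _ => by rw [w23 l i j, mul_neg]
  · ext i j k
    have key : ∀ i j k, OHat.pd i (∑ l, OHat.coord l * w l j k)
        = w i j k + ∑ l, OHat.coord l * OHat.pd i (w l j k) := by
      intro i j k
      simp only [map_sum, Derivation.leibniz, smul_eq_mul, OHat.pd_coord, Finset.sum_add_distrib]
      rw [add_comm]
      simp
    have c1 : w j k i = w i j k := by rw [w23 j k i, w12 j i k, neg_neg]
    have c2 : w k i j = w i j k := by rw [w12 k i j, w23 i k j, neg_neg]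
    simp only [dTwo, Matrix.of_apply, key, c1, c2]
    rw [← hw, OHat.eulerAdd_apply]
    have : ∑ l, OHat.coord l * OHat.pd l (w i j k) = ∑ l, OHat.coord l * OHat.pd i (w l j k)
        + ∑ l, OHat.coord l * OHat.pd j (w l k i) + ∑ l, OHat.coord l * OHat.pd k (w l i j) := by
      rw [← Finset.sum_add_distrib, ← Finset.sum_add_distrib]
      exact Finset.sum_congr rfl fun l _ => by rw [wd]; ring
    rw [this]
    push_cast
    module

/-! ### The transgression form is closed -/

theorem pd_leftForm (g : CoordChange N) (l i : Fin N) : (g.leftForm i).map (OHat.pd l)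
    = -(g.leftForm l * g.leftForm i) + g.jac⁻¹ * (g.jac.map (OHat.pd i)).map (OHat.pd l) := by
  rw [CoordChange.leftForm, CoordChange.leftForm, pd_matrix_mul,
    pd_matrix_inv _ g.isUnit_det_jac]
  congr 1
  simp only [Matrix.neg_mul, Matrix.mul_assoc]

/-- By `dθ = -θ ∧ θ`, the differential of `tr θ³` is a multiple of `tr θ⁴`, which vanishes because
moving one `1`-form around the cyclic trace of an even number of them changes the sign. -/
theorem chernTwoTransgression_closed (g : CoordChange N) (l i j k : Fin N) :
    OHat.pd l (chernTwoTransgression g i j k) = OHat.pd i (chernTwoTransgression g l j k)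
      + OHat.pd j (chernTwoTransgression g l k i) + OHat.pd k (chernTwoTransgression g l i j) := by
  let T : Fin N → Fin N → Fin N → Fin N → OHat N := fun a b c d =>
    (g.leftForm a * g.leftForm b * g.leftForm c * g.leftForm d).trace
  let S : Fin N → Fin N → Fin N → Fin N → OHat N := fun a b c d =>
    (g.jac⁻¹ * (g.jac.map (OHat.pd b)).map (OHat.pd a) * g.leftForm c * g.leftForm d).trace
  have hS : ∀ a b c d, S a b c d = S b a c d := by
    intro a b c d
    have : (g.jac.map (OHat.pd b)).map (OHat.pd a) = (g.jac.map (OHat.pd a)).map (OHat.pd b) := by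
      ext x y
      exact OHat.pd_comm _ _ _
    simp only [S, this]
  have hT : ∀ a b c d, T a b c d = T b c d a := by
    intro a b c d
    simp only [T]
    rw [Matrix.mul_assoc, Matrix.mul_assoc, Matrix.trace_mul_comm, Matrix.mul_assoc,
      Matrix.mul_assoc, Matrix.mul_assoc, Matrix.mul_assoc]
  -- `T` collects the quartic traces, `S` the terms with second derivatives of `∂g`.
  -- Antisymmetrisation cancels the latter by symmetry of `S` in its first two indices, the former
  -- by cyclicity.
  have hD : ∀ a b c d, OHat.pd a (g.leftForm b * g.leftForm c * g.leftForm d).trace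
      = -T a b c d - T b a c d - T b c a d + S a b c d + S a c d b + S a d b c := by
    intro a b c d
    have e1 : (g.leftForm b * (g.jac⁻¹ * (g.jac.map (OHat.pd c)).map (OHat.pd a))
        * g.leftForm d).trace = S a c d b := by
      rw [Matrix.mul_assoc, Matrix.trace_mul_comm]
    have e2 : (g.leftForm b * g.leftForm c * (g.jac⁻¹ * (g.jac.map (OHat.pd d)).map
        (OHat.pd a))).trace = S a d b c := by
      rw [Matrix.trace_mul_comm]
      simp only [S, Matrix.mul_assoc]
    rw [pd_trace, pd_matrix_mul, pd_matrix_mul, pd_leftForm, pd_leftForm, pd_leftForm]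
    simp only [Matrix.mul_add, Matrix.add_mul, Matrix.trace_add, e1, e2]
    simp only [T, S, Matrix.mul_neg, Matrix.neg_mul, Matrix.trace_neg, Matrix.mul_assoc]
    ring
  simp only [chernTwoTransgression, Derivation.map_smul, map_sub, hD, ← smul_add]
  congr 1
  have r1 : ∀ a b c, T a l b c = T l b c a := fun a b c => hT a l b c
  have r2 : ∀ a b c, T a b l c = T l c a b := fun a b c => by rw [hT, hT]
  simp only [r2, hS i l, hS j l, hS k l, hS j i, hS k i, hS k j]
  simp only [r1]
  ring

theorem exists_transgression (g : CoordChange N) :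
    ∃ η ∈ twoForms N, dTwo η = chernTwoTransgression g := by
  have c : ∀ i j k, (g.leftForm i * g.leftForm j * g.leftForm k).trace
      = (g.leftForm k * g.leftForm i * g.leftForm j).trace := fun i j k =>
    Matrix.trace_mul_cycle _ _ _
  refine exists_dTwo_eq (fun i j k => ?_) (fun i j k => ?_)
    (chernTwoTransgression_closed g)
  · simp only [chernTwoTransgression]
    rw [c j i k, c k j i, c j k i, ← smul_neg, neg_sub]
  · simp only [chernTwoTransgression]
    rw [← smul_neg, neg_sub]

end

/-! ### The group of natural automorphisms as an extension -/

section

variable {N : ℕ}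

namespace CoordChange

theorem map_pd_one (l : Fin N) :
    (1 : Matrix (Fin N) (Fin N) (OHat N)).map (OHat.pd l) = 0 := by
  ext i j
  rw [Matrix.map_apply, Matrix.one_apply]
  split_ifs <;> simp

theorem leftForm_one (l : Fin N) : (1 : CoordChange N).leftForm l = 0 := by
  rw [leftForm, jac_one, map_pd_one, Matrix.mul_zero]

theorem rightForm_one (l : Fin N) : (1 : CoordChange N).rightForm l = 0 := by
  rw [rightForm, jac_one, map_pd_one, Matrix.zero_mul]

theorem crossTrace_one_right (g : CoordChange N) : g.crossTrace 1 = 0 := by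
  ext k l
  have : g.crossForm 1 k = 0 := by
    rw [crossForm, pullMatrixForm]
    refine Finset.sum_eq_zero fun m _ => ?_
    rw [rightForm_one, show (0 : Matrix (Fin N) (Fin N) (OHat N)).map g.pull = 0 by
      ext i j; simp, smul_zero]
  rw [crossTrace, Matrix.of_apply, this, Matrix.zero_mul, Matrix.trace_zero, Matrix.zero_apply]

theorem liftForm_one (β : Matrix (Fin N) (Fin N) (OHat N)) :
    (1 : CoordChange N).liftForm β = -β := by
  ext k l
  rw [liftForm, Matrix.of_apply, leftForm_one, Matrix.zero_mul, Matrix.trace_zero, smul_zero,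
    zero_sub, Matrix.neg_apply]

theorem liftForm_liftForm (g : CoordChange N) (β : Matrix (Fin N) (Fin N) (OHat N)) :
    g.liftForm (g.liftForm β) = β := by
  ext k l
  simp only [liftForm, Matrix.of_apply, sub_sub_cancel]

theorem pullVectorField_single (g : CoordChange N) (i : Fin N) :
    g.pullVectorField (Pi.single i 1) = g.jac⁻¹ i := by
  ext j
  rw [pullVectorField, Finset.sum_eq_single i]
  · simp
  · intro k _ hk
    simp [hk]
  · simp

end CoordChange

theorem chernTwoTransgression_one : chernTwoTransgression (1 : CoordChange N) = 0 := by
  ext i j k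
  simp [chernTwoTransgression, CoordChange.leftForm_one]

theorem Induces.unique {F : DHat N ≃ₗ[ℂ] DHat N} {g g' : CoordChange N} (h : Induces F g)
    (h' : Induces F g') : g = g' := by
  ext i
  rw [← g.pull_coord, ← g'.pull_coord]
  exact ofFun_injective ((h.1 _).symm.trans (h'.1 _))

theorem exists_isLift_one {H : Matrix (Fin N) (Fin N) (OHat N)} (hH : H ∈ closedTwoForms N) :
    ∃ F, IsLift F (1 : CoordChange N) H := by
  have hn := neg_mem hH
  obtain ⟨F, hF⟩ := exists_isLift (1 : CoordChange N) (β := -H) hn.1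
    (by rw [chernTwoTransgression_one]; exact funext fun i => funext fun j => funext (hn.2 i j))
  rw [CoordChange.liftForm_one, neg_neg] at hF
  exact ⟨F, hF⟩

namespace IsLift

variable {F F' : DHat N →ₗ[ℂ] DHat N} {g g' : CoordChange N}
  {H H' : Matrix (Fin N) (Fin N) (OHat N)}

theorem comp_one (h : IsLift F 1 H) (h' : IsLift F' g' H') : IsLift (F ∘ₗ F') g' (H + H') := by
  have := h.comp h'
  rwa [one_mul, CoordChange.pullTwo_one, crossTrace_one_left, add_zero] at this

/-- Over the identity, composition adds the matrices, so the lift with matrix `-H` is a two-sided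
inverse. -/
theorem bijective_of_one (h : IsLift F 1 H) : Function.Bijective F := by
  obtain ⟨K, hK⟩ := exists_isLift_one (neg_mem h.mem_closedTwoForms)
  have h1 := h.comp_one hK
  have h2 := hK.comp_one h
  rw [add_neg_cancel] at h1
  rw [neg_add_cancel] at h2
  have e1 := h1.unique IsLift.id
  have e2 := h2.unique IsLift.id
  exact Function.bijective_iff_has_inverse.2 ⟨K, LinearMap.congr_fun e2, LinearMap.congr_fun e1⟩

/-- Composing with a lift of `g⁻¹` on either side gives a lift of the identity, which is bijective;
this yields both injectivity and surjectivity. -/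
theorem bijective (h : IsLift F g H) : Function.Bijective F := by
  obtain ⟨β, hβ, hd⟩ := exists_transgression g⁻¹
  obtain ⟨K, hK⟩ := exists_isLift g⁻¹ hβ hd
  have h1 := h.comp hK
  have h2 := hK.comp h
  rw [mul_inv_cancel] at h1
  rw [inv_mul_cancel] at h2
  have b1 := h1.bijective_of_one
  have b2 := h2.bijective_of_one
  rw [LinearMap.coe_comp] at b1 b2
  exact ⟨b2.1.of_comp, b1.2.of_comp⟩

theorem induces (h : IsLift F g H) : Induces (LinearEquiv.ofBijective F h.bijective) g :=
  ⟨h.ofFun, h.oneForm, fun τ => ⟨_, h.vectorField τ⟩⟩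

/-- Lifts of coordinate changes are natural automorphisms. -/
theorem exists_natAut (h : IsLift F g H) :
    ∃ F' : natAut N, Induces F'.1 g ∧ (F'.1 : DHat N →ₗ[ℂ] DHat N) = F :=
  ⟨⟨LinearEquiv.ofBijective F h.bijective, ⟨h.map_one, h.nProd⟩, g, h.induces⟩, h.induces, rfl⟩

end IsLift

/-- The defining property of a natural automorphism leaves only the `1`-form parts of the images of
the `a^i_{-1}` undetermined. Multiplying the matrix of these forms by `∂g` gives `H`. -/
theorem Induces.exists_isLift {F : natAut N} {g : CoordChange N} (h : Induces F.1 g) :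
    ∃ H, IsLift (F.1 : DHat N →ₗ[ℂ] DHat N) g H := by
  choose ω hω using fun i : Fin N => h.2.2 (Pi.single i 1)
  refine ⟨g.jac * Matrix.of ω, ?_, h.1, fun i => ?_⟩
  · exact eq_top_iff.2 fun u _ n v => F.2.1.2 n u v
  · rw [CoordChange.liftState, ← Matrix.mul_assoc, g.inv_mul_jac, Matrix.one_mul,
      ← g.pullVectorField_single, ← ofVectorField_single]
    exact hω i

/-! ### The group of natural automorphisms -/

/-- The coordinate change induced by a natural automorphism. -/
def natAut.toCoordChange (N : ℕ) : natAut N →* CoordChange N :=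
  MonoidHom.mk' (fun F => F.2.2.choose) fun F F' => by
    obtain ⟨H, h⟩ := F.2.2.choose_spec.exists_isLift
    obtain ⟨H', h'⟩ := F'.2.2.choose_spec.exists_isLift
    obtain ⟨H'', h''⟩ := (F * F').2.2.choose_spec.exists_isLift
    ext i
    rw [← CoordChange.pull_coord, ← CoordChange.pull_coord]
    exact ofFun_injective ((h''.ofFun _).symm.trans ((h.comp h').ofFun _))

namespace natAut

theorem induces (F : natAut N) : Induces F.1 (toCoordChange N F) := F.2.2.choose_spec

/-- The matrix of a natural automorphism as a lift of a coordinate change. -/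
def matrix (F : natAut N) : Matrix (Fin N) (Fin N) (OHat N) := (induces F).exists_isLift.choose

theorem isLift (F : natAut N) :
    IsLift (F.1 : DHat N →ₗ[ℂ] DHat N) (toCoordChange N F) (matrix F) :=
  (induces F).exists_isLift.choose_spec

theorem ext_of_matrix {F F' : natAut N} (h : toCoordChange N F = toCoordChange N F')
    (h' : (matrix F) = (matrix F')) : F = F' :=
  Subtype.ext (LinearEquiv.toLinearMap_injective ((isLift F).unique (h ▸ h' ▸ (isLift F'))))

theorem matrix_mul (F F' : natAut N) : (matrix (F * F')) = (matrix F)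
    + (toCoordChange N F).pullTwo (matrix F')
    + (toCoordChange N F).crossTrace (toCoordChange N F') := by
  have h := (isLift (F * F'))
  rw [map_mul] at h
  exact h.matrix_unique ((isLift F).comp (isLift F'))

theorem exists_of_isLift {F : DHat N →ₗ[ℂ] DHat N} {g : CoordChange N}
    {H : Matrix (Fin N) (Fin N) (OHat N)} (h : IsLift F g H) :
    ∃ F' : natAut N, toCoordChange N F' = g ∧ (matrix F') = H := by
  obtain ⟨F', h1, rfl⟩ := h.exists_natAut
  have e : toCoordChange N F' = g := (induces F').unique h1
  exact ⟨F', e, (isLift F').matrix_unique (e ▸ h)⟩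

theorem toCoordChange_surjective : Function.Surjective (toCoordChange N) := fun g => by
  obtain ⟨β, hβ, hd⟩ := exists_transgression g
  obtain ⟨F, hF⟩ := exists_isLift g hβ hd
  obtain ⟨F', h, -⟩ := exists_of_isLift hF
  exact ⟨F', h⟩

/-- The factor comes from `ω = ∑_{k,i} h^{ki} db^k ∧ db^i` over all pairs: the coefficients are
`ω_{ki} = 2 h^{ki}`, and the entry at `(i, k)` of the matrix is `h^{ki} = -ω_{ik}/2`. -/
theorem exists_ofClosedTwoForm (ω : closedTwoForms N) :
    ∃ F : natAut N, toCoordChange N F = 1 ∧ (matrix F) = (-1 / 2 : ℂ) • ω.1 := by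
  obtain ⟨F, hF⟩ := exists_isLift_one ((closedTwoForms N).smul_mem (-1 / 2 : ℂ) ω.2)
  exact exists_of_isLift hF

/-- The natural automorphism attached to a closed `2`-form. -/
def ofClosedTwoForm (N : ℕ) : Multiplicative (closedTwoForms N) →* natAut N :=
  MonoidHom.mk' (fun ω => (exists_ofClosedTwoForm ω.toAdd).choose) fun ω ω' => by
    have h := (exists_ofClosedTwoForm ω.toAdd).choose_spec
    have h' := (exists_ofClosedTwoForm ω'.toAdd).choose_spec
    have h'' := (exists_ofClosedTwoForm (ω * ω').toAdd).choose_spec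
    refine ext_of_matrix ?_ ?_
    · rw [h''.1, map_mul (toCoordChange N), h.1, h'.1, one_mul]
    · rw [matrix_mul, h.1, h.2, h'.2, h''.2, IsLift.crossTrace_one_left, CoordChange.pullTwo_one,
        add_zero, toAdd_mul, Submodule.coe_add, smul_add]

theorem toCoordChange_ofClosedTwoForm (ω : Multiplicative (closedTwoForms N)) :
    toCoordChange N (ofClosedTwoForm N ω) = 1 :=
  (exists_ofClosedTwoForm ω.toAdd).choose_spec.1

theorem matrix_ofClosedTwoForm (ω : Multiplicative (closedTwoForms N)) :
    (matrix (ofClosedTwoForm N ω)) = (-1 / 2 : ℂ) • ω.toAdd.1 :=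
  (exists_ofClosedTwoForm ω.toAdd).choose_spec.2

theorem exists_ofClosedTwoForm_eq {F : natAut N} (h : toCoordChange N F = 1) :
    ∃ ω, ofClosedTwoForm N ω = F := by
  have hF := (isLift F)
  rw [h] at hF
  refine ⟨Multiplicative.ofAdd ⟨(-2 : ℂ) • (matrix F),
    (closedTwoForms N).smul_mem _ hF.mem_closedTwoForms⟩, ext_of_matrix ?_ ?_⟩
  · rw [toCoordChange_ofClosedTwoForm, h]
  · rw [matrix_ofClosedTwoForm, toAdd_ofAdd, smul_smul]
    norm_num

/-- The extension `0 → Ω^{2,cl} → G^∼ → G → 1`. -/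
def extension (N : ℕ) :
    GroupExtension (Multiplicative (closedTwoMod N)) (natAut N) (CoordChange N) where
  inl := ofClosedTwoForm N
  rightHom := toCoordChange N
  inl_injective ω ω' h := by
    have e := congrArg matrix h
    rw [matrix_ofClosedTwoForm, matrix_ofClosedTwoForm] at e
    exact Subtype.ext (smul_right_injective _ (by norm_num : (-1 / 2 : ℂ) ≠ 0) e)
  range_inl_eq_ker_rightHom := by
    ext F
    refine ⟨?_, fun h => exists_ofClosedTwoForm_eq h⟩
    rintro ⟨ω, rfl⟩
    exact toCoordChange_ofClosedTwoForm ω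
  rightHom_surjective := toCoordChange_surjective

/-- The cross term of the composition law vanishes if one factor lies over the identity; what
remains is addition of matrices, with the pull-back when the closed form is on the right. -/
theorem conj_ofClosedTwoForm (F : natAut N) (ω : closedTwoForms N) :
    F * ofClosedTwoForm N (Multiplicative.ofAdd ω) * F⁻¹ = ofClosedTwoForm N
      (Multiplicative.ofAdd (closedTwoRep N (toCoordChange N F) ω)) := by
  rw [mul_inv_eq_iff_eq_mul]
  refine ext_of_matrix ?_ ?_
  · rw [map_mul, map_mul, toCoordChange_ofClosedTwoForm, toCoordChange_ofClosedTwoForm, mul_one,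
      one_mul]
  · rw [matrix_mul, matrix_mul, toCoordChange_ofClosedTwoForm, toCoordChange_ofClosedTwoForm,
      matrix_ofClosedTwoForm, matrix_ofClosedTwoForm, CoordChange.crossTrace_one_right,
      IsLift.crossTrace_one_left, CoordChange.pullTwo_one, map_smul, add_zero, add_zero, add_comm]
    rfl

theorem ofClosedTwoForm_ofFun (ω : closedTwoForms N) (f : OHat N) :
    (ofClosedTwoForm N (Multiplicative.ofAdd ω)).1 (ofFun f) = ofFun f := by
  have h := (isLift (ofClosedTwoForm N (Multiplicative.ofAdd ω))).ofFun f
  rwa [toCoordChange_ofClosedTwoForm, CoordChange.pull_one] at h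

theorem ofClosedTwoForm_a (ω : closedTwoForms N) (i : Fin N) :
    (ofClosedTwoForm N (Multiplicative.ofAdd ω)).1 (MvPolynomial.X (Letter.a i 0))
      = MvPolynomial.X (Letter.a i 0) + ofOneForm (fun k => (1 / 2 : ℂ) • ω.1 k i) := by
  have h := (isLift (ofClosedTwoForm N (Multiplicative.ofAdd ω))).a i
  rw [toCoordChange_ofClosedTwoForm, matrix_ofClosedTwoForm] at h
  refine h.trans ?_
  rw [CoordChange.liftState, ← CoordChange.pullVectorField_single, CoordChange.pullVectorField_one,
    CoordChange.jac_one, inv_one, Matrix.one_mul, ofVectorField_single]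
  congr 2
  ext k : 1
  rw [Matrix.smul_apply, toAdd_ofAdd, ω.2.1 i k]
  module

/-- The `2`-form which determines a natural automorphism over a coordinate change. -/
def transgression (F : natAut N) : Matrix (Fin N) (Fin N) (OHat N) :=
  (toCoordChange N F).liftForm (matrix F)

theorem matrix_eq (F : natAut N) : (matrix F) = (toCoordChange N F).liftForm (transgression F) :=
  (CoordChange.liftForm_liftForm _ _).symm

/-- Every natural automorphism over `g` differs from a lift constructed from some `β` by a closed
form `ω`, and the determining `2`-form is `β + ω/2`, with the same differential. -/
theorem transgression_spec (F : natAut N) : (transgression F) ∈ twoForms N ∧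
    dTwo (transgression F) = chernTwoTransgression (toCoordChange N F) := by
  obtain ⟨β, hβ, hd⟩ := exists_transgression (toCoordChange N F)
  obtain ⟨K, hK⟩ := exists_isLift _ hβ hd
  obtain ⟨K', h1, h2⟩ := exists_of_isLift hK
  obtain ⟨ω, hω⟩ := exists_ofClosedTwoForm_eq (F := F * K'⁻¹)
    (by rw [map_mul, map_inv, h1, mul_inv_cancel])
  rw [eq_mul_inv_iff_mul_eq] at hω
  have e := matrix_mul (ofClosedTwoForm N ω) K'
  rw [hω, toCoordChange_ofClosedTwoForm, IsLift.crossTrace_one_left, CoordChange.pullTwo_one,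
    matrix_ofClosedTwoForm, add_zero, h2] at e
  have e2 : (transgression F) = β + (1 / 2 : ℂ) • ω.toAdd.1 := by
    rw [transgression, e]
    ext k l
    simp only [CoordChange.liftForm, Matrix.of_apply, Matrix.add_apply, Matrix.smul_apply]
    module
  have hc := (closedTwoForms N).smul_mem (1 / 2 : ℂ) ω.toAdd.2
  refine ⟨e2 ▸ add_mem hβ hc.1, ?_⟩
  rw [e2, ← hd]
  ext i j k
  have := hc.2 i j k
  simp only [dTwo, Matrix.add_apply, map_add] at this ⊢
  linear_combination this

end natAut

end

/-! ### The factor set of the extension and the class `c_2` -/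

section

variable {N : ℕ}

namespace CoordChange

/-- The matrix `tr(θ_k θ_l)`. -/
def traceSq (g : CoordChange N) : Matrix (Fin N) (Fin N) (OHat N) :=
  Matrix.of fun k l => (g.leftForm k * g.leftForm l).trace

/-- The logarithmic derivative of `∂g₁ · g₁^*(∂g₂)` is the sum of those of the factors, up to
conjugation by `g₁^*(∂g₂)`, which traces do not see. -/
theorem leftForm_mul (g₁ g₂ : CoordChange N) (k : Fin N) : (g₁ * g₂).leftForm k
    = g₂.jac⁻¹.map g₁.pull * (g₁.leftForm k + g₁.crossForm g₂ k) * g₂.jac.map g₁.pull := by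
  have hB := Matrix.nonsing_inv_mul _ (isUnit_det_map_pull g₁ g₂)
  rw [inv_map_pull] at hB
  rw [leftForm, jac_mul_inv_eq, jac_mul, pd_matrix_mul, crossForm_eq, leftForm]
  simp only [Matrix.mul_add, Matrix.add_mul, Matrix.mul_assoc, hB, Matrix.mul_one]
  congr 2
  rw [← Matrix.mul_assoc g₁.jac⁻¹, inv_mul_jac, Matrix.one_mul]

theorem trace_rightForm (g : CoordChange N) (k : Fin N) :
    (g.rightForm k).trace = g.traceForm k := by
  rw [rightForm, Matrix.trace_mul_comm]
  rfl

theorem trace_rightForm_mul (g : CoordChange N) (k l : Fin N) :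
    (g.rightForm k * g.rightForm l).trace = g.traceSq k l := by
  rw [traceSq, Matrix.of_apply, rightForm, rightForm, leftForm, leftForm, Matrix.mul_assoc,
    Matrix.trace_mul_comm, ← Matrix.mul_assoc, Matrix.mul_assoc, Matrix.trace_mul_comm]

theorem trace_map_pull (g : CoordChange N) (A : Matrix (Fin N) (Fin N) (OHat N)) :
    (A.map g.pull).trace = g.pull A.trace := by
  simp [Matrix.trace]

theorem trace_crossForm (g₁ g₂ : CoordChange N) (k : Fin N) :
    (g₁.crossForm g₂ k).trace = g₁.pullOne g₂.traceForm k := by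
  rw [crossForm, pullMatrixForm, Matrix.trace_sum, pullOne_apply]
  exact Finset.sum_congr rfl fun l _ => by
    rw [Matrix.trace_smul, smul_eq_mul, trace_map_pull, trace_rightForm]

theorem trace_crossForm_mul (g₁ g₂ : CoordChange N) (k l : Fin N) :
    (g₁.crossForm g₂ k * g₁.crossForm g₂ l).trace = g₁.pullTwo g₂.traceSq k l := by
  rw [crossForm, crossForm, pullMatrixForm, pullMatrixForm, pullTwo_apply]
  simp only [Matrix.sum_mul, Matrix.trace_sum, Matrix.smul_mul, Matrix.mul_smul,
    Matrix.trace_smul, smul_eq_mul, ← Matrix.map_mul, trace_map_pull, trace_rightForm_mul,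
    Finset.mul_sum]
  exact Finset.sum_congr rfl fun a _ => Finset.sum_congr rfl fun b _ => by ring

theorem traceSq_mul (g₁ g₂ : CoordChange N) (k l : Fin N) : (g₁ * g₂).traceSq k l
    = g₁.traceSq k l + g₁.crossTrace g₂ k l + g₁.crossTrace g₂ l k + g₁.pullTwo g₂.traceSq k l := by
  have hB := Matrix.mul_nonsing_inv _ (isUnit_det_map_pull g₁ g₂)
  rw [inv_map_pull] at hB
  have e : ∀ X Y : Matrix (Fin N) (Fin N) (OHat N),
      (g₂.jac⁻¹.map g₁.pull * X * g₂.jac.map g₁.pull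
        * (g₂.jac⁻¹.map g₁.pull * Y * g₂.jac.map g₁.pull)).trace = (X * Y).trace := by
    intro X Y
    calc _ = (g₂.jac⁻¹.map g₁.pull * (X * (g₂.jac.map g₁.pull * g₂.jac⁻¹.map g₁.pull) * Y
          * g₂.jac.map g₁.pull)).trace := by simp only [Matrix.mul_assoc]
      _ = _ := by
        rw [Matrix.trace_mul_comm, hB, Matrix.mul_one, Matrix.mul_assoc, hB, Matrix.mul_one]
  rw [traceSq, Matrix.of_apply, leftForm_mul, leftForm_mul, e, ← trace_crossForm_mul]
  simp only [Matrix.mul_add, Matrix.add_mul, Matrix.trace_add]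
  rw [Matrix.trace_mul_comm (g₁.leftForm k) (g₁.crossForm g₂ l), traceSq, Matrix.of_apply,
    crossTrace, Matrix.of_apply, Matrix.of_apply]
  ring

theorem liftForm_eq (g : CoordChange N) (β : Matrix (Fin N) (Fin N) (OHat N)) :
    g.liftForm β = (1 / 2 : ℂ) • g.traceSq - β := rfl

end CoordChange

/-! ### The cocycle of the extension -/

-- `traceSq_mul` determines the symmetrisation of `crossTrace`, while `tr(θ ∧ ρ)` is its
-- antisymmetrisation up to sign. Eliminating the transpose gives the relation needed to compare
-- lifts.
open CoordChange in
theorem traceWedge_crossForm (g₁ g₂ : CoordChange N) :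
    traceWedge g₁.leftForm (g₁.crossForm g₂)
      = (g₁ * g₂).traceSq - g₁.traceSq - g₁.pullTwo g₂.traceSq - (2 : ℂ) • g₁.crossTrace g₂ := by
  ext k l
  rw [traceWedge, Matrix.of_apply, Matrix.trace_mul_comm, Matrix.trace_mul_comm (g₁.leftForm l)]
  simp only [Matrix.sub_apply, Matrix.smul_apply, traceSq_mul]
  rw [crossTrace, Matrix.of_apply, Matrix.of_apply, two_smul]
  ring

theorem two_smul_chernTwoForm (g₁ g₂ : CoordChange N) : (2 : ℂ) • chernTwoForm g₁ g₂
    = wedge g₁.traceForm (g₁.pullOne g₂.traceForm)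
      - traceWedge g₁.leftForm (g₁.crossForm g₂) := by
  have e : (fun k => (g₁.pullMatrixForm g₂.rightForm k).trace) = g₁.pullOne g₂.traceForm :=
    funext (g₁.trace_crossForm g₂)
  rw [chernTwoForm, smul_smul, e]
  norm_num
  rfl

namespace natAut

/-- Comparison of matrices: `-ω/2` is the composite matrix of `F₁ F₂` minus that of `F`. The terms
`tr(θ_k θ_l)/2` and `crossTrace` combine to `-tr(θ ∧ ρ)/2`, so `ω = tr(θ ∧ ρ) + 2 δβ`, and `tr(θ ∧
ρ) = tr θ ∧ tr ρ - 2u`. -/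
theorem mul_eq_ofClosedTwoForm_mul_iff {F₁ F₂ F : natAut N}
    (h : toCoordChange N F = toCoordChange N F₁ * toCoordChange N F₂) (ω : closedTwoForms N) :
    F₁ * F₂ = ofClosedTwoForm N (Multiplicative.ofAdd ω) * F ↔
      ω.1 = wedge (toCoordChange N F₁).traceForm
          ((toCoordChange N F₁).pullOne (toCoordChange N F₂).traceForm)
        - (2 : ℂ) • (chernTwoForm (toCoordChange N F₁) (toCoordChange N F₂)
          - ((toCoordChange N F₁).pullTwo (transgression F₂) - transgression F
            + transgression F₁)) := by
  have e : F₁ * F₂ = ofClosedTwoForm N (Multiplicative.ofAdd ω) * F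
      ↔ matrix (F₁ * F₂) = matrix (ofClosedTwoForm N (Multiplicative.ofAdd ω) * F) :=
    ⟨fun h => h ▸ rfl, ext_of_matrix (by
      rw [map_mul, map_mul, toCoordChange_ofClosedTwoForm, one_mul, h])⟩
  rw [e, matrix_mul, matrix_mul, toCoordChange_ofClosedTwoForm, IsLift.crossTrace_one_left,
    CoordChange.pullTwo_one, matrix_ofClosedTwoForm, matrix_eq F₁, matrix_eq F₂, matrix_eq F,
    CoordChange.liftForm_eq, CoordChange.liftForm_eq, CoordChange.liftForm_eq, map_sub, map_smul,
    smul_sub, two_smul_chernTwoForm, traceWedge_crossForm, h, toAdd_ofAdd]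
  constructor
  · intro h
    linear_combination (norm := module) (2 : ℂ) • h
  · intro h
    linear_combination (norm := module) (1 / 2 : ℂ) • h

end natAut

open groupCohomology

/-- The factor set of a section of an extension by a module is a cocycle. -/
theorem exists_factorSet {G E : Type} [Group G] [Group E] {A : Rep.{0} ℂ G}
    (S : GroupExtension (Multiplicative A) E G)
    (hS : ∀ (e : E) (a : A), e * S.inl (Multiplicative.ofAdd a) * e⁻¹
      = S.inl (Multiplicative.ofAdd (A.ρ (S.rightHom e) a))) (σ : S.Section) :
    ∃ z : cocycles₂ A, ∀ g₁ g₂ : G, σ.toFun g₁ * σ.toFun g₂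
      = S.inl (Multiplicative.ofAdd (z (g₁, g₂))) * σ.toFun (g₁ * g₂) := by
  have hσ : ∀ g, S.rightHom (σ.toFun g) = g := σ.rightInverse_rightHom
  have hz : ∀ g : G × G, ∃ a : A, σ.toFun g.1 * σ.toFun g.2
      = S.inl (Multiplicative.ofAdd a) * σ.toFun (g.1 * g.2) := by
    intro g
    have : σ.toFun g.1 * σ.toFun g.2 * (σ.toFun (g.1 * g.2))⁻¹ ∈ S.rightHom.ker := by
      rw [MonoidHom.mem_ker, map_mul, map_mul, map_inv, hσ, hσ, hσ, mul_inv_cancel]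
    rw [← S.range_inl_eq_ker_rightHom] at this
    obtain ⟨a, ha⟩ := this
    exact ⟨a.toAdd, mul_inv_eq_iff_eq_mul.1 ha.symm⟩
  choose z hz using hz
  refine ⟨⟨z, (mem_cocycles₂_iff z).2 fun g h j => ?_⟩, fun g₁ g₂ => hz (g₁, g₂)⟩
  -- The cocycle identity is associativity of three values of the section, once all factors from the
  -- kernel are moved to the left by `hS`.
  have h1 := mul_assoc (σ.toFun g) (σ.toFun h) (σ.toFun j)
  have hg := mul_inv_eq_iff_eq_mul.1 (hS (σ.toFun g) (z (h, j)))
  rw [hz (g, h), hz (h, j), mul_assoc, hz (g * h, j), ← mul_assoc (σ.toFun g), hg, hσ,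
    mul_assoc (S.inl _) (σ.toFun g), hz (g, h * j), ← mul_assoc, ← mul_assoc, mul_assoc g h j] at h1
  have h2 := mul_right_cancel h1
  rw [← map_mul S.inl, ← map_mul S.inl] at h2
  have h3 := congrArg Multiplicative.toAdd (S.inl_injective h2)
  rw [add_comm]
  exact h3

/-- Two choices of `η` have the same differential, so their difference takes values in closed forms
and is a cochain whose coboundary is the difference of the cocycles. -/
theorem IsChernTwo.unique {x y : H2 (closedTwoMod N)} (hx : IsChernTwo x) (hy : IsChernTwo y) :
    x = y := by
  obtain ⟨η, z, h1, h2, rfl⟩ := hx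
  obtain ⟨η', z', h1', h2', rfl⟩ := hy
  have hcl : ∀ g, (η' g).1 - (η g).1 ∈ closedTwoForms N := fun g =>
    ⟨sub_mem (η' g).2 (η g).2, fun i j k => by
      have e := (congrFun (congrFun (congrFun (h1 g) i) j) k).trans
        (congrFun (congrFun (congrFun (h1' g) i) j) k).symm
      simp only [dTwo, Matrix.sub_apply, map_sub] at e ⊢
      linear_combination -e⟩
  rw [H2π_eq_iff]
  refine ⟨fun g => ⟨_, hcl g⟩, funext fun g => Subtype.ext ?_⟩
  change g.1.pullTwo ((η' g.2).1 - (η g.2).1) - ((η' (g.1 * g.2)).1 - (η (g.1 * g.2)).1)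
    + ((η' g.1).1 - (η g.1).1) = (z g).1 - (z' g).1
  rw [h2, h2', map_sub]
  abel

/-- The relation between the class of an extension of natural automorphisms and `c_2`. -/
theorem isChernTwo_of_section (σ : (natAut.extension N).Section) (z : cocycles₂ (closedTwoMod N))
    (hz : ∀ g₁ g₂, σ.toFun g₁ * σ.toFun g₂
      = (natAut.extension N).inl (Multiplicative.ofAdd (z (g₁, g₂))) * σ.toFun (g₁ * g₂)) :
    IsChernTwo (H2π (closedTwoMod N)
      ((1 / 2 : ℂ) • (cup (chernOneCocycle N) (chernOneCocycle N) - z))) := by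
  have hσ : ∀ g, natAut.toCoordChange N (σ.toFun g) = g := σ.rightInverse_rightHom
  -- The cochain `η` is read off from the section: the `2`-form which determines `σ(g)`. The factor
  -- set formula, solved for `u - δη`, is the second condition.
  refine ⟨fun g => ⟨natAut.transgression (σ.toFun g), (natAut.transgression_spec _).1⟩, _,
    fun g => ?_, fun g₁ g₂ => ?_, rfl⟩
  · rw [(natAut.transgression_spec _).2, hσ]
  · have h := (natAut.mul_eq_ofClosedTwoForm_mul_iff (by rw [hσ, hσ, hσ]) (z (g₁, g₂))).1 (hz g₁ g₂)
    rw [hσ, hσ] at h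
    change (1 / 2 : ℂ) • (wedge g₁.traceForm (g₁.pullOne g₂.traceForm) - (z (g₁, g₂)).1) = _
    rw [h, sub_sub_cancel, smul_smul]
    norm_num

theorem exists_section (N : ℕ) : ∃ (σ : (natAut.extension N).Section)
    (z : cocycles₂ (closedTwoMod N)), ∀ g₁ g₂, σ.toFun g₁ * σ.toFun g₂
      = (natAut.extension N).inl (Multiplicative.ofAdd (z (g₁, g₂))) * σ.toFun (g₁ * g₂) := by
  let σ : (natAut.extension N).Section :=
    ⟨Function.surjInv (natAut.extension N).rightHom_surjective,
      Function.rightInverse_surjInv (natAut.extension N).rightHom_surjective⟩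
  exact ⟨σ, exists_factorSet _ natAut.conj_ofClosedTwoForm σ⟩

theorem eq_chernOneSq_sub_of_section (σ : (natAut.extension N).Section)
    (z : cocycles₂ (closedTwoMod N))
    (hz : ∀ g₁ g₂, σ.toFun g₁ * σ.toFun g₂
      = (natAut.extension N).inl (Multiplicative.ofAdd (z (g₁, g₂))) * σ.toFun (g₁ * g₂))
    {c₂ : H2 (closedTwoMod N)} (hc : IsChernTwo c₂) :
    H2π (closedTwoMod N) z = chernOneSq N - 2 • c₂ := by
  rw [hc.unique (isChernTwo_of_section σ z hz), chernOneSq, ← map_nsmul, ← map_sub]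
  congr 1
  module

end

end ChiralDO

end

theorem theorem6p2 (N : ℕ) (hN : 1 ≤ N) :
    ∃ S : GroupExtension (Multiplicative (ChiralDO.closedTwoMod N)) (ChiralDO.natAut N)
        (ChiralDO.CoordChange N),
      (∀ F : ChiralDO.natAut N, ChiralDO.Induces F.1 (S.rightHom F)) ∧
      (∀ ω : ChiralDO.closedTwoMod N,
        (∀ f : ChiralDO.OHat N,
          (S.inl (Multiplicative.ofAdd ω)).1 (ChiralDO.ofFun f) = ChiralDO.ofFun f) ∧
        (∀ i : Fin N, (S.inl (Multiplicative.ofAdd ω)).1 (MvPolynomial.X (ChiralDO.Letter.a i 0))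
          = MvPolynomial.X (ChiralDO.Letter.a i 0)
            + ChiralDO.ofOneForm (fun k => (1 / 2 : ℂ) • ω.1 k i))) ∧
      (∀ (F : ChiralDO.natAut N) (ω : ChiralDO.closedTwoMod N),
        F * S.inl (Multiplicative.ofAdd ω) * F⁻¹
          = S.inl (Multiplicative.ofAdd ((ChiralDO.closedTwoMod N).ρ (S.rightHom F) ω))) ∧
      (∃! c₂ : groupCohomology.H2 (ChiralDO.closedTwoMod N), ChiralDO.IsChernTwo c₂) ∧
      ∀ c₂ : groupCohomology.H2 (ChiralDO.closedTwoMod N), ChiralDO.IsChernTwo c₂ →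
        ∀ x : groupCohomology.H2 (ChiralDO.closedTwoMod N),
          ChiralDO.IsExtensionClass S x ↔ x = ChiralDO.chernOneSq N - 2 • c₂ := by
  -- One section suffices both for the existence of `c_2` and for realising the extension class; the
  -- computation for an arbitrary section shows that no other class occurs.
  obtain ⟨σ, z, hz⟩ := ChiralDO.exists_section N
  refine ⟨ChiralDO.natAut.extension N, ChiralDO.natAut.induces,
    fun ω => ⟨ChiralDO.natAut.ofClosedTwoForm_ofFun ω, ChiralDO.natAut.ofClosedTwoForm_a ω⟩,
    ChiralDO.natAut.conj_ofClosedTwoForm,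
    ⟨_, ChiralDO.isChernTwo_of_section σ z hz,
      fun y hy => hy.unique (ChiralDO.isChernTwo_of_section σ z hz)⟩,
    fun c₂ hc x => ⟨?_, ?_⟩⟩
  · rintro ⟨σ', z', hz', rfl⟩
    exact ChiralDO.eq_chernOneSq_sub_of_section σ' z' hz' hc
  · rintro rfl
    exact ⟨σ, z, hz, (ChiralDO.eq_chernOneSq_sub_of_section σ z hz hc).symm⟩
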